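/- **Definitions.** An integral cone is a set $\sigma$ with a lattice $M^\sigma$ of real-valued functions on $\sigma$ such that evaluation identifies $\sigma$ with a strongly convex rational polyhedral cone in $\operatorname{Hom}(M^\sigma,\mathbb R)$ that is full-dimensional (i.e. spans it); put $N^\sigma=\operatorname{Hom}(M^\sigma,\mathbb Z)$. A subcone is a rational polyhedral subcone with the lattice of restricted functions. A cone complex $\Sigma$ is a space $|\Sigma|$ that is the union of a finite set $\Sigma$ of closed integral cones which contains all faces of its members and in which the intersection of two cones is a union of common faces. A morphism of cone complexes is a map that sends every cone into a cone and pulls integral linear functions back to integral linear functions there. A proper subdivision of $\Sigma$ is a cone complex on the same space whose cones are subcones of cones of $\Sigma$. A *weakly embedded cone complex* is a cone complex $\Sigma$ with a lattice $N^\Sigma$ and a map $\phi_\Sigma\colon|\Sigma|\to N^\Sigma_{\mathbb R}$ that is integral linear on every cone; a morphism is a morphism of cone complexes with a homomorphism of lattices compatible with the weak embeddings. Put $N^\Sigma_\sigma=N^\Sigma\cap\operatorname{Lin}\phi_\Sigma(\sigma)$. For $\tau\in\Sigma$, the *star* $\operatorname{Star}_\Sigma(\tau)$ is glued from the cones $\sigma/\tau\subseteq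 N^\sigma_{\mathbb R}/N^\tau_{\mathbb R}$ ($\tau\preceq\sigma\in\Sigma$), with lattice $N^\Sigma/N^\Sigma_\tau$ and the induced weak embedding. The extended cone complex $\overline\Sigma$ is stratified by the stars $\operatorname{Star}_\Sigma(\tau)$, $\tau\in\Sigma$, and $\overline{\operatorname{Star}_\Sigma(\tau)}\subseteq\overline\Sigma$. A morphism $f\colon\Sigma\to\Delta$ of weakly embedded cone complexes extends to a *dominant* morphism $\overline\Sigma\to\overline\Delta$; on the stratum of $\sigma\in\Sigma$ it is the induced morphism $\operatorname{Star}_\Sigma(\sigma)\to\operatorname{Star}_\Delta(\delta)$, where $\delta$ is the smallest cone of $\Delta$ containing $f(\sigma)$. A *morphism of weakly embedded extended cone complexes* $\overline\Sigma\to\overline\Delta$ is a dominant morphism, or a dominant morphism $\overline\Sigma\to\overline{\operatorname{Star}_\Delta(\delta)}$ for some $\delta\in\Delta$ followed by the inclusion into $\overline\Delta$. A $k$-dimensional *Minkowski weight* on $\Sigma$ is a map $c$ from the $k$-dimensional cones of $\Sigma$ to $\mathbb Z$ such that $\sum_{\sigma}c(\sigma)u_{\sigma/\tau}=0$ in $N^\Sigma/N^\Sigma_\tau$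 for every $(k-1)$-dimensional cone $\tau$, where $\sigma$ runs over the $k$-dimensional cones containing $\tau$ and $u_{\sigma/\tau}$ is the image under $\phi_\Sigma$ of the generator of $N^\sigma/N^\tau$ that lies in the image of $\sigma\cap N^\sigma$. The group $Z_k(\Sigma)$ of *tropical $k$-cycles* is the direct limit of the groups of $k$-dimensional Minkowski weights on the proper subdivisions of $\Sigma$; $[c]$ denotes the class of $c$. Put $Z_k(\overline\Sigma)=\bigoplus_{\sigma\in\Sigma}Z_k(\operatorname{Star}_\Sigma(\sigma))$. *Push-forward.* For a dominant $f$, and after proper subdivisions for which $f$ maps cones onto cones, $f_*[c]$ is given for a weight $c$ on $\Sigma$ by $f_*c(\delta)=\sum_{\sigma\mapsto\delta}[N^\delta:f(N^\sigma)]\,c(\sigma)$, the sum being over the $k$-dimensional cones $\sigma$ with image $\delta$, $\dim\delta=k$. For a morphism $f\colon\overline\Sigma\to\overline\Delta$ of weakly embedded extended cone complexes, $f_*$ is given on each summand $Z_k(\operatorname{Star}_\Sigma(\sigma))$ by the push-forward along the dominant morphism to $\overline{\operatorname{Star}_\Delta(\delta)}$ that $f$ induces. *Rational equivalence.* For a function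 $\psi$ on $|\Sigma|$ that is integral linear on all cones and a Minkowski weight $c$ of dimension $k+1$ on a proper subdivision $\Sigma'$ of $\Sigma$, let $\psi\cdot[c]\in Z_k(\overline\Sigma)$ be the push-forward along $\overline{\Sigma'}\to\overline\Sigma$ of $\sum_\rho\psi(u_\rho)[i_\rho^*c]$, where $\rho$ runs over the rays of $\Sigma'$, $u_\rho$ is the primitive generator of $\rho$, and $i_\rho^*c$ is the weight $\sigma/\rho\mapsto c(\sigma)$ on $\operatorname{Star}_{\Sigma'}(\rho)$. Let $\Pi^1$ be the complete fan in $\mathbb R$, $\psi_{\Pi^1}$ the identity function of $\mathbb R$, and $p,q$ the projections of $\Sigma\times\Pi^1$ to $\Sigma$ and $\Pi^1$. Let $R_k(\overline\Sigma)$ be the subgroup generated by all $p_*(q^*\psi_{\Pi^1}\cdot A)$ with $\sigma\in\Sigma$ and $A\in Z_{k+1}(\operatorname{Star}_{\Sigma\times\Pi^1}(\sigma\times0))$, where $q^*\psi_{\Pi^1}$ is viewed as a function on this star. Put $A_k(\overline\Sigma)=Z_k(\overline\Sigma)/R_k(\overline\Sigma)$ and $A_*(\overline\Sigma)=\bigoplus_{k\ge0}A_k(\overline\Sigma)$.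 **Proposition.** Let $f\colon\overline\Sigma\to\overline\Delta$ be a morphism of weakly embedded extended cone complexes. Then, for all $k$, $f_*(Z_k(\overline\Sigma))\subseteq Z_k(\overline\Delta)$ and $f_*(R_k(\overline\Sigma))\subseteq R_k(\overline\Delta)$. Hence there is a unique homomorphism of graded groups $f_*\colon A_*(\overline\Sigma)\to A_*(\overline\Delta)$ with $f_*[A]=[f_*A]$ for every cycle $A$. In particular, let $\Pi^0$ be the one-point complex with zero lattice and $g\colon\overline\Sigma\to\overline\Pi{}^0$ the unique morphism. There is a unique homomorphism $\deg\colon A_*(\overline\Sigma)\to\mathbb Z$ with $g_*A=\deg([A])\cdot[\Pi^0]$ for every homogeneous cycle $A$ on $\overline\Sigma$, where $[\Pi^0]$ is the $0$-cycle on $\overline\Pi{}^0$ with weight $1$. -/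

import Mathlib

open scoped TensorProduct DirectSum

universe u v u' v'

noncomputable section

namespace TropicalCycles

section Cones

variable {X : Type u} {Y : Type u'}

/-- Restriction of real-valued functions to a subset `S`, extended by zero outside of `S`. -/
def restr (S : Set X) : (X → ℝ) →+ (X → ℝ) where
  toFun m := S.indicator m
  map_zero' := Set.indicator_zero' _
  map_add' := Set.indicator_add' S

/-- A point at which all functions of `M` take integral values. -/
def IsIntegralPt (M : AddSubgroup (X → ℝ)) (x : X) : Prop :=
  ∀ m ∈ M, ∃ n : ℤ, m x = n

/-- `(S, M)` is an integral cone: `M` is a lattice of real functions on `S` (extended by zero to the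
ambient point set `X`), and evaluation is a bijection from `S` onto a strongly convex rational
polyhedral cone in `Hom(M, ℝ)`, i.e. onto the cone spanned by finitely many points of
`N = Hom(M, ℤ)` (the points where all `m ∈ M` are integral), not containing a line. The topology of
`S` is the one induced by this bijection; it carries no additional information. -/
structure IsIntegralCone (S : Set X) (M : AddSubgroup (X → ℝ)) : Prop where
  supp : ∀ m ∈ M, ∀ x ∉ S, m x = 0
  fg : Module.Finite ℤ M
  separates : ∀ x ∈ S, ∀ y ∈ S, (∀ m ∈ M, m x = m y) → x = y
  generated : ∃ (ι : Type) (_ : Fintype ι) (g : ι → X), (∀ i, g i ∈ S ∧ IsIntegralPt M (g i)) ∧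
    ∀ e : M →+ ℝ, (∃ x ∈ S, ∀ m : M, e m = m.1 x) ↔
      ∃ a : ι → ℝ, (∀ i, 0 ≤ a i) ∧ ∀ m : M, e m = ∑ i, a i * m.1 (g i)
  salient : ∀ x ∈ S, ∀ y ∈ S, (∀ m ∈ M, m x + m y = 0) → ∀ m ∈ M, m x = 0

/-- `(S', M')` is a face of `(S, M)`: the zero set of a function of `M` that is non-negative on `S`,
with the restricted functions. -/
def IsFaceOf (S' : Set X) (M' : AddSubgroup (X → ℝ)) (S : Set X) (M : AddSubgroup (X → ℝ)) : Prop :=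
  M' = M.map (restr S') ∧ ∃ m ∈ M, (∀ x ∈ S, 0 ≤ m x) ∧ S' = {x ∈ S | m x = 0}

theorem restr_of_mem {S : Set X} {x : X} (h : x ∈ S) (m : X → ℝ) : restr S m x = m x :=
  Set.indicator_of_mem h m

theorem restr_of_notMem {S : Set X} {x : X} (h : x ∉ S) (m : X → ℝ) : restr S m x = 0 :=
  Set.indicator_of_notMem h m

theorem restr_restr {S T : Set X} (h : S ⊆ T) (m : X → ℝ) : restr S (restr T m) = restr S m := by
  funext x
  by_cases hx : x ∈ S
  · rw [restr_of_mem hx, restr_of_mem hx, restr_of_mem (h hx)]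
  · rw [restr_of_notMem hx, restr_of_notMem hx]

theorem map_restr_restr {S T : Set X} (h : S ⊆ T) (M : AddSubgroup (X → ℝ)) :
    (M.map (restr T)).map (restr S) = M.map (restr S) := by
  rw [AddSubgroup.map_map]
  congr 1
  ext m : 1
  exact restr_restr h m

theorem finite_map {A : Type*} {B : Type*} [AddCommGroup A] [AddCommGroup B] {M : AddSubgroup A}
    (h : Module.Finite ℤ M) (r : A →+ B) : Module.Finite ℤ (M.map r) :=
  Module.Finite.of_surjective (r.addSubgroupMap M).toIntLinearMap (r.addSubgroupMap_surjective M)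

namespace IsIntegralCone

variable {S : Set X} {M : AddSubgroup (X → ℝ)}

theorem exists_gen (h : IsIntegralCone S M) : ∃ (ι : Type) (_ : Fintype ι) (g : ι → X),
    (∀ i, g i ∈ S ∧ IsIntegralPt M (g i)) ∧
    (∀ x ∈ S, ∃ a : ι → ℝ, (∀ i, 0 ≤ a i) ∧ ∀ m ∈ M, m x = ∑ i, a i * m (g i)) ∧
    ∀ a : ι → ℝ, (∀ i, 0 ≤ a i) → ∃ x ∈ S, ∀ m ∈ M, m x = ∑ i, a i * m (g i) := by
  obtain ⟨ι, inferInstance, g, hG, hgen⟩ := h.generated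
  refine ⟨ι, inferInstance, g, hG, fun x hx => ?_, fun a ha => ?_⟩
  · obtain ⟨a, ha, h'⟩ := (hgen ((Pi.evalAddMonoidHom _ x).comp M.subtype)).1
      ⟨x, hx, fun _ => rfl⟩
    exact ⟨a, ha, fun m hm => h' ⟨m, hm⟩⟩
  · let e : M →+ ℝ := AddMonoidHom.mk' (fun m => ∑ i, a i * m.1 (g i)) (by
      intro m m'
      rw [← Finset.sum_add_distrib]
      exact Finset.sum_congr rfl fun g _ => by simp [mul_add])
    obtain ⟨x, hx, h'⟩ := (hgen e).2 ⟨a, ha, fun _ => rfl⟩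
    exact ⟨x, hx, fun m hm => (h' ⟨m, hm⟩).symm⟩

theorem of_gen (supp : ∀ m ∈ M, ∀ x ∉ S, m x = 0) (fg : Module.Finite ℤ M)
    (sep : ∀ x ∈ S, ∀ y ∈ S, (∀ m ∈ M, m x = m y) → x = y)
    {ι : Type} [Fintype ι] (g : ι → X) (hG : ∀ i, g i ∈ S ∧ IsIntegralPt M (g i))
    (h₁ : ∀ x ∈ S, ∃ a : ι → ℝ, (∀ i, 0 ≤ a i) ∧ ∀ m ∈ M, m x = ∑ i, a i * m (g i))
    (h₂ : ∀ a : ι → ℝ, (∀ i, 0 ≤ a i) → ∃ x ∈ S, ∀ m ∈ M, m x = ∑ i, a i * m (g i))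
    (sal : ∀ x ∈ S, ∀ y ∈ S, (∀ m ∈ M, m x + m y = 0) → ∀ m ∈ M, m x = 0) :
    IsIntegralCone S M := by
  refine ⟨supp, fg, sep, ⟨ι, inferInstance, g, hG, fun e => ⟨?_, ?_⟩⟩, sal⟩
  · rintro ⟨x, hx, h⟩
    obtain ⟨a, ha, h'⟩ := h₁ x hx
    exact ⟨a, ha, fun m => by rw [h m, h' m.1 m.2]⟩
  · rintro ⟨a, ha, h⟩
    obtain ⟨x, hx, h'⟩ := h₂ a ha
    exact ⟨x, hx, fun m => by rw [h m, h' m.1 m.2]⟩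

theorem exists_add (h : IsIntegralCone S M) {x y : X} (hx : x ∈ S) (hy : y ∈ S) :
    ∃ z ∈ S, ∀ m ∈ M, m z = m x + m y := by
  obtain ⟨ι, _, g, -, h₁, h₂⟩ := h.exists_gen
  obtain ⟨a, ha, hxa⟩ := h₁ x hx
  obtain ⟨b, hb, hyb⟩ := h₁ y hy
  obtain ⟨z, hz, hzc⟩ := h₂ (a + b) fun i => add_nonneg (ha i) (hb i)
  refine ⟨z, hz, fun m hm => ?_⟩
  rw [hzc m hm, hxa m hm, hyb m hm, ← Finset.sum_add_distrib]
  exact Finset.sum_congr rfl fun i _ => by simp [add_mul]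

theorem exists_zero (h : IsIntegralCone S M) : ∃ z ∈ S, ∀ m ∈ M, m z = 0 := by
  obtain ⟨ι, _, g, -, h₁, h₂⟩ := h.exists_gen
  obtain ⟨z, hz, hzc⟩ := h₂ 0 fun i => le_rfl
  exact ⟨z, hz, fun m hm => by simp [hzc m hm]⟩

/-- Integral cones have integral points in their relative interior. -/
theorem exists_interior (h : IsIntegralCone S M) : ∃ t ∈ S, IsIntegralPt M t ∧
    ∀ m ∈ M, (∀ x ∈ S, 0 ≤ m x) → m t = 0 → ∀ x ∈ S, m x = 0 := by
  obtain ⟨ι, inferInstance, g, hG, h₁, h₂⟩ := h.exists_gen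
  obtain ⟨t, ht, htc⟩ := h₂ 1 fun i => zero_le_one
  refine ⟨t, ht, fun m hm => ?_, fun m hm h0 hmt x hx => ?_⟩
  · choose n hn using fun i => (hG i).2 m hm
    refine ⟨∑ i, n i, ?_⟩
    rw [htc m hm, Int.cast_sum]
    exact Finset.sum_congr rfl fun i _ => by simp [hn i]
  · rw [htc m hm] at hmt
    have h0' : ∀ i, m (g i) = 0 := fun i => by
      have := (Finset.sum_eq_zero_iff_of_nonneg fun i _ => by
        simpa using h0 (g i) (hG i).1).1 hmt i (Finset.mem_univ i)
      simpa using this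
    obtain ⟨a, -, ha⟩ := h₁ x hx
    rw [ha m hm]
    exact Finset.sum_eq_zero fun i _ => by rw [h0' i, mul_zero]

/-- The image of an integral cone under an integral linear map is an integral cone. -/
theorem image {f : X → Y} {S' : Set Y} {M' : AddSubgroup (Y → ℝ)} (h : IsIntegralCone S M)
    (h' : IsIntegralCone S' M') (hf : Set.MapsTo f S S')
    (hM : ∀ m ∈ M', restr S (m ∘ f) ∈ M) :
    IsIntegralCone (f '' S) (M'.map (restr (f '' S))) := by
  obtain ⟨ι, inferInstance, g, hG, h₁, h₂⟩ := h.exists_gen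
  have key : ∀ m : Y → ℝ, ∀ x ∈ S, restr (f '' S) m (f x) = restr S (m ∘ f) x := fun m x hx => by
    rw [restr_of_mem (Set.mem_image_of_mem f hx), restr_of_mem hx]; rfl
  have key' : ∀ m : Y → ℝ, ∀ x ∈ S, restr (f '' S) m (f x) = m (f x) := fun m x hx =>
    restr_of_mem (Set.mem_image_of_mem f hx) m
  refine of_gen ?_ (finite_map h'.fg _) ?_ (f ∘ g) (fun i => ⟨Set.mem_image_of_mem f (hG i).1, ?_⟩) ?_ ?_ ?_
  · rintro _ ⟨m, hm, rfl⟩ x hx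
    exact restr_of_notMem hx m
  · rintro _ ⟨x, hx, rfl⟩ _ ⟨y, hy, rfl⟩ hxy
    refine h'.separates _ (hf hx) _ (hf hy) fun m hm => ?_
    have := hxy _ (AddSubgroup.mem_map_of_mem _ hm)
    rwa [key' m x hx, key' m y hy] at this
  · rintro _ ⟨m, hm, rfl⟩
    rw [Function.comp_apply, key m _ (hG i).1]
    exact (hG i).2 _ (hM m hm)
  · rintro _ ⟨x, hx, rfl⟩
    obtain ⟨a, ha, hxa⟩ := h₁ x hx
    refine ⟨a, ha, ?_⟩
    rintro _ ⟨m, hm, rfl⟩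
    rw [key m x hx, hxa _ (hM m hm)]
    exact Finset.sum_congr rfl fun i _ => by rw [Function.comp_apply, key m _ (hG i).1]
  · intro a ha
    obtain ⟨x, hx, hxa⟩ := h₂ a ha
    refine ⟨f x, Set.mem_image_of_mem f hx, ?_⟩
    rintro _ ⟨m, hm, rfl⟩
    rw [key m x hx, hxa _ (hM m hm)]
    exact Finset.sum_congr rfl fun i _ => by rw [Function.comp_apply, key m _ (hG i).1]
  · rintro _ ⟨x, hx, rfl⟩ _ ⟨y, hy, rfl⟩ hxy _ ⟨m, hm, rfl⟩
    rw [key' m x hx]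
    refine h'.salient _ (hf hx) _ (hf hy) (fun m hm => ?_) m hm
    have := hxy _ (AddSubgroup.mem_map_of_mem _ hm)
    rwa [key' m x hx, key' m y hy] at this

end IsIntegralCone

end Cones

/-- A cone complex with set of points `X`: finitely many integral cones in `X`, covering `X`, closed
under taking faces, such that the intersection of any two is a union of common faces. (The topology
of `X` is the one for which the finitely many cones are closed subspaces; it is determined by the
cones, and maps that are integral linear on cones are automatically continuous.) -/
structure ConeComplex (X : Type u) where
  Idx : Type
  finite : Finite Idx
  carrier : Idx → Set X
  M : Idx → AddSubgroup (X → ℝ)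
  isCone : ∀ i, IsIntegralCone (carrier i) (M i)
  carrier_injective : Function.Injective carrier
  cover : ∀ x, ∃ i, x ∈ carrier i
  exists_face : ∀ i S' M', IsFaceOf S' M' (carrier i) (M i) → ∃ j, carrier j = S' ∧ M j = M'
  inter : ∀ i j, ∀ x ∈ carrier i ∩ carrier j, ∃ k, x ∈ carrier k ∧
    IsFaceOf (carrier k) (M k) (carrier i) (M i) ∧ IsFaceOf (carrier k) (M k) (carrier j) (M j)

attribute [instance] ConeComplex.finite

namespace ConeComplex

variable {X : Type u} {Y : Type u'} (K : ConeComplex X) (L : ConeComplex Y)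

theorem face_subset {S S' : Set X} {M M' : AddSubgroup (X → ℝ)} (h : IsFaceOf S' M' S M) :
    S' ⊆ S := by
  obtain ⟨-, m, -, -, rfl⟩ := h
  exact fun x hx => hx.1

variable {K L}

theorem exists_common_face {i j : K.Idx} {S : Set X} {M : AddSubgroup (X → ℝ)}
    (h : IsIntegralCone S M) (hi : S ⊆ K.carrier i) (hj : S ⊆ K.carrier j)
    (hM : ∀ m ∈ K.M i, restr S m ∈ M) : ∃ k, S ⊆ K.carrier k ∧
      IsFaceOf (K.carrier k) (K.M k) (K.carrier i) (K.M i) ∧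
      IsFaceOf (K.carrier k) (K.M k) (K.carrier j) (K.M j) := by
  obtain ⟨t, ht, -, h0⟩ := h.exists_interior
  obtain ⟨k, hk, hki, hkj⟩ := K.inter i j t ⟨hi ht, hj ht⟩
  refine ⟨k, fun x hx => ?_, hki, hkj⟩
  obtain ⟨-, m, hm, hm0, he⟩ := hki
  rw [he] at hk ⊢
  refine ⟨hi hx, ?_⟩
  have := h0 _ (hM m hm) (fun x hx => by rw [restr_of_mem hx]; exact hm0 x (hi hx))
    (by rw [restr_of_mem ht]; exact hk.2) x hx
  rwa [restr_of_mem hx] at this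

theorem restr_self {i : K.Idx} {m : X → ℝ} (hm : m ∈ K.M i) : restr (K.carrier i) m = m := by
  funext x
  by_cases hx : x ∈ K.carrier i
  · exact restr_of_mem hx m
  · rw [restr_of_notMem hx, (K.isCone i).supp m hm x hx]

theorem map_restr_self (i : K.Idx) : (K.M i).map (restr (K.carrier i)) = K.M i := by
  ext m
  constructor
  · rintro ⟨m, hm, rfl⟩
    rwa [restr_self hm]
  · exact fun hm => ⟨m, hm, restr_self hm⟩

theorem isFaceOf_of_subset {i j : K.Idx} (h : K.carrier i ⊆ K.carrier j) :
    IsFaceOf (K.carrier i) (K.M i) (K.carrier j) (K.M j) := by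
  obtain ⟨k, hk, hki, hkj⟩ := exists_common_face (K.isCone i) (subset_refl _) h
    fun m hm => by rwa [restr_self hm]
  obtain rfl := K.carrier_injective (hk.antisymm (face_subset hki))
  exact hkj

theorem restr_mem {i j : K.Idx} (h : K.carrier i ⊆ K.carrier j) {m : X → ℝ} (hm : m ∈ K.M j) :
    restr (K.carrier i) m ∈ K.M i := by
  rw [(isFaceOf_of_subset h).1]
  exact AddSubgroup.mem_map_of_mem _ hm

theorem exists_minimal (x : X) :
    ∃ i, x ∈ K.carrier i ∧ ∀ j, x ∈ K.carrier j → K.carrier i ⊆ K.carrier j := by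
  obtain ⟨i, hi, hmin⟩ := Set.exists_min_image {i | x ∈ K.carrier i} (fun i => Nat.card {j |
    K.carrier j ⊆ K.carrier i}) (Set.toFinite _) (K.cover x)
  refine ⟨i, hi, fun j hj => ?_⟩
  obtain ⟨k, hk, hki, hkj⟩ := K.inter i j x ⟨hi, hj⟩
  have hki' := face_subset hki
  have hle : {j | K.carrier j ⊆ K.carrier k} ⊆ {j | K.carrier j ⊆ K.carrier i} :=
    fun j hj => hj.trans hki'
  have := Set.eq_of_subset_of_ncard_le hle (hmin k hk)
  have hi' : i ∈ {j | K.carrier j ⊆ K.carrier k} := this ▸ subset_refl (K.carrier i)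
  exact hi'.trans (face_subset hkj)

variable (K L)

/-- The lattice of integral linear functions on a subset of a cone of `K`: the restrictions of the
integral linear functions on a cone containing it. -/
def fn (S : Set X) : AddSubgroup (X → ℝ) :=
  ⨆ (i : K.Idx) (_ : S ⊆ K.carrier i), (K.M i).map (restr S)

/-- A subset of a cone of `K` is a subcone if the restrictions of the integral linear functions make
it an integral cone. -/
def IsSubcone (S : Set X) : Prop :=
  ∃ i, S ⊆ K.carrier i ∧ IsIntegralCone S ((K.M i).map (restr S))

/-- The dimension of a subcone. -/
def dim (S : Set X) : ℕ := Module.finrank ℤ (K.fn S)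

/-- The dual lattice `N^S` of a subcone. -/
abbrev lat (S : Set X) : Type u := K.fn S →+ ℤ

variable {K L}

theorem isSubcone_carrier (i : K.Idx) : K.IsSubcone (K.carrier i) :=
  ⟨i, subset_rfl, by rw [map_restr_self]; exact K.isCone i⟩

theorem IsSubcone.fn_eq {S : Set X} (hS : K.IsSubcone S) {i : K.Idx} (hi : S ⊆ K.carrier i) :
    K.fn S = (K.M i).map (restr S) := by
  have key : ∀ i j, S ⊆ K.carrier i → S ⊆ K.carrier j →
      (K.M j).map (restr S) = (K.M i).map (restr S) := by
    obtain ⟨k₀, hk₀, hc⟩ := hS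
    have : ∀ j, S ⊆ K.carrier j → (K.M j).map (restr S) = (K.M k₀).map (restr S) := by
      intro j hj
      obtain ⟨k, hk, hk1, hk2⟩ := exists_common_face hc hk₀ hj
        fun m hm => AddSubgroup.mem_map_of_mem _ hm
      have h1 : (K.M k).map (restr S) = (K.M k₀).map (restr S) := by
        rw [hk1.1, map_restr_restr hk]
      have h2 : (K.M k).map (restr S) = (K.M j).map (restr S) := by
        rw [hk2.1, map_restr_restr hk]
      rw [← h2, h1]
    exact fun i j hi hj => (this j hj).trans (this i hi).symm
  refine le_antisymm (iSup₂_le fun j hj => (key i j hi hj).le) ?_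
  exact le_iSup₂_of_le (f := fun (i : K.Idx) (_ : S ⊆ K.carrier i) => (K.M i).map (restr S))
    i hi le_rfl

theorem fn_carrier (i : K.Idx) : K.fn (K.carrier i) = K.M i := by
  rw [(isSubcone_carrier i).fn_eq subset_rfl, map_restr_self]

theorem IsSubcone.isCone {S : Set X} (hS : K.IsSubcone S) : IsIntegralCone S (K.fn S) := by
  obtain ⟨i, hi, h⟩ := id hS
  rwa [hS.fn_eq hi]

theorem IsSubcone.map_restr {S T : Set X} (hS : K.IsSubcone S) (hT : K.IsSubcone T) (h : S ⊆ T) :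
    (K.fn T).map (restr S) = K.fn S := by
  obtain ⟨i, hi, -⟩ := id hT
  rw [hT.fn_eq hi, hS.fn_eq (h.trans hi), map_restr_restr h]

variable (K L)

/-- A morphism of cone complexes: every cone is mapped to a cone, by an integral linear map. -/
@[ext] structure Mor where
  toFun : X → Y
  map_cone : ∀ i, ∃ j, Set.MapsTo toFun (K.carrier i) (L.carrier j) ∧
    ∀ m ∈ L.M j, restr (K.carrier i) (m ∘ toFun) ∈ K.M i

variable {K L}

theorem restr_comp {S : Set X} {T : Set Y} {f : X → Y} (h : Set.MapsTo f S T) (m : Y → ℝ) :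
    restr S (restr T m ∘ f) = restr S (m ∘ f) := by
  funext x
  by_cases hx : x ∈ S
  · rw [restr_of_mem hx, restr_of_mem hx]; exact restr_of_mem (h hx) m
  · rw [restr_of_notMem hx, restr_of_notMem hx]

theorem Mor.isSubcone_image (f : Mor K L) {S : Set X} (hS : K.IsSubcone S) :
    L.IsSubcone (f.toFun '' S) := by
  obtain ⟨i, hi, -⟩ := id hS
  obtain ⟨j, hj, hm⟩ := f.map_cone i
  refine ⟨j, (hj.mono_left hi).image_subset, hS.isCone.image (L.isCone j) (hj.mono_left hi) ?_⟩
  intro m hmj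
  rw [hS.fn_eq hi, ← restr_restr hi]
  exact AddSubgroup.mem_map_of_mem _ (hm m hmj)

/-- Pull-back of integral linear functions along `S → f(S)`. -/
def Mor.pull (f : Mor K L) {S : Set X} (hS : K.IsSubcone S) : L.fn (f.toFun '' S) →+ K.fn S where
  toFun m := ⟨restr S (m.1 ∘ f.toFun), by
    obtain ⟨i, hi, -⟩ := id hS
    obtain ⟨j, hj, hm⟩ := f.map_cone i
    obtain ⟨m, hmj⟩ := m
    rw [(f.isSubcone_image hS).fn_eq (hj.mono_left hi).image_subset] at hmj
    obtain ⟨m, hmj', rfl⟩ := hmj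
    rw [restr_comp (Set.mapsTo_image _ _), hS.fn_eq hi, ← restr_restr hi]
    exact AddSubgroup.mem_map_of_mem _ (hm m hmj')⟩
  map_zero' := Subtype.ext (by
    change restr S 0 = 0
    exact map_zero _)
  map_add' m m' := Subtype.ext (by
    change restr S ((m.1 ∘ f.toFun) + (m'.1 ∘ f.toFun)) = _
    exact map_add _ _ _)

/-- The induced map `N^S → N^{f(S)}`. -/
def Mor.latMap (f : Mor K L) {S : Set X} (hS : K.IsSubcone S) :
    K.lat S →+ L.lat (f.toFun '' S) :=
  AddMonoidHom.compHom' (f.pull hS)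

/-- The lattice index `[N^{f(S)} : f(N^S)]`. -/
def Mor.latIndex (f : Mor K L) {S : Set X} (hS : K.IsSubcone S) : ℕ :=
  (f.latMap hS).range.index

variable (K)

/-- The `k`-dimensional subcones of `K`. -/
@[ext] structure Subcone (k : ℕ) where
  carrier : Set X
  isSubcone : K.IsSubcone carrier
  dim_eq : K.dim carrier = k

/-- `T` subdivides the `k`-dimensional subcone `σ` into `k`-dimensional subcones: they cover `σ`,
and the interiors of any two are disjoint, i.e. there is a rational hyperplane separating them. -/
def IsSubdivision {k : ℕ} (σ : K.Subcone k) (T : Finset (K.Subcone k)) : Prop :=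
  σ.carrier = ⋃ τ ∈ T, τ.carrier ∧ ∀ τ ∈ T, ∀ τ' ∈ T, τ ≠ τ' →
    ∃ m ∈ K.fn σ.carrier, m ≠ 0 ∧ (∀ x ∈ τ.carrier, 0 ≤ m x) ∧ ∀ x ∈ τ'.carrier, m x ≤ 0

/-- The relations identifying a subcone with the sum of the parts of a subdivision. -/
def subdivisionRel (k : ℕ) : AddSubgroup (FreeAbelianGroup (K.Subcone k)) :=
  AddSubgroup.closure {a | ∃ σ T, K.IsSubdivision σ T ∧
    a = FreeAbelianGroup.of σ - ∑ τ ∈ T, FreeAbelianGroup.of τ}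

/-- The group of `k`-dimensional weights on `K` up to subdivision: integral combinations of
`k`-dimensional subcones, where a subcone is identified with the sum of the parts of any of its
subdivisions. This is the direct limit, over all proper subdivisions `K'` of `K`, of the groups of
all integral weights on the `k`-dimensional cones of `K'`; it contains the tropical cycles, which
are the classes of balanced weights. -/
abbrev Weight (k : ℕ) : Type u := FreeAbelianGroup (K.Subcone k) ⧸ K.subdivisionRel k

open Classical in
/-- The class of a subcone `S` in the group of `k`-dimensional weights, for `k = dim S`. (It is zero
by convention if `S` has another dimension.) -/
def cls (k : ℕ) (S : Set X) : K.Weight k :=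
  if h : K.IsSubcone S ∧ K.dim S = k then
    QuotientAddGroup.mk' (K.subdivisionRel k) (FreeAbelianGroup.of ⟨S, h.1, h.2⟩) else 0

variable {K}

section Lattices

theorem injective_of_finrank {A : Type*} {B : Type*} [AddCommGroup A] [AddCommGroup B]
    [Module.Finite ℤ A] [Module.Finite ℤ B] [Module.Free ℤ A] [Module.Free ℤ B]
    (h : Module.finrank ℤ A = Module.finrank ℤ B) (r : A →+ B) (hr : Function.Surjective r) :
    Function.Injective r := by
  let e := LinearEquiv.ofFinrankEq A B h
  have := IsNoetherian.injective_of_surjective_endomorphism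
    (e.symm.toLinearMap ∘ₗ r.toIntLinearMap) (e.symm.surjective.comp hr)
  exact Function.Injective.of_comp this

theorem exists_smul_of_finrank {A : Type*} {B : Type*} [AddCommGroup A] [AddCommGroup B]
    [Module.Finite ℤ A] [Module.Finite ℤ B] [Module.Free ℤ A] [Module.Free ℤ B]
    (h : Module.finrank ℤ A = Module.finrank ℤ B) (r : A →+ B) (hr : Function.Injective r)
    (b : B) : ∃ n : ℤ, 0 < n ∧ ∃ a, r a = n • b := by
  have h1 : Module.finrank ℤ (LinearMap.range r.toIntLinearMap) = Module.finrank ℤ B := by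
    rw [LinearMap.finrank_range_of_inj hr, h]
  have h2 := Submodule.finrank_quotient_add_finrank (LinearMap.range r.toIntLinearMap)
  have h3 : Module.finrank ℤ (B ⧸ LinearMap.range r.toIntLinearMap) = 0 := by omega
  obtain ⟨n, hn, hb⟩ := Module.finrank_eq_zero_iff.1 h3
    (Submodule.Quotient.mk b)
  rw [← Submodule.Quotient.mk_smul, Submodule.Quotient.mk_eq_zero] at hb
  obtain ⟨a, ha⟩ := hb
  rcases lt_or_gt_of_ne hn with hn | hn
  · exact ⟨-n, by omega, -a, by rw [map_neg, neg_smul]; exact congrArg _ ha⟩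
  · exact ⟨n, hn, a, ha⟩

end Lattices

theorem finite_fn {S : Set X} (hS : K.IsSubcone S) : Module.Finite ℤ (K.fn S) := hS.isCone.fg

theorem free_fn {S : Set X} (hS : K.IsSubcone S) : Module.Free ℤ (K.fn S) :=
  have := finite_fn hS
  inferInstance

/-- A function vanishing on a full-dimensional part vanishes. -/
theorem eq_zero_of_restr {S T : Set X} (hS : K.IsSubcone S) (hT : K.IsSubcone T) (h : S ⊆ T)
    (hd : K.dim S = K.dim T) {m : X → ℝ} (hm : m ∈ K.fn T) (h0 : ∀ x ∈ S, m x = 0) : m = 0 := by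
  have := finite_fn hS
  have hfin := finite_fn hT
  have := free_fn hS
  have := free_fn hT
  have hd' : Module.finrank ℤ (K.fn T) = Module.finrank ℤ ((K.fn T).map (restr S)) := by
    rw [hS.map_restr hT h]; exact hd.symm
  have : Module.Finite ℤ ((K.fn T).map (restr S)) := finite_map hfin _
  have := injective_of_finrank hd' ((restr S).addSubgroupMap _)
    ((restr S).addSubgroupMap_surjective _)
  have h1 : (⟨m, hm⟩ : K.fn T) = 0 := this (by
    rw [map_zero]
    refine Subtype.ext ?_
    funext x
    by_cases hx : x ∈ S
    · exact (restr_of_mem hx m).trans (h0 x hx)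
    · exact restr_of_notMem hx m)
  exact congrArg Subtype.val h1

/-- Restriction of integral linear functions to a smaller subcone. -/
def resHom {S T : Set X} (hS : K.IsSubcone S) (hT : K.IsSubcone T) (h : S ⊆ T) :
    K.fn T →+ K.fn S where
  toFun m := ⟨restr S m.1, hS.map_restr hT h ▸ AddSubgroup.mem_map_of_mem _ m.2⟩
  map_zero' := Subtype.ext (map_zero (restr S))
  map_add' m m' := Subtype.ext (map_add (restr S) m.1 m'.1)

theorem resHom_surjective {S T : Set X} (hS : K.IsSubcone S) (hT : K.IsSubcone T) (h : S ⊆ T) :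
    Function.Surjective (resHom hS hT h) := by
  rintro ⟨m, hm⟩
  have hm' := hm
  rw [← hS.map_restr hT h] at hm'
  obtain ⟨m', hm', rfl⟩ := hm'
  exact ⟨⟨m', hm'⟩, rfl⟩

theorem resHom_injective {S T : Set X} (hS : K.IsSubcone S) (hT : K.IsSubcone T) (h : S ⊆ T)
    (h0 : ∀ m ∈ K.fn T, (∀ x ∈ S, m x = 0) → m = 0) : Function.Injective (resHom hS hT h) := by
  rw [injective_iff_map_eq_zero]
  rintro ⟨m, hm⟩ hm0
  refine Subtype.ext (h0 m hm fun x hx => ?_)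
  have := congrFun (congrArg Subtype.val hm0) x
  exact (restr_of_mem hx m).symm.trans this

theorem bijective_dual {A : Type*} {B : Type*} [AddCommGroup A] [AddCommGroup B] (e : A →+ B)
    (he1 : Function.Injective e) (he2 : Function.Surjective e) :
    Function.Bijective (AddMonoidHom.compHom' e : (B →+ ℤ) →+ (A →+ ℤ)) := by
  let e' := AddEquiv.ofBijective e ⟨he1, he2⟩
  refine ⟨fun n n' hn => ?_, fun n => ⟨n.comp e'.symm.toAddMonoidHom, ?_⟩⟩
  · ext b
    obtain ⟨a, rfl⟩ := he2 b
    exact DFunLike.congr_fun hn a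
  · ext a
    exact congrArg n (e'.symm_apply_apply a)

namespace Mor

variable (f : Mor K L) {S T : Set X}

theorem pull_apply (hS : K.IsSubcone S) (m : L.fn (f.toFun '' S)) {x : X} (hx : x ∈ S) :
    (f.pull hS m).1 x = m.1 (f.toFun x) :=
  restr_of_mem hx _

theorem image_eq_zero (hS : K.IsSubcone S) (hT : K.IsSubcone T) (h : S ⊆ T)
    (hd : K.dim S = K.dim T) {m : Y → ℝ} (hm : m ∈ L.fn (f.toFun '' T))
    (h0 : ∀ y ∈ f.toFun '' S, m y = 0) : m = 0 := by
  have h1 : (f.pull hT ⟨m, hm⟩).1 = 0 := eq_zero_of_restr hS hT h hd (f.pull hT ⟨m, hm⟩).2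
    fun x hx => (f.pull_apply hT ⟨m, hm⟩ (h hx)).trans (h0 _ (Set.mem_image_of_mem _ hx))
  funext y
  by_cases hy : y ∈ f.toFun '' T
  · obtain ⟨x, hx, rfl⟩ := hy
    refine (f.pull_apply hT ⟨m, hm⟩ hx).symm.trans ?_
    rw [h1]; rfl
  · exact (f.isSubcone_image hT).isCone.supp m hm y hy

theorem dim_image (hS : K.IsSubcone S) (hT : K.IsSubcone T) (h : S ⊆ T)
    (hd : K.dim S = K.dim T) : L.dim (f.toFun '' S) = L.dim (f.toFun '' T) := by
  have hi := resHom_injective (f.isSubcone_image hS) (f.isSubcone_image hT) (Set.image_mono h)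
    fun m hm h0 => f.image_eq_zero hS hT h hd hm h0
  have hs := resHom_surjective (f.isSubcone_image hS) (f.isSubcone_image hT) (Set.image_mono h)
  exact (LinearEquiv.finrank_eq (LinearEquiv.ofBijective
    (resHom (f.isSubcone_image hS) (f.isSubcone_image hT) (Set.image_mono h)).toIntLinearMap
    ⟨hi, hs⟩)).symm

theorem latIndex_eq (hS : K.IsSubcone S) (hT : K.IsSubcone T) (h : S ⊆ T)
    (hd : K.dim S = K.dim T) : f.latIndex hS = f.latIndex hT := by
  have hi := resHom_injective (f.isSubcone_image hS) (f.isSubcone_image hT) (Set.image_mono h)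
    fun m hm h0 => f.image_eq_zero hS hT h hd hm h0
  have hs := resHom_surjective (f.isSubcone_image hS) (f.isSubcone_image hT) (Set.image_mono h)
  have hi' := resHom_injective hS hT h fun m hm h0 => eq_zero_of_restr hS hT h hd hm h0
  have hs' := resHom_surjective hS hT h
  set r := resHom hS hT h
  set r' := resHom (f.isSubcone_image hS) (f.isSubcone_image hT) (Set.image_mono h)
  have comm : ∀ m, r (f.pull hT m) = f.pull hS (r' m) := fun m => Subtype.ext (by
    funext x
    by_cases hx : x ∈ S
    · rw [f.pull_apply hS _ hx]
      refine (restr_of_mem hx _).trans ((f.pull_apply hT m (h hx)).trans ?_)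
      exact (restr_of_mem (Set.mem_image_of_mem _ hx) m.1).symm
    · exact (restr_of_notMem hx _).trans (restr_of_notMem hx _).symm)
  let R : K.lat S →+ K.lat T := AddMonoidHom.compHom' r
  let R' : L.lat (f.toFun '' S) →+ L.lat (f.toFun '' T) := AddMonoidHom.compHom' r'
  have hR := bijective_dual r hi' hs'
  have hR' := bijective_dual r' hi hs
  have : (f.latMap hS).range.map R' = (f.latMap hT).range := by
    have hc : R'.comp (f.latMap hS) = (f.latMap hT).comp R := by
      ext n m
      exact congrArg n (comm m).symm
    rw [AddMonoidHom.map_range, hc, ← AddMonoidHom.map_range,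
      AddMonoidHom.range_eq_top.2 hR.2, ← AddMonoidHom.range_eq_map]
  have e := AddSubgroup.index_map_equiv (f.latMap hS).range (AddEquiv.ofBijective R' hR')
  rw [latIndex, latIndex, ← e, ← this]
  rfl

variable {k : ℕ}

/-- The push-forward of weights on subcones: a `k`-dimensional subcone `σ` on which `f` is injective
is mapped to `[N^{f(σ)} : f(N^σ)]` times its image, all other `k`-dimensional subcones to zero. -/
def pushGen (k : ℕ) : FreeAbelianGroup (K.Subcone k) →+ L.Weight k :=
  FreeAbelianGroup.lift fun σ => (f.latIndex σ.isSubcone : ℤ) • L.cls k (f.toFun '' σ.carrier)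

theorem cls_image_subdivision {σ : K.Subcone k} {T : Finset (K.Subcone k)}
    (hT : K.IsSubdivision σ T) :
    L.cls k (f.toFun '' σ.carrier) = ∑ τ ∈ T, L.cls k (f.toFun '' τ.carrier) := by
  classical
  have hsub : ∀ τ ∈ T, τ.carrier ⊆ σ.carrier := fun τ hτ => by
    rw [hT.1]; exact Set.subset_biUnion_of_mem (u := fun τ : K.Subcone k => τ.carrier) hτ
  have hdim : ∀ τ ∈ T, L.dim (f.toFun '' τ.carrier) = L.dim (f.toFun '' σ.carrier) := fun τ hτ =>
    f.dim_image τ.isSubcone σ.isSubcone (hsub τ hτ) (τ.dim_eq.trans σ.dim_eq.symm)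
  by_cases hk : L.dim (f.toFun '' σ.carrier) = k
  swap
  · rw [cls, dif_neg fun h => hk h.2, Finset.sum_eq_zero]
    exact fun τ hτ => dif_neg fun h => hk ((hdim τ hτ).symm.trans h.2)
  have := finite_fn σ.isSubcone
  have := free_fn σ.isSubcone
  have := finite_fn (f.isSubcone_image σ.isSubcone)
  have := free_fn (f.isSubcone_image σ.isSubcone)
  have hinj : Function.Injective (f.pull σ.isSubcone) := by
    rw [injective_iff_map_eq_zero]
    rintro ⟨m, hm⟩ hm0
    refine Subtype.ext ?_
    funext y
    by_cases hy : y ∈ f.toFun '' σ.carrier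
    · obtain ⟨x, hx, rfl⟩ := hy
      refine (f.pull_apply σ.isSubcone ⟨m, hm⟩ hx).symm.trans ?_
      rw [hm0]; rfl
    · exact (f.isSubcone_image σ.isSubcone).isCone.supp m hm y hy
  have hsep : ∀ τ ∈ T, ∀ τ' ∈ T, τ ≠ τ' → ∃ m ∈ L.fn (f.toFun '' σ.carrier), m ≠ 0 ∧
      (∀ y ∈ f.toFun '' τ.carrier, 0 ≤ m y) ∧ ∀ y ∈ f.toFun '' τ'.carrier, m y ≤ 0 := by
    intro τ hτ τ' hτ' hne
    obtain ⟨m, hm, hm0, h1, h2⟩ := hT.2 τ hτ τ' hτ' hne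
    obtain ⟨n, hn, ⟨m', hm'⟩, he⟩ := exists_smul_of_finrank (hk.trans σ.dim_eq.symm)
      (f.pull σ.isSubcone) hinj ⟨m, hm⟩
    have hv : ∀ x ∈ σ.carrier, m' (f.toFun x) = n * m x := fun x hx => by
      refine (f.pull_apply σ.isSubcone ⟨m', hm'⟩ hx).symm.trans ?_
      rw [he]
      exact zsmul_eq_mul _ _
    have hn' : (0 : ℝ) < n := by exact_mod_cast hn
    refine ⟨m', hm', ?_, ?_, ?_⟩
    · rintro rfl
      refine hm0 (funext fun x => ?_)
      by_cases hx : x ∈ σ.carrier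
      · have := hv x hx
        rw [Pi.zero_apply, eq_comm, mul_eq_zero] at this
        exact this.resolve_left hn'.ne'
      · exact σ.isSubcone.isCone.supp m hm x hx
    · rintro _ ⟨x, hx, rfl⟩
      rw [hv x (hsub τ hτ hx)]
      exact mul_nonneg hn'.le (h1 x hx)
    · rintro _ ⟨x, hx, rfl⟩
      rw [hv x (hsub τ' hτ' hx)]
      exact mul_nonpos_of_nonneg_of_nonpos hn'.le (h2 x hx)
  -- the images of the parts are pairwise distinct
  have hne : ∀ τ ∈ T, ∀ τ' ∈ T, f.toFun '' τ.carrier = f.toFun '' τ'.carrier → τ = τ' := by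
    intro τ hτ τ' hτ' he
    by_contra hc
    obtain ⟨m, hm, hm0, h1, h2⟩ := hsep τ hτ τ' hτ' hc
    exact hm0 (f.image_eq_zero τ.isSubcone σ.isSubcone (hsub τ hτ) (τ.dim_eq.trans σ.dim_eq.symm) hm
      fun y hy => le_antisymm (h2 y (he ▸ hy)) (h1 y hy))
  let im : K.Subcone k → L.Subcone k := fun τ =>
    if h : L.dim (f.toFun '' τ.carrier) = k then ⟨f.toFun '' τ.carrier, f.isSubcone_image τ.isSubcone, h⟩
    else ⟨f.toFun '' σ.carrier, f.isSubcone_image σ.isSubcone, hk⟩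
  have him : ∀ τ ∈ T, (im τ).carrier = f.toFun '' τ.carrier := fun τ hτ => by
    simp only [im]
    rw [dif_pos ((hdim τ hτ).trans hk)]
  have hinjT : Set.InjOn im T := fun τ hτ τ' hτ' he => hne τ hτ τ' hτ' (by
    rw [← him τ hτ, ← him τ' hτ', he])
  have hs : L.IsSubdivision ⟨f.toFun '' σ.carrier, f.isSubcone_image σ.isSubcone, hk⟩ (T.image im) := by
    constructor
    · change f.toFun '' σ.carrier = _
      rw [hT.1, Set.image_iUnion₂, Finset.set_biUnion_finset_image]
      exact Set.iUnion₂_congr fun τ hτ => (him τ hτ).symm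
    · intro ρ hρ ρ' hρ' hne'
      obtain ⟨τ, hτ, rfl⟩ := Finset.mem_image.1 hρ
      obtain ⟨τ', hτ', rfl⟩ := Finset.mem_image.1 hρ'
      rw [him τ hτ, him τ' hτ']
      exact hsep τ hτ τ' hτ' fun h => hne' (h ▸ rfl)
  have hrel := (QuotientAddGroup.eq_zero_iff (N := L.subdivisionRel k) _).2
    (AddSubgroup.subset_closure ⟨_, _, hs, rfl⟩)
  have hrel' := sub_eq_zero.1 ((map_sub (QuotientAddGroup.mk' (L.subdivisionRel k)) _ _).symm.trans
    hrel)
  rw [map_sum, Finset.sum_image hinjT] at hrel'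
  rw [cls, dif_pos ⟨f.isSubcone_image σ.isSubcone, hk⟩]
  refine hrel'.trans (Finset.sum_congr rfl fun τ hτ => ?_)
  rw [cls, dif_pos ⟨f.isSubcone_image τ.isSubcone, (hdim τ hτ).trans hk⟩]
  congr 2
  exact Subcone.ext (him τ hτ)

/-- The push-forward of weights along a morphism of cone complexes. -/
def push (k : ℕ) : K.Weight k →+ L.Weight k :=
  QuotientAddGroup.lift (K.subdivisionRel k) (f.pushGen k) (by
    rw [subdivisionRel, AddSubgroup.closure_le]
    rintro _ ⟨σ, T, hT, rfl⟩
    have hsub : ∀ τ ∈ T, τ.carrier ⊆ σ.carrier := fun τ hτ => by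
      rw [hT.1]; exact Set.subset_biUnion_of_mem (u := fun τ : K.Subcone k => τ.carrier) hτ
    change f.pushGen k _ = 0
    rw [map_sub, map_sum, sub_eq_zero]
    simp only [pushGen, FreeAbelianGroup.lift_apply_of]
    rw [f.cls_image_subdivision hT, Finset.smul_sum]
    refine Finset.sum_congr rfl fun τ hτ => ?_
    rw [f.latIndex_eq τ.isSubcone σ.isSubcone (hsub τ hτ) (τ.dim_eq.trans σ.dim_eq.symm)])

end Mor

section Star

/-- The points of `X` such that every cone containing them contains the cone `i`. -/
def openStar (K : ConeComplex X) (i : K.Idx) : Set X :=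
  {x | ∀ j, x ∈ K.carrier j → K.carrier i ⊆ K.carrier j}

/-- Two points of the open star of the cone `τ` are equivalent if they lie in the same cones, and
have the same image in `N^σ_ℝ / N^τ_ℝ` for all these cones `σ`. -/
def starSetoid (K : ConeComplex X) (i : K.Idx) : Setoid (K.openStar i) where
  r x y := (∀ j, x.1 ∈ K.carrier j ↔ y.1 ∈ K.carrier j) ∧
    ∀ j, x.1 ∈ K.carrier j → ∀ m ∈ K.M j, (∀ z ∈ K.carrier i, m z = 0) → m x.1 = m y.1
  iseqv :=
    { refl := fun _ => ⟨fun _ => Iff.rfl, fun _ _ _ _ _ => rfl⟩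
      symm := fun h => ⟨fun j => (h.1 j).symm,
        fun j hj m hm h0 => (h.2 j ((h.1 j).2 hj) m hm h0).symm⟩
      trans := fun h h' => ⟨fun j => (h.1 j).trans (h'.1 j), fun j hj m hm h0 =>
        (h.2 j hj m hm h0).trans (h'.2 j ((h.1 j).1 hj) m hm h0)⟩ }

/-- The points of the star of `K` at the cone `τ`: the star is the disjoint union of the relative
interiors of the cones `σ/τ` for `σ ⊇ τ`, where `σ/τ` is the image of `σ` in `N^σ_ℝ / N^τ_ℝ`. -/
def StarPt (K : ConeComplex X) (i : K.Idx) : Type u := Quotient (K.starSetoid i)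

/-- The projection of the open star to the star. -/
def starMk (i : K.Idx) (x : K.openStar i) : K.StarPt i := Quotient.mk _ x

theorem starMk_surjective (i : K.Idx) : Function.Surjective (K.starMk i) := Quotient.mk_surjective

theorem starMk_eq {i : K.Idx} {x y : K.openStar i} : K.starMk i x = K.starMk i y ↔
    (∀ j, x.1 ∈ K.carrier j ↔ y.1 ∈ K.carrier j) ∧
    ∀ j, x.1 ∈ K.carrier j → ∀ m ∈ K.M j, (∀ z ∈ K.carrier i, m z = 0) → m x.1 = m y.1 :=
  Quotient.eq (r := K.starSetoid i)

/-- The cone `σ/τ` as a subset of the star. -/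
def starCarrier (K : ConeComplex X) (i j : K.Idx) : Set (K.StarPt i) :=
  {p | ∃ x, x.1 ∈ K.carrier j ∧ K.starMk i x = p}

/-- The integral linear functions on `σ/τ`: they are induced by those on `σ` vanishing on `τ`. -/
def starM (K : ConeComplex X) (i j : K.Idx) : AddSubgroup (K.StarPt i → ℝ) where
  carrier := {g | ∃ m ∈ K.M j, (∀ z ∈ K.carrier i, m z = 0) ∧ ∀ x, g (K.starMk i x) = m x.1}
  add_mem' := by
    rintro g g' ⟨m, hm, h0, hg⟩ ⟨m', hm', h0', hg'⟩
    exact ⟨m + m', add_mem hm hm', fun z hz => by simp [h0 z hz, h0' z hz],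
      fun x => by simp [hg x, hg' x]⟩
  zero_mem' := ⟨0, zero_mem _, fun _ _ => rfl, fun _ => rfl⟩
  neg_mem' := by
    rintro g ⟨m, hm, h0, hg⟩
    exact ⟨-m, neg_mem hm, fun z hz => by simp [h0 z hz], fun x => by simp [hg x]⟩

theorem mem_starCarrier {i j : K.Idx} {x : K.openStar i} :
    K.starMk i x ∈ K.starCarrier i j ↔ x.1 ∈ K.carrier j := by
  constructor
  · rintro ⟨y, hy, h⟩
    exact ((starMk_eq.1 h).1 j).1 hy
  · exact fun h => ⟨x, h, rfl⟩

theorem exists_star_fn {i j : K.Idx} {m : X → ℝ} (hm : m ∈ K.M j)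
    (h0 : ∀ z ∈ K.carrier i, m z = 0) :
    ∃ g ∈ K.starM i j, ∀ x : K.openStar i, g (K.starMk i x) = m x.1 := by
  refine ⟨Quotient.lift (fun x : K.openStar i => m x.1) ?_, ⟨m, hm, h0, fun _ => rfl⟩,
    fun _ => rfl⟩
  intro x y h
  by_cases hx : x.1 ∈ K.carrier j
  · exact h.2 j hx m hm h0
  · rw [(K.isCone j).supp m hm _ hx, (K.isCone j).supp m hm _ fun hy => hx ((h.1 j).2 hy)]

/-- Adding an interior point of `τ` to a point of `σ ⊇ τ` leads to a point of the open star. -/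
theorem exists_shift {i j : K.Idx} (h : K.carrier i ⊆ K.carrier j) :
    ∃ t ∈ K.carrier i, IsIntegralPt (K.M j) t ∧ ∀ x ∈ K.carrier j, ∃ y : K.openStar i,
      y.1 ∈ K.carrier j ∧ ∀ m ∈ K.M j, m y.1 = m x + m t := by
  obtain ⟨t, ht, hti, h0⟩ := (K.isCone i).exists_interior
  have hres : ∀ m ∈ K.M j, ∀ x ∈ K.carrier i, restr (K.carrier i) m x = m x := fun m _ x hx =>
    restr_of_mem hx m
  refine ⟨t, ht, fun m hm => ?_, fun x hx => ?_⟩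
  · obtain ⟨n, hn⟩ := hti _ (restr_mem h hm)
    exact ⟨n, by rw [← hn, hres m hm t ht]⟩
  obtain ⟨y, hy, hym⟩ := (K.isCone j).exists_add hx (h ht)
  refine ⟨⟨y, fun l hl => ?_⟩, hy, hym⟩
  obtain ⟨k, hk, hkj, hkl⟩ := K.inter j l y ⟨hy, hl⟩
  refine subset_trans ?_ (face_subset hkl)
  obtain ⟨-, m, hm, hm0, he⟩ := hkj
  rw [he] at hk ⊢
  have hmt : m t = 0 := by
    have h1 := hk.2
    rw [hym m hm] at h1
    have := hm0 x hx
    have := hm0 t (h ht)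
    linarith
  intro z hz
  refine ⟨h hz, ?_⟩
  rw [← hres m hm z hz]
  refine h0 _ (restr_mem h hm) (fun x hx => ?_) ?_ z hz
  · rw [hres m hm x hx]; exact hm0 x (h hx)
  · rw [hres m hm t ht, hmt]

theorem star_isCone {i j : K.Idx} (h : K.carrier i ⊆ K.carrier j) :
    IsIntegralCone (K.starCarrier i j) (K.starM i j) := by
  obtain ⟨t, ht, htint, hsh⟩ := exists_shift h
  obtain ⟨ι, _, g, hg, h₁, h₂⟩ := (K.isCone j).exists_gen
  choose y hyj hym using fun k => hsh (g k) (hg k).1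
  have hym' : ∀ k, ∀ m ∈ K.M j, (∀ z ∈ K.carrier i, m z = 0) → m (y k).1 = m (g k) :=
    fun k m hm h0 => by rw [hym k m hm, h0 t ht, add_zero]
  refine IsIntegralCone.of_gen ?_ ?_ ?_ (fun k => K.starMk i (y k)) ?_ ?_ ?_ ?_
  · rintro g ⟨m, hm, h0, hg⟩ p hp
    obtain ⟨x, rfl⟩ := starMk_surjective i p
    rw [hg x, (K.isCone j).supp m hm _ fun hx => hp (mem_starCarrier.2 hx)]
  · have := (K.isCone j).fg
    let A : AddSubgroup (K.M j) :=
      { carrier := {m | ∀ z ∈ K.carrier i, m.1 z = 0}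
        add_mem' := fun {m m'} hm hm' z hz => by
          have h1 := hm z hz
          have h2 := hm' z hz
          simp [h1, h2]
        zero_mem' := fun _ _ => rfl
        neg_mem' := fun {m} hm z hz => by
          have h1 := hm z hz
          simp [h1] }
    have hA : ∀ a : A, ∃ g : K.starM i j, ∀ x : K.openStar i, g.1 (K.starMk i x) = a.1.1 x.1 := by
      intro a
      obtain ⟨g, hg, h'⟩ := exists_star_fn a.1.2 a.2
      exact ⟨⟨g, hg⟩, h'⟩
    choose F hF using hA
    let F' : A →+ K.starM i j := AddMonoidHom.mk' F fun a b => by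
      refine Subtype.ext (funext fun p => ?_)
      obtain ⟨x, rfl⟩ := starMk_surjective i p
      exact (hF _ x).trans (congrArg₂ (· + ·) (hF a x) (hF b x)).symm
    have hfin : Module.Finite ℤ A :=
      Module.Finite.of_injective A.subtype.toIntLinearMap Subtype.val_injective
    refine Module.Finite.of_surjective F'.toIntLinearMap ?_
    rintro ⟨g, m, hm, h0, hg⟩
    refine ⟨⟨⟨m, hm⟩, h0⟩, Subtype.ext (funext fun p => ?_)⟩
    obtain ⟨x, rfl⟩ := starMk_surjective i p
    exact (hF _ x).trans (hg x).symm
  · rintro _ ⟨x, hx, rfl⟩ _ ⟨x', hx', rfl⟩ hxx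
    have hm' : ∀ m ∈ K.M j, (∀ z ∈ K.carrier i, m z = 0) → m x.1 = m x'.1 := by
      intro m hm h0
      obtain ⟨g, hg, hgm⟩ := exists_star_fn hm h0
      rw [← hgm x, ← hgm x', hxx g hg]
    have main : ∀ x x' : K.openStar i, x.1 ∈ K.carrier j → x'.1 ∈ K.carrier j →
        (∀ m ∈ K.M j, (∀ z ∈ K.carrier i, m z = 0) → m x.1 = m x'.1) →
        ∀ l, x.1 ∈ K.carrier l → x'.1 ∈ K.carrier l := by
      intro x x' hx hx' hm' l hl
      obtain ⟨k, hk, hkj, hkl⟩ := K.inter j l x.1 ⟨hx, hl⟩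
      refine face_subset hkl ?_
      have hik := x.2 k hk
      obtain ⟨-, m, hm, -, he⟩ := hkj
      rw [he] at hik hk ⊢
      exact ⟨hx', (hm' m hm fun z hz => (hik hz).2) ▸ hk.2⟩
    have hl := fun l => Iff.intro (main x x' hx hx' hm' l)
      (main x' x hx' hx (fun m hm h0 => (hm' m hm h0).symm) l)
    refine starMk_eq.2 ⟨hl, fun l hxl m hm h0 => ?_⟩
    -- pass to a common face of the two cones
    obtain ⟨k, hk, hkj, hkl⟩ := K.inter j l x.1 ⟨hx, hxl⟩
    have hk' := (hl k).1 hk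
    have h1 := restr_mem (face_subset hkl) hm
    have h2 := h1
    rw [hkj.1] at h2
    obtain ⟨m', hm1, hm2⟩ := h2
    have e : ∀ z ∈ K.carrier k, m z = m' z := fun z hz => by
      rw [← restr_of_mem hz m, ← hm2, restr_of_mem hz]
    rw [e _ hk, e _ hk']
    refine hm' m' hm1 fun z hz => ?_
    rw [← e z (x.2 k hk hz), h0 z hz]
  · refine fun k => ⟨⟨y k, hyj k, rfl⟩, ?_⟩
    rintro _ ⟨m, hm, h0, hgm⟩
    obtain ⟨n, hn⟩ := (hg k).2 m hm
    exact ⟨n, by rw [hgm, hym' k m hm h0, hn]⟩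
  · rintro _ ⟨x, hx, rfl⟩
    obtain ⟨a, ha, hxa⟩ := h₁ x.1 hx
    refine ⟨a, ha, ?_⟩
    rintro _ ⟨m, hm, h0, hgm⟩
    rw [hgm, hxa m hm]
    exact Finset.sum_congr rfl fun k _ => by rw [hgm, hym' k m hm h0]
  · intro a ha
    obtain ⟨x, hx, hxa⟩ := h₂ a ha
    obtain ⟨x', hx', hxx'⟩ := hsh x hx
    refine ⟨_, ⟨x', hx', rfl⟩, ?_⟩
    rintro _ ⟨m, hm, h0, hgm⟩
    rw [hgm, hxx' m hm, h0 t ht, add_zero, hxa m hm]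
    exact Finset.sum_congr rfl fun k _ => by rw [hgm, hym' k m hm h0]
  · rintro _ ⟨x, hx, rfl⟩ _ ⟨x', hx', rfl⟩ hxx _ ⟨m, hm, h0, hgm⟩
    obtain ⟨-, m₀, hm₀, hpos, he⟩ := isFaceOf_of_subset h
    obtain ⟨g, hg', hgm₀⟩ := exists_star_fn (i := i) hm₀ fun z hz => (he ▸ hz : z ∈ {x ∈ _ | _}).2
    have h3 := hxx g hg'
    rw [hgm₀, hgm₀] at h3
    have h4 := hpos _ hx
    have h5 := hpos _ hx'
    have h6 : x.1 ∈ K.carrier i := by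
      rw [he]; exact ⟨hx, by linarith⟩
    rw [hgm, h0 _ h6]

theorem starM_eq_map {i k j : K.Idx} (hik : K.carrier i ⊆ K.carrier k)
    (hkj : K.carrier k ⊆ K.carrier j) :
    K.starM i k = (K.starM i j).map (restr (K.starCarrier i k)) := by
  ext g'
  constructor
  · rintro ⟨m', hm', h0', hg'⟩
    have h2 := hm'
    rw [(isFaceOf_of_subset hkj).1] at h2
    obtain ⟨m'', hm1, rfl⟩ := h2
    have h0'' : ∀ z ∈ K.carrier i, m'' z = 0 := fun z hz => by
      rw [← restr_of_mem (hik hz) m'', h0' z hz]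
    obtain ⟨g'', hg1, hg2⟩ := exists_star_fn hm1 h0''
    refine ⟨g'', hg1, funext fun p => ?_⟩
    obtain ⟨x, rfl⟩ := starMk_surjective i p
    rw [hg']
    by_cases hx : x.1 ∈ K.carrier k
    · rw [restr_of_mem (mem_starCarrier.2 hx), restr_of_mem hx, hg2]
    · rw [restr_of_notMem (fun h => hx (mem_starCarrier.1 h)), restr_of_notMem hx]
  · rintro ⟨g'', ⟨m', hm', h0', hg''⟩, rfl⟩
    refine ⟨restr (K.carrier k) m', restr_mem hkj hm', fun z hz => ?_, fun x => ?_⟩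
    · rw [restr_of_mem (hik hz), h0' z hz]
    · by_cases hx : x.1 ∈ K.carrier k
      · rw [restr_of_mem (mem_starCarrier.2 hx), restr_of_mem hx, hg'']
      · rw [restr_of_notMem (fun h => hx (mem_starCarrier.1 h)), restr_of_notMem hx]

theorem star_isFaceOf {i k j : K.Idx} (hik : K.carrier i ⊆ K.carrier k)
    (hkj : K.carrier k ⊆ K.carrier j) :
    IsFaceOf (K.starCarrier i k) (K.starM i k) (K.starCarrier i j) (K.starM i j) := by
  refine ⟨starM_eq_map hik hkj, ?_⟩
  obtain ⟨-, m, hm, hpos, he⟩ := isFaceOf_of_subset hkj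
  have he' : ∀ x, x ∈ K.carrier k ↔ x ∈ K.carrier j ∧ m x = 0 := fun x => by rw [he]; rfl
  obtain ⟨g, hg, hgm⟩ := exists_star_fn (i := i) hm fun z hz => ((he' z).1 (hik hz)).2
  refine ⟨g, hg, ?_, ?_⟩
  · rintro _ ⟨x, hx, rfl⟩
    rw [hgm]; exact hpos _ hx
  · ext p
    obtain ⟨x, rfl⟩ := starMk_surjective i p
    change _ ↔ K.starMk i x ∈ K.starCarrier i j ∧ g (K.starMk i x) = 0
    rw [mem_starCarrier, mem_starCarrier, hgm, he']

theorem subset_of_starCarrier_subset {i j j' : K.Idx} (hj : K.carrier i ⊆ K.carrier j)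
    (he : K.starCarrier i j ⊆ K.starCarrier i j') : K.carrier j ⊆ K.carrier j' := by
  obtain ⟨s, hs, -, hs0⟩ := (K.isCone j).exists_interior
  obtain ⟨t, ht, -, hsh⟩ := exists_shift hj
  obtain ⟨y, hy, hym⟩ := hsh s hs
  have hy' : y.1 ∈ K.carrier j' := mem_starCarrier.1 (he (mem_starCarrier.2 hy))
  obtain ⟨k, hk, hkj, hkj'⟩ := K.inter j j' y.1 ⟨hy, hy'⟩
  refine subset_trans ?_ (face_subset hkj')
  obtain ⟨-, m, hm, hm0, hke⟩ := hkj
  rw [hke] at hk ⊢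
  refine fun z hz => ⟨hz, hs0 m hm hm0 ?_ z hz⟩
  have h1 := hk.2
  rw [hym m hm] at h1
  have := hm0 s hs
  have := hm0 t (hj ht)
  linarith

variable (K) in
/-- The star of `K` at the cone `i`. Its cones are the cones `σ/τ` for `σ ⊇ τ`. -/
def star (i : K.Idx) : ConeComplex (K.StarPt i) where
  Idx := {j : K.Idx // K.carrier i ⊆ K.carrier j}
  finite := inferInstance
  carrier j := K.starCarrier i j.1
  M j := K.starM i j.1
  isCone j := star_isCone j.2
  carrier_injective := by
    intro j j' he
    exact Subtype.ext (K.carrier_injective ((subset_of_starCarrier_subset j.2 he.subset).antisymm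
      (subset_of_starCarrier_subset j'.2 he.symm.subset)))
  cover p := by
    obtain ⟨x, rfl⟩ := starMk_surjective i p
    obtain ⟨j, hj⟩ := K.cover x.1
    exact ⟨⟨j, x.2 j hj⟩, mem_starCarrier.2 hj⟩
  exists_face := by
    rintro ⟨j, hj⟩ S' M' ⟨rfl, g, ⟨m, hm, h0, hgm⟩, hpos, rfl⟩
    obtain ⟨t, ht, -, hsh⟩ := exists_shift hj
    have hpos' : ∀ x ∈ K.carrier j, 0 ≤ m x := fun x hx => by
      obtain ⟨y, hy, hym⟩ := hsh x hx
      have := hpos _ (mem_starCarrier.2 hy)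
      rwa [hgm, hym m hm, h0 t ht, add_zero] at this
    obtain ⟨k, hk, hkM⟩ := K.exists_face j _ _ ⟨rfl, m, hm, hpos', rfl⟩
    have hik : K.carrier i ⊆ K.carrier k := fun z hz => by
      rw [hk]; exact ⟨hj hz, h0 z hz⟩
    have hcar : K.starCarrier i k = {p ∈ K.starCarrier i j | g p = 0} := by
      ext p
      obtain ⟨x, rfl⟩ := starMk_surjective i p
      change _ ↔ K.starMk i x ∈ K.starCarrier i j ∧ g (K.starMk i x) = 0
      rw [mem_starCarrier, mem_starCarrier, hk, hgm]
      exact Iff.rfl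
    refine ⟨⟨k, hik⟩, hcar, ?_⟩
    rw [← hcar]
    have hkj : K.carrier k ⊆ K.carrier j := fun z hz => by
      rw [hk] at hz; exact hz.1
    exact starM_eq_map hik hkj
  inter := by
    rintro ⟨j, hj⟩ ⟨l, hl⟩ p ⟨hpj, hpl⟩
    obtain ⟨x, rfl⟩ := starMk_surjective i p
    obtain ⟨k, hk, hkj, hkl⟩ := K.inter j l x.1 ⟨mem_starCarrier.1 hpj, mem_starCarrier.1 hpl⟩
    exact ⟨⟨k, x.2 k hk⟩, mem_starCarrier.2 hk,
      star_isFaceOf (x.2 k hk) (face_subset hkj), star_isFaceOf (x.2 k hk) (face_subset hkl)⟩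

end Star

section StarMaps

theorem exists_generic {i : K.Idx} : ∃ t ∈ K.carrier i, ∀ j, t ∈ K.carrier j →
    K.carrier i ⊆ K.carrier j := by
  obtain ⟨t, ht, -, h0⟩ := (K.isCone i).exists_interior
  refine ⟨t, ht, fun j hj => ?_⟩
  obtain ⟨k, hk, hki, hkj⟩ := K.inter i j t ⟨ht, hj⟩
  refine subset_trans ?_ (face_subset hkj)
  obtain ⟨-, m, hm, hm0, he⟩ := hki
  rw [he] at hk ⊢
  exact fun x hx => ⟨hx, h0 m hm hm0 hk.2 x hx⟩

theorem Mor.restr_comp_mem (f : Mor K L) {i : K.Idx} {j : L.Idx}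
    (h : Set.MapsTo f.toFun (K.carrier i) (L.carrier j)) {m : Y → ℝ} (hm : m ∈ L.M j) :
    restr (K.carrier i) (m ∘ f.toFun) ∈ K.M i := by
  have h1 : restr (f.toFun '' K.carrier i) m ∈ L.fn (f.toFun '' K.carrier i) := by
    rw [(f.isSubcone_image (isSubcone_carrier i)).fn_eq h.image_subset]
    exact AddSubgroup.mem_map_of_mem _ hm
  have h2 := (f.pull (isSubcone_carrier i) ⟨_, h1⟩).2
  change restr _ (restr _ m ∘ f.toFun) ∈ _ at h2
  rwa [fn_carrier, restr_comp (Set.mapsTo_image _ _)] at h2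

theorem Mor.mapsTo_of_minimal (f : Mor K L) {i : K.Idx} {j : L.Idx} {x : X} (hx : x ∈ K.carrier i)
    (hmin : ∀ j, x ∈ K.carrier j → K.carrier i ⊆ K.carrier j) (hj : f.toFun x ∈ L.carrier j) :
    Set.MapsTo f.toFun (K.carrier i) (L.carrier j) := by
  obtain ⟨j', hj', hM⟩ := f.map_cone i
  obtain ⟨k, hk, hkj', hkj⟩ := L.inter j' j _ ⟨hj' hx, hj⟩
  intro y hy
  refine face_subset hkj ?_
  obtain ⟨-, m, hm, hm0, he⟩ := hkj'
  rw [he] at hk ⊢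
  refine ⟨hj' hy, ?_⟩
  have e : ∀ y ∈ K.carrier i, restr (K.carrier i) (m ∘ f.toFun) y = m (f.toFun y) :=
    fun y hy => restr_of_mem hy _
  obtain ⟨l, hl, -⟩ := K.exists_face i _ _ ⟨rfl, _, hM m hm,
    fun y hy => by rw [e y hy]; exact hm0 _ (hj' hy), rfl⟩
  have hxl : x ∈ K.carrier l := by
    rw [hl]; exact ⟨hx, (e x hx).trans hk.2⟩
  have hyl := hmin l hxl hy
  rw [hl] at hyl
  exact (e y hy).symm.trans hyl.2

theorem Mor.exists_target (f : Mor K L) (i : K.Idx) :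
    ∃ j, Set.MapsTo f.toFun (K.carrier i) (L.carrier j) ∧
      ∀ j', Set.MapsTo f.toFun (K.carrier i) (L.carrier j') → L.carrier j ⊆ L.carrier j' := by
  obtain ⟨t, ht, hmin⟩ := exists_generic (i := i)
  obtain ⟨j, hj, hj'⟩ := L.exists_minimal (f.toFun t)
  exact ⟨j, f.mapsTo_of_minimal ht hmin hj, fun j' h => hj' j' (h ht)⟩

/-- The minimal cone of `L` containing the image of the cone `i` of `K`. -/
def Mor.target (f : Mor K L) (i : K.Idx) : L.Idx := (f.exists_target i).choose

theorem Mor.mapsTo_target (f : Mor K L) (i : K.Idx) :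
    Set.MapsTo f.toFun (K.carrier i) (L.carrier (f.target i)) := (f.exists_target i).choose_spec.1

theorem Mor.target_subset (f : Mor K L) {i : K.Idx} {j : L.Idx}
    (h : Set.MapsTo f.toFun (K.carrier i) (L.carrier j)) :
    L.carrier (f.target i) ⊆ L.carrier j := (f.exists_target i).choose_spec.2 j h

theorem Mor.mapsTo_of_mem (f : Mor K L) {i : K.Idx} (x : K.openStar i) {j : L.Idx}
    (hj : f.toFun x.1 ∈ L.carrier j) : ∃ k, x.1 ∈ K.carrier k ∧ K.carrier i ⊆ K.carrier k ∧
      Set.MapsTo f.toFun (K.carrier k) (L.carrier j) := by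
  obtain ⟨k, hk, hmin⟩ := K.exists_minimal x.1
  exact ⟨k, hk, x.2 k hk, f.mapsTo_of_minimal hk hmin hj⟩

/-- The map on points induced by `f` on the star of `i`, to the star of the minimal cone containing
the image of `i`. -/
def Mor.starFun (f : Mor K L) (i : K.Idx) : K.StarPt i → L.StarPt (f.target i) :=
  Quotient.lift (fun x => L.starMk (f.target i) ⟨f.toFun x.1, fun j hj => by
    obtain ⟨k, -, hik, hkj⟩ := f.mapsTo_of_mem x hj
    exact f.target_subset (hkj.mono_left hik)⟩) (by
    intro x y h
    have aux : ∀ x y : K.openStar i, (∀ j, x.1 ∈ K.carrier j ↔ y.1 ∈ K.carrier j) →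
        ∀ j, f.toFun x.1 ∈ L.carrier j → f.toFun y.1 ∈ L.carrier j := by
      intro x y h j hj
      obtain ⟨k, hk, -, hkj⟩ := f.mapsTo_of_mem x hj
      exact hkj ((h k).1 hk)
    refine starMk_eq.2 ⟨fun j => ⟨aux x y h.1 j, aux y x (fun j => (h.1 j).symm) j⟩, ?_⟩
    intro j hj m hm h0
    obtain ⟨k, hk, hik, hkj⟩ := f.mapsTo_of_mem x hj
    have h1 := h.2 k hk _ (f.restr_comp_mem hkj hm) fun z hz => by
      rw [restr_of_mem (hik hz)]
      exact h0 _ (f.mapsTo_target i hz)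
    rwa [restr_of_mem hk, restr_of_mem ((h.1 k).1 hk)] at h1)

/-- The morphism `Star_f(i)` induced by `f` between the stars of the cone `i` and of the minimal cone
containing its image. -/
def Mor.starMap (f : Mor K L) (i : K.Idx) : Mor (K.star i) (L.star (f.target i)) where
  toFun := f.starFun i
  map_cone := by
    rintro ⟨j, hj⟩
    refine ⟨⟨f.target j, f.target_subset ((f.mapsTo_target j).mono_left hj)⟩, ?_, ?_⟩
    · rintro _ ⟨x, hx, rfl⟩
      exact ⟨_, f.mapsTo_target j hx, rfl⟩
    · rintro g ⟨m, hm, h0, hg⟩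
      refine ⟨_, f.restr_comp_mem (f.mapsTo_target j) hm, fun z hz => ?_, fun x => ?_⟩
      · rw [restr_of_mem (hj hz)]
        exact h0 _ (f.mapsTo_target i hz)
      · change restr (K.starCarrier i j) (g ∘ f.starFun i) _ = _
        by_cases hx : x.1 ∈ K.carrier j
        · rw [restr_of_mem (mem_starCarrier.2 hx), restr_of_mem hx]
          exact hg _
        · rw [restr_of_notMem (fun h => hx (mem_starCarrier.1 h)), restr_of_notMem hx]

variable (K) in
/-- Every point of the star at `j/i` of the star of `K` at `i` is represented by a point of the open
star of `j`. -/
theorem exists_starStar (i : K.Idx) (j : (K.star i).Idx) (p : (K.star i).StarPt j) :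
    ∃ (x : K.openStar j.1) (h : K.starMk i ⟨x.1, fun l hl => j.2.trans (x.2 l hl)⟩ ∈
      (K.star i).openStar j), (K.star i).starMk j ⟨_, h⟩ = p := by
  obtain ⟨⟨q, hq⟩, rfl⟩ := starMk_surjective j p
  obtain ⟨x, rfl⟩ := starMk_surjective i q
  exact ⟨⟨x.1, fun l hl => subset_of_starCarrier_subset j.2
    (hq ⟨l, x.2 l hl⟩ (mem_starCarrier.2 hl))⟩, hq, rfl⟩

variable (K) in
/-- The canonical identification of the star at `j/i` of the star of `K` at `i` with the star of `K`
at `j`. It is the restriction to this stratum of the inclusion of the extended cone complex of the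
star at `i` into the extended cone complex of `K`. -/
def starIncl (i : K.Idx) (j : (K.star i).Idx) : Mor ((K.star i).star j) (K.star j.1) where
  toFun p := K.starMk j.1 (K.exists_starStar i j p).choose
  map_cone := by
    rintro ⟨⟨l, hil⟩, hjl⟩
    have hjl' : K.carrier j.1 ⊆ K.carrier l := subset_of_starCarrier_subset j.2 hjl
    refine ⟨⟨l, hjl'⟩, ?_, ?_⟩
    · intro p hp
      obtain ⟨h, he⟩ := (K.exists_starStar i j p).choose_spec
      rw [← he] at hp
      have hp' : _ ∈ K.starCarrier i l := mem_starCarrier.1 hp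
      exact mem_starCarrier.2 (mem_starCarrier.1 hp' :)
    · rintro g ⟨m, hm, h0, hg⟩
      obtain ⟨g', hg', hgm⟩ := exists_star_fn (i := i) hm fun z hz => h0 z (j.2 hz)
      refine ⟨g', hg', ?_, ?_⟩
      · rintro _ ⟨x, hx, rfl⟩
        rw [hgm, h0 _ hx]
      · intro q
        have hmem : ∀ p : (K.star i).StarPt j, p ∈ (K.star i).starCarrier j ⟨l, hil⟩ ↔
            (K.exists_starStar i j p).choose.1 ∈ K.carrier l := by
          intro p
          obtain ⟨h, he⟩ := (K.exists_starStar i j p).choose_spec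
          conv_lhs => rw [← he]
          exact mem_starCarrier.trans mem_starCarrier
        by_cases hq : q.1 ∈ K.starCarrier i l
        · have hq' : (K.star i).starMk j q ∈ (K.star i).starCarrier j ⟨l, hil⟩ :=
            mem_starCarrier.2 hq
          refine (restr_of_mem hq' _).trans ((hg _).trans ?_)
          obtain ⟨h, he⟩ := (K.exists_starStar i j ((K.star i).starMk j q)).choose_spec
          have h2 := (starMk_eq.1 he).2 ⟨l, hil⟩ (mem_starCarrier.2 ((hmem _).1 hq')) g' hg' (by
            rintro _ ⟨x, hx, rfl⟩
            rw [hgm, h0 _ hx])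
          exact (hgm _).symm.trans h2
        · refine (restr_of_notMem (fun h => hq (mem_starCarrier.1 h)) _).trans ?_
          obtain ⟨x, hx⟩ := starMk_surjective i q.1
          rw [← hx, hgm, (K.isCone l).supp m hm _ fun h => hq (hx ▸ mem_starCarrier.2 h)]

variable (K) in
/-- The group of `k`-dimensional weights on the extended cone complex of `K`. -/
abbrev ExtWeight (k : ℕ) : Type u := ⨁ i : K.Idx, (K.star i).Weight k

open Classical in
/-- The push-forward along the dominant morphism of extended cone complexes induced by `f`. -/
def Mor.extPush (f : Mor K L) (k : ℕ) : K.ExtWeight k →+ L.ExtWeight k :=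
  DirectSum.toAddMonoid fun i =>
    (DirectSum.of (fun j => (L.star j).Weight k) (f.target i)).comp ((f.starMap i).push k)

open Classical in
variable (K) in
/-- The push-forward along the inclusion into the extended cone complex of `K` of the extended cone
complex of the star at `i`. -/
def inclPush (i : K.Idx) (k : ℕ) : (K.star i).ExtWeight k →+ K.ExtWeight k :=
  DirectSum.toAddMonoid fun j =>
    (DirectSum.of (fun j => (K.star j).Weight k) j.1).comp ((K.starIncl i j).push k)

end StarMaps

section Products

/-- The function `(x, y) ↦ m x + m' y` on `S × S'`, extended by zero. -/
def sumFn (S : Set X) (S' : Set Y) : (X → ℝ) × (Y → ℝ) →+ (X × Y → ℝ) :=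
  (restr (S ×ˢ S')).comp
    { toFun := fun m p => m.1 p.1 + m.2 p.2
      map_zero' := by funext p; simp
      map_add' := by intro m m'; funext p; simp only [Prod.fst_add, Prod.snd_add, Pi.add_apply]; ring }

theorem sumFn_apply {S : Set X} {S' : Set Y} {p : X × Y} (hp : p ∈ S ×ˢ S')
    (m : (X → ℝ) × (Y → ℝ)) : sumFn S S' m p = m.1 p.1 + m.2 p.2 :=
  restr_of_mem hp _

theorem prod_isCone {S : Set X} {S' : Set Y} {M : AddSubgroup (X → ℝ)} {M' : AddSubgroup (Y → ℝ)}
    (h : IsIntegralCone S M) (h' : IsIntegralCone S' M') :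
    IsIntegralCone (S ×ˢ S') ((M.prod M').map (sumFn S S')) := by
  obtain ⟨z, hz, hz0⟩ := h.exists_zero
  obtain ⟨z', hz', hz0'⟩ := h'.exists_zero
  obtain ⟨ι, _, g, hg, h₁, h₂⟩ := h.exists_gen
  obtain ⟨ι', _, g', hg', h₁', h₂'⟩ := h'.exists_gen
  refine IsIntegralCone.of_gen ?_ ?_ ?_ (ι := ι ⊕ ι')
    (Sum.elim (fun i => (g i, z')) (fun i => (z, g' i))) ?_ ?_ ?_ ?_
  · rintro _ ⟨m, -, rfl⟩ x hx
    exact restr_of_notMem hx _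
  · refine finite_map ?_ _
    have := h.fg
    have := h'.fg
    exact Module.Finite.of_surjective (AddSubgroup.prodEquiv M M').symm.toAddMonoidHom.toIntLinearMap
      (AddSubgroup.prodEquiv M M').symm.surjective
  · rintro ⟨x, x'⟩ hx ⟨y, y'⟩ hy hxy
    refine Prod.ext (h.separates _ hx.1 _ hy.1 fun m hm => ?_)
      (h'.separates _ hx.2 _ hy.2 fun m hm => ?_)
    · have := hxy _ ⟨(m, 0), ⟨hm, zero_mem _⟩, rfl⟩
      simpa [sumFn_apply hx, sumFn_apply hy] using this
    · have := hxy _ ⟨(0, m), ⟨zero_mem _, hm⟩, rfl⟩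
      simpa [sumFn_apply hx, sumFn_apply hy] using this
  · rintro (i | i)
    · refine ⟨⟨(hg i).1, hz'⟩, ?_⟩
      rintro _ ⟨m, hm, rfl⟩
      obtain ⟨n, hn⟩ := (hg i).2 m.1 hm.1
      exact ⟨n, by rw [Sum.elim_inl, sumFn_apply ⟨(hg i).1, hz'⟩, hz0' _ hm.2, hn, add_zero]⟩
    · refine ⟨⟨hz, (hg' i).1⟩, ?_⟩
      rintro _ ⟨m, hm, rfl⟩
      obtain ⟨n, hn⟩ := (hg' i).2 m.2 hm.2
      exact ⟨n, by rw [Sum.elim_inr, sumFn_apply ⟨hz, (hg' i).1⟩, hz0 _ hm.1, hn, zero_add]⟩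
  · rintro ⟨x, x'⟩ hx
    obtain ⟨a, ha, hxa⟩ := h₁ x hx.1
    obtain ⟨b, hb, hxb⟩ := h₁' x' hx.2
    refine ⟨Sum.elim a b, by rintro (i | i) <;> simp [ha, hb], ?_⟩
    rintro _ ⟨m, hm, rfl⟩
    rw [sumFn_apply hx, hxa _ hm.1, hxb _ hm.2, Fintype.sum_sum_type]
    refine congrArg₂ _ (Finset.sum_congr rfl fun i _ => ?_) (Finset.sum_congr rfl fun i _ => ?_)
    · rw [Sum.elim_inl, Sum.elim_inl, sumFn_apply ⟨(hg i).1, hz'⟩, hz0' _ hm.2, add_zero]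
    · rw [Sum.elim_inr, Sum.elim_inr, sumFn_apply ⟨hz, (hg' i).1⟩, hz0 _ hm.1, zero_add]
  · intro a ha
    obtain ⟨x, hx, hxa⟩ := h₂ (a ∘ Sum.inl) fun i => ha _
    obtain ⟨x', hx', hxa'⟩ := h₂' (a ∘ Sum.inr) fun i => ha _
    refine ⟨(x, x'), ⟨hx, hx'⟩, ?_⟩
    rintro _ ⟨m, hm, rfl⟩
    rw [sumFn_apply ⟨hx, hx'⟩, hxa _ hm.1, hxa' _ hm.2, Fintype.sum_sum_type]
    refine congrArg₂ _ (Finset.sum_congr rfl fun i _ => ?_) (Finset.sum_congr rfl fun i _ => ?_)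
    · rw [Sum.elim_inl, sumFn_apply ⟨(hg i).1, hz'⟩, hz0' _ hm.2, add_zero, Function.comp_apply]
    · rw [Sum.elim_inr, sumFn_apply ⟨hz, (hg' i).1⟩, hz0 _ hm.1, zero_add, Function.comp_apply]
  · rintro ⟨x, x'⟩ hx ⟨y, y'⟩ hy hxy _ ⟨m, hm, rfl⟩
    rw [sumFn_apply hx, h.salient _ hx.1 _ hy.1 (fun m hm => ?_) m.1 hm.1,
      h'.salient _ hx.2 _ hy.2 (fun m hm => ?_) m.2 hm.2, add_zero]
    · have := hxy _ ⟨(0, m), ⟨zero_mem _, hm⟩, rfl⟩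
      simpa [sumFn_apply hx, sumFn_apply hy] using this
    · have := hxy _ ⟨(m, 0), ⟨hm, zero_mem _⟩, rfl⟩
      simpa [sumFn_apply hx, sumFn_apply hy] using this

theorem prod_restr {S T : Set X} {S' T' : Set Y} (h : S ⊆ T) (h' : S' ⊆ T')
    (M : AddSubgroup (X → ℝ)) (M' : AddSubgroup (Y → ℝ)) :
    ((M.map (restr S)).prod (M'.map (restr S'))).map (sumFn S S') =
      ((M.prod M').map (sumFn T T')).map (restr (S ×ˢ S')) := by
  have key : ∀ m m', sumFn S S' (restr S m, restr S' m') = restr (S ×ˢ S') (sumFn T T' (m, m')) := by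
    intro m m'
    funext p
    by_cases hp : p ∈ S ×ˢ S'
    · rw [sumFn_apply hp, restr_of_mem hp, sumFn_apply (Set.prod_mono h h' hp)]
      change restr S m p.1 + restr S' m' p.2 = _
      rw [restr_of_mem hp.1, restr_of_mem hp.2]
    · exact (restr_of_notMem hp _).trans (restr_of_notMem hp _).symm
  ext q
  constructor
  · rintro ⟨⟨_, _⟩, ⟨⟨m, hm, rfl⟩, ⟨m', hm', rfl⟩⟩, rfl⟩
    exact ⟨_, ⟨(m, m'), ⟨hm, hm'⟩, rfl⟩, (key m m').symm⟩
  · rintro ⟨_, ⟨⟨m, m'⟩, ⟨hm, hm'⟩, rfl⟩, rfl⟩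
    exact ⟨(restr S m, restr S' m'), ⟨⟨m, hm, rfl⟩, ⟨m', hm', rfl⟩⟩, key m m'⟩

theorem prod_isFaceOf {S T : Set X} {S' T' : Set Y} {M N : AddSubgroup (X → ℝ)}
    {M' N' : AddSubgroup (Y → ℝ)} (h : IsFaceOf S M T N) (h' : IsFaceOf S' M' T' N') :
    IsFaceOf (S ×ˢ S') ((M.prod M').map (sumFn S S'))
      (T ×ˢ T') ((N.prod N').map (sumFn T T')) := by
  have hs := face_subset h
  have hs' := face_subset h'
  obtain ⟨rfl, m, hm, hm0, he⟩ := h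
  obtain ⟨rfl, m', hm', hm0', he'⟩ := h'
  refine ⟨prod_restr hs hs' N N', _, ⟨(m, m'), ⟨hm, hm'⟩, rfl⟩, ?_, ?_⟩
  · intro p hp
    rw [sumFn_apply hp]
    exact add_nonneg (hm0 _ hp.1) (hm0' _ hp.2)
  · ext p
    have e : ∀ x, x ∈ S ↔ x ∈ T ∧ m x = 0 := fun x => by rw [he]; rfl
    have e' : ∀ x, x ∈ S' ↔ x ∈ T' ∧ m' x = 0 := fun x => by rw [he']; rfl
    change p.1 ∈ S ∧ p.2 ∈ S' ↔ p ∈ T ×ˢ T' ∧ _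
    rw [e, e']
    constructor
    · rintro ⟨⟨h1, h2⟩, ⟨h3, h4⟩⟩
      refine ⟨⟨h1, h3⟩, ?_⟩
      rw [sumFn_apply ⟨h1, h3⟩]
      change m p.1 + m' p.2 = 0
      rw [h2, h4, add_zero]
    · rintro ⟨hp, h0⟩
      rw [sumFn_apply hp] at h0
      change m p.1 + m' p.2 = 0 at h0
      have := hm0 _ hp.1
      have := hm0' _ hp.2
      exact ⟨⟨hp.1, by linarith⟩, ⟨hp.2, by linarith⟩⟩

variable (K L) in
/-- The product of two cone complexes. -/
def prod : ConeComplex (X × Y) where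
  Idx := K.Idx × L.Idx
  finite := inferInstance
  carrier i := K.carrier i.1 ×ˢ L.carrier i.2
  M i := ((K.M i.1).prod (L.M i.2)).map (sumFn (K.carrier i.1) (L.carrier i.2))
  isCone i := prod_isCone (K.isCone i.1) (L.isCone i.2)
  carrier_injective := by
    rintro ⟨i, i'⟩ ⟨j, j'⟩ h
    obtain ⟨x, hx, -⟩ := (K.isCone i).exists_zero
    obtain ⟨x', hx', -⟩ := (L.isCone i').exists_zero
    have hne : (K.carrier i ×ˢ L.carrier i').Nonempty := ⟨(x, x'), hx, hx'⟩
    obtain ⟨h1, h2⟩ := (Set.prod_eq_prod_iff_of_nonempty hne).1 h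
    rw [K.carrier_injective h1, L.carrier_injective h2]
  cover p := by
    obtain ⟨i, hi⟩ := K.cover p.1
    obtain ⟨j, hj⟩ := L.cover p.2
    exact ⟨(i, j), hi, hj⟩
  exists_face := by
    rintro ⟨i, i'⟩ S M ⟨rfl, _, ⟨⟨m, m'⟩, ⟨hm, hm'⟩, rfl⟩, hpos, rfl⟩
    obtain ⟨z, hz, hz0⟩ := (K.isCone i).exists_zero
    obtain ⟨z', hz', hz0'⟩ := (L.isCone i').exists_zero
    have hp1 : ∀ x ∈ K.carrier i, 0 ≤ m x := fun x hx => by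
      have := hpos (x, z') ⟨hx, hz'⟩
      rw [sumFn_apply ⟨hx, hz'⟩] at this
      simpa [hz0' m' hm'] using this
    have hp2 : ∀ x ∈ L.carrier i', 0 ≤ m' x := fun x hx => by
      have := hpos (z, x) ⟨hz, hx⟩
      rw [sumFn_apply ⟨hz, hx⟩] at this
      simpa [hz0 m hm] using this
    have hf : IsFaceOf {x ∈ K.carrier i | m x = 0}
        ((K.M i).map (restr {x ∈ K.carrier i | m x = 0})) (K.carrier i) (K.M i) :=
      ⟨rfl, m, hm, hp1, rfl⟩
    have hf' : IsFaceOf {x ∈ L.carrier i' | m' x = 0}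
        ((L.M i').map (restr {x ∈ L.carrier i' | m' x = 0})) (L.carrier i') (L.M i') :=
      ⟨rfl, m', hm', hp2, rfl⟩
    obtain ⟨j, hj, hjM⟩ := K.exists_face i _ _ hf
    obtain ⟨j', hj', hjM'⟩ := L.exists_face i' _ _ hf'
    have hset : K.carrier j ×ˢ L.carrier j' = {x ∈ K.carrier i ×ˢ L.carrier i' |
        sumFn (K.carrier i) (L.carrier i') (m, m') x = 0} := by
      ext p
      rw [hj, hj']
      change (p.1 ∈ K.carrier i ∧ m p.1 = 0) ∧ (p.2 ∈ L.carrier i' ∧ m' p.2 = 0) ↔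
        p ∈ K.carrier i ×ˢ L.carrier i' ∧ _
      constructor
      · rintro ⟨⟨h1, h2⟩, ⟨h3, h4⟩⟩
        refine ⟨⟨h1, h3⟩, ?_⟩
        rw [sumFn_apply ⟨h1, h3⟩]
        change m p.1 + m' p.2 = 0
        rw [h2, h4, add_zero]
      · rintro ⟨hp, h0⟩
        rw [sumFn_apply hp] at h0
        change m p.1 + m' p.2 = 0 at h0
        have := hp1 _ hp.1
        have := hp2 _ hp.2
        exact ⟨⟨hp.1, by linarith⟩, ⟨hp.2, by linarith⟩⟩
    refine ⟨(j, j'), hset, ?_⟩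
    rw [← hset, ← prod_restr (hj ▸ face_subset hf) (hj' ▸ face_subset hf'), hjM, hjM', ← hj, ← hj']
  inter := by
    rintro ⟨i, i'⟩ ⟨j, j'⟩ p ⟨hp, hp'⟩
    obtain ⟨k, hk, hki, hkj⟩ := K.inter i j p.1 ⟨hp.1, hp'.1⟩
    obtain ⟨k', hk', hki', hkj'⟩ := L.inter i' j' p.2 ⟨hp.2, hp'.2⟩
    exact ⟨(k, k'), ⟨hk, hk'⟩, prod_isFaceOf hki hki', prod_isFaceOf hkj hkj'⟩

variable (K L) in
/-- The projection to the first factor. -/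
def fstMor : Mor (K.prod L) K where
  toFun := Prod.fst
  map_cone := by
    rintro ⟨i, j⟩
    refine ⟨i, fun p hp => hp.1, fun m hm => ⟨(m, 0), ⟨hm, zero_mem _⟩, ?_⟩⟩
    funext p
    by_cases hp : p ∈ K.carrier i ×ˢ L.carrier j
    · rw [sumFn_apply hp]
      refine Eq.trans ?_ (restr_of_mem (S := K.carrier i ×ˢ L.carrier j) hp _).symm
      simp
    · exact (restr_of_notMem hp _).trans
        (restr_of_notMem (S := K.carrier i ×ˢ L.carrier j) hp _).symm

end Products

section Examples

/-- The lattice of integral multiples of the identity on a subset of `ℝ`. -/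
def lineM (S : Set ℝ) : AddSubgroup (ℝ → ℝ) :=
  (AddSubgroup.zmultiples (id : ℝ → ℝ)).map (restr S)

theorem lineM_restr {S T : Set ℝ} (h : S ⊆ T) : (lineM T).map (restr S) = lineM S :=
  map_restr_restr h _

/-- The ray in `ℝ` spanned by `s`. -/
def lineRay (s : SignType) : Set ℝ := {x | ∃ t : ℝ, 0 ≤ t ∧ x = t * (s : ℝ)}

theorem lineRay_isCone (s : SignType) : IsIntegralCone (lineRay s) (lineM (lineRay s)) := by
  have hs : (s : ℝ) ∈ lineRay s := ⟨1, zero_le_one, by simp⟩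
  have hval : ∀ x ∈ lineRay s, ∀ n : ℤ, restr (lineRay s) (n • id) x = n * x := fun x hx n => by
    rw [restr_of_mem hx]; simp
  have hid : restr (lineRay s) id ∈ lineM (lineRay s) :=
    AddSubgroup.mem_map_of_mem _ (AddSubgroup.mem_zmultiples _)
  refine IsIntegralCone.of_gen ?_ ?_ ?_ (ι := Unit) (fun _ => (s : ℝ)) ?_ ?_ ?_ ?_
  · rintro _ ⟨m, -, rfl⟩ x hx
    exact restr_of_notMem hx m
  · refine finite_map ?_ _
    exact Module.Finite.of_surjective
      ((AddMonoidHom.rangeRestrict (zmultiplesHom (ℝ → ℝ) id)).toIntLinearMap)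
      (AddMonoidHom.rangeRestrict_surjective _)
  · intro x hx y hy h
    have := h _ hid
    rwa [restr_of_mem hx, restr_of_mem hy] at this
  · refine fun _ => ⟨hs, ?_⟩
    rintro _ ⟨_, ⟨n, rfl⟩, rfl⟩
    refine ⟨n * (s : ℤ), ?_⟩
    rw [hval _ hs]
    push_cast
    cases s <;> simp
  · rintro x ⟨t, ht, rfl⟩
    refine ⟨fun _ => t, fun _ => ht, ?_⟩
    rintro _ ⟨_, ⟨n, rfl⟩, rfl⟩
    dsimp only
    rw [hval _ ⟨t, ht, rfl⟩, hval _ hs]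
    simp; ring
  · intro a ha
    refine ⟨_, ⟨a (), ha (), rfl⟩, ?_⟩
    rintro _ ⟨_, ⟨n, rfl⟩, rfl⟩
    dsimp only
    rw [hval _ ⟨_, ha (), rfl⟩, hval _ hs]
    simp; ring
  · rintro x hx y hy h
    have h0 := h _ hid
    rw [restr_of_mem hx, restr_of_mem hy] at h0
    have hx0 : x = 0 := by
      obtain ⟨t, ht, rfl⟩ := hx
      obtain ⟨t', ht', rfl⟩ := hy
      cases s
      · simp
      · simp at h0 ⊢; linarith
      · simp at h0 ⊢; linarith
    rintro _ ⟨_, ⟨n, rfl⟩, rfl⟩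
    dsimp only
    rw [hval _ hx, hx0, mul_zero]

theorem lineRay_zero : lineRay 0 = {0} := by
  ext x
  constructor
  · rintro ⟨t, -, rfl⟩
    simp
  · rintro rfl
    exact ⟨0, le_rfl, by simp⟩

theorem zero_mem_lineRay (s : SignType) : (0 : ℝ) ∈ lineRay s := ⟨0, le_rfl, by simp⟩

theorem lineRay_inter {s s' : SignType} (h : s ≠ s') {x : ℝ} (hx : x ∈ lineRay s)
    (hx' : x ∈ lineRay s') : x = 0 := by
  obtain ⟨t, ht, rfl⟩ := hx
  obtain ⟨t', ht', h'⟩ := hx'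
  cases s <;> cases s' <;> simp at h h' ⊢ <;> linarith

theorem lineRay_isFaceOf_zero (s : SignType) :
    IsFaceOf (lineRay 0) (lineM (lineRay 0)) (lineRay s) (lineM (lineRay s)) := by
  have hsub : lineRay 0 ⊆ lineRay s := by
    rw [lineRay_zero]; rintro _ rfl; exact zero_mem_lineRay s
  refine ⟨(lineM_restr hsub).symm, restr (lineRay s) ((s : ℤ) • id),
    AddSubgroup.mem_map_of_mem _ ⟨(s : ℤ), rfl⟩, ?_, ?_⟩
  · rintro x hx
    rw [restr_of_mem hx]
    obtain ⟨t, ht, rfl⟩ := hx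
    cases s <;> simp [ht]
  · ext x
    rw [lineRay_zero]
    constructor
    · rintro rfl
      refine ⟨zero_mem_lineRay s, ?_⟩
      rw [restr_of_mem (zero_mem_lineRay s)]
      simp
    · rintro ⟨hx, h0⟩
      rw [restr_of_mem hx] at h0
      obtain ⟨t, ht, rfl⟩ := hx
      cases s <;> simp at h0 ⊢ <;> exact h0

/-- The complete fan `Π¹` in `ℝ`: its cones are `0`, `ℝ_{≥ 0}` and `ℝ_{≤ 0}`. -/
def line : ConeComplex ℝ where
  Idx := SignType
  finite := inferInstance
  carrier := lineRay
  M s := lineM (lineRay s)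
  isCone := lineRay_isCone
  carrier_injective := by
    intro s s' h
    by_contra hne
    have key : ∀ s s' : SignType, lineRay s = lineRay s' → s ≠ s' → (s : ℝ) = 0 := by
      intro s s' h hne
      have hs : (s : ℝ) ∈ lineRay s := ⟨1, zero_le_one, by simp⟩
      exact lineRay_inter hne hs (h ▸ hs)
    have h1 := key s s' h hne
    have h2 := key s' s h.symm (Ne.symm hne)
    cases s <;> cases s' <;> simp at h1 h2 hne
  cover x := ⟨SignType.sign x, |x|, abs_nonneg x, by rw [mul_comm]; exact (sign_mul_abs x).symm⟩
  exists_face := by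
    rintro s S' M' ⟨rfl, _, ⟨_, ⟨n, rfl⟩, rfl⟩, hpos, rfl⟩
    dsimp only at hpos ⊢
    have hval : ∀ x ∈ lineRay s, restr (lineRay s) (n • id) x = n * x := fun x hx => by
      rw [restr_of_mem hx]; simp
    by_cases hn : (n : ℝ) = 0
    · have : {x ∈ lineRay s | restr (lineRay s) (n • id) x = 0} = lineRay s := by
        refine Set.Subset.antisymm (fun x hx => hx.1) fun x hx => ⟨hx, ?_⟩
        rw [hval x hx, hn, zero_mul]
      rw [this]
      exact ⟨s, rfl, (lineM_restr subset_rfl).symm⟩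
    · have : {x ∈ lineRay s | restr (lineRay s) (n • id) x = 0} = lineRay 0 := by
        rw [lineRay_zero]
        ext x
        constructor
        · rintro ⟨hx, h0⟩
          rw [hval x hx] at h0
          exact (mul_eq_zero.1 h0).resolve_left hn
        · rintro rfl
          exact ⟨zero_mem_lineRay s, by rw [hval _ (zero_mem_lineRay s), mul_zero]⟩
      rw [this]
      exact ⟨0, rfl, (lineRay_isFaceOf_zero s).1⟩
  inter := by
    rintro s s' x ⟨hx, hx'⟩
    by_cases h : s = s'
    · subst h
      have : IsFaceOf (lineRay s) (lineM (lineRay s)) (lineRay s) (lineM (lineRay s)) := by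
        refine ⟨(lineM_restr subset_rfl).symm, 0, zero_mem _, fun _ _ => le_rfl, ?_⟩
        ext x
        exact ⟨fun h => ⟨h, rfl⟩, fun h => h.1⟩
      exact ⟨s, hx, this, this⟩
    · refine ⟨0, ?_, lineRay_isFaceOf_zero s, lineRay_isFaceOf_zero s'⟩
      rw [lineRay_inter h hx hx']
      exact zero_mem_lineRay 0

/-- The cone complex `Π⁰` consisting of one point. -/
def point : ConeComplex Unit where
  Idx := Unit
  finite := inferInstance
  carrier _ := Set.univ
  M _ := ⊥
  isCone _ := by
    refine IsIntegralCone.of_gen ?_ ?_ (fun _ _ _ _ _ => rfl) (ι := Empty) Empty.elim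
      (fun i => i.elim) ?_ ?_ ?_
    · rintro m - x hx
      exact absurd (Set.mem_univ x) hx
    · infer_instance
    · rintro x -
      refine ⟨Empty.elim, fun i => i.elim, fun m hm => ?_⟩
      rw [AddSubgroup.mem_bot.1 hm]; rfl
    · intro a _
      refine ⟨(), Set.mem_univ _, fun m hm => ?_⟩
      rw [AddSubgroup.mem_bot.1 hm]; rfl
    · intro x _ y _ _ m hm
      rw [AddSubgroup.mem_bot.1 hm]; rfl
  carrier_injective _ _ _ := rfl
  cover x := ⟨(), Set.mem_univ x⟩
  exists_face := by
    rintro _ S' M' ⟨rfl, m, hm, -, rfl⟩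
    refine ⟨(), ?_, by rw [AddSubgroup.map_bot]⟩
    ext x
    exact ⟨fun _ => ⟨Set.mem_univ x, by rw [AddSubgroup.mem_bot.1 hm]; rfl⟩, fun _ => Set.mem_univ x⟩
  inter := by
    rintro _ _ x -
    have : IsFaceOf (Set.univ : Set Unit) ⊥ Set.univ ⊥ := by
      refine ⟨by rw [AddSubgroup.map_bot], 0, zero_mem _, fun _ _ => le_rfl, ?_⟩
      ext x
      exact ⟨fun h => ⟨h, rfl⟩, fun h => h.1⟩
    exact ⟨(), Set.mem_univ x, this, this⟩

end Examples

end ConeComplex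


open ConeComplex

/-- The real-valued linear function on `N_ℝ = ℝ ⊗ N` induced by `m ∈ M = Hom(N, ℤ)`. -/
def evalR {N : Type v} [AddCommGroup N] (m : N →ₗ[ℤ] ℤ) : ℝ ⊗[ℤ] N →ₗ[ℝ] ℝ :=
  (TensorProduct.AlgebraTensorModule.rid ℤ ℝ ℝ).toLinearMap ∘ₗ m.baseChange ℝ

theorem evalR_tmul {N : Type v} [AddCommGroup N] (m : N →ₗ[ℤ] ℤ) (r : ℝ) (n : N) :
    evalR m (r ⊗ₜ n) = m n * r := by
  simp [evalR]

theorem evalR_baseChange {N : Type v} {N' : Type u'} [AddCommGroup N] [AddCommGroup N']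
    (m : N' →ₗ[ℤ] ℤ) (h : N →ₗ[ℤ] N') (z : ℝ ⊗[ℤ] N) :
    evalR m (h.baseChange ℝ z) = evalR (m ∘ₗ h) z := by
  simp [evalR, LinearMap.baseChange_comp]

theorem evalR_basis {N : Type v} [AddCommGroup N] {ι : Type*} (b : Module.Basis ι ℤ N) (i : ι)
    (z : ℝ ⊗[ℤ] N) : evalR (b.coord i) z = (Algebra.TensorProduct.basis ℝ b).coord i z := by
  congr 1
  refine (Algebra.TensorProduct.basis ℝ b).ext fun j => ?_
  rw [Algebra.TensorProduct.basis_apply, evalR_tmul]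
  have : (1 : ℝ) ⊗ₜ[ℤ] b j = Algebra.TensorProduct.basis ℝ b j := by
    rw [Algebra.TensorProduct.basis_apply]
  rw [this, Module.Basis.coord_apply, Module.Basis.coord_apply, Module.Basis.repr_self,
    Module.Basis.repr_self]
  by_cases h : j = i
  · subst h; simp
  · simp [h]

theorem eq_of_evalR {N : Type v} [AddCommGroup N] [Module.Free ℤ N] {z z' : ℝ ⊗[ℤ] N}
    (h : ∀ m : N →ₗ[ℤ] ℤ, evalR m z = evalR m z') : z = z' := by
  let b := Module.Free.chooseBasis ℤ N
  refine (Algebra.TensorProduct.basis ℝ b).ext_elem fun i => ?_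
  have := h (b.coord i)
  rwa [evalR_basis, evalR_basis] at this

theorem exists_lattice_point {N : Type v} [AddCommGroup N] [Module.Free ℤ N] [Module.Finite ℤ N]
    {z : ℝ ⊗[ℤ] N} (h : ∀ m : N →ₗ[ℤ] ℤ, ∃ n : ℤ, evalR m z = n) : ∃ n : N, z = 1 ⊗ₜ n := by
  let b := Module.Free.chooseBasis ℤ N
  choose n hn using fun i => h (b.coord i)
  refine ⟨∑ i, n i • b i, (Algebra.TensorProduct.basis ℝ b).ext_elem fun i => ?_⟩
  have h1 := hn i
  have h2 := evalR_basis b i ((1 : ℝ) ⊗ₜ ∑ i, n i • b i)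
  rw [evalR_basis] at h1
  rw [evalR_tmul] at h2
  refine h1.trans (Eq.trans ?_ h2)
  rw [Module.Basis.coord_apply, Module.Basis.repr_sum_self, mul_one]

/-- A weakly embedded cone complex: a cone complex together with a lattice `N` and a map
`φ : X → N_ℝ` which is integral linear on every cone, i.e. for `m ∈ Hom(N, ℤ)` the function `m ∘ φ`
is integral linear on every cone. -/
structure WECC (X : Type u) extends ConeComplex X where
  N : Type v
  [addCommGroup : AddCommGroup N]
  [free : Module.Free ℤ N]
  [fg : Module.Finite ℤ N]
  φ : X → ℝ ⊗[ℤ] N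
  integral : ∀ i (m : N →ₗ[ℤ] ℤ), restr (carrier i) (fun x => evalR m (φ x)) ∈ M i

attribute [instance] WECC.addCommGroup WECC.free WECC.fg

namespace WECC

variable {X : Type u} {Y : Type u'} (W : WECC.{u, v} X)

/-- The linear span of `φ(S)` in `N_ℝ`. -/
def linSpan (S : Set X) : Submodule ℝ (ℝ ⊗[ℤ] W.N) := Submodule.span ℝ (W.φ '' S)

/-- The sublattice `N_S = N ∩ Lin φ(S)` of `N`. -/
def subLattice (S : Set X) : Submodule ℤ W.N :=
  ((W.linSpan S).restrictScalars ℤ).comap (TensorProduct.mk ℤ ℝ W.N 1)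

theorem mem_subLattice {S : Set X} {n : W.N} :
    n ∈ W.subLattice S ↔ (1 : ℝ) ⊗ₜ[ℤ] n ∈ W.linSpan S := Iff.rfl

instance (S : Set X) : Module.Free ℤ (W.N ⧸ W.subLattice S) := by
  have : Module.IsTorsionFree ℤ (W.N ⧸ W.subLattice S) := by
    refine Module.isTorsionFree_iff_smul_eq_zero.2 fun r q h => ?_
    obtain ⟨n, rfl⟩ := Submodule.Quotient.mk_surjective _ q
    by_cases hr : r = 0
    · exact Or.inl hr
    rw [← Submodule.Quotient.mk_smul, Submodule.Quotient.mk_eq_zero, mem_subLattice,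
      TensorProduct.tmul_smul] at h
    refine Or.inr ((Submodule.Quotient.mk_eq_zero _).2 (W.mem_subLattice.2 ?_))
    have hr' : (r : ℝ) ≠ 0 := by exact_mod_cast hr
    rw [← Int.cast_smul_eq_zsmul ℝ] at h
    exact (Submodule.smul_mem_iff _ hr').1 h
  infer_instance

theorem evalR_φ_eq_zero {i : W.Idx} (m : W.N →ₗ[ℤ] ℤ)
    (hm : ∀ n ∈ W.subLattice (W.carrier i), m n = 0) {z : X} (hz : z ∈ W.carrier i) :
    evalR m (W.φ z) = 0 := by
  obtain ⟨ι, _, g, hg, h₁, -⟩ := (W.isCone i).exists_gen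
  obtain ⟨a, -, ha⟩ := h₁ z hz
  have hn : ∀ k, ∃ n : W.N, W.φ (g k) = 1 ⊗ₜ n := fun k => exists_lattice_point fun m => by
    obtain ⟨n, hn⟩ := (hg k).2 _ (W.integral i m)
    exact ⟨n, by rw [← hn, restr_of_mem (hg k).1]⟩
  have h := ha _ (W.integral i m)
  rw [restr_of_mem hz] at h
  rw [h]
  refine Finset.sum_eq_zero fun k _ => ?_
  obtain ⟨n, hn⟩ := hn k
  rw [restr_of_mem (hg k).1, hn, evalR_tmul, hm n, Int.cast_zero, zero_mul, mul_zero]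
  rw [mem_subLattice, ← hn]
  exact Submodule.subset_span (Set.mem_image_of_mem _ (hg k).1)

theorem evalR_mkQ_φ_eq_zero {i : W.Idx} (m : W.N ⧸ W.subLattice (W.carrier i) →ₗ[ℤ] ℤ) {z : X}
    (hz : z ∈ W.carrier i) : evalR (m ∘ₗ (W.subLattice (W.carrier i)).mkQ) (W.φ z) = 0 :=
  W.evalR_φ_eq_zero _ (fun n hn => by
    rw [LinearMap.comp_apply, Submodule.mkQ_apply, (Submodule.Quotient.mk_eq_zero _).2 hn,
      map_zero]) hz

/-- The star of a weakly embedded cone complex, with lattice `N / N_τ` and the induced weak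
embedding. -/
def star (i : W.Idx) : WECC.{u, v} (W.StarPt i) where
  toConeComplex := W.toConeComplex.star i
  N := W.N ⧸ W.subLattice (W.carrier i)
  φ := Quotient.lift (fun x => (W.subLattice (W.carrier i)).mkQ.baseChange ℝ (W.φ x.1)) (by
    intro x y h
    refine eq_of_evalR fun m => ?_
    rw [evalR_baseChange, evalR_baseChange]
    obtain ⟨j, hj⟩ := W.cover x.1
    have := h.2 j hj _ (W.integral j (m ∘ₗ (W.subLattice (W.carrier i)).mkQ)) fun z hz => by
      rw [restr_of_mem (x.2 j hj hz), W.evalR_mkQ_φ_eq_zero m hz]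
    rwa [restr_of_mem hj, restr_of_mem ((h.1 j).1 hj)] at this)
  integral := by
    rintro ⟨j, hj⟩ m
    refine ⟨_, W.integral j (m ∘ₗ (W.subLattice (W.carrier i)).mkQ), fun z hz => ?_, fun x => ?_⟩
    · rw [restr_of_mem (hj hz), W.evalR_mkQ_φ_eq_zero m hz]
    · change restr (W.starCarrier i j) _ _ = _
      by_cases hx : x.1 ∈ W.carrier j
      · rw [restr_of_mem (mem_starCarrier.2 hx), restr_of_mem hx]
        exact evalR_baseChange _ _ _
      · rw [restr_of_notMem (fun h => hx (mem_starCarrier.1 h)), restr_of_notMem hx]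

/-- The product of weakly embedded cone complexes. -/
def prod (W : WECC.{u, v} X) (V : WECC.{u', v'} Y) : WECC.{max u u', max v v'} (X × Y) where
  toConeComplex := W.toConeComplex.prod V.toConeComplex
  N := W.N × V.N
  φ p := (LinearMap.inl ℤ W.N V.N).baseChange ℝ (W.φ p.1) +
    (LinearMap.inr ℤ W.N V.N).baseChange ℝ (V.φ p.2)
  integral := by
    rintro ⟨i, j⟩ m
    refine ⟨(restr (W.carrier i) fun x => evalR (m ∘ₗ LinearMap.inl ℤ W.N V.N) (W.φ x),
      restr (V.carrier j) fun y => evalR (m ∘ₗ LinearMap.inr ℤ W.N V.N) (V.φ y)),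
      ⟨W.integral i (m ∘ₗ LinearMap.inl ℤ W.N V.N),
      V.integral j (m ∘ₗ LinearMap.inr ℤ W.N V.N)⟩, ?_⟩
    funext p
    change _ = restr (W.carrier i ×ˢ V.carrier j) _ p
    by_cases hp : p ∈ W.carrier i ×ˢ V.carrier j
    · rw [sumFn_apply hp, restr_of_mem hp]
      dsimp only
      rw [restr_of_mem hp.1, restr_of_mem hp.2, map_add, evalR_baseChange, evalR_baseChange]
    · exact (restr_of_notMem hp _).trans (restr_of_notMem hp _).symm

/-- The complete fan `Π¹` in `ℝ`, with lattice `ℤ`. -/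
def line : WECC.{0, 0} ℝ where
  toConeComplex := ConeComplex.line
  N := ℤ
  φ x := x ⊗ₜ 1
  integral s m := by
    refine ⟨_, ⟨m 1, rfl⟩, ?_⟩
    refine congrArg _ (funext fun x => ?_)
    exact (zsmul_eq_mul x (m 1)).trans (evalR_tmul m x 1).symm

/-- The complex `Π⁰` consisting of one point, with the zero lattice. -/
def point : WECC.{0, 0} Unit where
  toConeComplex := ConeComplex.point
  N := PUnit
  φ _ := 0
  integral i m := by
    change _ ∈ (⊥ : AddSubgroup _)
    rw [AddSubgroup.mem_bot]
    funext x
    exact (restr_of_mem (Set.mem_univ x) _).trans (map_zero _)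

end WECC

section Cycles

variable {X : Type u} (K : ConeComplex X)

namespace ConeComplex

/-- `K'` is a proper subdivision of `K`: a cone complex with the same set of points all of whose
cones are subcones of `K`. -/
def IsProperSubdivision (K' : ConeComplex X) : Prop :=
  ∀ i, ∃ j, K'.carrier i ⊆ K.carrier j ∧ K'.M i = (K.M j).map (restr (K'.carrier i))

/-- The `k`-dimensional cones of `K`. -/
def ConesOfDim (k : ℕ) : Type := {i : K.Idx // K.dim (K.carrier i) = k}

/-- The `k`-dimensional cones of `K` containing the cone `τ`. -/
def ConesOver (k : ℕ) (τ : K.Idx) : Type := {σ : K.ConesOfDim k // K.carrier τ ⊆ K.carrier σ.1}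

variable {K}

/-- The morphism `K' → K` defined by a subdivision. -/
def IsProperSubdivision.mor {K' : ConeComplex X} (h : K.IsProperSubdivision K') : Mor K' K where
  toFun := id
  map_cone i := by
    obtain ⟨j, hj, hM⟩ := h i
    refine ⟨j, hj, fun m hm => ?_⟩
    rw [hM]
    exact AddSubgroup.mem_map_of_mem _ hm

variable (K)

/-- The point `v` of the cone `σ` is integral and its image generates `N^σ / N^τ`, where `τ` is a
face of `σ` of codimension `1`. The lattice normal vector `u_{σ/τ}` is the class of `φ(v)` for any
such `v`. -/
def IsLatticeNormal (σ τ : K.Idx) (v : X) : Prop :=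
  v ∈ K.carrier σ ∧ IsIntegralPt (K.M σ) v ∧ ∃ m ∈ K.M σ, (∀ x ∈ K.carrier τ, m x = 0) ∧ m v = 1

/-- The point `u` is the primitive generator of the ray `ρ`. -/
def IsPrimitiveGenerator (ρ : K.Idx) (u : X) : Prop :=
  u ∈ K.carrier ρ ∧ IsIntegralPt (K.M ρ) u ∧ ∃ m ∈ K.M ρ, m u = 1

variable {K} in
/-- The class of a weight on the `k`-dimensional cones of a subdivision. -/
def weightClass {K' : ConeComplex X} (_ : K.IsProperSubdivision K') {k : ℕ}
    (c : K'.ConesOfDim k → ℤ) : K.Weight k :=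
  ∑ᶠ σ, c σ • K.cls k (K'.carrier σ.1)

/-- A Cartier divisor on `K` is a function which is integral linear on every cone. -/
def IsDivisor (ψ : X → ℝ) : Prop := ∀ i, restr (K.carrier i) ψ ∈ K.M i

open Classical in
/-- The integer `ψ(u_ρ)`, where `u_ρ` is the primitive generator of the ray `ρ` and `ψ` is a Cartier
divisor. -/
def raySlope (ψ : X → ℝ) (ρ : K.Idx) : ℤ :=
  if h : ∃ u, K.IsPrimitiveGenerator ρ u then ⌊ψ h.choose⌋ else 0

/-- The pull-back `i_ρ^* c` of a weight on the `(k + 1)`-dimensional cones of `K` to the star at the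
ray `ρ`: its weight on `σ/ρ` is `c(σ)`. -/
def pullbackWeight {k : ℕ} (c : K.ConesOfDim (k + 1) → ℤ) (ρ : K.Idx) : (K.star ρ).Weight k :=
  ∑ᶠ σ : K.ConesOver (k + 1) ρ, c σ.1 • (K.star ρ).cls k (K.starCarrier ρ σ.1.1)

variable {K} in
open Classical in
/-- The intersection product `ψ · [c]` of a Cartier divisor with the class of a weight on the
`(k + 1)`-dimensional cones of a proper subdivision `K'` of `K`: the push-forward from the extended
complex of `K'` to that of `K` of the sum of `ψ(u_ρ) [i_ρ^* c]` over all rays `ρ` of `K'`. -/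
def divisorProduct {K' : ConeComplex X} (h : K.IsProperSubdivision K') (ψ : X → ℝ) {k : ℕ}
    (c : K'.ConesOfDim (k + 1) → ℤ) : K.ExtWeight k :=
  h.mor.extPush k (∑ᶠ ρ : K'.ConesOfDim 1, K'.raySlope ψ ρ.1 •
    DirectSum.of (fun i => (K'.star i).Weight k) ρ.1 (K'.pullbackWeight c ρ.1))

variable {K} in
/-- The pull-back to the star at `i` of a Cartier divisor that vanishes on the cone `i`. -/
def starDivisor {ψ : X → ℝ} (hψ : K.IsDivisor ψ) (i : K.Idx) (h0 : ∀ x ∈ K.carrier i, ψ x = 0) :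
    K.StarPt i → ℝ :=
  Quotient.lift (fun x => ψ x.1) (by
    intro x y h
    obtain ⟨j, hj⟩ := K.cover x.1
    have := h.2 j hj _ (hψ j) fun z hz => by rw [restr_of_mem (x.2 j hj hz), h0 z hz]
    rwa [restr_of_mem hj, restr_of_mem ((h.1 j).1 hj)] at this)

/-- The pull-back along the second projection `K × Π¹ → Π¹` of the divisor on `Π¹` given by the
identity is a divisor. -/
theorem isDivisor_snd : (K.prod line).IsDivisor Prod.snd := by
  rintro ⟨i, s⟩
  refine ⟨(0, restr (lineRay s) ((1 : ℤ) • id)), ⟨zero_mem _, ⟨_, ⟨1, rfl⟩, rfl⟩⟩, ?_⟩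
  funext p
  change _ = restr (K.carrier i ×ˢ lineRay s) _ p
  by_cases hp : p ∈ K.carrier i ×ˢ lineRay s
  · rw [restr_of_mem hp]
    refine (sumFn_apply hp _).trans ?_
    change (0 : ℝ) + restr (lineRay s) ((1 : ℤ) • id) p.2 = _
    rw [restr_of_mem hp.2]
    simp
  · exact (restr_of_notMem hp _).trans (restr_of_notMem hp _).symm

theorem snd_eq_zero (σ : K.Idx) : ∀ x ∈ (K.prod line).carrier (σ, (0 : SignType)), x.2 = 0 := by
  rintro x ⟨-, hx⟩
  change x.2 ∈ lineRay 0 at hx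
  rw [lineRay_zero] at hx
  exact hx

end ConeComplex

namespace WECC

variable {Y : Type u'}

/-- A morphism of weakly embedded cone complexes. -/
structure Mor (W : WECC.{u, v} X) (V : WECC.{u', v'} Y) extends
    ConeComplex.Mor W.toConeComplex V.toConeComplex where
  latHom : W.N →ₗ[ℤ] V.N
  comm : ∀ x, V.φ (toFun x) = latHom.baseChange ℝ (W.φ x)

/-- A morphism of weakly embedded extended cone complexes: it is either dominant, i.e. induced by a
morphism `f : W → V`, or the composite of a dominant morphism to the extended cone complex of the
star of `V` at some cone `δ` and the inclusion into the extended cone complex of `V`. -/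
inductive ExtMor (W : WECC.{u, v} X) (V : WECC.{u', v'} Y)
  | dominant (f : Mor W V) : ExtMor W V
  | boundary (δ : V.Idx) (f : Mor W (V.star δ)) : ExtMor W V

/-- The push-forward along a morphism of weakly embedded extended cone complexes. -/
def ExtMor.push {W : WECC.{u, v} X} {V : WECC.{u', v'} Y} (k : ℕ) :
    ExtMor W V → (W.ExtWeight k →+ V.ExtWeight k)
  | dominant f => f.extPush k
  | boundary δ f => (V.inclPush δ k).comp (f.extPush k)

variable (W : WECC.{u, v} X)

/-- The weakly embedded cone complex given by a proper subdivision. -/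
def refine (K' : ConeComplex X) (h : W.IsProperSubdivision K') : WECC.{u, v} X where
  toConeComplex := K'
  N := W.N
  φ := W.φ
  integral i m := by
    obtain ⟨j, hj, hM⟩ := h i
    rw [hM]
    exact ⟨_, W.integral j m, restr_restr hj _⟩

/-- A weight on the `k`-dimensional cones is a Minkowski weight if it satisfies the balancing
condition around every `(k - 1)`-dimensional cone `τ`: the sum of `c(σ) u_{σ/τ}` over the
`k`-dimensional cones `σ` containing `τ` vanishes modulo `N_τ = N ∩ Lin φ(τ)`. -/
def IsMinkowskiWeight {k : ℕ} (c : W.ConesOfDim k → ℤ) : Prop :=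
  ∀ τ : W.Idx, W.dim (W.carrier τ) + 1 = k → ∀ v : W.ConesOver k τ → X,
    (∀ σ, W.IsLatticeNormal σ.1.1 τ (v σ)) →
    ∑ᶠ σ : W.ConesOver k τ, c σ.1 • W.φ (v σ) ∈ W.linSpan (W.carrier τ)

/-- The group `Z_k` of tropical `k`-cycles on `W`: the classes of Minkowski weights on proper
subdivisions of `W`. -/
def cycles (k : ℕ) : AddSubgroup (W.Weight k) :=
  AddSubgroup.closure {A | ∃ (K' : ConeComplex X) (h : W.IsProperSubdivision K')
    (c : K'.ConesOfDim k → ℤ), (W.refine K' h).IsMinkowskiWeight c ∧ A = weightClass h c}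

/-- The group of tropical `k`-cycles on the extended cone complex: the direct sum of the groups of
`k`-cycles on all stars. -/
def extCycles (k : ℕ) : AddSubgroup (W.ExtWeight k) where
  carrier := {A | ∀ i, A i ∈ (W.star i).cycles k}
  add_mem' hA hB i := add_mem (hA i) (hB i)
  zero_mem' _ := zero_mem _
  neg_mem' hA i := neg_mem (hA i)

/-- The subgroup `R_k` of `k`-cycles rationally equivalent to zero, generated by the cycles
`p_*(q^* ψ · [c])` for the Minkowski weights `c` of dimension `k + 1` on proper subdivisions of the
star of `W × Π¹` at a cone of the form `σ × 0`, where `p` and `q` are the projections and `ψ` is the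
divisor on `Π¹` given by the identity. -/
def ratEquiv (k : ℕ) : AddSubgroup (W.ExtWeight k) :=
  AddSubgroup.closure {B | ∃ (σ : W.Idx) (K' : ConeComplex ((W.prod line).StarPt (σ, (0 : SignType))))
    (h : ((W.prod line).star (σ, (0 : SignType))).IsProperSubdivision K')
    (c : K'.ConesOfDim (k + 1) → ℤ),
    (((W.prod line).star (σ, (0 : SignType))).refine K' h).IsMinkowskiWeight c ∧
    B = (fstMor W.toConeComplex ConeComplex.line).extPush k
      ((W.prod line).inclPush (σ, (0 : SignType)) k
        (divisorProduct h (starDivisor W.isDivisor_snd (σ, (0 : SignType)) (W.snd_eq_zero σ)) c))}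

/-- The `k`-th tropical Chow group of the extended cone complex: `k`-cycles modulo rational
equivalence. -/
abbrev Chow (k : ℕ) : Type u := W.extCycles k ⧸ (W.ratEquiv k).addSubgroupOf (W.extCycles k)

/-- The class of a cycle in the Chow group. -/
def chowClass {k : ℕ} (A : W.extCycles k) : W.Chow k := QuotientAddGroup.mk A

/-- The unique morphism to `Π⁰`. -/
def toPoint : Mor W point where
  toFun _ := ()
  map_cone i := ⟨(), fun _ _ => Set.mem_univ _, fun m hm => by
    have : m = 0 := AddSubgroup.mem_bot.1 hm
    subst this
    have : restr (W.carrier i) ((0 : Unit → ℝ) ∘ fun _ => ()) = 0 := map_zero (restr (W.carrier i))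
    rw [this]
    exact zero_mem _⟩
  latHom := 0
  comm x := by
    rw [LinearMap.baseChange_zero]
    rfl

/-- The `0`-cycle on (the extended complex) `Π⁰` with weight one on its only cone, as an element of
the graded group of weights. The identification of the group of cycles on `Π⁰` with `ℤ` is given by
the multiples of this cycle. -/
def pointCycle : ⨁ k, (point.ExtWeight k) :=
  DirectSum.of (fun k => point.ExtWeight k) 0
    (DirectSum.of (fun i : Unit => (point.toConeComplex.star i).Weight 0) ()
      ((point.toConeComplex.star ()).cls 0 Set.univ))

end WECC

end Cycles

end TropicalCycles

end

-- Two facts about one morphism `f : K → L` of cone complexes carry the theorem, and both are proved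
-- one cone at a time. The source `K` is a subdivision carrying the given weight and is not
-- subdivided further. Only the target is refined: `exists_adapted` gives a subdivision `L'` in
-- which the image of every cone of `K` is a union of cones. To obtain it, pass to the barycentric
-- subdivision, where a multiple of any integral linear function on a cone extends to a divisor
-- because barycentric coordinates are globally defined, and then cut along the zero sets of the
-- divisors that describe the given subcones. On `L'` the push-forward is an actual weight
-- `pushWeight`: a `k`-dimensional cone receives index times weight from each `σ` whose image is
-- `k`-dimensional and contains it.
--
-- Cycles map to cycles. Since the span of a cone is rational, balancing at `κ` can be tested with
-- integral functionals vanishing on `κ` (`WECC.isMinkowskiWeight_iff`). For such a functional `μ`,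
-- the contribution of `σ` equals a sum over the facets `τ` of `σ` with `κ ⊆ f(τ)`, each facet
-- contributing its index times the value of `μ` on the image of its normal vector (`cone_sum`).
-- Indeed, inside `f(σ)` either `κ` is an interior wall and both sides vanish, or `κ` lies on the
-- boundary and exactly one facet of `σ` lies over it; there the index on `σ` is the index on the
-- facet times an index of rank one. Exchanging the two sums reduces balancing at `κ` to balancing
-- at the cones `τ` of the source.
--
-- Rational equivalence is preserved because of the projection formula `f_*(f^*ψ · c) = ψ · f_*c`
-- (`extPush_rayProduct`). The rays of `σ` with a nonzero contribution correspond to such rays of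
-- `L'` inside `f(σ)`. If `f` sends a primitive generator to `b` times a primitive generator, then
-- `b` enters the slopes of `ψ` and, inversely, the index of `f` on the quotient by the ray
-- (`dualIndex_mul_dualIndex_proj`), so the contributions agree. Moreover push-forward on extended
-- complexes is functorial and compatible with the inclusions of strata (`Mor.extPush_comp`,
-- `Mor.extPush_inclPush`, `inclPush_inclPush`). For dominant `f` these facts are applied to `f ×
-- id` on products with `Π¹`. For the inclusion of a stratum they are applied to the morphism from
-- the product of the star at `δ` with `Π¹` to the star of the product at `δ × 0`. Both morphisms
-- preserve the second coordinate, so generators of `R_k` go to generators (`WECC.mem_ratEquiv`).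
--
-- For the degree, weights of positive dimension on `Π⁰` vanish and those of dimension zero are
-- multiples of the point. A generator of `R_0` comes from a balanced one-dimensional weight `c` on
-- a subdivided line, and balancing at the origin says precisely that its degree, the sum of all
-- `c(ρ) ψ(u_ρ)`, is zero.

universe u'' v''

noncomputable section

namespace TropicalCycles

/-! ### Finitely generated cones and half-spaces -/

section Halfspaces

/-- The largest lower bound or the smallest upper bound serves as `t`. This is the one-variable case
of the elimination of variables from linear inequalities. -/
theorem exists_between_finsets {α : Type*} (L U : Finset α) (l u : α → ℝ)
    (h : ∀ a ∈ L, ∀ b ∈ U, l a ≤ u b) : ∃ t, (∀ a ∈ L, l a ≤ t) ∧ ∀ b ∈ U, t ≤ u b := by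
  rcases L.eq_empty_or_nonempty with rfl | hL
  · rcases U.eq_empty_or_nonempty with rfl | hU
    · exact ⟨0, by simp, by simp⟩
    · obtain ⟨b, hb, hmin⟩ := U.exists_min_image u hU
      exact ⟨u b, by simp, hmin⟩
  · obtain ⟨a, ha, hmax⟩ := L.exists_max_image l hL
    exact ⟨l a, hmax, h a ha⟩

variable {A : Type*} [AddCommGroup A]

open Classical in
/-- The Weyl theorem: a cone spanned by finitely many integral functionals on a finitely generated
group is cut out by finitely many elements of the group. -/
theorem exists_halfspaces [Module.Finite ℤ A] {ι : Type*} (s : Finset ι) (g : ι → A →+ ℝ)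
    (hg : ∀ i a, ∃ n : ℤ, g i a = n) : ∃ B : Finset A, ∀ e : A →+ ℝ,
      (∃ c : ι → ℝ, (∀ i, 0 ≤ c i) ∧ e = ∑ i ∈ s, c i • g i) ↔ ∀ b ∈ B, 0 ≤ e b := by
  induction s using Finset.induction_on with
  | empty =>
    obtain ⟨G, hG⟩ := (Module.Finite.fg_top : (⊤ : Submodule ℤ A).FG)
    -- The zero cone is cut out by the generators of the group and their negatives.
    refine ⟨G ∪ G.image Neg.neg, fun e => ⟨?_, fun h => ⟨0, fun _ => le_rfl, ?_⟩⟩⟩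
    · rintro ⟨c, -, rfl⟩ b -
      simp
    · rw [Finset.sum_empty]
      have h0 : e.toIntLinearMap = 0 := by
        refine LinearMap.ext_on_range (v := fun x : G => x.1) ?_ fun x => ?_
        · exact (congrArg _ (Subtype.range_coe (s := (G : Set A)))).trans hG
        · have h1 := h x.1 (Finset.mem_union_left _ x.2)
          have h2 := h (-x.1) (Finset.mem_union_right _ (Finset.mem_image_of_mem _ x.2))
          rw [map_neg] at h2
          exact le_antisymm (neg_nonneg.1 h2) h1
      ext a
      exact LinearMap.congr_fun h0 a
  | insert i s hi ih =>
    obtain ⟨B, hB⟩ := ih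
    choose n hn using hg i
    -- Fourier–Motzkin elimination: `n b` is the value of the new generator at `b`. Inequalities
    -- with `0 ≤ n b` stay valid, and two with values of opposite signs are combined so that the new
    -- generator cancels.
    refine ⟨B.filter (fun b => 0 ≤ n b) ∪ ((B ×ˢ B).filter fun p => 0 < n p.1 ∧ n p.2 < 0).image
      fun p => n p.1 • p.2 - n p.2 • p.1, fun e => ?_⟩
    -- A functional lies in the larger cone if and only if subtracting a suitable multiple `t ≥ 0`
    -- of the new generator leads into the old cone. It remains to eliminate `t`.
    have step : (∃ c : ι → ℝ, (∀ i, 0 ≤ c i) ∧ e = ∑ j ∈ insert i s, c j • g j) ↔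
        ∃ t : ℝ, 0 ≤ t ∧ ∀ b ∈ B, 0 ≤ e b - t * n b := by
      constructor
      · rintro ⟨c, hc, rfl⟩
        refine ⟨c i, hc i, fun b hb => ?_⟩
        have := (hB (∑ j ∈ s, c j • g j)).1 ⟨c, hc, rfl⟩ b hb
        rw [Finset.sum_insert hi, AddMonoidHom.add_apply, AddMonoidHom.smul_apply, hn, smul_eq_mul]
        linarith
      · rintro ⟨t, ht, h⟩
        obtain ⟨c, hc, he⟩ := (hB (e - t • g i)).2 fun b hb => by
          rw [AddMonoidHom.sub_apply, AddMonoidHom.smul_apply, hn, smul_eq_mul]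
          exact h b hb
        refine ⟨Function.update c i t, fun j => ?_, ?_⟩
        · by_cases hj : j = i
          · subst hj; simpa using ht
          · simpa [hj] using hc j
        · rw [Finset.sum_insert hi, Function.update_self, ← sub_eq_iff_eq_add', he]
          refine Finset.sum_congr rfl fun j hj => ?_
          rw [Function.update_of_ne (fun h : j = i => hi (h ▸ hj))]
    rw [step]
    constructor
    · rintro ⟨t, ht, h⟩ b hb
      rcases Finset.mem_union.1 hb with hb | hb
      · obtain ⟨hb, hnb⟩ := Finset.mem_filter.1 hb
        have := h b hb
        have : (0 : ℝ) ≤ n b := by exact_mod_cast hnb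
        nlinarith
      · obtain ⟨⟨b, b'⟩, hp, rfl⟩ := Finset.mem_image.1 hb
        obtain ⟨hp, h1, h2⟩ := Finset.mem_filter.1 hp
        obtain ⟨hb, hb'⟩ := Finset.mem_product.1 hp
        have h3 := h b hb
        have h4 := h b' hb'
        have h1' : (0 : ℝ) < n b := by exact_mod_cast h1
        have h2' : (n b' : ℝ) < 0 := by exact_mod_cast h2
        rw [map_sub, map_zsmul, map_zsmul, zsmul_eq_mul, zsmul_eq_mul]
        dsimp only at *
        nlinarith
    · intro h
      -- The inequalities with `n b < 0` bound `t` below and those with `0 < n b` bound it above.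
      -- The element `0` is added to the lower bounds to encode `0 ≤ t`, since its quotient is `0`.
      obtain ⟨t, hl, hu⟩ := exists_between_finsets
        (insert 0 (B.filter fun b => n b < 0)) (B.filter fun b => 0 < n b)
        (fun b => e b / n b) (fun b => e b / n b) (by
          intro a ha b hb
          obtain ⟨hb, hnb⟩ := Finset.mem_filter.1 hb
          have hnb' : (0 : ℝ) < n b := by exact_mod_cast hnb
          rcases Finset.mem_insert.1 ha with rfl | ha
          · rw [map_zero, zero_div]
            exact div_nonneg (h b (Finset.mem_union_left _ (Finset.mem_filter.2 ⟨hb, hnb.le⟩))) hnb'.le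
          · obtain ⟨ha, hna⟩ := Finset.mem_filter.1 ha
            have hna' : (n a : ℝ) < 0 := by exact_mod_cast hna
            have := h _ (Finset.mem_union_right _ (Finset.mem_image_of_mem _
              (Finset.mem_filter.2 ⟨Finset.mk_mem_product hb ha, hnb, hna⟩)))
            rw [map_sub, map_zsmul, map_zsmul, zsmul_eq_mul, zsmul_eq_mul] at this
            rw [le_div_iff₀ hnb', div_mul_eq_mul_div, div_le_iff_of_neg hna']
            dsimp only at this
            linarith)
      have ht : 0 ≤ t := by simpa using hl 0 (Finset.mem_insert_self _ _)
      refine ⟨t, ht, fun b hb => ?_⟩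
      rcases lt_trichotomy (n b) 0 with hnb | hnb | hnb
      · have hnb' : (n b : ℝ) < 0 := by exact_mod_cast hnb
        have := hl b (Finset.mem_insert_of_mem (Finset.mem_filter.2 ⟨hb, hnb⟩))
        rw [div_le_iff_of_neg hnb'] at this
        linarith
      · have := h b (Finset.mem_union_left _ (Finset.mem_filter.2 ⟨hb, hnb.ge⟩))
        simpa [hnb] using this
      · have hnb' : (0 : ℝ) < n b := by exact_mod_cast hnb
        have := hu b (Finset.mem_filter.2 ⟨hb, hnb⟩)
        rw [le_div_iff₀ hnb'] at this
        linarith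

open Classical in
/-- Generators of the part of a finitely generated cone in a half-space. -/
theorem exists_halfspace_generators {E : Type*} [AddCommGroup E] [Module ℝ E] {ι : Type*}
    [Fintype ι] (g : ι → E) (a : E →ₗ[ℝ] ℝ) (c : ι → ℝ) (hc : ∀ i, 0 ≤ c i)
    (h : 0 ≤ a (∑ i, c i • g i)) : ∃ (d : ι → ℝ) (d' : ι × ι → ℝ), (∀ i, 0 ≤ d i) ∧
      (∀ p, 0 ≤ d' p) ∧ (∀ i, a (g i) < 0 → d i = 0) ∧
      (∀ p, ¬ (0 < a (g p.1) ∧ a (g p.2) < 0) → d' p = 0) ∧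
      ∑ i, c i • g i = ∑ i, d i • g i + ∑ p, d' p • (a (g p.1) • g p.2 - a (g p.2) • g p.1) := by
  set pos : Finset ι := Finset.univ.filter fun i => 0 < a (g i)
  set neg : Finset ι := Finset.univ.filter fun i => a (g i) < 0
  -- `P` and `Q` are the total positive and negative parts of the value of `a`; the hypothesis says
  -- `Q ≤ P`.
  set P := ∑ i ∈ pos, c i * a (g i) with hP
  set Q := ∑ i ∈ neg, c i * (-a (g i)) with hQ
  have hQ0 : 0 ≤ Q := Finset.sum_nonneg fun i hi =>
    mul_nonneg (hc i) (by have := (Finset.mem_filter.1 hi).2; linarith)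
  have hP0 : 0 ≤ P := Finset.sum_nonneg fun i hi =>
    mul_nonneg (hc i) (Finset.mem_filter.1 hi).2.le
  have hPQ : a (∑ i, c i • g i) = P - Q := by
    rw [map_sum, hP, hQ, Finset.sum_filter, Finset.sum_filter, ← Finset.sum_sub_distrib]
    refine Finset.sum_congr rfl fun i _ => ?_
    rw [map_smul, smul_eq_mul]
    split_ifs <;> first | linarith | skip
    have : a (g i) = 0 := by linarith
    rw [this]; simp
  rw [hPQ] at h
  -- The fraction `Q / P` of the positive part is used to cancel the negative part: each positive
  -- generator is paired with each negative one, with coefficient `c i * c j / P`, in a vector on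
  -- which `a` vanishes. The fraction `1 - Q / P` is left over.
  refine ⟨fun i => if a (g i) < 0 then 0 else if 0 < a (g i) then (1 - Q / P) * c i else c i,
    fun p => if 0 < a (g p.1) ∧ a (g p.2) < 0 then c p.1 * c p.2 / P else 0, ?_, ?_, ?_, ?_, ?_⟩
  · intro i
    dsimp only
    have : 0 ≤ 1 - Q / P := by
      rcases hP0.eq_or_lt with h0 | h0
      · rw [← h0]; simp
      · rw [sub_nonneg, div_le_one h0]; linarith
    have := hc i
    split_ifs
    · exact le_rfl
    · positivity
    · assumption
  · intro p
    dsimp only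
    have := hc p.1
    have := hc p.2
    split_ifs
    · positivity
    · exact le_rfl
  · intro i hi; simp [hi]
  · intro p hp; simp [hp]
  · have e1 : ∑ p : ι × ι, (if 0 < a (g p.1) ∧ a (g p.2) < 0 then c p.1 * c p.2 / P else 0) •
        (a (g p.1) • g p.2 - a (g p.2) • g p.1) =
        (P / P) • ∑ j ∈ neg, c j • g j + (Q / P) • ∑ i ∈ pos, c i • g i := by
      have : ∀ p : ι × ι, (if 0 < a (g p.1) ∧ a (g p.2) < 0 then c p.1 * c p.2 / P else 0) •
          (a (g p.1) • g p.2 - a (g p.2) • g p.1) =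
          (if 0 < a (g p.1) then c p.1 * a (g p.1) / P else 0) • (if a (g p.2) < 0 then c p.2 • g p.2 else 0)
          + (if a (g p.2) < 0 then c p.2 * (-a (g p.2)) / P else 0) •
            (if 0 < a (g p.1) then c p.1 • g p.1 else 0) := by
        intro p
        by_cases h1 : 0 < a (g p.1) <;> by_cases h2 : a (g p.2) < 0 <;> simp only [h1, h2, if_true,
          if_false, and_true, and_false, zero_smul, smul_zero, add_zero]
        rw [smul_sub, smul_smul, smul_smul, smul_smul, smul_smul, sub_eq_add_neg, ← neg_smul]
        congr 2 <;> ring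
      rw [Finset.sum_congr rfl fun p _ => this p, Finset.sum_add_distrib, Fintype.sum_prod_type,
        Fintype.sum_prod_type_right]
      simp only [← Finset.smul_sum, ← Finset.sum_smul]
      rw [hP, hQ, Finset.sum_div, Finset.sum_div]
      simp only [pos, neg, Finset.sum_filter]
    rw [e1]
    have e2 : ∑ i, c i • g i = ∑ i ∈ neg, c i • g i + ∑ i ∈ pos, c i • g i +
        ∑ i ∈ Finset.univ.filter (fun i => a (g i) = 0), c i • g i := by
      simp only [pos, neg, Finset.sum_filter, ← Finset.sum_add_distrib]
      refine Finset.sum_congr rfl fun i _ => ?_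
      rcases lt_trichotomy (a (g i)) 0 with h | h | h
      · simp [h, h.not_gt, h.ne]
      · simp [h]
      · simp [h, h.not_gt, h.ne']
    have e3 : ∑ i, (if a (g i) < 0 then 0 else if 0 < a (g i) then (1 - Q / P) * c i else c i) • g i =
        (1 - Q / P) • ∑ i ∈ pos, c i • g i +
        ∑ i ∈ Finset.univ.filter (fun i => a (g i) = 0), c i • g i := by
      simp only [pos, Finset.sum_filter, Finset.smul_sum, ← Finset.sum_add_distrib]
      refine Finset.sum_congr rfl fun i _ => ?_
      rcases lt_trichotomy (a (g i)) 0 with h | h | h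
      · simp [h, h.not_gt, h.ne]
      · simp [h]
      · simp [h, h.not_gt, h.ne', smul_smul]
    rw [e2, e3]
    rcases hP0.eq_or_lt with h0 | h0
    · have hq : Q = 0 := by linarith
      have hneg : ∑ j ∈ neg, c j • g j = 0 := Finset.sum_eq_zero fun j hj => by
        have hj' := (Finset.mem_filter.1 hj).2
        have := (Finset.sum_eq_zero_iff_of_nonneg fun i hi => mul_nonneg (hc i) (by
          have := (Finset.mem_filter.1 hi).2; linarith)).1 (hQ.symm.trans hq) j hj
        rcases mul_eq_zero.1 this with h | h
        · rw [h, zero_smul]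
        · linarith
      rw [hneg, hq]
      simp
    · rw [div_self h0.ne', one_smul, sub_smul, one_smul]
      abel

end Halfspaces

/-! ### Inequalities, inner points and cuts of integral cones -/

section Cones

variable {X : Type u} {Y : Type u'}

/-- The evaluation of the functions of `M` at a point. -/
def evalAt (M : AddSubgroup (X → ℝ)) (x : X) : M →+ ℝ := (Pi.evalAddMonoidHom _ x).comp M.subtype

@[simp] theorem evalAt_apply (M : AddSubgroup (X → ℝ)) (x : X) (m : M) : evalAt M x m = m.1 x := rfl

/-- A point in the relative interior of a cone: it lies on no proper face. -/
def IsInner (S : Set X) (M : AddSubgroup (X → ℝ)) (t : X) : Prop :=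
  t ∈ S ∧ ∀ m ∈ M, (∀ x ∈ S, 0 ≤ m x) → m t = 0 → ∀ x ∈ S, m x = 0

namespace IsIntegralCone

variable {S : Set X} {M : AddSubgroup (X → ℝ)}

theorem exists_inner (h : IsIntegralCone S M) : ∃ t, IsInner S M t ∧ IsIntegralPt M t := by
  obtain ⟨t, ht, hi, h0⟩ := h.exists_interior
  exact ⟨t, ⟨ht, h0⟩, hi⟩

/-- A cone inside `S`, spanned by integral points, is cut out by functions of `M`. -/
theorem exists_ineq_of_gen {T : Set X} (fg : Module.Finite ℤ M) {ι : Type} [Fintype ι] (g : ι → X)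
    (hg : ∀ i, g i ∈ T ∧ IsIntegralPt M (g i))
    (h₁ : ∀ x ∈ T, ∃ a : ι → ℝ, (∀ i, 0 ≤ a i) ∧ ∀ m ∈ M, m x = ∑ i, a i * m (g i))
    (h₂ : ∀ a : ι → ℝ, (∀ i, 0 ≤ a i) → ∃ x ∈ T, ∀ m ∈ M, m x = ∑ i, a i * m (g i)) :
    ∃ B : Finset M, (∀ b ∈ B, ∀ x ∈ T, 0 ≤ b.1 x) ∧
      ∀ e : M →+ ℝ, (∀ b ∈ B, 0 ≤ e b) → ∃ x ∈ T, ∀ m : M, m.1 x = e m := by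
  obtain ⟨B, hB⟩ := exists_halfspaces Finset.univ (fun i => evalAt M (g i))
    fun i m => (hg i).2 m.1 m.2
  have hs : ∀ (a : ι → ℝ) (m : M), (∑ i, a i • evalAt M (g i)) m = ∑ i, a i * m.1 (g i) := by
    intro a m
    rw [AddMonoidHom.finsetSum_apply]
    rfl
  refine ⟨B, fun b hb x hx => ?_, fun e he => ?_⟩
  · obtain ⟨a, ha, hxa⟩ := h₁ x hx
    refine (hB (evalAt M x)).1 ⟨a, ha, ?_⟩ b hb
    ext m
    rw [hs]
    exact hxa m.1 m.2
  · obtain ⟨a, ha, rfl⟩ := (hB e).2 he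
    obtain ⟨x, hx, hxa⟩ := h₂ a ha
    exact ⟨x, hx, fun m => by rw [hs]; exact hxa m.1 m.2⟩

/-- Besides describing the cone, the inequalities construct points of it: a real functional on `M`
that satisfies them is the evaluation at some point of `S`. Most points needed below are produced in
this way. -/
theorem exists_ineq (h : IsIntegralCone S M) : ∃ B : Finset M, (∀ b ∈ B, ∀ x ∈ S, 0 ≤ b.1 x) ∧
    ∀ e : M →+ ℝ, (∀ b ∈ B, 0 ≤ e b) → ∃ x ∈ S, ∀ m : M, m.1 x = e m := by
  obtain ⟨ι, _, g, hg, h₁, h₂⟩ := h.exists_gen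
  exact exists_ineq_of_gen h.fg g hg h₁ h₂

/-- A subcone `T` of `S` is cut out of `S` by finitely many functions of `M`. -/
theorem exists_ineq_of_subset (h : IsIntegralCone S M) {T : Set X} (hT : T ⊆ S)
    (h' : IsIntegralCone T (M.map (restr T))) : ∃ B : Finset M, (∀ b ∈ B, ∀ x ∈ T, 0 ≤ b.1 x) ∧
    ∀ x ∈ S, (∀ b ∈ B, 0 ≤ b.1 x) → x ∈ T := by
  obtain ⟨ι, _, g, hg, h₁, h₂⟩ := h'.exists_gen
  have hr : ∀ m : X → ℝ, ∀ x ∈ T, restr T m x = m x := fun m x hx => restr_of_mem hx m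
  obtain ⟨B, hB, hB'⟩ := exists_ineq_of_gen (T := T) h.fg g (fun i => ⟨(hg i).1, fun m hm => by
      obtain ⟨n, hn⟩ := (hg i).2 _ (AddSubgroup.mem_map_of_mem _ hm)
      exact ⟨n, by rw [← hn, hr _ _ (hg i).1]⟩⟩)
    (fun x hx => by
      obtain ⟨a, ha, hxa⟩ := h₁ x hx
      refine ⟨a, ha, fun m hm => ?_⟩
      rw [← hr m x hx, hxa _ (AddSubgroup.mem_map_of_mem _ hm)]
      exact Finset.sum_congr rfl fun i _ => by rw [hr _ _ (hg i).1])
    (fun a ha => by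
      obtain ⟨x, hx, hxa⟩ := h₂ a ha
      refine ⟨x, hx, fun m hm => ?_⟩
      rw [← hr m x hx, hxa _ (AddSubgroup.mem_map_of_mem _ hm)]
      exact Finset.sum_congr rfl fun i _ => by rw [hr _ _ (hg i).1])
  refine ⟨B, hB, fun x hx hb => ?_⟩
  obtain ⟨y, hy, hxy⟩ := hB' (evalAt M x) hb
  rwa [h.separates x hx y (hT hy) fun m hm => (hxy ⟨m, hm⟩).symm]

/-- An inner point can be moved a little in any direction. -/
theorem exists_move (h : IsIntegralCone S M) {t : X} (ht : IsInner S M t) (e : M →+ ℝ) :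
    ∃ ε > 0, ∀ δ, 0 ≤ δ → δ ≤ ε → ∃ z ∈ S, ∀ m : M, m.1 z = m.1 t + δ * e m := by
  obtain ⟨B, hB, hB'⟩ := h.exists_ineq
  -- An inequality that is tight at the inner point vanishes on all of `S`, so it is the zero
  -- element of `M` and puts no condition on the direction `e`.
  have hz : ∀ b ∈ B, b.1 t = 0 → e b = 0 := by
    intro b hb h0
    have : b = 0 := by
      refine Subtype.ext (funext fun x => ?_)
      by_cases hx : x ∈ S
      · exact ht.2 b.1 b.2 (hB b hb) h0 x hx
      · exact h.supp b.1 b.2 x hx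
    rw [this, map_zero]
  obtain ⟨ε, hε, hεb⟩ : ∃ ε > 0, ∀ b ∈ B, ∀ δ, 0 ≤ δ → δ ≤ ε → 0 ≤ b.1 t + δ * e b := by
    classical
    have key : ∀ b ∈ B, ∃ ε > 0, ∀ δ, 0 ≤ δ → δ ≤ ε → 0 ≤ b.1 t + δ * e b := by
      intro b hb
      rcases (hB b hb t ht.1).eq_or_lt with h0 | h0
      · exact ⟨1, one_pos, fun δ _ _ => by rw [← h0, hz b hb h0.symm]; simp⟩
      · refine ⟨b.1 t / (|e b| + 1), by positivity, fun δ hδ hδ' => ?_⟩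
        rw [le_div_iff₀ (by positivity)] at hδ'
        have := neg_abs_le (e b)
        nlinarith
    clear hB hB' hz
    induction B using Finset.induction_on with
    | empty => exact ⟨1, one_pos, by simp⟩
    | insert b B hb ih =>
      obtain ⟨ε, hε, h1⟩ := ih fun b hb => key b (Finset.mem_insert_of_mem hb)
      obtain ⟨ε', hε', h2⟩ := key b (Finset.mem_insert_self _ _)
      refine ⟨min ε ε', lt_min hε hε', fun b' hb' δ hδ hδ' => ?_⟩
      rcases Finset.mem_insert.1 hb' with rfl | hb'
      · exact h2 δ hδ (hδ'.trans (min_le_right _ _))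
      · exact h1 b' hb' δ hδ (hδ'.trans (min_le_left _ _))
  refine ⟨ε, hε, fun δ hδ hδ' => ?_⟩
  obtain ⟨z, hz, hzm⟩ := hB' (evalAt M t + δ • e) fun b hb => hεb b hb δ hδ hδ'
  exact ⟨z, hz, hzm⟩

theorem exists_smul (h : IsIntegralCone S M) {x : X} (hx : x ∈ S) {a : ℝ} (ha : 0 ≤ a) :
    ∃ z ∈ S, ∀ m ∈ M, m z = a * m x := by
  obtain ⟨ι, _, g, -, h₁, h₂⟩ := h.exists_gen
  obtain ⟨c, hc, hxc⟩ := h₁ x hx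
  obtain ⟨z, hz, hzc⟩ := h₂ (fun i => a * c i) fun i => mul_nonneg ha (hc i)
  refine ⟨z, hz, fun m hm => ?_⟩
  rw [hzc m hm, hxc m hm, Finset.mul_sum]
  exact Finset.sum_congr rfl fun i _ => by ring

theorem exists_add_smul (h : IsIntegralCone S M) {x y : X} (hx : x ∈ S) (hy : y ∈ S) {a : ℝ}
    (ha : 0 ≤ a) : ∃ z ∈ S, ∀ m ∈ M, m z = m x + a * m y := by
  obtain ⟨w, hw, hwm⟩ := h.exists_smul hy ha
  obtain ⟨z, hz, hzm⟩ := h.exists_add hx hw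
  exact ⟨z, hz, fun m hm => by rw [hzm m hm, hwm m hm]⟩

theorem exists_sum (h : IsIntegralCone S M) {ι : Type*} (s : Finset ι) (g : ι → X) (a : ι → ℝ)
    (hg : ∀ i ∈ s, g i ∈ S) (ha : ∀ i ∈ s, 0 ≤ a i) :
    ∃ z ∈ S, ∀ m ∈ M, m z = ∑ i ∈ s, a i * m (g i) := by
  classical
  induction s using Finset.induction_on with
  | empty => simpa using h.exists_zero
  | insert i s hi ih =>
    obtain ⟨z, hz, hzm⟩ := ih (fun j hj => hg j (Finset.mem_insert_of_mem hj))
      fun j hj => ha j (Finset.mem_insert_of_mem hj)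
    obtain ⟨w, hw, hwm⟩ := h.exists_add_smul hz (hg i (Finset.mem_insert_self _ _))
      (ha i (Finset.mem_insert_self _ _))
    exact ⟨w, hw, fun m hm => by rw [hwm m hm, hzm m hm, Finset.sum_insert hi, add_comm]⟩

/-- A cone in `S` cut out by arbitrary restrictions: the conditions on the functions are inherited
by subsets. -/
theorem of_gen_subset (h : IsIntegralCone S M) {T : Set X} (hT : T ⊆ S) {ι : Type} [Fintype ι]
    (g : ι → X) (hg : ∀ i, g i ∈ T ∧ IsIntegralPt M (g i))
    (h₁ : ∀ x ∈ T, ∃ a : ι → ℝ, (∀ i, 0 ≤ a i) ∧ ∀ m ∈ M, m x = ∑ i, a i * m (g i))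
    (h₂ : ∀ a : ι → ℝ, (∀ i, 0 ≤ a i) → ∃ x ∈ T, ∀ m ∈ M, m x = ∑ i, a i * m (g i)) :
    IsIntegralCone T (M.map (restr T)) := by
  have hr : ∀ m : X → ℝ, ∀ x ∈ T, restr T m x = m x := fun m x hx => restr_of_mem hx m
  refine of_gen ?_ (finite_map h.fg _) ?_ g (fun i => ⟨(hg i).1, ?_⟩) ?_ ?_ ?_
  · rintro _ ⟨m, -, rfl⟩ x hx
    exact restr_of_notMem hx m
  · intro x hx y hy hxy
    refine h.separates x (hT hx) y (hT hy) fun m hm => ?_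
    have := hxy _ (AddSubgroup.mem_map_of_mem _ hm)
    rwa [hr _ _ hx, hr _ _ hy] at this
  · rintro _ ⟨m, hm, rfl⟩
    rw [hr _ _ (hg i).1]
    exact (hg i).2 m hm
  · intro x hx
    obtain ⟨a, ha, hxa⟩ := h₁ x hx
    refine ⟨a, ha, ?_⟩
    rintro _ ⟨m, hm, rfl⟩
    rw [hr _ _ hx, hxa m hm]
    exact Finset.sum_congr rfl fun i _ => by rw [hr _ _ (hg i).1]
  · intro a ha
    obtain ⟨x, hx, hxa⟩ := h₂ a ha
    refine ⟨x, hx, ?_⟩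
    rintro _ ⟨m, hm, rfl⟩
    rw [hr _ _ hx, hxa m hm]
    exact Finset.sum_congr rfl fun i _ => by rw [hr _ _ (hg i).1]
  · rintro x hx y hy hxy _ ⟨m, hm, rfl⟩
    rw [hr _ _ hx]
    refine h.salient x (hT hx) y (hT hy) (fun m hm => ?_) m hm
    have := hxy _ (AddSubgroup.mem_map_of_mem _ hm)
    rwa [hr _ _ hx, hr _ _ hy] at this

/-- The part of an integral cone in a rational half-space is an integral cone. -/
theorem halfspace (h : IsIntegralCone S M) {m : X → ℝ} (hm : m ∈ M) :
    IsIntegralCone {x ∈ S | 0 ≤ m x} (M.map (restr {x ∈ S | 0 ≤ m x})) := by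
  classical
  obtain ⟨ι, _, g, hg, h₁, h₂⟩ := h.exists_gen
  obtain ⟨z, hz, hz0⟩ := h.exists_zero
  have hzi : IsIntegralPt M z := fun m hm => ⟨0, by simp [hz0 m hm]⟩
  -- For two generators on opposite sides of the hyperplane, this is a point of their span on the
  -- hyperplane. Its coefficients are values of `m` at integral points, so it is integral again.
  have hpt : ∀ p : ι × ι, 0 < m (g p.1) ∧ m (g p.2) < 0 →
      ∃ w ∈ S, ∀ m' ∈ M, m' w = m (g p.1) * m' (g p.2) - m (g p.2) * m' (g p.1) := by
    intro p hp
    obtain ⟨w, hw, hwm⟩ := h.exists_smul (hg p.2).1 hp.1.le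
    obtain ⟨w', hw', hwm'⟩ := h.exists_add_smul hw (hg p.1).1 (neg_nonneg.2 hp.2.le)
    exact ⟨w', hw', fun m' hm' => by rw [hwm' m' hm', hwm m' hm']; ring⟩
  have : Nonempty X := ⟨z⟩
  choose! w hwS hw using hpt
  -- Indices that yield no generator are sent to the zero `z` of the cone.
  let G : ι ⊕ (ι × ι) → X := Sum.elim (fun i => if m (g i) < 0 then z else g i)
    (fun p => if 0 < m (g p.1) ∧ m (g p.2) < 0 then w p else z)
  have hG : ∀ k, G k ∈ {x ∈ S | 0 ≤ m x} ∧ IsIntegralPt M (G k) := by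
    rintro (i | p)
    · by_cases hi : m (g i) < 0
      · simpa [G, hi] using ⟨⟨hz, (hz0 m hm).ge⟩, hzi⟩
      · simpa [G, hi] using ⟨⟨(hg i).1, not_lt.1 hi⟩, (hg i).2⟩
    · by_cases hp : 0 < m (g p.1) ∧ m (g p.2) < 0
      · have hG : G (Sum.inr p) = w p := by simp [G, hp]
        rw [hG]
        refine ⟨⟨hwS p hp, ?_⟩, fun m' hm' => ?_⟩
        · rw [hw p hp m hm]; linarith
        · obtain ⟨n1, h1⟩ := (hg p.1).2 m hm
          obtain ⟨n2, h2⟩ := (hg p.2).2 m hm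
          obtain ⟨n3, h3⟩ := (hg p.1).2 m' hm'
          obtain ⟨n4, h4⟩ := (hg p.2).2 m' hm'
          exact ⟨n1 * n4 - n2 * n3, by rw [hw p hp m' hm', h1, h2, h3, h4]; push_cast; ring⟩
      · have hG : G (Sum.inr p) = z := by simp [G, hp]
        rw [hG]
        exact ⟨⟨hz, (hz0 m hm).ge⟩, hzi⟩
  refine h.of_gen_subset (fun x hx => hx.1) G hG ?_ ?_
  · rintro x ⟨hx, hmx⟩
    obtain ⟨c, hc, hxc⟩ := h₁ x hx
    let a : (M →+ ℝ) →ₗ[ℝ] ℝ :=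
      { toFun := fun e => e ⟨m, hm⟩, map_add' := fun _ _ => rfl, map_smul' := fun _ _ => rfl }
    have hs : ∀ (m' : M), (∑ i, c i • evalAt M (g i)) m' = m'.1 x := by
      intro m'
      rw [AddMonoidHom.finsetSum_apply, hxc m'.1 m'.2]
      rfl
    obtain ⟨d, d', hd, hd', hd0, hd0', he⟩ := exists_halfspace_generators (fun i => evalAt M (g i)) a
      c hc (by change 0 ≤ (∑ i, c i • evalAt M (g i)) ⟨m, hm⟩; rw [hs]; exact hmx)
    refine ⟨Sum.elim d d', by rintro (i | p) <;> simp [hd, hd'], fun m' hm' => ?_⟩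
    refine (hs ⟨m', hm'⟩).symm.trans ?_
    rw [he, Fintype.sum_sum_type, AddMonoidHom.add_apply,
      AddMonoidHom.finsetSum_apply, AddMonoidHom.finsetSum_apply]
    congr 1
    · refine Finset.sum_congr rfl fun i _ => ?_
      by_cases hi : m (g i) < 0
      · have : d i = 0 := hd0 i hi
        simp [this]
      · simp [G, hi]
    · refine Finset.sum_congr rfl fun p _ => ?_
      by_cases hp : 0 < m (g p.1) ∧ m (g p.2) < 0
      · have hG : G (Sum.inr p) = w p := by simp [G, hp]
        rw [hG, hw p hp m' hm']
        rfl
      · have : d' p = 0 := hd0' p hp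
        simp [this]
  · intro a ha
    obtain ⟨y, hy, hym⟩ := h.exists_sum Finset.univ G a (fun k _ => (hG k).1.1) fun k _ => ha k
    refine ⟨y, ⟨hy, ?_⟩, hym⟩
    rw [hym m hm]
    exact Finset.sum_nonneg fun k _ => mul_nonneg (ha k) (hG k).1.2

theorem cut (h : IsIntegralCone S M) (B : Finset (X → ℝ)) (hB : ∀ m ∈ B, m ∈ M) :
    IsIntegralCone {x ∈ S | ∀ m ∈ B, 0 ≤ m x} (M.map (restr {x ∈ S | ∀ m ∈ B, 0 ≤ m x})) := by
  classical
  induction B using Finset.induction_on with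
  | empty =>
    have : {x ∈ S | ∀ m ∈ (∅ : Finset (X → ℝ)), 0 ≤ m x} = S := by ext; simp
    rw [this]
    have : M.map (restr S) = M := by
      have key : ∀ m ∈ M, restr S m = m := fun m hm => by
        funext x
        by_cases hx : x ∈ S
        · exact restr_of_mem hx m
        · rw [restr_of_notMem hx, h.supp m hm x hx]
      ext m
      exact ⟨fun ⟨m', hm', he⟩ => he ▸ (key m' hm').symm ▸ hm', fun hm => ⟨m, hm, key m hm⟩⟩
    rwa [this]
  | insert b B hb ih =>
    have ih' := ih fun m hm => hB m (Finset.mem_insert_of_mem hm)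
    have := ih'.halfspace (AddSubgroup.mem_map_of_mem _ (hB b (Finset.mem_insert_self _ _)))
    have he : {x ∈ {x ∈ S | ∀ m ∈ B, 0 ≤ m x} | 0 ≤ restr {x ∈ S | ∀ m ∈ B, 0 ≤ m x} b x} =
        {x ∈ S | ∀ m ∈ insert b B, 0 ≤ m x} := by
      ext x
      constructor
      · rintro ⟨hx, hbx⟩
        rw [restr_of_mem hx] at hbx
        refine ⟨hx.1, fun m hm => ?_⟩
        rcases Finset.mem_insert.1 hm with rfl | hm
        · exact hbx
        · exact hx.2 m hm
      · rintro ⟨hx, h⟩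
        have hx' : x ∈ {x ∈ S | ∀ m ∈ B, 0 ≤ m x} := ⟨hx, fun m hm => h m (Finset.mem_insert_of_mem hm)⟩
        exact ⟨hx', by rw [restr_of_mem hx']; exact h b (Finset.mem_insert_self _ _)⟩
    rw [he, map_restr_restr (by rw [← he]; exact fun x hx => hx.1)] at this
    exact this

/-- Faces of integral cones are integral cones. -/
theorem face (h : IsIntegralCone S M) {S' : Set X} {M' : AddSubgroup (X → ℝ)}
    (hf : IsFaceOf S' M' S M) : IsIntegralCone S' M' := by
  classical
  obtain ⟨rfl, m, hm, hpos, rfl⟩ := hf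
  -- As `m` is non-negative on `S`, the face is the part of `S` where `-m` is non-negative.
  have := h.cut {-m} (by simpa using hm)
  have he : {x ∈ S | ∀ m' ∈ ({-m} : Finset (X → ℝ)), 0 ≤ m' x} = {x ∈ S | m x = 0} := by
    ext x
    simp only [Finset.mem_singleton, forall_eq, Pi.neg_apply, Left.nonneg_neg_iff, Set.mem_ofPred_eq]
    exact ⟨fun hx => ⟨hx.1, le_antisymm hx.2 (hpos x hx.1)⟩, fun hx => ⟨hx.1, hx.2.le⟩⟩
  rwa [he] at this

end IsIntegralCone

end Cones

namespace ConeComplex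

variable {X : Type u} {Y : Type u'}

/-! ### Cone complexes from systems of cells -/

section OfCells

theorem IsFaceOf.map_eq_of_eq {S S' : Set X} {M M' : AddSubgroup (X → ℝ)} (h : IsIntegralCone S M)
    (hf : IsFaceOf S' M' S M) (he : S' = S) : M' = M := by
  subst he
  rw [hf.1]
  have key : ∀ m ∈ M, restr S' m = m := fun m hm => by
    funext x
    by_cases hx : x ∈ S'
    · exact restr_of_mem hx m
    · rw [restr_of_notMem hx, h.supp m hm x hx]
  ext m
  exact ⟨fun ⟨m', hm', he⟩ => he ▸ (key m' hm').symm ▸ hm', fun hm => ⟨m, hm, key m hm⟩⟩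

/-- A family of cells, one around each point, which are integral cones containing the point in
their relative interiors, and such that the cell of a point of a cell is a face of the latter. -/
structure CellSystem (X : Type u) where
  cell : X → Set X
  F : X → AddSubgroup (X → ℝ)
  finite : (Set.range cell).Finite
  isCone : ∀ x, IsIntegralCone (cell x) (F x)
  inner : ∀ x, IsInner (cell x) (F x) x
  face : ∀ x, ∀ y ∈ cell x, IsFaceOf (cell y) (F y) (cell x) (F x)

namespace CellSystem

variable (C : CellSystem X)

instance : Finite (Set.range C.cell) := C.finite

/-- The points indexing the distinct cells. -/
def rep (i : Fin (Nat.card (Set.range C.cell))) : X :=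
  ((Finite.equivFin (Set.range C.cell)).symm i).2.choose

theorem cell_rep (i : Fin (Nat.card (Set.range C.cell))) :
    C.cell (C.rep i) = ((Finite.equivFin (Set.range C.cell)).symm i).1 :=
  ((Finite.equivFin (Set.range C.cell)).symm i).2.choose_spec

theorem F_eq {x y : X} (h : C.cell x = C.cell y) : C.F x = C.F y :=
  IsFaceOf.map_eq_of_eq (C.isCone y) (C.face y x (h ▸ (C.inner x).1)) h

theorem exists_rep (x : X) : ∃ i, C.cell (C.rep i) = C.cell x ∧ C.F (C.rep i) = C.F x := by
  have h : C.cell (C.rep (Finite.equivFin (Set.range C.cell) ⟨_, x, rfl⟩)) = C.cell x := by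
    rw [cell_rep, Equiv.symm_apply_apply]
  exact ⟨_, h, C.F_eq h⟩

/-- The cone complex formed by the cells. -/
def complex : ConeComplex X where
  Idx := Fin (Nat.card (Set.range C.cell))
  finite := inferInstance
  carrier i := C.cell (C.rep i)
  M i := C.F (C.rep i)
  isCone i := C.isCone _
  carrier_injective i j h := by
    dsimp only at h
    rw [cell_rep, cell_rep] at h
    exact (Finite.equivFin (Set.range C.cell)).symm.injective (Subtype.ext h)
  cover x := by
    obtain ⟨i, hi, -⟩ := C.exists_rep x
    exact ⟨i, hi ▸ (C.inner x).1⟩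
  exists_face i S' M' hf := by
    -- A face is the cell of any of its inner points `t`: the given face and the cell of `t` are
    -- both faces of the same cell with `t` in their interiors, so each function cutting out one of
    -- them vanishes on the other.
    obtain ⟨t, ht, -⟩ := ((C.isCone _).face hf).exists_inner
    obtain ⟨j, hj, hj'⟩ := C.exists_rep t
    obtain ⟨rfl, m, hm, hpos, hS'⟩ := hf
    have hti : t ∈ C.cell (C.rep i) := by
      have := ht.1
      rw [hS'] at this
      exact this.1
    obtain ⟨hF, m', hm', hpos', hc⟩ := C.face _ t hti
    have he : C.cell t = S' := by
      refine Set.Subset.antisymm (fun x hx => ?_) fun x hx => ?_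
      · have hx' : x ∈ C.cell (C.rep i) := by rw [hc] at hx; exact hx.1
        have hsub : C.cell t ⊆ C.cell (C.rep i) := fun x hx => by rw [hc] at hx; exact hx.1
        rw [hS']
        refine ⟨hx', ?_⟩
        have htm : m t = 0 := by
          have := ht.1
          rw [hS'] at this
          exact this.2
        have := (C.inner t).2 (restr (C.cell t) m) (hF ▸ AddSubgroup.mem_map_of_mem _ hm)
          (fun y hy => by rw [restr_of_mem hy]; exact hpos y (hsub hy))
          (by rw [restr_of_mem (C.inner t).1, htm]) x hx
        rwa [restr_of_mem hx] at this
      · have hsub : S' ⊆ C.cell (C.rep i) := fun x hx => by rw [hS'] at hx; exact hx.1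
        rw [hc]
        refine ⟨hsub hx, ?_⟩
        have htm : m' t = 0 := by
          have := (C.inner t).1
          rw [hc] at this
          exact this.2
        have := ht.2 (restr S' m') (AddSubgroup.mem_map_of_mem _ hm')
          (fun y hy => by rw [restr_of_mem hy]; exact hpos' y (hsub hy))
          (by rw [restr_of_mem ht.1, htm]) x hx
        rwa [restr_of_mem hx] at this
    exact ⟨j, hj.trans he, by rw [hj', hF, he]⟩
  inter i j x hx := by
    obtain ⟨k, hk, hk'⟩ := C.exists_rep x
    refine ⟨k, hk ▸ (C.inner x).1, ?_, ?_⟩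
    · rw [hk, hk']; exact C.face _ x hx.1
    · rw [hk, hk']; exact C.face _ x hx.2

theorem exists_idx (x : X) : ∃ i, C.complex.carrier i = C.cell x ∧ C.complex.M i = C.F x :=
  C.exists_rep x

theorem exists_eq_cell (i : C.complex.Idx) :
    ∃ x, C.complex.carrier i = C.cell x ∧ C.complex.M i = C.F x := ⟨C.rep i, rfl, rfl⟩

end CellSystem

end OfCells

/-! ### Minimal cones and proper subdivisions -/

section MinCone

variable (K : ConeComplex X)

/-- The minimal cone containing a point. -/
def minCone (x : X) : K.Idx := (K.exists_minimal x).choose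

theorem mem_minCone (x : X) : x ∈ K.carrier (K.minCone x) := (K.exists_minimal x).choose_spec.1

variable {K}

theorem minCone_subset {x : X} {j : K.Idx} (h : x ∈ K.carrier j) :
    K.carrier (K.minCone x) ⊆ K.carrier j := (K.exists_minimal x).choose_spec.2 j h

/-- The zero set of a non-negative function that vanishes at `x` is a face containing `x`, so by
minimality it is the whole cone. -/
theorem isInner_minCone (x : X) :
    IsInner (K.carrier (K.minCone x)) (K.M (K.minCone x)) x := by
  refine ⟨K.mem_minCone x, fun m hm hpos h0 y hy => ?_⟩
  obtain ⟨j, hj, -⟩ := K.exists_face _ _ _ ⟨rfl, m, hm, hpos, rfl⟩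
  have : x ∈ K.carrier j := by rw [hj]; exact ⟨K.mem_minCone x, h0⟩
  have := minCone_subset this hy
  rw [hj] at this
  exact this.2

/-- A common face through an inner point of `i` must be all of `i`. -/
theorem subset_of_isInner {i j : K.Idx} {t : X} (ht : IsInner (K.carrier i) (K.M i) t)
    (hj : t ∈ K.carrier j) : K.carrier i ⊆ K.carrier j := by
  obtain ⟨k, hk, hki, hkj⟩ := K.inter i j t ⟨ht.1, hj⟩
  refine subset_trans ?_ (face_subset hkj)
  obtain ⟨-, m, hm, hm0, he⟩ := hki
  rw [he] at hk ⊢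
  exact fun x hx => ⟨hx, ht.2 m hm hm0 hk.2 x hx⟩

theorem minCone_eq_of_isInner {i : K.Idx} {t : X} (ht : IsInner (K.carrier i) (K.M i) t) :
    K.minCone t = i :=
  K.carrier_injective ((minCone_subset ht.1).antisymm (subset_of_isInner ht (K.mem_minCone t)))

theorem exists_inner (i : K.Idx) : ∃ t, IsInner (K.carrier i) (K.M i) t ∧ K.minCone t = i := by
  obtain ⟨t, ht, -⟩ := (K.isCone i).exists_inner
  exact ⟨t, ht, minCone_eq_of_isInner ht⟩

/-- The minimal cone of a point in a subdivision lies in the minimal cone in the complex. -/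
theorem IsProperSubdivision.minCone_subset {K' : ConeComplex X} (h : K.IsProperSubdivision K')
    (x : X) : K'.carrier (K'.minCone x) ⊆ K.carrier (K.minCone x) := by
  obtain ⟨j, hj, hM⟩ := h (K'.minCone x)
  obtain ⟨-, m, hm, hpos, he⟩ := isFaceOf_of_subset
    (K.minCone_subset (hj (K'.mem_minCone x)) : K.carrier (K.minCone x) ⊆ K.carrier j)
  have hx := K.mem_minCone x
  rw [he] at hx ⊢
  refine fun y hy => ⟨hj hy, ?_⟩
  have := (isInner_minCone x).2 (restr (K'.carrier (K'.minCone x)) m)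
    (hM ▸ AddSubgroup.mem_map_of_mem _ hm)
    (fun z hz => by rw [restr_of_mem hz]; exact hpos z (hj hz))
    (by rw [restr_of_mem (K'.mem_minCone x)]; exact hx.2) y hy
  rwa [restr_of_mem hy] at this

theorem IsProperSubdivision.isSubcone {K' : ConeComplex X} (h : K.IsProperSubdivision K')
    (i : K'.Idx) : K.IsSubcone (K'.carrier i) := by
  obtain ⟨j, hj, hM⟩ := h i
  exact ⟨j, hj, hM ▸ K'.isCone i⟩

theorem IsProperSubdivision.fn_carrier {K' : ConeComplex X} (h : K.IsProperSubdivision K')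
    (i : K'.Idx) : K.fn (K'.carrier i) = K'.M i := by
  obtain ⟨j, hj, hM⟩ := h i
  rw [(h.isSubcone i).fn_eq hj, hM]

theorem IsProperSubdivision.trans {K' K'' : ConeComplex X} (h : K.IsProperSubdivision K')
    (h' : K'.IsProperSubdivision K'') : K.IsProperSubdivision K'' := by
  intro i
  obtain ⟨j, hj, hM⟩ := h' i
  obtain ⟨l, hl, hM'⟩ := h j
  exact ⟨l, hj.trans hl, by rw [hM, hM', map_restr_restr hj]⟩

end MinCone

/-! ### Subdivision by the zero sets of divisors -/

section Arrangement

variable (K : ConeComplex X)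

theorem exists_move_eventually {S : Set X} {M : AddSubgroup (X → ℝ)} (h : IsIntegralCone S M)
    {t : X} (ht : IsInner S M t) (e : M →+ ℝ) :
    ∀ᶠ δ in nhdsWithin (0 : ℝ) (Set.Ioi 0), ∃ z ∈ S, ∀ m : M, m.1 z = m.1 t + δ * e m := by
  obtain ⟨ε, hε, h⟩ := h.exists_move ht e
  filter_upwards [Ioc_mem_nhdsGT hε] with δ hδ
  exact h δ hδ.1.le hδ.2

/-- The cells of the subdivision of `K` by the zero sets of finitely many divisors. -/
def arrCell (H : Finset (X → ℝ)) (x : X) : Set X :=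
  {y ∈ K.carrier (K.minCone x) | ∀ h ∈ H, (0 ≤ h x → 0 ≤ h y) ∧ (h x ≤ 0 → h y ≤ 0)}

variable {K}

theorem arrCell_subset (H : Finset (X → ℝ)) (x : X) :
    K.arrCell H x ⊆ K.carrier (K.minCone x) := fun _ h => h.1

theorem arrCell_mono {H : Finset (X → ℝ)} {x y : X} (hy : y ∈ K.arrCell H x) :
    K.arrCell H y ⊆ K.arrCell H x := fun _ hz =>
  ⟨minCone_subset hy.1 hz.1, fun h hh => ⟨fun h0 => (hz.2 h hh).1 ((hy.2 h hh).1 h0),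
    fun h0 => (hz.2 h hh).2 ((hy.2 h hh).2 h0)⟩⟩

theorem mem_arrCell (H : Finset (X → ℝ)) (x : X) : x ∈ K.arrCell H x :=
  ⟨K.mem_minCone x, fun _ _ => ⟨id, id⟩⟩

open Classical in
theorem arrCell_isCone {H : Finset (X → ℝ)} (hH : ∀ h ∈ H, K.IsDivisor h) (x : X) :
    IsIntegralCone (K.arrCell H x) ((K.M (K.minCone x)).map (restr (K.arrCell H x))) := by
  have := (K.isCone (K.minCone x)).cut
    ((H.filter fun h => 0 ≤ h x).image (restr (K.carrier (K.minCone x))) ∪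
      (H.filter fun h => h x ≤ 0).image fun h => -restr (K.carrier (K.minCone x)) h) (by
    intro m hm
    rcases Finset.mem_union.1 hm with hm | hm
    · obtain ⟨h, hh, rfl⟩ := Finset.mem_image.1 hm
      exact hH h (Finset.mem_filter.1 hh).1 _
    · obtain ⟨h, hh, rfl⟩ := Finset.mem_image.1 hm
      exact neg_mem (hH h (Finset.mem_filter.1 hh).1 _))
  have key : K.arrCell H x = {y ∈ K.carrier (K.minCone x) | ∀ m ∈ (H.filter fun h => 0 ≤ h x).image (restr (K.carrier (K.minCone x))) ∪
      (H.filter fun h => h x ≤ 0).image fun h => -restr (K.carrier (K.minCone x)) h, 0 ≤ m y} := by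
    ext y
    constructor
    · rintro ⟨hy, h⟩
      refine ⟨hy, fun m hm => ?_⟩
      rcases Finset.mem_union.1 hm with hm | hm
      · obtain ⟨f, hf, rfl⟩ := Finset.mem_image.1 hm
        rw [restr_of_mem hy]
        exact (h f (Finset.mem_filter.1 hf).1).1 (Finset.mem_filter.1 hf).2
      · obtain ⟨f, hf, rfl⟩ := Finset.mem_image.1 hm
        rw [Pi.neg_apply, restr_of_mem hy]
        exact neg_nonneg.2 ((h f (Finset.mem_filter.1 hf).1).2 (Finset.mem_filter.1 hf).2)
    · rintro ⟨hy, h⟩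
      refine ⟨hy, fun f hf => ⟨fun h0 => ?_, fun h0 => ?_⟩⟩
      · have := h _ (Finset.mem_union_left _ (Finset.mem_image_of_mem _ (Finset.mem_filter.2 ⟨hf, h0⟩)))
        rwa [restr_of_mem hy] at this
      · have := h _ (Finset.mem_union_right _ (Finset.mem_image_of_mem _ (Finset.mem_filter.2 ⟨hf, h0⟩)))
        rw [Pi.neg_apply, restr_of_mem hy] at this
        linarith
  rwa [← key] at this

open Classical in
-- The supporting function is the sum of one that cuts out the minimal cone of `y` and of the
-- functions of `H` vanishing at `y`, each with a sign making it non-negative on the cell of `x`.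
-- The remaining functions of `H` are nonzero at `y` and already have the sign there that they have
-- at `x`.
theorem arrCell_isFaceOf {H : Finset (X → ℝ)} (hH : ∀ h ∈ H, K.IsDivisor h) {x y : X}
    (hy : y ∈ K.arrCell H x) :
    IsFaceOf (K.arrCell H y) ((K.M (K.minCone y)).map (restr (K.arrCell H y)))
      (K.arrCell H x) ((K.M (K.minCone x)).map (restr (K.arrCell H x))) := by
  obtain ⟨hM, m, hm, hpos, he⟩ := isFaceOf_of_subset (K.minCone_subset hy.1)
  have hsub := arrCell_mono hy
  refine ⟨by rw [hM, map_restr_restr hsub, map_restr_restr (arrCell_subset H y)], ?_⟩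
  -- If `h x = 0`, then `h` vanishes on the whole cell and the choice of sign is immaterial.
  let s : (X → ℝ) → X → ℝ := fun h => if 0 ≤ h x then restr (K.carrier (K.minCone x)) h else
    -restr (K.carrier (K.minCone x)) h
  have hs : ∀ h ∈ H, ∀ z ∈ K.arrCell H x, 0 ≤ s h z ∧ (s h z = 0 ↔ h z = 0) := by
    intro h hh z hz
    by_cases h0 : 0 ≤ h x
    · simp only [s, h0, if_true, restr_of_mem hz.1]
      exact ⟨(hz.2 h hh).1 h0, trivial⟩
    · simp only [s, h0, if_false, Pi.neg_apply, restr_of_mem hz.1]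
      exact ⟨neg_nonneg.2 ((hz.2 h hh).2 (le_of_not_ge h0)), neg_eq_zero⟩
  have hval : ∀ z ∈ K.arrCell H x, restr (K.arrCell H x) (m + ∑ h ∈ H with h y = 0, s h) z =
      m z + ∑ h ∈ H with h y = 0, s h z := fun z hz => by
    rw [restr_of_mem hz, Pi.add_apply, Finset.sum_apply]
  have hsum : ∀ z ∈ K.arrCell H x, 0 ≤ ∑ h ∈ H with h y = 0, s h z := fun z hz =>
    Finset.sum_nonneg fun h hh => (hs h (Finset.mem_filter.1 hh).1 z hz).1
  refine ⟨_, AddSubgroup.mem_map_of_mem _ (add_mem hm (sum_mem fun h hh => ?_) :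
    m + ∑ h ∈ H with h y = 0, s h ∈ _), fun z hz => ?_, ?_⟩
  · by_cases h0 : 0 ≤ h x
    · simp only [s, h0, if_true]; exact hH h (Finset.mem_filter.1 hh).1 _
    · simp only [s, h0, if_false]; exact neg_mem (hH h (Finset.mem_filter.1 hh).1 _)
  · rw [hval z hz]
    exact add_nonneg (hpos z hz.1) (hsum z hz)
  · ext z
    constructor
    · intro hz
      refine ⟨hsub hz, ?_⟩
      rw [hval z (hsub hz)]
      have h1 := hz.1
      rw [he] at h1
      rw [h1.2, zero_add]
      refine Finset.sum_eq_zero fun h hh => ?_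
      obtain ⟨hh, h0⟩ := Finset.mem_filter.1 hh
      exact (hs h hh z (hsub hz)).2.2 (le_antisymm ((hz.2 h hh).2 h0.le) ((hz.2 h hh).1 h0.ge))
    · rintro ⟨hz, h0⟩
      rw [hval z hz] at h0
      have h1 := hpos z hz.1
      have h2 := hsum z hz
      have h3 : ∑ h ∈ H with h y = 0, s h z = 0 := by linarith
      rw [Finset.sum_eq_zero_iff_of_nonneg fun h hh => (hs h (Finset.mem_filter.1 hh).1 z hz).1] at h3
      have h4 : ∀ h ∈ H, h y = 0 → h z = 0 := fun h hh h0 =>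
        (hs h hh z hz).2.1 (h3 h (Finset.mem_filter.2 ⟨hh, h0⟩))
      refine ⟨?_, fun h hh => ⟨fun h5 => ?_, fun h5 => ?_⟩⟩
      · rw [he]; exact ⟨hz.1, by linarith⟩
      · rcases h5.eq_or_lt with h6 | h6
        · exact (h4 h hh h6.symm).ge
        · refine (hz.2 h hh).1 (le_of_not_ge fun h7 => ?_)
          exact absurd ((hy.2 h hh).2 h7) (not_le.2 h6)
      · rcases h5.eq_or_lt with h6 | h6
        · exact (h4 h hh h6).le
        · refine (hz.2 h hh).2 (le_of_not_ge fun h7 => ?_)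
          exact absurd ((hy.2 h hh).1 h7) (not_le.2 h6)

/-- Starting at `x`, a small step in the direction opposite to `y` stays in the cell. A non-negative
function vanishing at `x` would become negative there unless it vanishes at `y`. -/
theorem arrCell_inner {H : Finset (X → ℝ)} (hH : ∀ h ∈ H, K.IsDivisor h) (x : X) :
    IsInner (K.arrCell H x) ((K.M (K.minCone x)).map (restr (K.arrCell H x))) x := by
  refine ⟨mem_arrCell H x, ?_⟩
  rintro _ ⟨m, hm, rfl⟩ hpos h0 y hy
  have hp := hpos y hy
  rw [restr_of_mem hy] at hp ⊢
  rw [restr_of_mem (mem_arrCell H x)] at h0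
  have h1 := exists_move_eventually (K.isCone (K.minCone x)) (isInner_minCone x)
    (-evalAt _ y)
  have h2 : ∀ᶠ δ in nhdsWithin (0 : ℝ) (Set.Ioi 0), ∀ h ∈ H,
      (0 ≤ h x → 0 ≤ h x - δ * h y) ∧ (h x ≤ 0 → h x - δ * h y ≤ 0) := by
    refine (Filter.eventually_all_finset H).2 fun h hh => ?_
    have hc : Filter.Tendsto (fun δ => h x - δ * h y) (nhdsWithin (0 : ℝ) (Set.Ioi 0))
        (nhds (h x - 0 * h y)) := Filter.Tendsto.mono_left
      (Continuous.tendsto (by fun_prop) 0) nhdsWithin_le_nhds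
    rw [zero_mul, sub_zero] at hc
    rcases lt_trichotomy (h x) 0 with h3 | h3 | h3
    · filter_upwards [hc.eventually_lt_const h3] with δ hδ
      exact ⟨fun h4 => absurd h3 (not_lt.2 h4), fun _ => hδ.le⟩
    · have : h y = 0 := le_antisymm ((hy.2 h hh).2 h3.le) ((hy.2 h hh).1 h3.ge)
      simp [h3, this]
    · filter_upwards [hc.eventually_const_lt h3] with δ hδ
      exact ⟨fun _ => hδ.le, fun h4 => absurd h3 (not_lt.2 h4)⟩
  obtain ⟨δ, ⟨⟨z, hz, hzm⟩, h3⟩, hδ⟩ := ((h1.and h2).and self_mem_nhdsWithin).exists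
  have hzm' : ∀ m ∈ K.M (K.minCone x), m z = m x + δ * -m y := fun m hm => hzm ⟨m, hm⟩
  have hz' : z ∈ K.arrCell H x := by
    refine ⟨hz, fun h hh => ?_⟩
    have := hzm' _ (hH h hh _)
    rw [restr_of_mem hz, restr_of_mem (K.mem_minCone x), restr_of_mem hy.1] at this
    rw [this, mul_neg, ← sub_eq_add_neg]
    exact h3 h hh
  have h4 := hpos z hz'
  rw [restr_of_mem hz', hzm' m hm, h0] at h4
  have hδ' : 0 < δ := hδ
  nlinarith

/-- The subdivision of a cone complex by the zero sets of finitely many divisors. -/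
def arrangement {H : Finset (X → ℝ)} (hH : ∀ h ∈ H, K.IsDivisor h) : CellSystem X where
  cell := K.arrCell H
  F x := (K.M (K.minCone x)).map (restr (K.arrCell H x))
  finite := by
    classical
    have : (Set.range fun p : K.Idx × (H → Prop) × (H → Prop) => {y ∈ K.carrier p.1 | ∀ h : H,
      (p.2.1 h → 0 ≤ h.1 y) ∧ (p.2.2 h → h.1 y ≤ 0)}).Finite := Set.finite_range _
    refine this.subset ?_
    rintro _ ⟨x, rfl⟩
    refine ⟨(K.minCone x, fun h => 0 ≤ h.1 x, fun h => h.1 x ≤ 0), ?_⟩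
    ext y
    exact and_congr_right fun _ => ⟨fun h f hf => h ⟨f, hf⟩, fun h f => h f.1 f.2⟩
  isCone := arrCell_isCone hH
  inner := arrCell_inner hH
  face _ _ := arrCell_isFaceOf hH

theorem exists_arrangement {H : Finset (X → ℝ)} (hH : ∀ h ∈ H, K.IsDivisor h) :
    ∃ K', K.IsProperSubdivision K' ∧ ∀ x, ∃ i, x ∈ K'.carrier i ∧
      K'.carrier i ⊆ K.carrier (K.minCone x) ∧ ∀ y ∈ K'.carrier i, ∀ h ∈ H, 0 ≤ h x → 0 ≤ h y := by
  refine ⟨(arrangement hH).complex, fun i => ?_, fun x => ?_⟩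
  · obtain ⟨x, hx, hx'⟩ := (arrangement hH).exists_eq_cell i
    rw [hx, hx']
    exact ⟨K.minCone x, arrCell_subset H x, rfl⟩
  · obtain ⟨i, hi, -⟩ := (arrangement hH).exists_idx x
    rw [show (arrangement hH).cell x = K.arrCell H x from rfl] at hi
    refine ⟨i, hi ▸ mem_arrCell H x, hi ▸ arrCell_subset H x, fun y hy h hh => ?_⟩
    rw [hi] at hy
    exact (hy.2 h hh).1

end Arrangement

end ConeComplex

namespace ConeComplex

variable {X : Type u} {Y : Type u'}

/-! ### Barycentric subdivision and adapted subdivisions -/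

section Barycentric

variable (K : ConeComplex X)

/-- An integral point in the relative interior of a cone. -/
def bary (i : K.Idx) : X := (K.isCone i).exists_inner.choose

variable {K}

theorem bary_inner (i : K.Idx) : IsInner (K.carrier i) (K.M i) (K.bary i) :=
  (K.isCone i).exists_inner.choose_spec.1

theorem bary_mem (i : K.Idx) : K.bary i ∈ K.carrier i := (bary_inner i).1

theorem bary_integral {i j : K.Idx} (h : K.carrier i ⊆ K.carrier j) :
    IsIntegralPt (K.M j) (K.bary i) := fun m hm => by
  obtain ⟨n, hn⟩ := (K.isCone i).exists_inner.choose_spec.2 _ (restr_mem h hm)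
  exact ⟨n, by rw [← hn]; exact (restr_of_mem (bary_mem i) m).symm⟩

theorem subset_of_bary_mem {i j : K.Idx} (h : K.bary i ∈ K.carrier j) :
    K.carrier i ⊆ K.carrier j := subset_of_isInner (bary_inner i) h

/-- The barycenter of a vertex does not contribute to a combination. Hence its coefficient is
arbitrary, and statements about barycentric coordinates exclude the vertices. -/
theorem apply_bary_of_bot {v t : K.Idx} (hv : K.M v = ⊥) (h : K.carrier v ⊆ K.carrier t) {m : X → ℝ}
    (hm : m ∈ K.M t) : m (K.bary v) = 0 := by
  have := restr_mem h hm
  rw [hv, AddSubgroup.mem_bot] at this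
  have := congrFun this (K.bary v)
  rwa [restr_of_mem (bary_mem v)] at this

theorem M_eq_bot_of_subset {v c : K.Idx} (hv : K.M v = ⊥) (h : K.carrier c ⊆ K.carrier v) :
    K.M c = ⊥ := by
  rw [(isFaceOf_of_subset h).1, hv, AddSubgroup.map_bot]

theorem eq_of_subset_bot {v c : K.Idx} (hv : K.M v = ⊥) (h : K.carrier c ⊆ K.carrier v) : c = v := by
  refine K.carrier_injective (h.antisymm fun x hx => ?_)
  have : x = K.bary c := (K.isCone v).separates x hx _ (h (bary_mem c)) fun m hm => by
    rw [hv, AddSubgroup.mem_bot] at hm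
    rw [hm]; rfl
  exact this ▸ bary_mem c

variable (K)

/-- A flag of cones with largest element `t`, containing a vertex. -/
structure IsFlag (C : Finset K.Idx) (t : K.Idx) : Prop where
  mem : t ∈ C
  le : ∀ i ∈ C, K.carrier i ⊆ K.carrier t
  chain : ∀ i ∈ C, ∀ j ∈ C, K.carrier i ⊆ K.carrier j ∨ K.carrier j ⊆ K.carrier i
  vertex : ∃ v ∈ C, K.M v = ⊥

/-- The point `x` of the cone `t` is the combination with coefficients `a` of the barycenters of the
cones in `C`. -/
def IsComb (C : Finset K.Idx) (t : K.Idx) (a : K.Idx → ℝ) (x : X) : Prop :=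
  x ∈ K.carrier t ∧ ∀ m ∈ K.M t, m x = ∑ i ∈ C, a i * m (K.bary i)

variable {K}

theorem IsFlag.of_subset {C C' : Finset K.Idx} {t : K.Idx} (h : K.IsFlag C t) (hC : C' ⊆ C)
    (hv : ∃ v ∈ C', K.M v = ⊥) : ∃ t', K.IsFlag C' t' := by
  obtain ⟨v, hv, hv'⟩ := hv
  obtain ⟨t', ht', hmax⟩ := C'.exists_max_image (fun i => Nat.card {j | K.carrier j ⊆ K.carrier i})
    ⟨v, hv⟩
  refine ⟨t', ht', fun i hi => ?_, fun i hi j hj => h.chain i (hC hi) j (hC hj), v, hv, hv'⟩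
  rcases h.chain i (hC hi) t' (hC ht') with h1 | h1
  · exact h1
  · have hle : {j | K.carrier j ⊆ K.carrier t'} ⊆ {j | K.carrier j ⊆ K.carrier i} :=
      fun j hj => hj.trans h1
    have := Set.eq_of_subset_of_ncard_le hle (hmax i hi)
    have : i ∈ {j | K.carrier j ⊆ K.carrier t'} := this ▸ subset_refl (K.carrier i)
    exact this

theorem IsFlag.erase [DecidableEq K.Idx] {C : Finset K.Idx} {t : K.Idx} (h : K.IsFlag C t)
    (ht : K.M t ≠ ⊥) : ∃ t', K.IsFlag (C.erase t) t' ∧ K.carrier t' ⊆ K.carrier t ∧ t' ≠ t := by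
  obtain ⟨v, hv, hv'⟩ := h.vertex
  obtain ⟨t', ht'⟩ := h.of_subset (C.erase_subset t)
    ⟨v, Finset.mem_erase.2 ⟨fun he => ht (he ▸ hv'), hv⟩, hv'⟩
  have := Finset.mem_erase.1 ht'.mem
  exact ⟨t', ht', h.le t' this.2, this.1⟩

theorem IsFlag.eq_singleton {C : Finset K.Idx} {t : K.Idx} (h : K.IsFlag C t) (ht : K.M t = ⊥) :
    C = {t} :=
  Finset.eq_singleton_iff_unique_mem.2 ⟨h.mem, fun i hi => eq_of_subset_bot ht (h.le i hi)⟩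

/-- The functional on a face vanishing on a smaller face. -/
theorem exists_face_fn {t t' : K.Idx} (h : K.carrier t' ⊆ K.carrier t) (hne : t' ≠ t) :
    ∃ m ∈ K.M t, 0 < m (K.bary t) ∧ ∀ x ∈ K.carrier t', m x = 0 := by
  obtain ⟨-, m, hm, hpos, he⟩ := isFaceOf_of_subset h
  refine ⟨m, hm, (hpos _ (bary_mem t)).lt_of_ne fun h0 => hne ?_, fun x hx => ?_⟩
  · exact K.carrier_injective (h.antisymm (subset_of_bary_mem (by
      rw [he]; exact ⟨bary_mem t, h0.symm⟩)))
  · rw [he] at hx; exact hx.2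

/-- Functions vanishing on all but one of the barycenters of a flag. -/
theorem IsFlag.exists_dual {C : Finset K.Idx} {t : K.Idx} (h : K.IsFlag C t) {c : K.Idx}
    (hc : c ∈ C) (hc' : K.M c ≠ ⊥) :
    ∃ m ∈ K.M t, 0 < m (K.bary c) ∧ ∀ i ∈ C, i ≠ c → m (K.bary i) = 0 := by
  classical
  induction hn : C.card generalizing C t with
  | zero => rw [Finset.card_eq_zero.1 hn] at hc; simp at hc
  | succ n ih =>
    have ht : K.M t ≠ ⊥ := fun h0 => hc' (M_eq_bot_of_subset h0 (h.le c hc))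
    obtain ⟨t', ht', hsub, hne⟩ := h.erase ht
    obtain ⟨μ, hμ, hμt, hμ0⟩ := exists_face_fn hsub hne
    have hμi : ∀ i ∈ C, i ≠ t → μ (K.bary i) = 0 := fun i hi hit =>
      hμ0 _ (ht'.le i (Finset.mem_erase.2 ⟨hit, hi⟩) (bary_mem i))
    by_cases hct : c = t
    · subst hct
      exact ⟨μ, hμ, hμt, hμi⟩
    · obtain ⟨m', hm', hm'c, hm'0⟩ := ih ht' (Finset.mem_erase.2 ⟨hct, hc⟩)
        (by rw [Finset.card_erase_of_mem h.mem, hn]; rfl)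
      rw [(isFaceOf_of_subset hsub).1] at hm'
      obtain ⟨m, hm, rfl⟩ := hm'
      have hr : ∀ i ∈ C, i ≠ t → restr (K.carrier t') m (K.bary i) = m (K.bary i) :=
        fun i hi hit => restr_of_mem (ht'.le i (Finset.mem_erase.2 ⟨hit, hi⟩) (bary_mem i)) m
      obtain ⟨p, hp⟩ := bary_integral subset_rfl μ hμ (i := t)
      obtain ⟨q, hq⟩ := bary_integral subset_rfl m hm (i := t)
      have hval : ∀ x, (p • m - q • μ) x = p * m x - q * μ x := fun x => by simp
      -- The dual function on the smaller flag is extended to `t` and corrected by a multiple of `μ`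
      -- to vanish at the barycenter of `t`. Multiplying by the integer `p`, the value of `μ` there,
      -- keeps the result integral.
      refine ⟨p • m - q • μ, sub_mem (zsmul_mem hm p) (zsmul_mem hμ q), ?_, fun i hi hic => ?_⟩
      · rw [hval, hμi c hc hct, mul_zero, sub_zero]
        rw [hr c hc hct] at hm'c
        rw [hp] at hμt
        exact mul_pos hμt hm'c
      · rw [hval]
        by_cases hit : i = t
        · rw [hit, hp, hq]; ring
        · have := hm'0 i (Finset.mem_erase.2 ⟨hit, hi⟩) hic
          rw [hr i hi hit] at this
          rw [this, hμi i hi hit]; ring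

theorem IsComb.apply_subset {C : Finset K.Idx} {t t' : K.Idx} {a : K.Idx → ℝ} {x : X}
    (h : K.IsComb C t' a x) (hC : ∀ i ∈ C, K.carrier i ⊆ K.carrier t')
    (ht : K.carrier t' ⊆ K.carrier t) : K.IsComb C t a x := by
  refine ⟨ht h.1, fun m hm => ?_⟩
  have := h.2 _ (restr_mem ht hm)
  rw [restr_of_mem h.1] at this
  rw [this]
  exact Finset.sum_congr rfl fun i hi => by rw [restr_of_mem (hC i hi (bary_mem i))]

/-- Restricting the combination to the smaller cone which contains its support. -/
theorem IsComb.restrict {C : Finset K.Idx} {t t' : K.Idx} {a : K.Idx → ℝ} {x : X}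
    (h : K.IsComb C t a x) (ha : ∀ i ∈ C, 0 ≤ a i) (hC : ∀ i ∈ C, K.carrier i ⊆ K.carrier t')
    (ht : K.carrier t' ⊆ K.carrier t) : K.IsComb C t' a x := by
  obtain ⟨z, hz, hzm⟩ := (K.isCone t').exists_sum C K.bary a (fun i hi => hC i hi (bary_mem i))
    ha
  have hz' : K.IsComb C t a z := IsComb.apply_subset ⟨hz, hzm⟩ hC ht
  have : z = x := (K.isCone t).separates z hz'.1 x h.1 fun m hm => by rw [hz'.2 m hm, h.2 m hm]
  exact this ▸ ⟨hz, hzm⟩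

/-- A non-negative function vanishing at `x` vanishes at every barycenter with positive coefficient,
in particular at that of `t`, which is an inner point. -/
theorem IsFlag.isInner {C : Finset K.Idx} {t : K.Idx} (h : K.IsFlag C t) {a : K.Idx → ℝ} {x : X}
    (ha : ∀ i ∈ C, 0 ≤ a i) (ht : 0 < a t) (hx : K.IsComb C t a x) :
    IsInner (K.carrier t) (K.M t) x := by
  refine ⟨hx.1, fun m hm hpos h0 => (bary_inner t).2 m hm hpos ?_⟩
  rw [hx.2 m hm, Finset.sum_eq_zero_iff_of_nonneg fun i hi =>
    mul_nonneg (ha i hi) (hpos _ (h.le i hi (bary_mem i)))] at h0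
  exact (mul_eq_zero.1 (h0 t h.mem)).resolve_left ht.ne'

/-- Both top cones are the minimal cone of `x`, hence equal. Subtracting the smaller of the two top
coefficients from both combinations gives a point represented by smaller flags, to which induction
on the total number of cones applies. -/
theorem IsFlag.unique {C C' : Finset K.Idx} {t t' : K.Idx} {a a' : K.Idx → ℝ} {x : X}
    (h : K.IsFlag C t) (h' : K.IsFlag C' t') (ha : ∀ i ∈ C, 0 < a i) (ha' : ∀ i ∈ C', 0 < a' i)
    (hx : K.IsComb C t a x) (hx' : K.IsComb C' t' a' x) :
    C = C' ∧ ∀ c ∈ C, K.M c ≠ ⊥ → a c = a' c := by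
  classical
  have main : ∀ n, ∀ (C C' : Finset K.Idx) (t t' : K.Idx) (a a' : K.Idx → ℝ) (x : X),
      C.card + C'.card = n → K.IsFlag C t → K.IsFlag C' t' → (∀ i ∈ C, 0 < a i) →
      (∀ i ∈ C', 0 < a' i) → K.IsComb C t a x → K.IsComb C' t' a' x →
      C = C' ∧ ∀ c ∈ C, K.M c ≠ ⊥ → a c = a' c := by
    intro n
    induction n using Nat.strong_induction_on with
    | _ n ih =>
      intro C C' t t' a a' x hn h h' ha ha' hx hx'
      have hi := h.isInner (fun i hi => (ha i hi).le) (ha t h.mem) hx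
      have hi' := h'.isInner (fun i hi => (ha' i hi).le) (ha' t' h'.mem) hx'
      have htt : t = t' := (minCone_eq_of_isInner hi).symm.trans (minCone_eq_of_isInner hi')
      subst htt
      by_cases ht : K.M t = ⊥
      · rw [h.eq_singleton ht, h'.eq_singleton ht]
        refine ⟨rfl, fun c hc hc' => absurd ?_ hc'⟩
        rw [Finset.mem_singleton.1 hc, ht]
      have step : ∀ (C C' : Finset K.Idx) (a a' : K.Idx → ℝ), C.card + C'.card = n →
          K.IsFlag C t → K.IsFlag C' t → (∀ i ∈ C, 0 < a i) → (∀ i ∈ C', 0 < a' i) →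
          K.IsComb C t a x → K.IsComb C' t a' x → a t ≤ a' t →
          C = C' ∧ ∀ c ∈ C, K.M c ≠ ⊥ → a c = a' c := by
        clear! C C' a a'
        intro C C' a a' hn h h' ha ha' hx hx' hle
        obtain ⟨t₀, ht₀, hsub, -⟩ := h.erase ht
        obtain ⟨t₀', ht₀', hsub', -⟩ := h'.erase ht
        have hcard := Finset.card_erase_lt_of_mem h.mem
        have hcard' := Finset.card_erase_lt_of_mem h'.mem
        obtain ⟨z, hz, hzm⟩ := (K.isCone t₀).exists_sum (C.erase t) K.bary a
          (fun i hi => ht₀.le i hi (bary_mem i)) fun i hi => (ha i (Finset.mem_of_mem_erase hi)).le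
        have hz1 : K.IsComb (C.erase t) t₀ a z := ⟨hz, hzm⟩
        have hz2 := hz1.apply_subset ht₀.le hsub
        have hz3 : ∀ m ∈ K.M t, m z = ∑ i ∈ C'.erase t, a' i * m (K.bary i) +
            (a' t - a t) * m (K.bary t) := fun m hm => by
          have e1 := hx.2 m hm
          have e2 := hx'.2 m hm
          rw [← Finset.sum_erase_add _ _ h.mem, ← hz2.2 m hm] at e1
          rw [← Finset.sum_erase_add _ _ h'.mem] at e2
          linarith
        rcases hle.eq_or_lt with he | hlt
        · have hz4 : K.IsComb (C'.erase t) t a' z := ⟨hz2.1, fun m hm => by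
            rw [hz3 m hm, he]; ring⟩
          have hz5 : K.IsComb (C'.erase t) t₀' a' z := hz4.restrict
            (fun i hi => (ha' i (Finset.mem_of_mem_erase hi)).le) ht₀'.le hsub'
          obtain ⟨h1, h2⟩ := ih _ (by omega) (C.erase t) (C'.erase t) t₀ t₀' a a' z rfl ht₀ ht₀'
            (fun i hi => ha i (Finset.mem_of_mem_erase hi))
            (fun i hi => ha' i (Finset.mem_of_mem_erase hi)) hz1 hz5
          refine ⟨?_, fun c hc hc' => ?_⟩
          · rw [← Finset.insert_erase h.mem, h1, Finset.insert_erase h'.mem]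
          · by_cases hct : c = t
            · rw [hct, he]
            · exact h2 c (Finset.mem_erase.2 ⟨hct, hc⟩) hc'
        -- If the top coefficients differ, only one of the two flags loses its top cone `t`,
        -- although by induction the remaining flags agree.
        · exfalso
          have hz4 : K.IsComb C' t (Function.update a' t (a' t - a t)) z := ⟨hz2.1, fun m hm => by
            rw [hz3 m hm, ← Finset.sum_erase_add _ _ h'.mem, Function.update_self]
            congr 1
            exact Finset.sum_congr rfl fun i hi => by
              rw [Function.update_of_ne (Finset.ne_of_mem_erase hi)]⟩
          obtain ⟨h1, -⟩ := ih _ (by omega) (C.erase t) C' t₀ t a (Function.update a' t (a' t - a t)) z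
            rfl ht₀ h' (fun i hi => ha i (Finset.mem_of_mem_erase hi)) (fun i hi => by
              by_cases hit : i = t
              · rw [hit, Function.update_self]; linarith
              · rw [Function.update_of_ne hit]; exact ha' i hi) hz1 hz4
          have := h'.mem
          rw [← h1] at this
          exact Finset.notMem_erase t C this
      rcases le_total (a t) (a' t) with hle | hle
      · exact step C C' a a' hn h h' ha ha' hx hx' hle
      · obtain ⟨h1, h2⟩ := step C' C a' a (by omega) h' h ha' ha hx' hx hle
        exact ⟨h1.symm, fun c hc hc' => (h2 c (h1 ▸ hc) hc').symm⟩
  exact main _ C C' t t' a a' x rfl h h' ha ha' hx hx'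

/-- Project `x` from the barycenter of its minimal cone `t` to the boundary: subtracting the largest
possible multiple of the barycenter leads to a point of a proper face, which has a flag by induction
on the number of faces. Adding `t` to this flag gives one for `x`. -/
theorem exists_flag (x : X) : ∃ (C : Finset K.Idx) (a : K.Idx → ℝ), K.IsFlag C (K.minCone x) ∧
    (∀ i ∈ C, 0 < a i) ∧ K.IsComb C (K.minCone x) a x := by
  classical
  induction hn : Set.ncard {j | K.carrier j ⊆ K.carrier (K.minCone x)} using
    Nat.strong_induction_on generalizing x with
  | _ n ih =>
    set t := K.minCone x with ht
    have hcone := K.isCone t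
    have hx := isInner_minCone (K := K) x
    rw [← ht] at hx
    by_cases hbot : K.M t = ⊥
    · refine ⟨{t}, fun _ => 1, ⟨by simp, by simp, by simp, t, by simp, hbot⟩, by simp,
        K.mem_minCone x, fun m hm => ?_⟩
      rw [hbot, AddSubgroup.mem_bot] at hm
      simp [hm]
    obtain ⟨B, hB, hB'⟩ := hcone.exists_ineq
    have hpos : ∀ b ∈ B, 0 ≤ b.1 (K.bary t) := fun b hb => hB b hb _ (bary_mem t)
    have hzero : ∀ b ∈ B, b.1 (K.bary t) = 0 → ∀ y ∈ K.carrier t, b.1 y = 0 := fun b hb h0 =>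
      (bary_inner t).2 b.1 b.2 (hB b hb) h0
    -- Otherwise all inequalities vanish on the cone, so it contains the negatives of its points.
    -- Since it is strongly convex, it would then be a vertex.
    have hne : (B.filter fun b => 0 < b.1 (K.bary t)).Nonempty := by
      by_contra hemp
      rw [Finset.not_nonempty_iff_eq_empty, Finset.filter_eq_empty_iff] at hemp
      refine hbot ((AddSubgroup.eq_bot_iff_forall _).2 fun m hm => funext fun y => ?_)
      by_cases hy : y ∈ K.carrier t
      · obtain ⟨z, hz, hzm⟩ := hB' (-evalAt _ y) fun b hb => by
          have : b.1 y = 0 := hzero b hb (le_antisymm (not_lt.1 (hemp hb)) (hpos b hb)) y hy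
          rw [AddMonoidHom.neg_apply, evalAt_apply, this, neg_zero]
        refine hcone.salient y hy z hz (fun m hm => ?_) m hm
        have : m z = -m y := hzm ⟨m, hm⟩
        rw [this, add_neg_cancel]
      · exact hcone.supp m hm y hy
    -- `β` is the inequality that becomes tight first, and the minimal ratio `s` is the coefficient
    -- of the barycenter.
    obtain ⟨β, hβ, hmin⟩ := Finset.exists_min_image _ (fun b => b.1 x / b.1 (K.bary t)) hne
    obtain ⟨hβB, hβ0⟩ := Finset.mem_filter.1 hβ
    set s := β.1 x / β.1 (K.bary t) with hs
    have hs0 : 0 < s := by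
      refine div_pos ((hB β hβB x hx.1).lt_of_ne fun h0 => ?_) hβ0
      exact hβ0.ne' (hx.2 β.1 β.2 (hB β hβB) h0.symm _ (bary_mem t))
    obtain ⟨z, hz, hzm⟩ := hB' (evalAt _ x - s • evalAt _ (K.bary t)) fun b hb => by
      rw [AddMonoidHom.sub_apply, AddMonoidHom.smul_apply, evalAt_apply, evalAt_apply, smul_eq_mul]
      rcases (hpos b hb).eq_or_lt with h0 | h0
      · rw [← h0, mul_zero, sub_zero]; exact hB b hb x hx.1
      · have := hmin b (Finset.mem_filter.2 ⟨hb, h0⟩)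
        rw [le_div_iff₀ h0] at this
        linarith
    have hzm' : ∀ m ∈ K.M t, m z = m x - s * m (K.bary t) := fun m hm => hzm ⟨m, hm⟩
    obtain ⟨j, hj, -⟩ := K.exists_face t _ _ ⟨rfl, β.1, β.2, hB β hβB, rfl⟩
    have hzj : z ∈ K.carrier j := by
      rw [hj]
      refine ⟨hz, ?_⟩
      rw [hzm' β.1 β.2, hs, div_mul_cancel₀ _ hβ0.ne', sub_self]
    have hjt : K.carrier j ⊆ K.carrier t := by rw [hj]; exact fun y hy => hy.1
    have hbj : K.bary t ∉ K.carrier j := by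
      rw [hj]; exact fun h => hβ0.ne' h.2
    have hzt : K.carrier (K.minCone z) ⊆ K.carrier t := (minCone_subset hzj).trans hjt
    have hlt : Set.ncard {j | K.carrier j ⊆ K.carrier (K.minCone z)} < n := by
      rw [← hn]
      refine Set.ncard_lt_ncard ⟨fun l hl => hl.trans hzt, fun h => hbj ?_⟩ (Set.toFinite _)
      exact minCone_subset hzj (h (subset_refl (K.carrier t)) (bary_mem t))
    obtain ⟨C, a, hC, ha, hcomb⟩ := ih _ hlt z rfl
    have htC : t ∉ C := fun h => hbj (minCone_subset hzj (hC.le t h (bary_mem t)))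
    refine ⟨insert t C, Function.update a t s, ⟨Finset.mem_insert_self _ _, ?_, ?_, ?_⟩, ?_,
      hx.1, fun m hm => ?_⟩
    · intro i hi
      rcases Finset.mem_insert.1 hi with rfl | hi
      · exact subset_rfl
      · exact (hC.le i hi).trans hzt
    · intro i hi l hl
      rcases Finset.mem_insert.1 hi with rfl | hi
      · rcases Finset.mem_insert.1 hl with rfl | hl
        · exact Or.inl subset_rfl
        · exact Or.inr ((hC.le l hl).trans hzt)
      · rcases Finset.mem_insert.1 hl with rfl | hl
        · exact Or.inl ((hC.le i hi).trans hzt)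
        · exact hC.chain i hi l hl
    · obtain ⟨v, hv, hv'⟩ := hC.vertex
      exact ⟨v, Finset.mem_insert_of_mem hv, hv'⟩
    · intro i hi
      rcases Finset.mem_insert.1 hi with rfl | hi
      · rw [Function.update_self]; exact hs0
      · rw [Function.update_of_ne (fun h : i = t => htC (h ▸ hi))]; exact ha i hi
    · rw [Finset.sum_insert htC, Function.update_self]
      have e1 := (hcomb.apply_subset hC.le hzt).2 m hm
      have e2 := hzm' m hm
      have e3 : ∑ i ∈ C, Function.update a t s i * m (K.bary i) = ∑ i ∈ C, a i * m (K.bary i) :=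
        Finset.sum_congr rfl fun i hi => by rw [Function.update_of_ne (fun h : i = t => htC (h ▸ hi))]
      rw [e3, ← e1, e2]; ring

variable (K)

/-- The flag of cones whose barycentric cell contains `x` in its interior. -/
def flag (x : X) : Finset K.Idx := (exists_flag (K := K) x).choose

/-- The barycentric coordinates of `x` on its flag. -/
def coord (x : X) : K.Idx → ℝ := (exists_flag (K := K) x).choose_spec.choose

variable {K}

theorem flag_isFlag (x : X) : K.IsFlag (K.flag x) (K.minCone x) :=
  (exists_flag (K := K) x).choose_spec.choose_spec.1

theorem coord_pos (x : X) : ∀ i ∈ K.flag x, 0 < K.coord x i :=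
  (exists_flag (K := K) x).choose_spec.choose_spec.2.1

theorem coord_isComb (x : X) : K.IsComb (K.flag x) (K.minCone x) (K.coord x) x :=
  (exists_flag (K := K) x).choose_spec.choose_spec.2.2

variable (K)

/-- The cell around `x` of the barycentric subdivision. -/
def baryCell (x : X) : Set X :=
  {y | ∃ a : K.Idx → ℝ, (∀ i, 0 ≤ a i) ∧ K.IsComb (K.flag x) (K.minCone x) a y}

variable {K}

theorem baryCell_subset (x : X) : K.baryCell x ⊆ K.carrier (K.minCone x) := fun _ ⟨_, _, h⟩ => h.1

theorem mem_baryCell (x : X) : x ∈ K.baryCell x := by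
  classical
  refine ⟨fun i => if i ∈ K.flag x then K.coord x i else 0, fun i => ?_, (coord_isComb x).1,
    fun m hm => ?_⟩
  · dsimp only
    split_ifs with h
    · exact (coord_pos x i h).le
    · exact le_rfl
  · rw [(coord_isComb x).2 m hm]
    exact Finset.sum_congr rfl fun i hi => by simp [hi]

theorem bary_mem_baryCell {x : X} {i : K.Idx} (hi : i ∈ K.flag x) : K.bary i ∈ K.baryCell x := by
  classical
  refine ⟨fun j => if j = i then 1 else 0, fun j => by dsimp only; split_ifs <;> simp,
    (flag_isFlag x).le i hi (bary_mem i), fun m hm => ?_⟩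
  simp [hi]

open Classical in
-- By uniqueness of the representation, the point `y` keeps precisely the cones with positive
-- coefficient. Vertices are kept whatever their coefficient, as a flag must contain one.
theorem flag_of_isComb {x y : X} {a : K.Idx → ℝ} (ha : ∀ i, 0 ≤ a i)
    (h : K.IsComb (K.flag x) (K.minCone x) a y) :
    K.flag y = (K.flag x).filter (fun i => 0 < a i ∨ K.M i = ⊥) ∧
      ∀ c ∈ K.flag y, K.M c ≠ ⊥ → K.coord y c = a c := by
  obtain ⟨v, hv, hv'⟩ := (flag_isFlag x).vertex
  obtain ⟨t', ht'⟩ := (flag_isFlag x).of_subset (Finset.filter_subset (fun i => 0 < a i ∨ K.M i = ⊥) _)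
    ⟨v, Finset.mem_filter.2 ⟨hv, Or.inr hv'⟩, hv'⟩
  have htx := (flag_isFlag x).le t' (Finset.mem_filter.1 ht'.mem).1
  -- The coefficients of vertices are replaced by `1` to make all of them positive; this does not
  -- change the combination.
  have h1 : K.IsComb ((K.flag x).filter fun i => 0 < a i ∨ K.M i = ⊥) (K.minCone x)
      (fun i => if K.M i = ⊥ then 1 else a i) y := by
    refine ⟨h.1, fun m hm => ?_⟩
    rw [h.2 m hm, Finset.sum_filter]
    refine Finset.sum_congr rfl fun i hi => ?_
    by_cases hb : K.M i = ⊥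
    · simp [hb, apply_bary_of_bot hb ((flag_isFlag x).le i hi) hm]
    · by_cases h0 : 0 < a i
      · simp [hb, h0]
      · have : a i = 0 := le_antisymm (not_lt.1 h0) (ha i)
        simp [hb, this]
  have hpos : ∀ i ∈ (K.flag x).filter fun i => 0 < a i ∨ K.M i = ⊥,
      0 < if K.M i = ⊥ then 1 else a i := by
    intro i hi
    split_ifs with hb
    · exact one_pos
    · exact (Finset.mem_filter.1 hi).2.resolve_right hb
  have h2 := h1.restrict (fun i hi => (hpos i hi).le) ht'.le htx
  obtain ⟨h3, h4⟩ := (flag_isFlag y).unique ht' (coord_pos y) hpos (coord_isComb y) h2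
  refine ⟨h3, fun c hc hc' => ?_⟩
  have := h4 c hc hc'
  rwa [if_neg hc'] at this

theorem flag_subset {x y : X} (hy : y ∈ K.baryCell x) : K.flag y ⊆ K.flag x := by
  classical
  obtain ⟨a, ha, h⟩ := hy
  rw [(flag_of_isComb ha h).1]
  exact Finset.filter_subset _ _

theorem baryCell_mono {x y : X} (hy : y ∈ K.baryCell x) : K.baryCell y ⊆ K.baryCell x := by
  classical
  rintro z ⟨a, ha, hz⟩
  have hz' := hz.apply_subset (flag_isFlag y).le (minCone_subset (baryCell_subset x hy))
  refine ⟨fun i => if i ∈ K.flag y then a i else 0, fun i => ?_, hz'.1, fun m hm => ?_⟩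
  · dsimp only
    split_ifs
    · exact ha i
    · exact le_rfl
  · rw [hz'.2 m hm]
    have := flag_subset hy
    rw [← Finset.sum_subset this fun i _ hi => by simp [hi]]
    exact Finset.sum_congr rfl fun i hi => by simp [hi]

theorem baryCell_isCone (x : X) :
    IsIntegralCone (K.baryCell x) ((K.M (K.minCone x)).map (restr (K.baryCell x))) := by
  refine (K.isCone (K.minCone x)).of_gen_subset (baryCell_subset x) (ι := {i // i ∈ K.flag x})
    (fun i => K.bary i.1) (fun i => ⟨bary_mem_baryCell i.2,
      bary_integral ((flag_isFlag x).le i.1 i.2)⟩) ?_ ?_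
  · rintro y ⟨a, ha, hy⟩
    refine ⟨fun i => a i.1, fun i => ha i.1, fun m hm => ?_⟩
    rw [hy.2 m hm]
    exact (Finset.sum_coe_sort (K.flag x) fun i => a i * m (K.bary i)).symm
  · classical
    intro a ha
    let a' : K.Idx → ℝ := fun i => if h : i ∈ K.flag x then a ⟨i, h⟩ else 0
    have ha' : ∀ i, 0 ≤ a' i := fun i => by
      simp only [a']
      split_ifs with h
      · exact ha _
      · exact le_rfl
    obtain ⟨z, hz, hzm⟩ := (K.isCone (K.minCone x)).exists_sum (K.flag x) K.bary a'
      (fun i hi => (flag_isFlag x).le i hi (bary_mem i)) fun i _ => ha' i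
    refine ⟨z, ⟨a', ha', hz, hzm⟩, fun m hm => ?_⟩
    rw [hzm m hm, ← Finset.sum_coe_sort]
    exact Finset.sum_congr rfl fun i _ => by simp [a']

theorem baryCell_inner (x : X) :
    IsInner (K.baryCell x) ((K.M (K.minCone x)).map (restr (K.baryCell x))) x := by
  refine ⟨mem_baryCell x, ?_⟩
  rintro _ ⟨m, hm, rfl⟩ hpos h0 y ⟨a, ha, hy⟩
  rw [restr_of_mem (show y ∈ K.baryCell x from ⟨a, ha, hy⟩), hy.2 m hm]
  rw [restr_of_mem (mem_baryCell x), (coord_isComb x).2 m hm] at h0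
  have hp : ∀ i ∈ K.flag x, 0 ≤ m (K.bary i) := fun i hi => by
    have := hpos _ (bary_mem_baryCell hi)
    rwa [restr_of_mem (bary_mem_baryCell hi)] at this
  rw [Finset.sum_eq_zero_iff_of_nonneg fun i hi => mul_nonneg (coord_pos x i hi).le (hp i hi)] at h0
  exact Finset.sum_eq_zero fun i hi => by
    rw [(mul_eq_zero.1 (h0 i hi)).resolve_left (coord_pos x i hi).ne', mul_zero]

/-- The cone is simplicial: the sum of the dual functions of the barycenters that are missing in the
flag of `y` vanishes exactly on the face spanned by the others. -/
theorem baryCell_isFaceOf {x y : X} (hy : y ∈ K.baryCell x) :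
    IsFaceOf (K.baryCell y) ((K.M (K.minCone y)).map (restr (K.baryCell y)))
      (K.baryCell x) ((K.M (K.minCone x)).map (restr (K.baryCell x))) := by
  classical
  have hsub := baryCell_mono hy
  have hmin := minCone_subset (baryCell_subset x hy)
  refine ⟨by rw [(isFaceOf_of_subset hmin).1, map_restr_restr hsub,
    map_restr_restr (baryCell_subset y)], ?_⟩
  have hd : ∀ c, ∃ m ∈ K.M (K.minCone x), c ∈ K.flag x → K.M c ≠ ⊥ →
      0 < m (K.bary c) ∧ ∀ i ∈ K.flag x, i ≠ c → m (K.bary i) = 0 := by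
    intro c
    by_cases h : c ∈ K.flag x ∧ K.M c ≠ ⊥
    · obtain ⟨m, hm, h'⟩ := (flag_isFlag x).exists_dual h.1 h.2
      exact ⟨m, hm, fun _ _ => h'⟩
    · exact ⟨0, zero_mem _, fun h1 h2 => absurd ⟨h1, h2⟩ h⟩
  choose μ hμ hμ' using hd
  set D := (K.flag x).filter fun c => c ∉ K.flag y ∧ K.M c ≠ ⊥ with hD
  have hv : ∀ (a : K.Idx → ℝ) (z : X), K.IsComb (K.flag x) (K.minCone x) a z → ∀ c ∈ D,
      μ c z = a c * μ c (K.bary c) := by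
    intro a z hz c hc
    obtain ⟨hc, hcy, hc'⟩ := Finset.mem_filter.1 hc
    rw [hz.2 _ (hμ c), Finset.sum_eq_single c]
    · intro i hi hic
      rw [(hμ' c hc hc').2 i hi hic, mul_zero]
    · exact fun h => absurd hc h
  have hpos : ∀ z ∈ K.baryCell x, ∀ c ∈ D, 0 ≤ μ c z := by
    rintro z ⟨a, ha, hz⟩ c hc
    rw [hv a z hz c hc]
    obtain ⟨hc, hcy, hc'⟩ := Finset.mem_filter.1 hc
    exact mul_nonneg (ha c) (hμ' c hc hc').1.le
  refine ⟨_, AddSubgroup.mem_map_of_mem _ (sum_mem fun c _ => hμ c : ∑ c ∈ D, μ c ∈ _), ?_, ?_⟩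
  · intro z hz
    rw [restr_of_mem hz, Finset.sum_apply]
    exact Finset.sum_nonneg (hpos z hz)
  · ext z
    constructor
    · intro hz
      refine ⟨hsub hz, ?_⟩
      rw [restr_of_mem (hsub hz), Finset.sum_apply]
      refine Finset.sum_eq_zero fun c hc => ?_
      obtain ⟨a, ha, hz⟩ := hz
      have hz' := hz.apply_subset (flag_isFlag y).le hmin
      rw [hz'.2 _ (hμ c)]
      refine Finset.sum_eq_zero fun i hi => ?_
      obtain ⟨hc, hcy, hc'⟩ := Finset.mem_filter.1 hc
      rw [(hμ' c hc hc').2 i (flag_subset hy hi) fun h => hcy (h ▸ hi), mul_zero]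
    · rintro ⟨hz, h0⟩
      rw [restr_of_mem hz, Finset.sum_apply, Finset.sum_eq_zero_iff_of_nonneg (hpos z hz)] at h0
      obtain ⟨a, ha, hz⟩ := hz
      have hz' : K.IsComb (K.flag y) (K.minCone x) a z := by
        refine ⟨hz.1, fun m hm => ?_⟩
        rw [hz.2 m hm]
        refine (Finset.sum_subset (flag_subset hy) fun c hc hcy => ?_).symm
        by_cases hc' : K.M c = ⊥
        · rw [apply_bary_of_bot hc' ((flag_isFlag x).le c hc) hm, mul_zero]
        · have hcD : c ∈ D := Finset.mem_filter.2 ⟨hc, hcy, hc'⟩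
          have := h0 c hcD
          rw [hv a z hz c hcD] at this
          rw [(mul_eq_zero.1 this).resolve_right (hμ' c hc hc').1.ne', zero_mul]
      exact ⟨a, ha, hz'.restrict (fun i _ => ha i) (flag_isFlag y).le hmin⟩

variable (K)

/-- The barycentric subdivision. -/
def barycentric : CellSystem X where
  cell := K.baryCell
  F x := (K.M (K.minCone x)).map (restr (K.baryCell x))
  finite := by
    have : (Set.range fun p : Finset K.Idx × K.Idx =>
      {y | ∃ a : K.Idx → ℝ, (∀ i, 0 ≤ a i) ∧ K.IsComb p.1 p.2 a y}).Finite := Set.finite_range _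
    refine this.subset ?_
    rintro _ ⟨x, rfl⟩
    exact ⟨(K.flag x, K.minCone x), rfl⟩
  isCone := baryCell_isCone
  inner := baryCell_inner
  face _ _ := baryCell_isFaceOf

theorem barycentric_isProperSubdivision : K.IsProperSubdivision K.barycentric.complex := by
  intro i
  obtain ⟨x, hx, hx'⟩ := K.barycentric.exists_eq_cell i
  rw [hx, hx']
  exact ⟨K.minCone x, baryCell_subset x, rfl⟩

open Classical in
/-- A barycentric coordinate as a function on all points. -/
def coordFn (c : K.Idx) (x : X) : ℝ := if c ∈ K.flag x then K.coord x c else 0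

variable {K}

/-- On a cell, the coordinate of `c` is a rational multiple of a function that is dual to the
barycenter of `c`, or it is zero. A product of denominators over the finitely many cells makes it
integral everywhere. -/
theorem exists_nsmul_coordFn_mem (c : K.Idx) (hc : K.M c ≠ ⊥) : ∃ n : ℕ, 0 < n ∧
    K.barycentric.complex.IsDivisor (n • K.coordFn c) := by
  classical
  have key : ∀ i : K.barycentric.complex.Idx, ∃ n : ℕ, 0 < n ∧
      n • restr (K.barycentric.complex.carrier i) (K.coordFn c) ∈ K.barycentric.complex.M i := by
    intro i
    obtain ⟨x, hx, hx'⟩ := K.barycentric.exists_eq_cell i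
    rw [hx, hx']
    change ∃ n : ℕ, 0 < n ∧ n • restr (K.baryCell x) (K.coordFn c) ∈
      (K.M (K.minCone x)).map (restr (K.baryCell x))
    by_cases hcx : c ∈ K.flag x
    · obtain ⟨m, hm, hmc, hm0⟩ := (flag_isFlag x).exists_dual hcx hc
      obtain ⟨n, hn⟩ := bary_integral ((flag_isFlag x).le c hcx) m hm
      rw [hn] at hmc
      have hn0 : 0 < n := by exact_mod_cast hmc
      refine ⟨n.toNat, by omega, m, hm, funext fun y => ?_⟩
      by_cases hy : y ∈ K.baryCell x
      · rw [Pi.smul_apply, restr_of_mem hy, restr_of_mem hy]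
        obtain ⟨a, ha, hy⟩ := hy
        rw [hy.2 m hm, Finset.sum_eq_single c (fun i hi hic => by rw [hm0 i hi hic, mul_zero])
          (fun h => absurd hcx h), hn, nsmul_eq_mul]
        have hnn : ((n.toNat : ℕ) : ℝ) = n := by
          have : ((n.toNat : ℕ) : ℤ) = n := Int.toNat_of_nonneg hn0.le
          exact_mod_cast this
        rw [hnn, coordFn]
        obtain ⟨h1, h2⟩ := flag_of_isComb ha hy
        split_ifs with hcy
        · rw [h2 c hcy hc]; ring
        · rw [h1, Finset.mem_filter] at hcy
          have : a c = 0 := le_antisymm (not_lt.1 fun h => hcy ⟨hcx, Or.inl h⟩) (ha c)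
          rw [this]; ring
      · rw [Pi.smul_apply, restr_of_notMem hy, restr_of_notMem hy, smul_zero]
    · refine ⟨1, one_pos, 0, zero_mem _, funext fun y => ?_⟩
      rw [map_zero, one_smul]
      by_cases hy : y ∈ K.baryCell x
      · rw [restr_of_mem hy, coordFn, if_neg fun h => hcx (flag_subset hy h)]
        rfl
      · rw [restr_of_notMem hy]; rfl
  choose n hn hmem using key
  have := Fintype.ofFinite K.barycentric.complex.Idx
  refine ⟨∏ i, n i, Finset.prod_pos fun i _ => hn i, fun i => ?_⟩
  rw [map_nsmul, ← Finset.prod_erase_mul _ _ (Finset.mem_univ i), mul_smul]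
  exact nsmul_mem (hmem i) _

/-- On the barycentric subdivision, functions on cones extend to divisors up to multiples. -/
theorem exists_divisor_extension (i : K.barycentric.complex.Idx) {m : X → ℝ}
    (hm : m ∈ K.barycentric.complex.M i) : ∃ n : ℕ, 0 < n ∧ ∃ ψ,
      K.barycentric.complex.IsDivisor ψ ∧ ∀ y ∈ K.barycentric.complex.carrier i, ψ y = n * m y := by
  classical
  obtain ⟨x, hx, hx'⟩ := K.barycentric.exists_eq_cell i
  change _ = K.baryCell x at hx
  change _ = (K.M (K.minCone x)).map (restr (K.baryCell x)) at hx'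
  rw [hx'] at hm
  obtain ⟨m, hm, rfl⟩ := hm
  have key : ∀ c : K.Idx, ∃ n : ℕ, 0 < n ∧
      (K.M c ≠ ⊥ → K.barycentric.complex.IsDivisor (n • K.coordFn c)) := fun c => by
    by_cases hc : K.M c = ⊥
    · exact ⟨1, one_pos, fun h => absurd hc h⟩
    · obtain ⟨n, hn, h⟩ := exists_nsmul_coordFn_mem c hc
      exact ⟨n, hn, fun _ => h⟩
  choose n hn hdiv using key
  have hz : ∀ c, ∃ z : ℤ, c ∈ K.flag x → m (K.bary c) = z := fun c => by
    by_cases hc : c ∈ K.flag x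
    · obtain ⟨z, hz⟩ := bary_integral ((flag_isFlag x).le c hc) m hm
      exact ⟨z, fun _ => hz⟩
    · exact ⟨0, fun h => absurd h hc⟩
  choose z hz using hz
  have := Fintype.ofFinite K.Idx
  -- On the cell, `m` is the sum of its values at the barycenters times the barycentric coordinates.
  -- The same formula makes sense on all cells, and the product of the `n c` clears denominators.
  refine ⟨∏ c, n c, Finset.prod_pos fun c _ => hn c, ∑ c ∈ K.flag x with K.M c ≠ ⊥,
    (z c * (∏ c' ∈ Finset.univ.erase c, n c' : ℕ)) • (n c • K.coordFn c), fun j => ?_, fun y hy => ?_⟩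
  · rw [map_sum]
    refine sum_mem fun c hc => ?_
    rw [map_zsmul]
    exact zsmul_mem (hdiv c (Finset.mem_filter.1 hc).2 j) _
  · rw [hx] at hy
    rw [restr_of_mem hy, Finset.sum_apply]
    obtain ⟨a, ha, hcomb⟩ := hy
    obtain ⟨h1, h2⟩ := flag_of_isComb ha hcomb
    rw [hcomb.2 m hm, Finset.mul_sum, Finset.sum_filter]
    refine Finset.sum_congr rfl fun c hc => ?_
    by_cases hb : K.M c = ⊥
    · rw [apply_bary_of_bot hb ((flag_isFlag x).le c hc) hm]; simp [hb]
    · rw [if_pos hb, hz c hc, ← Finset.prod_erase_mul _ _ (Finset.mem_univ c)]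
      have h3 : K.coordFn c y = a c := by
        rw [coordFn]
        split_ifs with hcy
        · exact h2 c hcy hb
        · rw [h1, Finset.mem_filter] at hcy
          exact (le_antisymm (not_lt.1 fun h => hcy ⟨hc, Or.inl h⟩) (ha c)).symm
      rw [Pi.smul_apply, Pi.smul_apply, h3, zsmul_eq_mul, nsmul_eq_mul]
      push_cast
      ring

/-- For any finite set of subcones there is a subdivision in which they are unions of cones. -/
theorem exists_adapted (K : ConeComplex X) {𝒮 : Set (Set X)} (hfin : 𝒮.Finite)
    (h𝒮 : ∀ S ∈ 𝒮, K.IsSubcone S) : ∃ K', K.IsProperSubdivision K' ∧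
      ∀ S ∈ 𝒮, ∀ x ∈ S, ∃ i, x ∈ K'.carrier i ∧ K'.carrier i ⊆ S := by
  classical
  set B := K.barycentric.complex with hB
  have hsub := K.barycentric_isProperSubdivision
  -- For points of the cone `β`, membership in `S` is decided by the signs of finitely many
  -- divisors: multiples of the inequalities of `S`, extended from `β` to the whole complex.
  have ext : ∀ S ∈ 𝒮, ∀ β : B.Idx, ∃ H : Finset (X → ℝ), (∀ h ∈ H, B.IsDivisor h) ∧
      ∀ x ∈ S, ∀ y, x ∈ B.carrier β → y ∈ B.carrier β → B.minCone x = β →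
        (∀ h ∈ H, 0 ≤ h x → 0 ≤ h y) → y ∈ S := by
    intro S hS β
    obtain ⟨i, hi, hcone⟩ := h𝒮 S hS
    obtain ⟨D, hD, hD'⟩ := (K.isCone i).exists_ineq_of_subset hi hcone
    by_cases hβ : B.carrier β ⊆ K.carrier i
    · have hmem : ∀ d : K.M i, restr (B.carrier β) d.1 ∈ B.M β := fun d => by
        rw [← hsub.fn_carrier β, (hsub.isSubcone β).fn_eq hβ]
        exact AddSubgroup.mem_map_of_mem _ d.2
      choose n hn ψ hψ hval using fun d => exists_divisor_extension β (hmem d)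
      refine ⟨D.image ψ, fun h hh => ?_, fun x hx y hxβ hyβ _ h => hD' y (hβ hyβ) fun d hd => ?_⟩
      · obtain ⟨d, -, rfl⟩ := Finset.mem_image.1 hh
        exact hψ d
      · have h1 := h _ (Finset.mem_image_of_mem ψ hd)
        rw [hval d x hxβ, hval d y hyβ, restr_of_mem hxβ, restr_of_mem hyβ] at h1
        have hn' : (0 : ℝ) < n d := by exact_mod_cast hn d
        exact nonneg_of_mul_nonneg_right (h1 (mul_nonneg hn'.le (hD d hd x hx))) hn'
    -- If `β` is not contained in the cone `i` around `S`, no point in the relative interior of `β`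
    -- lies in `S`, and no divisors are needed.
    · refine ⟨∅, by simp, fun x hx y _ _ hmin _ => absurd ?_ hβ⟩
      rw [← hmin]
      exact (hsub.minCone_subset x).trans (minCone_subset (hi hx))
  choose! H hH hH' using ext
  have := Fintype.ofFinite B.Idx
  obtain ⟨K', hK', hcell⟩ := exists_arrangement (K := B)
    (H := hfin.toFinset.biUnion fun S => Finset.univ.biUnion fun β => H S β) (by
      intro h hh
      simp only [Finset.mem_biUnion, Set.Finite.mem_toFinset, Finset.mem_univ, true_and] at hh
      obtain ⟨S, hS, β, hβ⟩ := hh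
      exact hH S hS β h hβ)
  refine ⟨K', hsub.trans hK', fun S hS x hx => ?_⟩
  obtain ⟨i, hxi, hi, hsgn⟩ := hcell x
  refine ⟨i, hxi, fun y hy => hH' S hS (B.minCone x) x hx y (B.mem_minCone x) (hi hy) rfl
    fun h hh => hsgn y hy h ?_⟩
  simp only [Finset.mem_biUnion, Set.Finite.mem_toFinset, Finset.mem_univ, true_and]
  exact ⟨S, hS, _, hh⟩

end Barycentric

end ConeComplex

namespace ConeComplex

variable {X : Type u} {Y : Type u'} {K : ConeComplex X} {L : ConeComplex Y}

/-! ### Dimensions of subcones and directions of approach -/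

section Subcones

variable {S T : Set X}

theorem IsSubcone.restr_mem (hS : K.IsSubcone S) (hT : K.IsSubcone T) (h : S ⊆ T) {m : X → ℝ}
    (hm : m ∈ K.fn T) : restr S m ∈ K.fn S :=
  hS.map_restr hT h ▸ AddSubgroup.mem_map_of_mem _ hm

theorem IsSubcone.exists_restr (hS : K.IsSubcone S) (hT : K.IsSubcone T) (h : S ⊆ T) {m : X → ℝ}
    (hm : m ∈ K.fn S) : ∃ m' ∈ K.fn T, restr S m' = m := by
  rw [← hS.map_restr hT h] at hm
  exact hm

/-- If no such function existed, restriction would be an isomorphism of the lattices of functions,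
and the dimensions would agree. -/
theorem exists_vanishing (hS : K.IsSubcone S) (hT : K.IsSubcone T) (h : S ⊆ T)
    (hd : K.dim S < K.dim T) : ∃ m ∈ K.fn T, m ≠ 0 ∧ ∀ x ∈ S, m x = 0 := by
  by_contra hc
  have hi := resHom_injective hS hT h fun m hm h0 => by
    by_contra hne
    exact hc ⟨m, hm, hne, h0⟩
  exact hd.ne' (LinearEquiv.finrank_eq (LinearEquiv.ofBijective (resHom hS hT h).toIntLinearMap
    ⟨hi, resHom_surjective hS hT h⟩))

theorem dim_mono (hS : K.IsSubcone S) (hT : K.IsSubcone T) (h : S ⊆ T) : K.dim S ≤ K.dim T := by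
  have := finite_fn hT
  exact LinearMap.finrank_le_finrank_of_surjective (f := (resHom hS hT h).toIntLinearMap)
    (resHom_surjective hS hT h)

theorem dim_lt_of_vanishing (hS : K.IsSubcone S) (hT : K.IsSubcone T) (h : S ⊆ T) {m : X → ℝ}
    (hm : m ∈ K.fn T) (hne : m ≠ 0) (h0 : ∀ x ∈ S, m x = 0) : K.dim S < K.dim T :=
  (dim_mono hS hT h).lt_of_ne fun hd => hne (eq_zero_of_restr hS hT h hd hm h0)

theorem exists_ne_zero {M : AddSubgroup (X → ℝ)} (hS : IsIntegralCone S M) {m : X → ℝ} (hm : m ∈ M)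
    (hne : m ≠ 0) : ∃ x ∈ S, m x ≠ 0 := by
  by_contra hc
  push Not at hc
  refine hne (funext fun x => ?_)
  by_cases hx : x ∈ S
  · exact hc x hx
  · exact hS.supp m hm x hx

/-- The points `x + δ w` lie in `A` for arbitrarily small `δ > 0`. -/
def ApproachedIn (M : AddSubgroup (X → ℝ)) (A : Set X) (x w : X) : Prop :=
  ∃ᶠ δ in nhdsWithin (0 : ℝ) (Set.Ioi 0), ∃ z ∈ A, ∀ m ∈ M, m z = m x + δ * m w

/-- The points `x + δ w` all lie in `S`, and finitely many sets cover `S`; so one of them is met for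
arbitrarily small `δ`. -/
theorem exists_approachedIn {M : AddSubgroup (X → ℝ)} (hS : IsIntegralCone S M) {ι : Type*}
    [Finite ι] (A : ι → Set X) {x w : X} (hx : x ∈ S) (hw : w ∈ S) (hcov : ∀ z ∈ S, ∃ i, z ∈ A i) :
    ∃ i, ApproachedIn M (A i) x w := by
  by_contra hc
  push Not at hc
  simp only [ApproachedIn, Filter.not_frequently] at hc
  have h := Filter.eventually_all.2 hc
  obtain ⟨δ, h, hδ⟩ := (h.and self_mem_nhdsWithin).exists
  obtain ⟨z, hz, hzm⟩ := hS.exists_add_smul hx hw (le_of_lt hδ)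
  obtain ⟨i, hi⟩ := hcov z hz
  exact h i ⟨z, hi, hzm⟩

theorem ApproachedIn.exists {M : AddSubgroup (X → ℝ)} {A : Set X} {x w : X}
    (h : ApproachedIn M A x w) : ∃ δ : ℝ, 0 < δ ∧ ∃ z ∈ A, ∀ m ∈ M, m z = m x + δ * m w := by
  obtain ⟨δ, h, hδ⟩ := (Filter.Frequently.and_eventually h self_mem_nhdsWithin).exists
  exact ⟨δ, hδ, h⟩

/-- A subcone is given by weak inequalities, which persist in the limit `δ → 0`. -/
theorem ApproachedIn.mem (hS : K.IsSubcone S) (hT : K.IsSubcone T) (h : S ⊆ T) {x w : X}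
    (hx : x ∈ T) (ha : ApproachedIn (K.fn T) S x w) : x ∈ S := by
  obtain ⟨B, hB, hB'⟩ := hT.isCone.exists_ineq_of_subset h (by
    rw [hS.map_restr hT h]; exact hS.isCone)
  refine hB' x hx fun b hb => ?_
  by_contra hneg
  have hc : Filter.Tendsto (fun δ => b.1 x + δ * b.1 w) (nhdsWithin (0 : ℝ) (Set.Ioi 0))
      (nhds (b.1 x + 0 * b.1 w)) := Filter.Tendsto.mono_left
    (Continuous.tendsto (by fun_prop) 0) nhdsWithin_le_nhds
  rw [zero_mul, add_zero] at hc
  obtain ⟨δ, ⟨z, hz, hzm⟩, hδ⟩ := (Filter.Frequently.and_eventually ha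
    (hc.eventually_lt_const (not_le.1 hneg))).exists
  rw [← hzm b.1 b.2] at hδ
  exact absurd (hB b hb z hz) (not_le.2 hδ)

end Subcones

/-! ### Decomposition of a subcone into the cones of a subdivision -/

section Adapted

variable {K' : ConeComplex X} (h : K.IsProperSubdivision K') {S : Set X}

instance (k : ℕ) : Finite (K.ConesOfDim k) := inferInstanceAs (Finite {_i : K.Idx // _})

instance (k : ℕ) (τ : K.Idx) : Finite (K.ConesOver k τ) :=
  inferInstanceAs (Finite {_σ : K.ConesOfDim k // _})

instance (k : ℕ) : Fintype (K.ConesOfDim k) := Fintype.ofFinite _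

instance (k : ℕ) (τ : K.Idx) : Fintype (K.ConesOver k τ) := Fintype.ofFinite _

/-- The set `S` is a union of cones of the complex. -/
def IsUnion (K' : ConeComplex X) (S : Set X) : Prop :=
  ∀ x ∈ S, ∃ i, x ∈ K'.carrier i ∧ K'.carrier i ⊆ S

include h in
theorem IsProperSubdivision.dim_eq (i : K'.Idx) : K'.dim (K'.carrier i) = K.dim (K'.carrier i) := by
  rw [dim, dim, h.fn_carrier, ConeComplex.fn_carrier]

include h in
-- Some cone of the subdivision inside `S` contains `y + δ z` for arbitrarily small `δ`. Being
-- closed it contains `y`, an inner point of `κ`, and therefore all of `κ`.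
theorem exists_over (hS : K.IsSubcone S) (hU : K'.IsUnion S) {κ : K'.Idx} (hκ : K'.carrier κ ⊆ S)
    {y : X} (hy : IsInner (K'.carrier κ) (K'.M κ) y) {z : X} (hz : z ∈ S) :
    ∃ i, K'.carrier κ ⊆ K'.carrier i ∧ K'.carrier i ⊆ S ∧
      ApproachedIn (K.fn S) (K'.carrier i) y z := by
  obtain ⟨i, hi⟩ := exists_approachedIn hS.isCone
    (fun i : {i : K'.Idx // K'.carrier i ⊆ S} => K'.carrier i.1) (hκ hy.1) hz fun z hz => by
      obtain ⟨i, hi, hi'⟩ := hU z hz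
      exact ⟨⟨i, hi'⟩, hi⟩
  exact ⟨i.1, subset_of_isInner hy (hi.mem (h.isSubcone i.1) hS i.2 (hκ hy.1)), i.2, hi⟩

include h in
/-- Moving away from `κ` in a direction where `m` is non-zero leads to a larger cone. -/
theorem exists_over_lt (hS : K.IsSubcone S) (hU : K'.IsUnion S) {κ : K'.Idx}
    (hκ : K'.carrier κ ⊆ S) {m : X → ℝ} (hm : m ∈ K.fn S) (h0 : ∀ x ∈ K'.carrier κ, m x = 0) {z : X}
    (hz : z ∈ S) (hmz : m z ≠ 0) : ∃ i, K'.carrier κ ⊆ K'.carrier i ∧ K'.carrier i ⊆ S ∧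
      K'.dim (K'.carrier κ) < K'.dim (K'.carrier i) ∧
      ∃ x ∈ K'.carrier i, ∃ δ > 0, m x = δ * m z := by
  obtain ⟨y, hy, -⟩ := (K'.isCone κ).exists_inner
  obtain ⟨i, hκi, hi, ha⟩ := exists_over h hS hU hκ hy hz
  obtain ⟨δ, hδ, x, hx, hxm⟩ := ha.exists
  have hmx : m x = δ * m z := by rw [hxm m hm, h0 y hy.1, zero_add]
  refine ⟨i, hκi, hi, ?_, x, hx, δ, hδ, hmx⟩
  rw [h.dim_eq, h.dim_eq]
  refine dim_lt_of_vanishing (h.isSubcone κ) (h.isSubcone i) hκi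
    ((h.isSubcone i).restr_mem hS hi hm) (fun he => ?_) fun x hx => ?_
  · have := congrFun he x
    rw [restr_of_mem hx, hmx] at this
    exact mul_ne_zero hδ.ne' hmz this
  · rw [restr_of_mem (hκi hx), h0 x hx]

include h in
-- Take a cone of maximal dimension over `κ` inside `S`. If it were not full-dimensional, a function
-- on `S` vanishing on it would provide a direction leading to a larger cone.
theorem exists_full (hS : K.IsSubcone S) (hU : K'.IsUnion S) {κ : K'.Idx} (hκ : K'.carrier κ ⊆ S) :
    ∃ i, K'.carrier κ ⊆ K'.carrier i ∧ K'.carrier i ⊆ S ∧ K'.dim (K'.carrier i) = K.dim S := by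
  obtain ⟨i, ⟨hi, hi'⟩, hmax⟩ := Set.exists_max_image
    {i | K'.carrier κ ⊆ K'.carrier i ∧ K'.carrier i ⊆ S} (fun i => K'.dim (K'.carrier i))
    (Set.toFinite _) ⟨κ, subset_rfl, hκ⟩
  refine ⟨i, hi, hi', ?_⟩
  by_contra hne
  have hlt : K.dim (K'.carrier i) < K.dim S :=
    (dim_mono (h.isSubcone i) hS hi').lt_of_ne fun h' => hne ((h.dim_eq i).trans h')
  obtain ⟨m, hm, hm0, hv⟩ := exists_vanishing (h.isSubcone i) hS hi' hlt
  obtain ⟨z, hz, hmz⟩ := exists_ne_zero hS.isCone hm hm0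
  obtain ⟨j, hij, hj, hd, -⟩ := exists_over_lt h hS hU hi' hm hv hz hmz
  exact absurd (hmax j ⟨hi.trans hij, hj⟩) (not_le.2 hd)

include h in
/-- Distinct full-dimensional cones are separated by a hyperplane. -/
theorem exists_separation (hS : K.IsSubcone S) {i j : K'.Idx} (hij : i ≠ j)
    (hi : K'.carrier i ⊆ S) (hj : K'.carrier j ⊆ S) : ∃ m ∈ K.fn S, m ≠ 0 ∧
      (∀ x ∈ K'.carrier i, 0 ≤ m x) ∧ ∀ x ∈ K'.carrier j, m x ≤ 0 := by
  have hMi : K'.M i = (K.fn S).map (restr (K'.carrier i)) := by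
    rw [(h.isSubcone i).map_restr hS hi, h.fn_carrier]
  have hMj : K'.M j = (K.fn S).map (restr (K'.carrier j)) := by
    rw [(h.isSubcone j).map_restr hS hj, h.fn_carrier]
  obtain ⟨ι, _, g, hg, h₁, h₂⟩ := (K'.isCone i).exists_gen
  obtain ⟨ι', _, g', hg', h₁', h₂'⟩ := (K'.isCone j).exists_gen
  have ri : ∀ m ∈ K.fn S, restr (K'.carrier i) m ∈ K'.M i := fun m hm =>
    hMi ▸ AddSubgroup.mem_map_of_mem _ hm
  have rj : ∀ m ∈ K.fn S, restr (K'.carrier j) m ∈ K'.M j := fun m hm =>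
    hMj ▸ AddSubgroup.mem_map_of_mem _ hm
  have := hS.isCone.fg
  -- These are the inequalities of the difference of the two cones, spanned by the generators of `i`
  -- and the negatives of those of `j`. Any nonzero one separates the two cones.
  obtain ⟨B, hB⟩ := exists_halfspaces (A := K.fn S) Finset.univ
    (Sum.elim (fun k => evalAt _ (g k)) fun k => -evalAt _ (g' k) : ι ⊕ ι' → _) (by
      rintro (k | k) m
      · obtain ⟨n, hn⟩ := (hg k).2 _ (ri m.1 m.2)
        rw [restr_of_mem (hg k).1] at hn
        exact ⟨n, hn⟩
      · obtain ⟨n, hn⟩ := (hg' k).2 _ (rj m.1 m.2)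
        rw [restr_of_mem (hg' k).1] at hn
        exact ⟨-n, by rw [Sum.elim_inr, AddMonoidHom.neg_apply, evalAt_apply, hn]; simp⟩)
  have hval : ∀ (c : ι ⊕ ι' → ℝ) (m : K.fn S), (∑ k, c k • (Sum.elim (fun k => evalAt _ (g k))
      fun k => -evalAt _ (g' k) : ι ⊕ ι' → K.fn S →+ ℝ) k) m =
      ∑ k, c (Sum.inl k) * m.1 (g k) - ∑ k, c (Sum.inr k) * m.1 (g' k) := by
    intro c m
    rw [Fintype.sum_sum_type, AddMonoidHom.add_apply, AddMonoidHom.finsetSum_apply,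
      AddMonoidHom.finsetSum_apply, sub_eq_add_neg, ← Finset.sum_neg_distrib]
    refine congrArg₂ _ rfl (Finset.sum_congr rfl fun k _ => ?_)
    rw [AddMonoidHom.smul_apply, Sum.elim_inr, AddMonoidHom.neg_apply, smul_eq_mul, evalAt_apply]
    ring
  by_cases hne : ∃ b ∈ B, b ≠ 0
  · obtain ⟨b, hb, hb0⟩ := hne
    refine ⟨b.1, b.2, fun h => hb0 (Subtype.ext h), fun x hx => ?_, fun x hx => ?_⟩
    · obtain ⟨a, ha, hxa⟩ := h₁ x hx
      have := (hB _).1 ⟨Sum.elim a 0, by rintro (k | k) <;> simp [ha], rfl⟩ b hb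
      rw [hval] at this
      have h3 := hxa _ (ri b.1 b.2)
      rw [restr_of_mem hx] at h3
      rw [h3]
      refine this.trans (le_of_eq ?_)
      simp only [Sum.elim_inl, Sum.elim_inr, Pi.zero_apply, zero_mul, Finset.sum_const_zero, sub_zero]
      exact Finset.sum_congr rfl fun k _ => by rw [restr_of_mem (hg k).1]
    · obtain ⟨a, ha, hxa⟩ := h₁' x hx
      have := (hB _).1 ⟨Sum.elim 0 a, by rintro (k | k) <;> simp [ha], rfl⟩ b hb
      rw [hval] at this
      have h3 := hxa _ (rj b.1 b.2)
      rw [restr_of_mem hx] at h3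
      have h4 : ∑ k, a k * b.1 (g' k) = ∑ k, a k * restr (K'.carrier j) b.1 (g' k) :=
        Finset.sum_congr rfl fun k _ => by rw [restr_of_mem (hg' k).1]
      simp only [Sum.elim_inl, Sum.elim_inr, Pi.zero_apply, zero_mul, Finset.sum_const_zero,
        zero_sub, h4, ← h3] at this
      linarith
  -- If all inequalities are zero, the differences fill the whole space. Writing `t' - t = p - p'`
  -- for inner points `t`, `t'` gives a point `t + p = t' + p'` in the interior of both cones, so
  -- they coincide.
  · push Not at hne
    exfalso
    obtain ⟨t, ht, -⟩ := (K'.isCone i).exists_inner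
    obtain ⟨t', ht', -⟩ := (K'.isCone j).exists_inner
    obtain ⟨c, hc, he⟩ := (hB (evalAt _ t' - evalAt _ t)).2 fun b hb => by
      rw [hne b hb, map_zero]
    obtain ⟨p, hp, hpm⟩ := h₂ (fun k => c (Sum.inl k)) fun k => hc _
    obtain ⟨p', hp', hpm'⟩ := h₂' (fun k => c (Sum.inr k)) fun k => hc _
    obtain ⟨z, hz, hzm⟩ := (K'.isCone i).exists_add ht.1 hp
    obtain ⟨z', hz', hzm'⟩ := (K'.isCone j).exists_add ht'.1 hp'
    have hzz : z = z' := by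
      refine hS.isCone.separates z (hi hz) z' (hj hz') fun m hm => ?_
      have e1 := hzm _ (ri m hm)
      have e2 := hzm' _ (rj m hm)
      have e3 := hpm _ (ri m hm)
      have e4 := hpm' _ (rj m hm)
      rw [restr_of_mem hz, restr_of_mem ht.1, e3,
        Finset.sum_congr rfl fun k _ => by rw [restr_of_mem (hg k).1]] at e1
      rw [restr_of_mem hz', restr_of_mem ht'.1, e4,
        Finset.sum_congr rfl fun k _ => by rw [restr_of_mem (hg' k).1]] at e2
      have e5 := DFunLike.congr_fun he (⟨m, hm⟩ : K.fn S)
      rw [hval, AddMonoidHom.sub_apply, evalAt_apply, evalAt_apply] at e5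
      dsimp only at e5
      rw [e1, e2]
      linarith
    have hin : ∀ (l : K'.Idx) (t p z : X), IsInner (K'.carrier l) (K'.M l) t → p ∈ K'.carrier l →
        z ∈ K'.carrier l → (∀ m ∈ K'.M l, m z = m t + m p) →
        IsInner (K'.carrier l) (K'.M l) z := by
      intro l t p z ht hp hz hzm
      refine ⟨hz, fun m hm hpos h0 => ht.2 m hm hpos ?_⟩
      rw [hzm m hm] at h0
      have := hpos t ht.1
      have := hpos p hp
      linarith
    have h5 := hin i t p z ht hp hz hzm
    have h6 := hin j t' p' z' ht' hp' hz' hzm'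
    rw [← hzz] at h6
    exact hij ((minCone_eq_of_isInner h5).symm.trans (minCone_eq_of_isInner h6))

theorem cls_of_dim {k : ℕ} (hS : K.IsSubcone S) (hd : K.dim S = k) :
    K.cls k S = QuotientAddGroup.mk' (K.subdivisionRel k) (FreeAbelianGroup.of ⟨S, hS, hd⟩) :=
  dif_pos ⟨hS, hd⟩

theorem cls_of_dim_ne {k : ℕ} (hd : K.dim S ≠ k) : K.cls k S = 0 := dif_neg fun h => hd h.2

theorem weight_hom_ext {A : Type*} [AddCommGroup A] {k : ℕ} {a b : K.Weight k →+ A}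
    (h : ∀ S, K.IsSubcone S → K.dim S = k → a (K.cls k S) = b (K.cls k S)) : a = b := by
  refine QuotientAddGroup.addMonoidHom_ext _ (FreeAbelianGroup.lift_ext _ _ fun σ => ?_)
  have := h σ.carrier σ.isSubcone σ.dim_eq
  rw [cls_of_dim σ.isSubcone σ.dim_eq] at this
  exact this

theorem cls_eq_sum_of_isSubdivision {k : ℕ} {σ : K.Subcone k} {T : Finset (K.Subcone k)}
    (hT : K.IsSubdivision σ T) : K.cls k σ.carrier = ∑ τ ∈ T, K.cls k τ.carrier := by
  have hrel := (QuotientAddGroup.eq_zero_iff (N := K.subdivisionRel k) _).2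
    (AddSubgroup.subset_closure ⟨_, _, hT, rfl⟩)
  have hrel' := sub_eq_zero.1 ((map_sub (QuotientAddGroup.mk' (K.subdivisionRel k)) _ _).symm.trans
    hrel)
  rw [map_sum] at hrel'
  rw [cls_of_dim σ.isSubcone σ.dim_eq]
  exact hrel'.trans (Finset.sum_congr rfl fun τ _ => (cls_of_dim τ.isSubcone τ.dim_eq).symm)

/-- Separated parts are distinct sets, since a function separating a full-dimensional part from
itself would vanish on it. So the indexed family defines a finite set of subcones without
collapsing. -/
theorem cls_eq_sum_of_separated {ι : Type*} (s : Finset ι) (A : ι → Set X) {k : ℕ}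
    (hS : K.IsSubcone S) (hd : K.dim S = k) (hA : ∀ i ∈ s, K.IsSubcone (A i))
    (hAd : ∀ i ∈ s, K.dim (A i) = k) (hcov : S = ⋃ i ∈ s, A i)
    (hsep : ∀ i ∈ s, ∀ j ∈ s, i ≠ j →
      ∃ m ∈ K.fn S, m ≠ 0 ∧ (∀ x ∈ A i, 0 ≤ m x) ∧ ∀ x ∈ A j, m x ≤ 0) :
    K.cls k S = ∑ i ∈ s, K.cls k (A i) := by
  classical
  have hsub : ∀ i ∈ s, A i ⊆ S := fun i hi => by
    rw [hcov]; exact Set.subset_biUnion_of_mem (u := A) hi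
  have hinj : Function.Injective fun i : s => (⟨A i.1, hA _ i.2, hAd _ i.2⟩ : K.Subcone k) := by
    intro i j hij
    have hij : A i.1 = A j.1 := congrArg Subcone.carrier hij
    by_contra hne
    obtain ⟨m, hm, hm0, h1, h2⟩ := hsep i.1 i.2 j.1 j.2 fun h => hne (Subtype.ext h)
    exact hm0 (eq_zero_of_restr (hA _ i.2) hS (hsub _ i.2) ((hAd _ i.2).trans hd.symm) hm
      fun x hx => le_antisymm (h2 x (hij ▸ hx)) (h1 x hx))
  have hsub : K.IsSubdivision (⟨S, hS, hd⟩ : K.Subcone k) (s.attach.map ⟨_, hinj⟩) := by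
    constructor
    · ext x
      simp [hcov]
    · intro τ hτ τ' hτ' hne
      obtain ⟨i, -, rfl⟩ := Finset.mem_map.1 hτ
      obtain ⟨j, -, rfl⟩ := Finset.mem_map.1 hτ'
      exact hsep i.1 i.2 j.1 j.2 fun he => hne (by rw [Subtype.ext he])
  rw [show S = (⟨S, hS, hd⟩ : K.Subcone k).carrier from rfl, cls_eq_sum_of_isSubdivision hsub,
    Finset.sum_map]
  exact Finset.sum_attach s fun i => K.cls k (A i)

open Classical in
include h in
-- Every cone of `K'` inside `S` lies in a full-dimensional one inside `S`, so those of dimension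
-- `k` already cover `S`.
theorem cls_eq_sum {k : ℕ} (hS : K.IsSubcone S) (hd : K.dim S = k) (hU : K'.IsUnion S) :
    K.cls k S = ∑ i : K'.ConesOfDim k with K'.carrier i.1 ⊆ S, K.cls k (K'.carrier i.1) := by
  refine cls_eq_sum_of_separated _ _ hS hd (fun i _ => h.isSubcone i.1)
    (fun i _ => (h.dim_eq i.1).symm.trans i.2) ?_ fun i hi j hj hne => ?_
  · ext x
    simp only [Finset.mem_filter, Finset.mem_univ, true_and, Set.mem_iUnion, exists_prop]
    constructor
    · intro hx
      obtain ⟨κ, hxκ, hκ⟩ := hU x hx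
      obtain ⟨i, hi, hi', hdi⟩ := exists_full h hS hU hκ
      exact ⟨⟨i, hdi.trans hd⟩, hi', hi hxκ⟩
    · rintro ⟨i, hi, hx⟩
      exact hi hx
  · exact exists_separation h hS (fun he => hne (Subtype.ext he))
      (Finset.mem_filter.1 hi).2 (Finset.mem_filter.1 hj).2

theorem weightClass_eq_sum {k : ℕ} (c : K'.ConesOfDim k → ℤ) :
    weightClass h c = ∑ σ, c σ • K.cls k (K'.carrier σ.1) := finsum_eq_sum_of_fintype _

end Adapted

/-! ### Lattice indices through duals -/

section DualIndex

/-- The index of the range of the dual of a homomorphism. -/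
def dualIndex {A B : Type*} [AddCommGroup A] [AddCommGroup B] (p : A →+ B) : ℕ :=
  (AddMonoidHom.compHom' p : (B →+ ℤ) →+ (A →+ ℤ)).range.index

variable {A B C : Type*} [AddCommGroup A] [AddCommGroup B] [AddCommGroup C]

/-- A functional that vanishes on the image of `p` vanishes on a positive multiple of every element
of `B`, and `ℤ` is torsion-free. -/
theorem dual_injective {p : A →+ B} (hp : ∀ b, ∃ n : ℤ, 0 < n ∧ ∃ a, p a = n • b) :
    Function.Injective (AddMonoidHom.compHom' p : (B →+ ℤ) →+ (A →+ ℤ)) := by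
  rw [injective_iff_map_eq_zero]
  intro φ hφ
  ext b
  obtain ⟨n, hn, a, ha⟩ := hp b
  have h1 : φ (p a) = 0 := DFunLike.congr_fun hφ a
  rw [ha, map_zsmul, smul_eq_mul] at h1
  exact (mul_eq_zero.1 h1).resolve_left hn.ne'

theorem dualIndex_comp (p : A →+ B) (q : B →+ C)
    (hp : ∀ b, ∃ n : ℤ, 0 < n ∧ ∃ a, p a = n • b) :
    dualIndex (q.comp p) = dualIndex q * dualIndex p := by
  have : (AddMonoidHom.compHom' (q.comp p) : (C →+ ℤ) →+ (A →+ ℤ)) =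
      (AddMonoidHom.compHom' p).comp (AddMonoidHom.compHom' q) := rfl
  rw [dualIndex, dualIndex, dualIndex, this, AddMonoidHom.range_comp,
    AddSubgroup.index_map_of_injective _ (dual_injective hp)]

/-- The index of `H` is the product of that of its image in `q(A)` and that of `H ∩ ker q` in `ker
q`. Stated without division, the formula also holds for infinite indices, which count as `0`. -/
theorem index_mul_index_range (q : A →+ B) (H : AddSubgroup A) :
    H.index * q.range.index = (H.map q).index * H.relIndex q.ker := by
  rw [AddSubgroup.index_map, ← AddSubgroup.relIndex_mul_index (le_sup_left : H ≤ H ⊔ q.ker),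
    sup_comm, AddSubgroup.relIndex_sup_right]
  ring

theorem dualIndex_of_bijective {p : A →+ B} (hp : Function.Bijective p) : dualIndex p = 1 := by
  rw [dualIndex, AddMonoidHom.range_eq_top.2 (bijective_dual p hp.1 hp.2).2, AddSubgroup.index_top]

end DualIndex

/-! ### Linear maps on subcones and functoriality of push-forward -/

section LinearMaps

variable {Z : Type u''} {Q : ConeComplex Z} {S : Set X} {T : Set Y} {R : Set Z}

variable (K L) in
/-- The map `π` restricts to an integral linear map of the subcone `S` of `K` onto the subcone `T` of
`L`. -/
structure IsLinOn (π : X → Y) (S : Set X) (T : Set Y) : Prop where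
  isSubcone : K.IsSubcone S
  isSubcone_image : L.IsSubcone T
  image_eq : π '' S = T
  restr_comp_mem : ∀ m ∈ L.fn T, restr S (m ∘ π) ∈ K.fn S

namespace IsLinOn

variable {π : X → Y} {π' : Y → Z}

theorem mapsTo (h : IsLinOn K L π S T) : Set.MapsTo π S T := h.image_eq ▸ Set.mapsTo_image π S

/-- Pull-back of functions. -/
def hom (h : IsLinOn K L π S T) : L.fn T →+ K.fn S where
  toFun m := ⟨restr S (m.1 ∘ π), h.restr_comp_mem m.1 m.2⟩
  map_zero' := Subtype.ext (map_zero (restr S))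
  map_add' m m' := Subtype.ext (by
    change restr S ((m.1 ∘ π) + (m'.1 ∘ π)) = _
    exact map_add _ _ _)

theorem hom_apply (h : IsLinOn K L π S T) (m : L.fn T) {x : X} (hx : x ∈ S) :
    (h.hom m).1 x = m.1 (π x) :=
  restr_of_mem hx _

theorem hom_injective (h : IsLinOn K L π S T) : Function.Injective h.hom := by
  rw [injective_iff_map_eq_zero]
  rintro ⟨m, hm⟩ hm0
  refine Subtype.ext (funext fun y => ?_)
  by_cases hy : y ∈ T
  · rw [← h.image_eq] at hy
    obtain ⟨x, hx, rfl⟩ := hy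
    refine (h.hom_apply ⟨m, hm⟩ hx).symm.trans ?_
    rw [hm0]; rfl
  · exact h.isSubcone_image.isCone.supp m hm y hy

theorem dim_le (h : IsLinOn K L π S T) : L.dim T ≤ K.dim S := by
  have := finite_fn h.isSubcone
  have := free_fn h.isSubcone
  exact LinearMap.finrank_le_finrank_of_injective (f := h.hom.toIntLinearMap) h.hom_injective

theorem exists_smul (h : IsLinOn K L π S T) (hd : L.dim T = K.dim S) (m : K.fn S) :
    ∃ n : ℤ, 0 < n ∧ ∃ a, h.hom a = n • m := by
  have := finite_fn h.isSubcone
  have := free_fn h.isSubcone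
  have := finite_fn h.isSubcone_image
  have := free_fn h.isSubcone_image
  exact exists_smul_of_finrank hd _ h.hom_injective m

theorem exists_smul' (h : IsLinOn K L π S T) (hd : L.dim T = K.dim S) {m : X → ℝ}
    (hm : m ∈ K.fn S) : ∃ n : ℤ, 0 < n ∧ ∃ a ∈ L.fn T, ∀ x ∈ S, a (π x) = n * m x := by
  obtain ⟨n, hn, a, ha⟩ := h.exists_smul hd ⟨m, hm⟩
  refine ⟨n, hn, a.1, a.2, fun x hx => ?_⟩
  rw [← h.hom_apply a hx, ha]
  exact zsmul_eq_mul _ _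

theorem comp (h' : IsLinOn L Q π' T R) (h : IsLinOn K L π S T) : IsLinOn K Q (π' ∘ π) S R where
  isSubcone := h.isSubcone
  isSubcone_image := h'.isSubcone_image
  image_eq := by rw [Set.image_comp, h.image_eq, h'.image_eq]
  restr_comp_mem m hm := by
    have := h.restr_comp_mem _ (h'.restr_comp_mem m hm)
    rwa [restr_comp h.mapsTo] at this

theorem hom_comp (h' : IsLinOn L Q π' T R) (h : IsLinOn K L π S T) :
    (h'.comp h).hom = h.hom.comp h'.hom := by
  refine AddMonoidHom.ext fun m => Subtype.ext (funext fun x => ?_)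
  by_cases hx : x ∈ S
  · rw [hom_apply _ m hx, AddMonoidHom.comp_apply, hom_apply _ _ hx, hom_apply _ _ (h.mapsTo hx)]
    rfl
  · exact (restr_of_notMem hx _).trans (restr_of_notMem hx _).symm

/-- The pull-back depends only on the values of the map. -/
theorem hom_congr {ρ : X → Y} (h : IsLinOn K L π S T) (h' : IsLinOn K L ρ S T)
    (he : ∀ x ∈ S, π x = ρ x) : h.hom = h'.hom := by
  refine AddMonoidHom.ext fun m => Subtype.ext (funext fun x => ?_)
  by_cases hx : x ∈ S
  · rw [hom_apply _ m hx, hom_apply _ m hx, he x hx]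
  · exact (restr_of_notMem hx _).trans (restr_of_notMem hx _).symm

end IsLinOn

namespace Mor

/-- The composition of morphisms. -/
def comp (g : Mor L Q) (f : Mor K L) : Mor K Q where
  toFun := g.toFun ∘ f.toFun
  map_cone i := by
    obtain ⟨j, hj, -⟩ := f.map_cone i
    obtain ⟨l, hl, -⟩ := g.map_cone j
    refine ⟨l, hl.comp hj, fun m hm => ?_⟩
    have := f.restr_comp_mem hj (g.restr_comp_mem hl hm)
    rwa [restr_comp hj] at this

theorem isLinOn (f : Mor K L) (hS : K.IsSubcone S) (hT : f.toFun '' S = T) :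
    IsLinOn K L f.toFun S T := by
  subst hT
  exact ⟨hS, f.isSubcone_image hS, rfl, fun m hm => (f.pull hS ⟨m, hm⟩).2⟩

theorem latIndex_eq_dualIndex (f : Mor K L) (hS : K.IsSubcone S) (h : IsLinOn K L f.toFun S T) :
    f.latIndex hS = dualIndex h.hom := by
  obtain rfl := h.image_eq
  rfl

theorem push_cls (f : Mor K L) {k : ℕ} (hS : K.IsSubcone S) (hd : K.dim S = k) :
    f.push k (K.cls k S) = (f.latIndex hS : ℤ) • L.cls k (f.toFun '' S) := by
  rw [cls_of_dim hS hd]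
  change f.pushGen k (FreeAbelianGroup.of _) = _
  rw [pushGen, FreeAbelianGroup.lift_apply_of]

theorem comp_image (g : Mor L Q) (f : Mor K L) (S : Set X) :
    (g.comp f).toFun '' S = g.toFun '' (f.toFun '' S) := by
  change (g.toFun ∘ f.toFun) '' S = _
  exact Set.image_comp _ _ _

theorem latIndex_comp (g : Mor L Q) (f : Mor K L) (hS : K.IsSubcone S)
    (hd : Q.dim (g.toFun '' (f.toFun '' S)) = L.dim (f.toFun '' S)) :
    (g.comp f).latIndex hS = f.latIndex hS * g.latIndex (f.isSubcone_image hS) := by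
  have h1 := f.isLinOn hS rfl
  have h2 := g.isLinOn (f.isSubcone_image hS) rfl
  have e1 : (g.comp f).latIndex hS = dualIndex (h2.comp h1).hom :=
    latIndex_eq_dualIndex (g.comp f) hS (h2.comp h1)
  have e2 := dualIndex_comp h2.hom h1.hom (h2.exists_smul hd)
  rw [← IsLinOn.hom_comp, ← e1, ← latIndex_eq_dualIndex f hS h1,
    ← latIndex_eq_dualIndex g (f.isSubcone_image hS) h2] at e2
  exact e2

/-- If the dimension of the image drops at either map, both sides vanish; otherwise the indices
multiply. -/
theorem push_comp (g : Mor L Q) (f : Mor K L) (k : ℕ) :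
    (g.comp f).push k = (g.push k).comp (f.push k) := by
  refine weight_hom_ext fun S hS hk => ?_
  have h1 := (f.isLinOn hS rfl).dim_le
  have h2 := (g.isLinOn (f.isSubcone_image hS) rfl).dim_le
  rw [AddMonoidHom.comp_apply, push_cls _ hS hk, push_cls _ hS hk, map_zsmul, comp_image]
  by_cases hd : L.dim (f.toFun '' S) = k
  · rw [push_cls _ (f.isSubcone_image hS) hd, smul_smul]
    by_cases hd' : Q.dim (g.toFun '' (f.toFun '' S)) = k
    · rw [latIndex_comp g f hS (hd'.trans hd.symm), Nat.cast_mul]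
    · rw [cls_of_dim_ne hd', smul_zero, smul_zero]
  · rw [cls_of_dim_ne hd, cls_of_dim_ne (by omega), map_zero, smul_zero, smul_zero]

end Mor

end LinearMaps

end ConeComplex

namespace ConeComplex

/-! ### Indices and sublattices of rank one -/

section Lattices

variable {A B A' B' D : Type*} [AddCommGroup A] [AddCommGroup B] [AddCommGroup A'] [AddCommGroup B']
  [AddCommGroup D]

/-- The kernel of `r` has rank one, and it is a direct summand because `B` is free. The coordinate
`n` is the projection to the kernel followed by the coordinate of a basis. -/
theorem exists_coordinate [Module.Finite ℤ A] [Module.Free ℤ A] [Module.Finite ℤ B]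
    [Module.Free ℤ B] (r : A →+ B) (hr : Function.Surjective r)
    (h : Module.finrank ℤ B + 1 = Module.finrank ℤ A) : ∃ a : A, r a = 0 ∧ ∃ n : A →+ ℤ, n a = 1 ∧
      ∀ x, r x = 0 → x = n x • a := by
  let R := r.toIntLinearMap
  have h1 : Module.finrank ℤ (LinearMap.ker R) = 1 := by
    have h2 := Submodule.finrank_quotient_add_finrank (LinearMap.ker R)
    have h3 := LinearEquiv.finrank_eq (R.quotKerEquivOfSurjective hr)
    omega
  let b := Module.finBasisOfFinrankEq ℤ (LinearMap.ker R) h1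
  obtain ⟨s, hs⟩ := Module.projective_lifting_property R LinearMap.id hr
  have hs' : ∀ y, R (s y) = y := fun y => LinearMap.congr_fun hs y
  let P : A →ₗ[ℤ] LinearMap.ker R := LinearMap.codRestrict _ (LinearMap.id - s ∘ₗ R) fun x => by
    rw [LinearMap.mem_ker, LinearMap.sub_apply, map_sub, LinearMap.comp_apply, hs',
      LinearMap.id_apply, sub_self]
  have hP : ∀ x (hx : R x = 0), P x = ⟨x, hx⟩ := fun x hx => Subtype.ext (by
    change x - s (R x) = x
    rw [hx, map_zero, sub_zero])
  refine ⟨(b 0).1, (b 0).2, (b.coord 0 ∘ₗ P).toAddMonoidHom, ?_, fun x hx => ?_⟩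
  · change b.coord 0 (P _) = 1
    rw [hP _ (b 0).2, Module.Basis.coord_apply]
    simp
  · change x = (b.coord 0 (P x)) • (b 0).1
    rw [hP x hx]
    have := b.sum_repr ⟨x, hx⟩
    rw [Fin.sum_univ_one] at this
    exact (congrArg Subtype.val this).symm

theorem exists_comp_eq {r : A →+ B} (hr : Function.Surjective r) (n : A →+ D)
    (h : ∀ a, r a = 0 → n a = 0) : ∃ n' : B →+ D, n'.comp r = n :=
  ⟨r.liftOfSurjective hr ⟨n, h⟩, r.liftOfRightInverse_comp _ _ _⟩

/-- The index of a map of lattices is the product of the indices on a sublattice and its quotient. -/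
theorem dualIndex_of_coordinate {p : A →+ B} {p' : A' →+ B'} {r : A →+ A'} {s : B →+ B'}
    (hr : Function.Surjective r) (hs : Function.Surjective s) (hc : s.comp p = p'.comp r)
    {a : A} {n : A →+ ℤ} (hn : n a = 1) (hra : r a = 0) (ha : ∀ x, r x = 0 → x = n x • a)
    {b : B} {n' : B →+ ℤ} (hn' : n' b = 1) (hb : ∀ x, s x = 0 → x = n' x • b)
    {c : ℤ} (hpc : p a = c • b) (hc0 : c ≠ 0) : dualIndex p = dualIndex p' * c.natAbs := by
  -- The index of `H` is computed with the evaluation `φ` at `a`: the image `φ(H)` is `cℤ`, while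
  -- the kernel of `φ` is the dual of `A'` and meets `H` in the image of the dual of `p'`.
  let H := (AddMonoidHom.compHom' p : (B →+ ℤ) →+ (A →+ ℤ)).range
  let φ : (A →+ ℤ) →+ ℤ := AddMonoidHom.eval a
  have hφ : ∀ z : ℤ, φ (z • n) = z := fun z => by
    change (z • n) a = z
    rw [AddMonoidHom.smul_apply, hn, smul_eq_mul, mul_one]
  have h1 : φ.range.index = 1 := by
    rw [AddMonoidHom.range_eq_top.2 fun z => ⟨_, hφ z⟩, AddSubgroup.index_top]
  have h2 : H.map φ = AddSubgroup.zmultiples c := by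
    refine le_antisymm ?_ ?_
    · rintro _ ⟨_, ⟨m, rfl⟩, rfl⟩
      refine ⟨m b, ?_⟩
      change m b • c = m (p a)
      rw [hpc, map_zsmul, smul_eq_mul, smul_eq_mul, mul_comm]
    · rw [AddSubgroup.zmultiples_le]
      refine ⟨_, ⟨n', rfl⟩, ?_⟩
      change n' (p a) = c
      rw [hpc, map_zsmul, hn', smul_eq_mul, mul_one]
  let ι : (A' →+ ℤ) →+ (A →+ ℤ) := AddMonoidHom.compHom' r
  have h3 : φ.ker = ι.range := by
    refine le_antisymm (fun m hm => ?_) ?_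
    · have hm : m a = 0 := hm
      obtain ⟨m', hm'⟩ := exists_comp_eq hr m fun x hx => by
        rw [ha x hx, map_zsmul, hm, smul_zero]
      exact ⟨m', hm'⟩
    · rintro _ ⟨m, rfl⟩
      change m (r a) = 0
      rw [hra, map_zero]
  have h4 : H.comap ι = (AddMonoidHom.compHom' p' : (B' →+ ℤ) →+ (A' →+ ℤ)).range := by
    refine le_antisymm ?_ ?_
    · rintro m ⟨m', hm'⟩
      have hm' : m'.comp p = m.comp r := hm'
      have h0 : m' b = 0 := by
        have h5 : m' (p a) = m (r a) := DFunLike.congr_fun hm' a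
        rw [hpc, hra, map_zero, map_zsmul, smul_eq_mul] at h5
        exact (mul_eq_zero.1 h5).resolve_left hc0
      obtain ⟨q, rfl⟩ := exists_comp_eq hs m' fun x hx => by
        rw [hb x hx, map_zsmul, h0, smul_zero]
      refine ⟨q, AddMonoidHom.ext fun x => ?_⟩
      obtain ⟨y, rfl⟩ := hr x
      refine Eq.trans ?_ (DFunLike.congr_fun hm' y)
      exact (congrArg q (DFunLike.congr_fun hc y)).symm
    · rintro _ ⟨q, rfl⟩
      refine ⟨q.comp s, AddMonoidHom.ext fun x => ?_⟩
      exact congrArg q (DFunLike.congr_fun hc x)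
  have h5 := index_mul_index_range φ H
  rw [h1, h2, h3, ← AddSubgroup.index_comap, h4, Int.index_zmultiples, mul_one] at h5
  rw [mul_comm]
  exact h5

end Lattices

variable {X : Type u} {Y : Type u'} {K : ConeComplex X} {L : ConeComplex Y}

/-! ### Conormal functions and lattice normal vectors -/

section Conormals

variable {κ S : Set X} {m : X → ℝ}

variable (K) in
/-- The function `m` on `S` generates the group of integral linear functions vanishing on `κ`. -/
structure IsConormal (κ S : Set X) (m : X → ℝ) : Prop where
  mem : m ∈ K.fn S
  eq_zero : ∀ x ∈ κ, m x = 0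
  exists_coord : ∃ n : K.fn S →+ ℤ, n ⟨m, mem⟩ = 1 ∧
    ∀ m' : K.fn S, (∀ x ∈ κ, m'.1 x = 0) → m' = n m' • ⟨m, mem⟩

theorem IsConormal.neg (h : K.IsConormal κ S m) : K.IsConormal κ S (-m) := by
  obtain ⟨n, hn, hn'⟩ := h.exists_coord
  refine ⟨neg_mem h.mem, fun x hx => by simp [h.eq_zero x hx], -n, ?_, fun m' hm' => ?_⟩
  · change -n (-⟨m, h.mem⟩) = 1
    rw [map_neg, neg_neg, hn]
  · refine (hn' m' hm').trans ?_
    rw [AddMonoidHom.neg_apply, show (⟨-m, neg_mem h.mem⟩ : K.fn S) = -⟨m, h.mem⟩ from rfl, neg_smul,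
      smul_neg, neg_neg]

theorem IsConormal.exists_mul (h : K.IsConormal κ S m) {m' : X → ℝ} (hm' : m' ∈ K.fn S)
    (h0 : ∀ x ∈ κ, m' x = 0) : ∃ n : ℤ, ∀ x, m' x = n * m x := by
  obtain ⟨n, -, hn'⟩ := h.exists_coord
  refine ⟨n ⟨m', hm'⟩, fun x => ?_⟩
  have := congrFun (congrArg Subtype.val (hn' ⟨m', hm'⟩ h0)) x
  exact this.trans (zsmul_eq_mul _ _)

theorem IsConormal.ne_zero (h : K.IsConormal κ S m) : m ≠ 0 := by
  obtain ⟨n, hn, -⟩ := h.exists_coord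
  rintro rfl
  rw [show (⟨0, h.mem⟩ : K.fn S) = 0 from rfl, map_zero] at hn
  exact zero_ne_one hn

theorem resHom_eq_zero {hκ : K.IsSubcone κ} {hS : K.IsSubcone S} {h : κ ⊆ S} {m : K.fn S} :
    resHom hκ hS h m = 0 ↔ ∀ x ∈ κ, m.1 x = 0 := by
  constructor
  · intro h0 x hx
    exact (restr_of_mem hx _).symm.trans (congrFun (congrArg Subtype.val h0) x)
  · intro h0
    refine Subtype.ext (funext fun x => ?_)
    by_cases hx : x ∈ κ
    · exact (restr_of_mem hx _).trans (h0 x hx)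
    · exact restr_of_notMem hx _

theorem exists_conormal (hκ : K.IsSubcone κ) (hS : K.IsSubcone S) (h : κ ⊆ S)
    (hd : K.dim κ + 1 = K.dim S) : ∃ m, K.IsConormal κ S m := by
  have := finite_fn hκ
  have := free_fn hκ
  have := finite_fn hS
  have := free_fn hS
  obtain ⟨m, hm, n, hn, hn'⟩ := exists_coordinate (resHom hκ hS h) (resHom_surjective hκ hS h) hd
  exact ⟨m.1, m.2, resHom_eq_zero.1 hm, n, hn, fun m' hm' => hn' m' (resHom_eq_zero.2 hm')⟩

end Conormals

section LatticeNormals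

variable {σ τ : K.Idx}

/-- A function that cuts out the face `τ` is a nonzero integral multiple of the conormal function,
so the latter has constant sign on `σ` and vanishes only on `τ`. -/
theorem exists_conormal_nonneg (h : K.carrier τ ⊆ K.carrier σ)
    (hd : K.dim (K.carrier τ) + 1 = K.dim (K.carrier σ)) :
    ∃ m, K.IsConormal (K.carrier τ) (K.carrier σ) m ∧ (∀ x ∈ K.carrier σ, 0 ≤ m x) ∧
      ∀ x ∈ K.carrier σ, m x = 0 → x ∈ K.carrier τ := by
  obtain ⟨m, hm⟩ := exists_conormal (isSubcone_carrier τ) (isSubcone_carrier σ) h hd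
  obtain ⟨-, q, hq, hpos, he⟩ := isFaceOf_of_subset h
  have he' : ∀ x, x ∈ K.carrier τ ↔ x ∈ K.carrier σ ∧ q x = 0 := fun x => by rw [he]; rfl
  obtain ⟨n, hn⟩ := hm.exists_mul (by rwa [fn_carrier]) fun x hx => ((he' x).1 hx).2
  have hn0 : n ≠ 0 := by
    rintro rfl
    have : K.carrier τ = K.carrier σ := h.antisymm fun x hx => (he' x).2 ⟨hx, by rw [hn]; simp⟩
    rw [this] at hd
    omega
  have hn0' : (n : ℝ) ≠ 0 := by exact_mod_cast hn0
  rcases lt_or_gt_of_ne hn0' with hlt | hgt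
  · refine ⟨-m, hm.neg, fun x hx => ?_, fun x hx h0 => (he' x).2 ⟨hx, ?_⟩⟩
    · have := hpos x hx
      rw [hn] at this
      rw [Pi.neg_apply]
      nlinarith
    · rw [hn, neg_eq_zero.1 h0, mul_zero]
  · refine ⟨m, hm, fun x hx => ?_, fun x hx h0 => (he' x).2 ⟨hx, ?_⟩⟩
    · have := hpos x hx
      rw [hn] at this
      nlinarith
    · rw [hn, h0, mul_zero]

/-- The function that takes the value `1` at `v` is an integral multiple of `m`, and `m` is integral
at `v`; so `m v` is a unit of `ℤ`. -/
theorem IsLatticeNormal.conormal_apply {m : X → ℝ} (hm : K.IsConormal (K.carrier τ) (K.carrier σ) m)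
    {v : X} (hv : K.IsLatticeNormal σ τ v) : m v = 1 ∨ m v = -1 := by
  obtain ⟨-, hi, m', hm', h0, h1⟩ := hv
  obtain ⟨n, hn⟩ := hm.exists_mul (by rwa [fn_carrier]) h0
  obtain ⟨l, hl⟩ := hi m (by rw [← fn_carrier]; exact hm.mem)
  rw [hn, hl] at h1
  have h2 : n * l = 1 := by exact_mod_cast h1
  rw [hl]
  rcases Int.eq_one_or_neg_one_of_mul_eq_one (mul_comm n l ▸ h2) with rfl | rfl
  · exact Or.inl (by simp)
  · exact Or.inr (by simp)

/-- The functional `n` dual to the conormal function need not be a point of the cone `σ`. Adding a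
large multiple of an integral inner point of `τ` moves it into `σ` without changing its values on
functions vanishing on `τ`. -/
theorem exists_isLatticeNormal (h : K.carrier τ ⊆ K.carrier σ)
    (hd : K.dim (K.carrier τ) + 1 = K.dim (K.carrier σ)) : ∃ v, K.IsLatticeNormal σ τ v := by
  obtain ⟨m, hm, hpos, -⟩ := exists_conormal_nonneg h hd
  obtain ⟨n, hn, hn'⟩ := hm.exists_coord
  obtain ⟨t, ht, hti⟩ := (K.isCone τ).exists_inner
  obtain ⟨B, hB, hB'⟩ := (isSubcone_carrier (K := K) σ).isCone.exists_ineq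
  have hres : ∀ b ∈ K.fn (K.carrier σ), restr (K.carrier τ) b ∈ K.M τ := fun b hb =>
    restr_mem h (by rwa [fn_carrier] at hb)
  have hti' : ∀ b ∈ K.fn (K.carrier σ), ∃ n : ℤ, b t = n := fun b hb => by
    obtain ⟨l, hl⟩ := hti _ (hres b hb)
    exact ⟨l, by rw [← hl, restr_of_mem ht.1]⟩
  -- An inequality that is positive at `t` holds after adding enough copies of `t`. One that
  -- vanishes at `t` vanishes on `τ`, so it is a multiple `n b • m` with `0 ≤ n b`.
  have hN : ∀ b ∈ B, ∃ N : ℕ, ∀ N', N ≤ N' → (0 : ℝ) ≤ n b + N' * b.1 t := by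
    intro b hb
    rcases (hB b hb t (h ht.1)).eq_or_lt with h0 | hlt
    · have hv : ∀ x ∈ K.carrier τ, b.1 x = 0 := fun x hx => by
        rw [← restr_of_mem hx b.1]
        exact ht.2 _ (hres _ b.2) (fun x hx => by
          rw [restr_of_mem hx]; exact hB b hb x (h hx)) (by rw [restr_of_mem ht.1, ← h0]) x hx
      have hb' := hn' b hv
      obtain ⟨x, hx, hmx⟩ := exists_ne_zero (isSubcone_carrier σ).isCone hm.mem hm.ne_zero
      have h1 : b.1 x = n b * m x :=
        (congrFun (congrArg Subtype.val hb') x).trans (zsmul_eq_mul _ _)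
      have h2 := hB b hb x hx
      have h3 := (hpos x hx).lt_of_ne' hmx
      refine ⟨0, fun N' _ => ?_⟩
      rw [← h0, mul_zero, add_zero]
      rw [h1] at h2
      exact nonneg_of_mul_nonneg_left h2 h3
    · obtain ⟨N, hN⟩ := exists_nat_ge (-(n b : ℝ) / b.1 t)
      refine ⟨N, fun N' hN' => ?_⟩
      have h1 : -(n b : ℝ) / b.1 t ≤ N' := hN.trans (by exact_mod_cast hN')
      rw [div_le_iff₀ hlt] at h1
      linarith
  choose! N hN using hN
  let N₀ := ∑ b ∈ B, N b
  let e : K.fn (K.carrier σ) →+ ℝ := (Int.castAddHom ℝ).comp n + (N₀ : ℝ) • evalAt _ t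
  have he : ∀ b, e b = n b + N₀ * b.1 t := fun _ => rfl
  obtain ⟨v, hv, hvm⟩ := hB' e fun b hb => by
    rw [he]
    exact hN b hb _ (Finset.single_le_sum (f := N) (fun _ _ => Nat.zero_le _) hb)
  refine ⟨v, hv, fun b hb => ?_, m, by rw [← fn_carrier]; exact hm.mem, hm.eq_zero, ?_⟩
  · rw [← fn_carrier] at hb
    obtain ⟨l, hl⟩ := hti' b hb
    refine ⟨n ⟨b, hb⟩ + N₀ * l, ?_⟩
    rw [show b v = n ⟨b, hb⟩ + N₀ * b t from hvm ⟨b, hb⟩, hl]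
    push_cast
    rfl
  · rw [show m v = n ⟨m, hm.mem⟩ + N₀ * m t from hvm ⟨m, hm.mem⟩, hn, hm.eq_zero t ht.1]
    simp

end LatticeNormals

end ConeComplex

namespace ConeComplex

variable {X : Type u} {Y : Type u'} {K : ConeComplex X} {L : ConeComplex Y}

/-! ### Cones around a wall in a subdivided subcone -/

section Sides

variable {L' : ConeComplex Y} (h' : L.IsProperSubdivision L') {S : Set Y} {κ : L'.Idx} {m : Y → ℝ}

include h' in
-- Functions on `i` extend to `S` and functions on `S` restrict to `i`. Hence `m` and `q` are
-- integral multiples of each other on `i`.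
theorem IsConormal.eq_or_eq_neg (hS : L.IsSubcone S) (hm : L.IsConormal (L'.carrier κ) S m)
    {i : L'.Idx} (hi : L'.carrier i ⊆ S) {q : Y → ℝ}
    (hq : L'.IsConormal (L'.carrier κ) (L'.carrier i) q) (hκi : L'.carrier κ ⊆ L'.carrier i) :
    (∀ x ∈ L'.carrier i, m x = q x) ∨ ∀ x ∈ L'.carrier i, m x = -q x := by
  have hq' : q ∈ L.fn (L'.carrier i) := by
    rw [h'.fn_carrier, ← ConeComplex.fn_carrier]; exact hq.mem
  obtain ⟨q', hq1, hq2⟩ := (h'.isSubcone i).exists_restr hS hi hq'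
  have e : ∀ x ∈ L'.carrier i, q x = q' x := fun x hx => by rw [← hq2, restr_of_mem hx]
  obtain ⟨n, hn⟩ := hm.exists_mul hq1 fun x hx => by rw [← e x (hκi hx), hq.eq_zero x hx]
  have hmr : restr (L'.carrier i) m ∈ L'.fn (L'.carrier i) := by
    rw [ConeComplex.fn_carrier, ← h'.fn_carrier]
    exact (h'.isSubcone i).restr_mem hS hi hm.mem
  obtain ⟨n', hn'⟩ := hq.exists_mul hmr fun x hx => by rw [restr_of_mem (hκi hx), hm.eq_zero x hx]
  have e' : ∀ x ∈ L'.carrier i, m x = n' * q x := fun x hx => by rw [← hn', restr_of_mem hx]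
  obtain ⟨x, hx, hqx⟩ := exists_ne_zero (isSubcone_carrier i).isCone hq.mem hq.ne_zero
  have h1 : (n : ℝ) * n' = 1 := by
    have h2 := e x hx
    rw [hn, e' x hx] at h2
    have h3 : q x * ((n : ℝ) * n' - 1) = 0 := by linear_combination -h2
    linarith [(mul_eq_zero.1 h3).resolve_left hqx]
  have h2 : n * n' = 1 := by exact_mod_cast h1
  rcases Int.eq_one_or_neg_one_of_mul_eq_one (mul_comm n n' ▸ h2) with rfl | rfl
  · exact Or.inl fun x hx => by rw [e' x hx]; simp
  · exact Or.inr fun x hx => by rw [e' x hx]; simp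

variable {l : ℕ} {v : L'.ConesOver (l + 1) κ → Y}

include h' in
theorem IsConormal.apply_normal (hS : L.IsSubcone S) (hm : L.IsConormal (L'.carrier κ) S m)
    (hκ : L'.dim (L'.carrier κ) = l) {i : L'.ConesOver (l + 1) κ} (hi : L'.carrier i.1.1 ⊆ S)
    {x : Y} (hx : L'.IsLatticeNormal i.1.1 κ x) :
    (m x = 1 ∧ ∀ y ∈ L'.carrier i.1.1, 0 ≤ m y) ∨ (m x = -1 ∧ ∀ y ∈ L'.carrier i.1.1, m y ≤ 0) := by
  obtain ⟨q, hq, hpos, -⟩ := exists_conormal_nonneg i.2 (by rw [hκ, i.1.2])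
  have hqx : q x = 1 := (hx.conormal_apply hq).resolve_right fun h => by
    have := hpos x hx.1
    rw [h] at this
    linarith
  rcases hm.eq_or_eq_neg h' hS hi hq i.2 with h | h
  · exact Or.inl ⟨by rw [h x hx.1, hqx], fun y hy => by rw [h y hy]; exact hpos y hy⟩
  · exact Or.inr ⟨by rw [h x hx.1, hqx], fun y hy => by rw [h y hy]; linarith [hpos y hy]⟩

open Classical in
include h' in
-- Walking from `κ` to a point with `m > 0` enters a cone over `κ` on that side. Two such cones
-- cannot coexist: a function separating them vanishes on `κ`, so it is a multiple of `m`, which is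
-- positive on both.
theorem IsConormal.card_side (hS : L.IsSubcone S) (hU : L'.IsUnion S)
    (hm : L.IsConormal (L'.carrier κ) S m) (hκ : L'.dim (L'.carrier κ) = l) (hκS : L'.carrier κ ⊆ S)
    (hd : L.dim S = l + 1) (hv : ∀ i, L'.IsLatticeNormal i.1.1 κ (v i)) :
    ((Finset.univ.filter fun i : L'.ConesOver (l + 1) κ => L'.carrier i.1.1 ⊆ S).filter
      fun i => 0 < m (v i)).card = if ∃ x ∈ S, 0 < m x then 1 else 0 := by
  split_ifs with hx
  · obtain ⟨z, hz, hmz⟩ := hx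
    obtain ⟨i, hκi, hi, hdi, x, hx, δ, hδ, hxm⟩ :=
      exists_over_lt h' hS hU hκS hm.mem hm.eq_zero hz hmz.ne'
    have hdi' : L'.dim (L'.carrier i) = l + 1 := by
      have h1 := dim_mono (h'.isSubcone i) hS hi
      rw [← h'.dim_eq] at h1
      omega
    have hmx : 0 < m x := by rw [hxm]; exact mul_pos hδ hmz
    rw [Finset.card_eq_one]
    refine ⟨⟨⟨i, hdi'⟩, hκi⟩, Finset.eq_singleton_iff_unique_mem.2 ⟨?_, ?_⟩⟩
    · refine Finset.mem_filter.2 ⟨Finset.mem_filter.2 ⟨Finset.mem_univ _, hi⟩, ?_⟩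
      rcases hm.apply_normal h' hS hκ (i := ⟨⟨i, hdi'⟩, hκi⟩) hi (hv _) with h | h
      · rw [h.1]; exact one_pos
      · exact absurd (h.2 x hx) (not_le.2 hmx)
    · intro j hj
      rw [Finset.mem_filter, Finset.mem_filter] at hj
      by_contra hne
      obtain ⟨q, hq, hq0, h1, h2⟩ := exists_separation h' hS (i := j.1.1) (j := i)
        (fun he => hne (Subtype.ext (Subtype.ext he))) hj.1.2 hi
      obtain ⟨n, hn⟩ := hm.exists_mul hq fun x hx => le_antisymm (h2 x (hκi hx)) (h1 x (j.2 hx))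
      have h3 := h1 _ (hv j).1
      have h4 := h2 x hx
      rw [hn] at h3 h4
      have h5 := nonneg_of_mul_nonneg_left h3 hj.2
      have h6 : (n : ℝ) ≤ 0 := by
        by_contra h
        exact absurd (mul_pos (not_le.1 h) hmx) (not_lt.2 h4)
      refine hq0 (funext fun x => ?_)
      rw [hn, le_antisymm h6 h5, zero_mul]
      rfl
  · rw [Finset.card_eq_zero, Finset.filter_eq_empty_iff]
    intro i hi hpos
    exact hx ⟨_, (Finset.mem_filter.1 hi).2 (hv i).1, hpos⟩

open Classical in
include h' in
-- Each normal vector has `m`-value `1` or `-1`, and each side of `κ` in `S` carries at most one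
-- cone. The sum is therefore `0` if `S` has points on both sides of `κ`, and a sign otherwise.
theorem IsConormal.sum_normals (hS : L.IsSubcone S) (hU : L'.IsUnion S)
    (hm : L.IsConormal (L'.carrier κ) S m) (hκ : L'.dim (L'.carrier κ) = l) (hκS : L'.carrier κ ⊆ S)
    (hd : L.dim S = l + 1) (hv : ∀ i, L'.IsLatticeNormal i.1.1 κ (v i)) :
    ∑ i : L'.ConesOver (l + 1) κ with L'.carrier i.1.1 ⊆ S, m (v i) =
      (if ∃ x ∈ S, 0 < m x then 1 else 0) - if ∃ x ∈ S, m x < 0 then 1 else 0 := by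
  have h1 := hm.card_side h' hS hU hκ hκS hd hv
  have h2 := hm.neg.card_side h' hS hU hκ hκS hd hv
  simp only [Pi.neg_apply, Left.neg_pos_iff] at h2
  have h3 : ∀ i ∈ Finset.univ.filter fun i : L'.ConesOver (l + 1) κ => L'.carrier i.1.1 ⊆ S,
      m (v i) = (if 0 < m (v i) then 1 else 0) - if m (v i) < 0 then 1 else 0 := by
    intro i hi
    rcases hm.apply_normal h' hS hκ (Finset.mem_filter.1 hi).2 (hv i) with h | h <;> rw [h.1] <;>
      norm_num
  rw [Finset.sum_congr rfl h3, Finset.sum_sub_distrib, Finset.sum_boole, Finset.sum_boole, h1, h2]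
  push_cast
  rfl

end Sides

/-! ### Balancing contribution of a single cone -/

section Facets

variable {L' : ConeComplex Y} (h' : L.IsProperSubdivision L') {κ : L'.Idx} {m : Y → ℝ} {l : ℕ}
  {f : Mor K L} {σ : K.Idx}

/-- As `f` does not lower the dimension of `σ`, a multiple of the conormal function `q` of `τ` comes
from a function on the image. That function vanishes on `κ`, so it is a multiple of `m`. -/
theorem exists_facet_coord {S κ : Set Y} (hS : IsLinOn K L f.toFun (K.carrier σ) S)
    (hd : L.dim S = K.dim (K.carrier σ)) (hm : L.IsConormal κ S m) {τ : K.Idx}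
    (hτ : K.carrier τ ⊆ K.carrier σ) (hτd : K.dim (K.carrier τ) + 1 = K.dim (K.carrier σ))
    (hκ : κ ⊆ f.toFun '' K.carrier τ) : ∃ c : ℝ, c ≠ 0 ∧ ∃ q,
      K.IsConormal (K.carrier τ) (K.carrier σ) q ∧ (∀ x ∈ K.carrier σ, 0 ≤ q x) ∧
      (∀ x ∈ K.carrier σ, q x = 0 → x ∈ K.carrier τ) ∧ ∀ x ∈ K.carrier σ, q x = c * m (f.toFun x) := by
  obtain ⟨q, hq, hpos, h0⟩ := exists_conormal_nonneg hτ hτd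
  obtain ⟨n, hn, a, ha, han⟩ := hS.exists_smul' hd hq.mem
  obtain ⟨n', hn'⟩ := hm.exists_mul ha fun y hy => by
    obtain ⟨x, hx, rfl⟩ := hκ hy
    rw [han x (hτ hx), hq.eq_zero x hx, mul_zero]
  have hn0 : (n : ℝ) ≠ 0 := by exact_mod_cast hn.ne'
  have e : ∀ x ∈ K.carrier σ, q x = (n' / n : ℝ) * m (f.toFun x) := fun x hx => by
    have := han x hx
    rw [hn'] at this
    field_simp
    linear_combination -this
  refine ⟨n' / n, fun h => ?_, q, hq, hpos, h0, e⟩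
  obtain ⟨x, hx, hqx⟩ := exists_ne_zero (isSubcone_carrier σ).isCone hq.mem hq.ne_zero
  exact hqx (by rw [e x hx, h, zero_mul])

include h' in
-- The image of `τ` has dimension at most `l` and contains the `l`-dimensional `κ`, so a function
-- vanishing on `κ` vanishes on the whole image.
theorem vanishes_on_facet {S : Set Y} (hS : L.IsSubcone S) (hm : L.IsConormal (L'.carrier κ) S m)
    (hκ : L'.dim (L'.carrier κ) = l) {τ : K.Idx} (hτ : K.dim (K.carrier τ) = l)
    (hτS : f.toFun '' K.carrier τ ⊆ S) (hκτ : L'.carrier κ ⊆ f.toFun '' K.carrier τ) :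
    ∀ x ∈ K.carrier τ, m (f.toFun x) = 0 := by
  have h1 := f.isLinOn (isSubcone_carrier τ) rfl
  have h2 := h1.dim_le
  have h3 := dim_mono (h'.isSubcone κ) h1.isSubcone_image hκτ
  rw [← h'.dim_eq] at h3
  have h4 := eq_zero_of_restr (h'.isSubcone κ) h1.isSubcone_image hκτ
    (by rw [← h'.dim_eq]; omega) (h1.isSubcone_image.restr_mem hS hτS hm.mem)
    fun x hx => by rw [restr_of_mem (hκτ hx), hm.eq_zero x hx]
  intro x hx
  rw [← restr_of_mem (Set.mem_image_of_mem f.toFun hx) m, h4]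
  rfl

open Classical in
include h' in
-- Here `κ` lies on the boundary of `S`, and exactly one facet `τ₀` of `σ` has an image containing
-- `κ`, namely the zero set of `m ∘ f`. So the sum has one term, and the claim is that the index on
-- `σ` is the index on `τ₀` times the value of `m` at the image of the normal vector.
theorem facet_sum_of_nonneg {S : Set Y} (hS : IsLinOn K L f.toFun (K.carrier σ) S)
    (hm : L.IsConormal (L'.carrier κ) S m) (hκ : L'.dim (L'.carrier κ) = l)
    (hκS : L'.carrier κ ⊆ S) (hd : L.dim S = l + 1) (hσ : K.dim (K.carrier σ) = l + 1)
    {w : K.ConesOfDim l → X}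
    (hw : ∀ τ : K.ConesOfDim l, K.carrier τ.1 ⊆ K.carrier σ → K.IsLatticeNormal σ τ.1 (w τ))
    (hpos : ∀ y ∈ S, 0 ≤ m y) :
    ∑ τ : K.ConesOfDim l with K.carrier τ.1 ⊆ K.carrier σ ∧
      L'.carrier κ ⊆ f.toFun '' K.carrier τ.1,
      (f.latIndex (isSubcone_carrier τ.1) : ℝ) * m (f.toFun (w τ)) =
      f.latIndex (isSubcone_carrier σ) := by
  have hp := hS.restr_comp_mem m hm.mem
  have hpv : ∀ x ∈ K.carrier σ, restr (K.carrier σ) (m ∘ f.toFun) x = m (f.toFun x) :=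
    fun x hx => restr_of_mem hx _
  obtain ⟨τ₀, hτ₀, -⟩ := K.exists_face σ _ _ ⟨rfl, _, by rwa [fn_carrier] at hp, fun x hx => by
    rw [hpv x hx]; exact hpos _ (hS.mapsTo hx), rfl⟩
  have hτ₀' : ∀ x, x ∈ K.carrier τ₀ ↔ x ∈ K.carrier σ ∧ m (f.toFun x) = 0 := fun x => by
    rw [hτ₀]
    exact ⟨fun h => ⟨h.1, (hpv x h.1) ▸ h.2⟩, fun h => ⟨h.1, (hpv x h.1).trans h.2⟩⟩
  have hsub : K.carrier τ₀ ⊆ K.carrier σ := fun x hx => ((hτ₀' x).1 hx).1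
  have hκτ : L'.carrier κ ⊆ f.toFun '' K.carrier τ₀ := fun y hy => by
    obtain ⟨x, hx, rfl⟩ := hS.image_eq.symm ▸ hκS hy
    exact ⟨x, (hτ₀' x).2 ⟨hx, hm.eq_zero _ hy⟩, rfl⟩
  have hτS : f.toFun '' K.carrier τ₀ ⊆ S := by
    rw [← hS.image_eq]; exact Set.image_mono hsub
  have hlin := f.isLinOn (isSubcone_carrier τ₀) rfl
  have hdτ : K.dim (K.carrier τ₀) = l := by
    have h1 := hlin.dim_le
    have h2 := dim_mono (h'.isSubcone κ) hlin.isSubcone_image hκτ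
    rw [← h'.dim_eq] at h2
    have h3 := dim_lt_of_vanishing (isSubcone_carrier τ₀) (isSubcone_carrier σ) hsub hp (fun h0 => by
      obtain ⟨y, hy, hmy⟩ := exists_ne_zero hS.isSubcone_image.isCone hm.mem hm.ne_zero
      rw [← hS.image_eq] at hy
      obtain ⟨x, hx, rfl⟩ := hy
      exact hmy ((hpv x hx).symm.trans (congrFun h0 x))) fun x hx => by
        rw [hpv x (hsub hx)]; exact ((hτ₀' x).1 hx).2
    omega
  have hfilter : (Finset.univ.filter fun τ : K.ConesOfDim l => K.carrier τ.1 ⊆ K.carrier σ ∧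
      L'.carrier κ ⊆ f.toFun '' K.carrier τ.1) = {⟨τ₀, hdτ⟩} := by
    refine Finset.eq_singleton_iff_unique_mem.2 ⟨?_, fun τ hτ => ?_⟩
    · exact Finset.mem_filter.2 ⟨Finset.mem_univ _, hsub, hκτ⟩
    · obtain ⟨-, h1, h2⟩ := Finset.mem_filter.1 hτ
      refine Subtype.ext (K.carrier_injective (Set.Subset.antisymm (fun x hx => ?_) fun x hx => ?_))
      · exact (hτ₀' x).2 ⟨h1 hx, vanishes_on_facet h' hS.isSubcone_image hm hκ τ.2
          (by rw [← hS.image_eq]; exact Set.image_mono h1) h2 x hx⟩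
      · obtain ⟨c, -, q, -, -, h0, he⟩ := exists_facet_coord hS (hd.trans hσ.symm) hm h1
          (by rw [τ.2, hσ]) h2
        obtain ⟨h3, h4⟩ := (hτ₀' x).1 hx
        exact h0 x h3 (by rw [he x h3, h4, mul_zero])
  rw [hfilter]
  refine (Finset.sum_singleton _ _).trans ?_
  obtain ⟨c, hc, q, hq, hqpos, -, he⟩ := exists_facet_coord hS (hd.trans hσ.symm) hm hsub
    (by rw [hdτ, hσ]) hκτ
  have hqw : q (w ⟨τ₀, hdτ⟩) = 1 := ((hw _ hsub).conormal_apply hq).resolve_right fun h => by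
    have := hqpos _ (hw ⟨τ₀, hdτ⟩ hsub).1
    rw [h] at this
    linarith
  obtain ⟨n, hn, hn'⟩ := hm.exists_coord
  obtain ⟨n₁, hn₁, hn₁'⟩ := hq.exists_coord
  obtain ⟨c', hc'⟩ := hq.exists_mul hp fun x hx => by
    rw [hpv x (hsub hx)]; exact ((hτ₀' x).1 hx).2
  have hc'' : ∀ x ∈ K.carrier σ, m (f.toFun x) = c' * q x := fun x hx => by
    rw [← hc' x, hpv x hx]
  have hmw := hc'' _ (hw ⟨τ₀, hdτ⟩ hsub).1
  rw [hqw, mul_one] at hmw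
  have hc0 : c' ≠ 0 := by
    rintro rfl
    have := he _ (hw ⟨τ₀, hdτ⟩ hsub).1
    rw [hqw, hmw] at this
    simp at this
  have hcpos : (0 : ℝ) ≤ c' := by
    rw [← hmw]; exact hpos _ (hS.mapsTo (hw ⟨τ₀, hdτ⟩ hsub).1)
  have hcn : ((c'.natAbs : ℕ) : ℝ) = c' := by
    rw [Nat.cast_natAbs, abs_of_nonneg (by exact_mod_cast hcpos)]
  -- The functions vanishing on the image of `τ₀` and on `τ₀` are generated by `m` and `q`
  -- respectively, and `m` pulls back to `c'` times `q`. Thus `c'` is the ratio of the two indices,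
  -- and it is also the value of `m` at the image of the normal vector, as `q` equals `1` there.
  have hidx := dualIndex_of_coordinate (p := hS.hom) (p' := hlin.hom)
    (resHom_surjective hlin.isSubcone_image hS.isSubcone_image hτS)
    (resHom_surjective (isSubcone_carrier τ₀) (isSubcone_carrier σ) hsub) (by
      refine AddMonoidHom.ext fun a => Subtype.ext (funext fun x => ?_)
      by_cases hx : x ∈ K.carrier τ₀
      · refine (restr_of_mem hx _).trans ((hS.hom_apply a (hsub hx)).trans ?_)
        refine Eq.trans ?_ (hlin.hom_apply _ hx).symm
        exact (restr_of_mem (Set.mem_image_of_mem f.toFun hx) _).symm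
      · exact (restr_of_notMem hx _).trans (restr_of_notMem hx _).symm)
    hn (resHom_eq_zero.2 fun y hy => by
      obtain ⟨x, hx, rfl⟩ := hy
      exact ((hτ₀' x).1 hx).2)
    (fun a ha => hn' a fun y hy => resHom_eq_zero.1 ha y (hκτ hy))
    hn₁ (fun a ha => hn₁' a fun y hy => resHom_eq_zero.1 ha y hy)
    (c := c') (Subtype.ext (funext fun x => (hc' x).trans (zsmul_eq_mul _ _).symm)) hc0
  rw [f.latIndex_eq_dualIndex (isSubcone_carrier σ) hS,
    f.latIndex_eq_dualIndex (isSubcone_carrier τ₀) hlin, hidx, hmw]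
  push_cast
  rw [← hcn]

open Classical in
include h' in
-- If `m` takes both signs on `S`, no facet of `σ` has an image containing `κ`: the conormal
-- function of such a facet would be a multiple of `m ∘ f` of constant sign. Otherwise `m` or `-m`
-- is non-negative on `S`.
theorem facet_sum {S : Set Y} (hS : IsLinOn K L f.toFun (K.carrier σ) S)
    (hm : L.IsConormal (L'.carrier κ) S m) (hκ : L'.dim (L'.carrier κ) = l)
    (hκS : L'.carrier κ ⊆ S) (hd : L.dim S = l + 1) (hσ : K.dim (K.carrier σ) = l + 1)
    {w : K.ConesOfDim l → X}
    (hw : ∀ τ : K.ConesOfDim l, K.carrier τ.1 ⊆ K.carrier σ → K.IsLatticeNormal σ τ.1 (w τ)) :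
    ∑ τ : K.ConesOfDim l with K.carrier τ.1 ⊆ K.carrier σ ∧
      L'.carrier κ ⊆ f.toFun '' K.carrier τ.1,
      (f.latIndex (isSubcone_carrier τ.1) : ℝ) * m (f.toFun (w τ)) =
      f.latIndex (isSubcone_carrier σ) *
        ((if ∃ x ∈ S, 0 < m x then 1 else 0) - if ∃ x ∈ S, m x < 0 then 1 else 0) := by
  obtain ⟨y, hy, hmy⟩ := exists_ne_zero hS.isSubcone_image.isCone hm.mem hm.ne_zero
  by_cases h1 : ∃ x ∈ S, 0 < m x
  · by_cases h2 : ∃ x ∈ S, m x < 0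
    · rw [if_pos h1, if_pos h2, sub_self, mul_zero]
      refine Finset.sum_eq_zero fun τ hτ => ?_
      obtain ⟨-, h3, h4⟩ := Finset.mem_filter.1 hτ
      obtain ⟨c, hc, q, -, hq, -, he⟩ := exists_facet_coord hS (hd.trans hσ.symm) hm h3
        (by rw [τ.2, hσ]) h4
      exfalso
      obtain ⟨x, hx, hmx⟩ := h1
      obtain ⟨z, hz, hmz⟩ := h2
      rw [← hS.image_eq] at hx hz
      obtain ⟨x, hx, rfl⟩ := hx
      obtain ⟨z, hz, rfl⟩ := hz
      have h5 := hq x hx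
      have h6 := hq z hz
      rw [he x hx] at h5
      rw [he z hz] at h6
      rcases lt_or_gt_of_ne hc with h | h
      · nlinarith
      · nlinarith
    · rw [if_pos h1, if_neg h2, sub_zero, mul_one]
      push Not at h2
      exact facet_sum_of_nonneg h' hS hm hκ hκS hd hσ hw h2
  · have h2 : ∃ x ∈ S, m x < 0 := ⟨y, hy, by
      push Not at h1
      exact (h1 y hy).lt_of_ne hmy⟩
    rw [if_neg h1, if_pos h2]
    push Not at h1
    have := facet_sum_of_nonneg h' hS hm.neg hκ hκS hd hσ hw fun y hy => by
      rw [Pi.neg_apply]; linarith [h1 y hy]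
    simp only [Pi.neg_apply, mul_neg, Finset.sum_neg_distrib] at this
    linarith

open Classical in
include h' in
/-- The contribution of a cone to the balancing condition at a cone of the target. -/
theorem cone_sum (hU : L'.IsUnion (f.toFun '' K.carrier σ)) (hκ : L'.dim (L'.carrier κ) = l)
    (hσ : K.dim (K.carrier σ) = l + 1) {μ : Y → ℝ} (hμ : L.IsDivisor μ)
    (hμκ : ∀ y ∈ L'.carrier κ, μ y = 0) {v : L'.ConesOver (l + 1) κ → Y}
    (hv : ∀ i, L'.IsLatticeNormal i.1.1 κ (v i)) {w : K.ConesOfDim l → X}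
    (hw : ∀ τ : K.ConesOfDim l, K.carrier τ.1 ⊆ K.carrier σ → K.IsLatticeNormal σ τ.1 (w τ)) :
    (if L.dim (f.toFun '' K.carrier σ) = l + 1 then (f.latIndex (isSubcone_carrier σ) : ℝ) *
      ∑ i : L'.ConesOver (l + 1) κ with L'.carrier i.1.1 ⊆ f.toFun '' K.carrier σ, μ (v i) else 0) =
    ∑ τ : K.ConesOfDim l with K.carrier τ.1 ⊆ K.carrier σ ∧
      L'.carrier κ ⊆ f.toFun '' K.carrier τ.1,
      (f.latIndex (isSubcone_carrier τ.1) : ℝ) * μ (f.toFun (w τ)) := by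
  have hS := f.isLinOn (isSubcone_carrier σ) rfl
  have hμS : restr (f.toFun '' K.carrier σ) μ ∈ L.fn (f.toFun '' K.carrier σ) := by
    obtain ⟨j, hj, -⟩ := id hS.isSubcone_image
    rw [hS.isSubcone_image.fn_eq hj, ← restr_restr hj]
    exact AddSubgroup.mem_map_of_mem _ (hμ j)
  have hle := hS.dim_le
  by_cases hκS : L'.carrier κ ⊆ f.toFun '' K.carrier σ
  swap
  · rw [Finset.sum_eq_zero, mul_zero, ite_self, Finset.sum_eq_zero]
    · intro τ hτ
      obtain ⟨-, h1, h2⟩ := Finset.mem_filter.1 hτ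
      exact absurd (h2.trans (Set.image_mono h1)) hκS
    · intro i hi
      exact absurd (i.2.trans (Finset.mem_filter.1 hi).2) hκS
  have hκd := dim_mono (h'.isSubcone κ) hS.isSubcone_image hκS
  rw [← h'.dim_eq] at hκd
  split_ifs with hd
  -- On the image, `μ` is an integral multiple of the conormal function `m` of `κ`. Both sides are
  -- linear in `μ`, so it suffices to compare them for `m`.
  · obtain ⟨m, hm⟩ := exists_conormal (h'.isSubcone κ) hS.isSubcone_image hκS
      (by rw [← h'.dim_eq, hκ, hd])
    obtain ⟨n, hn⟩ := hm.exists_mul hμS fun x hx => by rw [restr_of_mem (hκS hx), hμκ x hx]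
    have hn' : ∀ y ∈ f.toFun '' K.carrier σ, μ y = n * m y := fun y hy => by
      rw [← hn, restr_of_mem hy]
    have h1 := hm.sum_normals h' hS.isSubcone_image hU hκ hκS hd hv
    have h2 := facet_sum h' hS hm hκ hκS hd hσ hw
    have h3 : ∀ i ∈ Finset.univ.filter fun i : L'.ConesOver (l + 1) κ =>
        L'.carrier i.1.1 ⊆ f.toFun '' K.carrier σ, μ (v i) = n * m (v i) := fun i hi => by
      have hi := (Finset.mem_filter.1 hi).2
      exact hn' (v i) (hi (hv i).1)
    rw [Finset.sum_congr rfl h3, ← Finset.mul_sum, h1, mul_left_comm, ← h2, Finset.mul_sum]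
    refine Finset.sum_congr rfl fun τ hτ => ?_
    rw [hn' _ (Set.mem_image_of_mem _ (hw τ (Finset.mem_filter.1 hτ).2.1).1)]
    ring
  -- The image now has the same dimension as `κ`, so `μ` vanishes on it and both sides are zero.
  · have h0 : restr (f.toFun '' K.carrier σ) μ = 0 :=
      eq_zero_of_restr (h'.isSubcone κ) hS.isSubcone_image hκS (by rw [← h'.dim_eq]; omega) hμS
        fun x hx => by rw [restr_of_mem (hκS hx), hμκ x hx]
    refine (Finset.sum_eq_zero fun τ hτ => ?_).symm
    have hmem := Set.mem_image_of_mem f.toFun (hw τ (Finset.mem_filter.1 hτ).2.1).1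
    rw [← restr_of_mem hmem μ, h0, Pi.zero_apply, mul_zero]

end Facets

/-! ### Push-forward of weights and balancing -/

section PushWeight

variable {L' : ConeComplex Y} (h' : L.IsProperSubdivision L') (f : Mor K L) {k l : ℕ}

open Classical in
/-- The push-forward of a weight, as a weight on a subdivision of the target such that the images of
all cones are unions of cones. -/
def pushWeight (L' : ConeComplex Y) (f : Mor K L) {k : ℕ} (c : K.ConesOfDim k → ℤ) :
    L'.ConesOfDim k → ℤ := fun i => ∑ σ : K.ConesOfDim k,
      if L.dim (f.toFun '' K.carrier σ.1) = k ∧ L'.carrier i.1 ⊆ f.toFun '' K.carrier σ.1 then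
        (f.latIndex (isSubcone_carrier σ.1) : ℤ) * c σ else 0

include h' in
-- The image of each cone is the sum of its parts in `L'`. Collecting the coefficient of each cone
-- of `L'` gives `pushWeight`.
theorem push_weight (hU : ∀ σ, L'.IsUnion (f.toFun '' K.carrier σ)) (c : K.ConesOfDim k → ℤ) :
    f.push k (∑ σ, c σ • K.cls k (K.carrier σ.1)) = weightClass h' (pushWeight L' f c) := by
  classical
  rw [map_sum, weightClass_eq_sum]
  simp only [pushWeight, Finset.sum_smul]
  rw [Finset.sum_comm]
  refine Finset.sum_congr rfl fun σ _ => ?_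
  rw [map_zsmul, f.push_cls (isSubcone_carrier σ.1) σ.2]
  by_cases hd : L.dim (f.toFun '' K.carrier σ.1) = k
  · rw [cls_eq_sum h' (f.isSubcone_image (isSubcone_carrier σ.1)) hd (hU σ.1), Finset.smul_sum,
      Finset.smul_sum, Finset.sum_filter]
    refine Finset.sum_congr rfl fun i _ => ?_
    by_cases hi : L'.carrier i.1 ⊆ f.toFun '' K.carrier σ.1
    · rw [if_pos hi, if_pos ⟨hd, hi⟩, smul_smul, mul_comm]
    · rw [if_neg hi, if_neg fun h => hi h.2, zero_smul]
  · rw [cls_of_dim_ne hd, smul_zero, smul_zero]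
    refine (Finset.sum_eq_zero fun i _ => ?_).symm
    rw [if_neg fun h => hd h.1, zero_smul]

open Classical in
theorem sum_conesOver {A : Type*} [AddCommMonoid A] (τ : K.Idx) (g : K.ConesOfDim k → A) :
    ∑ σ : K.ConesOver k τ, g σ.1 = ∑ σ with K.carrier τ ⊆ K.carrier σ.1, g σ :=
  (Finset.sum_subtype (p := fun σ : K.ConesOfDim k => K.carrier τ ⊆ K.carrier σ.1) _
    (fun σ => by simp) g).symm

include h' in
/-- The push-forward of a balanced weight is balanced. -/
theorem pushWeight_balanced (hU : ∀ σ, L'.IsUnion (f.toFun '' K.carrier σ))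
    {c : K.ConesOfDim (l + 1) → ℤ} {κ : L'.Idx} (hκ : L'.dim (L'.carrier κ) = l) {μ : Y → ℝ}
    (hμ : L.IsDivisor μ) (hμκ : ∀ y ∈ L'.carrier κ, μ y = 0)
    (hc : ∀ τ : K.ConesOfDim l, (∀ x ∈ K.carrier τ.1, μ (f.toFun x) = 0) →
      ∀ w : K.ConesOver (l + 1) τ.1 → X, (∀ σ, K.IsLatticeNormal σ.1.1 τ.1 (w σ)) →
      ∑ σ, (c σ.1 : ℝ) * μ (f.toFun (w σ)) = 0)
    {v : L'.ConesOver (l + 1) κ → Y} (hv : ∀ i, L'.IsLatticeNormal i.1.1 κ (v i)) :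
    ∑ i : L'.ConesOver (l + 1) κ, (pushWeight L' f c i.1 : ℝ) * μ (v i) = 0 := by
  classical
  have hw : ∀ (σ : K.ConesOfDim (l + 1)) (τ : K.ConesOfDim l), ∃ w,
      K.carrier τ.1 ⊆ K.carrier σ.1 → K.IsLatticeNormal σ.1 τ.1 w := by
    intro σ τ
    by_cases h : K.carrier τ.1 ⊆ K.carrier σ.1
    · obtain ⟨w, hw⟩ := exists_isLatticeNormal h (by rw [τ.2, σ.2])
      exact ⟨w, fun _ => hw⟩
    · exact ⟨((K.isCone σ.1).exists_zero).choose, fun h' => absurd h' h⟩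
  choose w hw using hw
  have h1 : ∑ i : L'.ConesOver (l + 1) κ, (pushWeight L' f c i.1 : ℝ) * μ (v i) =
      ∑ σ : K.ConesOfDim (l + 1), (c σ : ℝ) *
        if L.dim (f.toFun '' K.carrier σ.1) = l + 1 then
          (f.latIndex (isSubcone_carrier σ.1) : ℝ) * ∑ i : L'.ConesOver (l + 1) κ with
            L'.carrier i.1.1 ⊆ f.toFun '' K.carrier σ.1, μ (v i) else 0 := by
    simp only [pushWeight, Int.cast_sum, Finset.sum_mul]
    rw [Finset.sum_comm]
    refine Finset.sum_congr rfl fun σ _ => ?_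
    by_cases hd : L.dim (f.toFun '' K.carrier σ.1) = l + 1
    · simp only [hd, true_and, if_true]
      rw [Finset.sum_filter, Finset.mul_sum, Finset.mul_sum]
      refine Finset.sum_congr rfl fun i _ => ?_
      split_ifs
      · push_cast; ring
      · simp
    · simp [hd]
  -- Each contribution becomes a sum over facets of `σ`. Exchanging the sums leaves, for each `τ`,
  -- the balancing sum of `c` at `τ`, multiplied by the index on `τ`.
  rw [h1, Finset.sum_congr rfl fun σ _ => by
    rw [cone_sum h' (hU σ.1) hκ σ.2 hμ hμκ hv (hw σ), Finset.sum_filter, Finset.mul_sum],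
    Finset.sum_comm]
  refine Finset.sum_eq_zero fun τ _ => ?_
  -- If the image of `τ` contains `κ`, the two have the same dimension. Hence `μ ∘ f` vanishes on
  -- `τ`, and balancing at `τ` may be tested with it.
  by_cases hκτ : L'.carrier κ ⊆ f.toFun '' K.carrier τ.1
  · have hτ := f.isLinOn (isSubcone_carrier τ.1) rfl
    have h2 := hτ.dim_le
    have h3 := dim_mono (h'.isSubcone κ) hτ.isSubcone_image hκτ
    rw [← h'.dim_eq] at h3
    have h4 := τ.2
    have h0 : restr (f.toFun '' K.carrier τ.1) μ = 0 := by
      refine eq_zero_of_restr (h'.isSubcone κ) hτ.isSubcone_image hκτ (by rw [← h'.dim_eq]; omega) ?_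
        fun x hx => by rw [restr_of_mem (hκτ hx), hμκ x hx]
      obtain ⟨j, hj, -⟩ := id hτ.isSubcone_image
      rw [hτ.isSubcone_image.fn_eq hj, ← restr_restr hj]
      exact AddSubgroup.mem_map_of_mem _ (hμ j)
    have h5 := hc τ (fun x hx => by
      rw [← restr_of_mem (Set.mem_image_of_mem f.toFun hx) μ, h0]; rfl)
      (fun σ => w σ.1 τ) fun σ => hw σ.1 τ σ.2
    rw [sum_conesOver τ.1 fun σ => (c σ : ℝ) * μ (f.toFun (w σ τ)), Finset.sum_filter] at h5
    have h6 : ∀ σ : K.ConesOfDim (l + 1), (c σ : ℝ) * (if K.carrier τ.1 ⊆ K.carrier σ.1 ∧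
        L'.carrier κ ⊆ f.toFun '' K.carrier τ.1 then
          (f.latIndex (isSubcone_carrier τ.1) : ℝ) * μ (f.toFun (w σ τ)) else 0) =
        (f.latIndex (isSubcone_carrier τ.1) : ℝ) * if K.carrier τ.1 ⊆ K.carrier σ.1 then
          (c σ : ℝ) * μ (f.toFun (w σ τ)) else 0 := by
      intro σ
      by_cases h : K.carrier τ.1 ⊆ K.carrier σ.1
      · rw [if_pos ⟨h, hκτ⟩, if_pos h]; ring
      · rw [if_neg fun h' => h h'.1, if_neg h, mul_zero, mul_zero]
    rw [Finset.sum_congr rfl fun σ _ => h6 σ, ← Finset.mul_sum, h5, mul_zero]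
  · refine Finset.sum_eq_zero fun σ _ => ?_
    rw [if_neg fun h => hκτ h.2, mul_zero]

end PushWeight

end ConeComplex

namespace ConeComplex

/-! ### Indices and the quotient by a primitive vector -/

section Lattices

variable {A B C D : Type*} [AddCommGroup A] [AddCommGroup B] [AddCommGroup C] [AddCommGroup D]

/-- The exact sequence splits because `C` is free, so functionals on `A` extend to `B`. -/
theorem dual_surjective {i : A →+ B} {r : B →+ C} (hi : Function.Injective i)
    (hr : Function.Surjective r) (hri : ∀ a, r (i a) = 0)
    (hir : ∀ b, r b = 0 → ∃ a, i a = b) [Module.Free ℤ C] :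
    Function.Surjective (AddMonoidHom.compHom' i : (B →+ ℤ) →+ (A →+ ℤ)) := by
  obtain ⟨s, hs⟩ := Module.projective_lifting_property r.toIntLinearMap LinearMap.id hr
  have hs' : ∀ y, r (s y) = y := fun y => LinearMap.congr_fun hs y
  choose P hP using fun b => hir (b - s (r b)) (by rw [map_sub, hs', sub_self])
  intro n
  refine ⟨n.comp (AddMonoidHom.mk' P fun b b' => hi ?_), AddMonoidHom.ext fun a => ?_⟩
  · rw [map_add, hP, hP, hP, map_add, map_add]
    abel
  · change n (P (i a)) = n a
    refine congrArg n (hi ?_)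
    rw [hP, hri, map_zero, sub_zero]

theorem dualIndex_comp_of_surjective {q : A →+ B} (p : D →+ A)
    (hq : Function.Surjective (AddMonoidHom.compHom' q : (B →+ ℤ) →+ (A →+ ℤ))) :
    dualIndex (q.comp p) = dualIndex p := by
  have : (AddMonoidHom.compHom' (q.comp p) : (B →+ ℤ) →+ (D →+ ℤ)) =
      (AddMonoidHom.compHom' p).comp (AddMonoidHom.compHom' q) := rfl
  rw [dualIndex, dualIndex, this, AddMonoidHom.range_comp, AddMonoidHom.range_eq_top.2 hq,
    ← AddMonoidHom.range_eq_map]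

theorem finrank_eq_of_exists_smul [Module.Finite ℤ A] [Module.Finite ℤ B] (r : A →+ B)
    (hr : Function.Injective r) (h : ∀ b, ∃ n : ℤ, n ≠ 0 ∧ ∃ a, r a = n • b) :
    Module.finrank ℤ A = Module.finrank ℤ B := by
  have h1 : Module.finrank ℤ (LinearMap.range r.toIntLinearMap) = Module.finrank ℤ A :=
    LinearMap.finrank_range_of_inj hr
  have h2 := Submodule.finrank_quotient_add_finrank (LinearMap.range r.toIntLinearMap)
  have h3 : Module.finrank ℤ (B ⧸ LinearMap.range r.toIntLinearMap) = 0 := by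
    rw [Module.finrank_eq_zero_iff]
    intro q
    obtain ⟨b, rfl⟩ := Submodule.Quotient.mk_surjective _ q
    obtain ⟨n, hn, a, ha⟩ := h b
    refine ⟨n, hn, ?_⟩
    rw [← Submodule.Quotient.mk_smul, Submodule.Quotient.mk_eq_zero]
    exact ⟨a, ha⟩
  omega

/-- By the rank hypothesis, the image of `q` is a subgroup of finite index in the kernel of `e`. -/
theorem exists_smul_of_eval_eq_zero [Module.Finite ℤ A] [Module.Free ℤ A] [Module.Finite ℤ D]
    [Module.Free ℤ D] {e : A →+ ℤ} (he : e ≠ 0) {q : D →+ A} (hq : Function.Injective q)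
    (heq : ∀ d, e (q d) = 0) (hd : Module.finrank ℤ D + 1 = Module.finrank ℤ A) {a : A}
    (ha : e a = 0) : ∃ n : ℤ, 0 < n ∧ ∃ d, q d = n • a := by
  let E := e.toIntLinearMap
  have h1 := Submodule.finrank_quotient_add_finrank (LinearMap.ker E)
  rw [LinearEquiv.finrank_eq E.quotKerEquivRange] at h1
  have h2 : Module.finrank ℤ (LinearMap.range E) = 1 := by
    refine le_antisymm ((Submodule.finrank_le _).trans (Module.finrank_self ℤ).le) ?_
    rw [Nat.one_le_iff_ne_zero, Ne, Submodule.finrank_eq_zero, LinearMap.range_eq_bot]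
    exact fun h => he (AddMonoidHom.ext fun a => LinearMap.congr_fun h a)
  let q' : D →+ LinearMap.ker E := (q.toIntLinearMap.codRestrict _ heq).toAddMonoidHom
  obtain ⟨n, hn, d, hd'⟩ := exists_smul_of_finrank (by omega) q'
    (fun x y h => hq (congrArg Subtype.val h)) ⟨a, ha⟩
  exact ⟨n, hn, d, congrArg Subtype.val hd'⟩

theorem eq_smul_of_eval {e n : A →+ ℤ} {x : A} (hx : e x = 1) (h : ∀ y, e y = 0 → n y = 0) :
    n = n x • e := by
  refine AddMonoidHom.ext fun y => ?_
  have h1 := h (y - e y • x) (by rw [map_sub, map_zsmul, hx, smul_eq_mul, mul_one, sub_self])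
  rw [map_sub, map_zsmul, sub_eq_zero] at h1
  rw [h1, AddMonoidHom.smul_apply, smul_eq_mul, smul_eq_mul, mul_comm]

/-- The index of a map of lattices is computed on the sublattice of multiples of a primitive vector
and on a further lattice to which the quotient maps. -/
theorem dualIndex_mul_dualIndex {p : A →+ B} {q : D →+ A} {e : A →+ ℤ} {e' : B →+ ℤ} {b : ℤ}
    (hb : b ≠ 0) (hp : ∀ x, ∃ n : ℤ, 0 < n ∧ ∃ a, p a = n • x) (hep : ∀ a, e' (p a) = b * e a)
    (heq : ∀ d, e (q d) = 0) (hq : ∀ a, e a = 0 → ∃ n : ℤ, 0 < n ∧ ∃ d, q d = n • a) {a₁ : A}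
    (ha₁ : e a₁ = 1) {b₁ : B} (hb₁ : e' b₁ = 1) :
    dualIndex p * dualIndex q = dualIndex (p.comp q) * b.natAbs := by
  -- The index formula is applied to `H` and to the restriction `φ` along `q`. The kernel of `φ` is
  -- generated by `e`, and it meets `H` in the multiples of `b • e`, since `e'` restricts to `b •
  -- e`.
  let H := (AddMonoidHom.compHom' p : (B →+ ℤ) →+ (A →+ ℤ)).range
  let φ : (A →+ ℤ) →+ (D →+ ℤ) := AddMonoidHom.compHom' q
  have h1 : H.map φ = (AddMonoidHom.compHom' (p.comp q) : (B →+ ℤ) →+ (D →+ ℤ)).range := by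
    have : (AddMonoidHom.compHom' (p.comp q) : (B →+ ℤ) →+ (D →+ ℤ)) =
        φ.comp (AddMonoidHom.compHom' p) := rfl
    rw [this, AddMonoidHom.range_comp]
  let ι : ℤ →+ (A →+ ℤ) := zmultiplesHom _ e
  have h2 : φ.ker = ι.range := by
    refine le_antisymm (fun n hn => ?_) ?_
    · refine ⟨n a₁, (eq_smul_of_eval ha₁ fun y hy => ?_).symm⟩
      obtain ⟨m, hm, d, hd⟩ := hq y hy
      have h3 : n (q d) = 0 := DFunLike.congr_fun hn d
      rw [hd, map_zsmul, smul_eq_mul] at h3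
      exact (mul_eq_zero.1 h3).resolve_left hm.ne'
    · rintro _ ⟨z, rfl⟩
      refine AddMonoidHom.ext fun d => ?_
      change (z • e) (q d) = 0
      rw [AddMonoidHom.smul_apply, heq, smul_zero]
  have h3 : H.comap ι = AddSubgroup.zmultiples b := by
    refine le_antisymm ?_ ?_
    · rintro z ⟨n, hn⟩
      have hn : ∀ a, n (p a) = z * e a := fun a => DFunLike.congr_fun hn a
      have h4 := eq_smul_of_eval (n := n) hb₁ fun y hy => by
        obtain ⟨m, hm, a, ha⟩ := hp y
        have h5 : e a = 0 := by
          have h6 := hep a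
          rw [ha, map_zsmul, hy, smul_zero, eq_comm, mul_eq_zero] at h6
          exact h6.resolve_left hb
        have h6 := hn a
        rw [ha, h5, mul_zero, map_zsmul, smul_eq_mul] at h6
        exact (mul_eq_zero.1 h6).resolve_left hm.ne'
      refine ⟨n b₁, ?_⟩
      have h5 := hn a₁
      rw [h4, AddMonoidHom.smul_apply, hep, ha₁, mul_one, mul_one] at h5
      exact h5
    · rw [AddSubgroup.zmultiples_le]
      refine ⟨e', AddMonoidHom.ext fun a => ?_⟩
      exact hep a
  have h4 := index_mul_index_range φ H
  rw [h1, h2, ← AddSubgroup.index_comap, h3, Int.index_zmultiples] at h4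
  exact h4

end Lattices

variable {X : Type u} {Y : Type u'} {K : ConeComplex X} {L : ConeComplex Y}

/-! ### Primitive generators of rays -/

section Rays

variable {ρ : K.Idx} {u : X}

/-- The lattice of functions has rank one, and strong convexity forces its elements to have constant
sign on the ray. An inner point is rescaled so that the non-negative generator has the value `1`
there. -/
theorem exists_isPrimitiveGenerator (hd : K.dim (K.carrier ρ) = 1) :
    ∃ u, K.IsPrimitiveGenerator ρ u := by
  have hS := isSubcone_carrier (K := K) ρ
  have hc := hS.isCone
  have := finite_fn hS
  have := free_fn hS
  obtain ⟨m₀, -, n, hn, hm₀⟩ := exists_coordinate (0 : K.fn (K.carrier ρ) →+ PUnit.{1})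
    (fun _ => ⟨0, rfl⟩) (by rw [Module.finrank_zero_of_subsingleton]; exact hd.symm)
  have hm₀' : ∀ m : K.fn (K.carrier ρ), ∀ x, m.1 x = n m * m₀.1 x := fun m x =>
    (congrFun (congrArg Subtype.val (hm₀ m rfl)) x).trans (zsmul_eq_mul _ _)
  have hne : m₀.1 ≠ 0 := fun h => by
    rw [show m₀ = 0 from Subtype.ext h, map_zero] at hn
    exact zero_ne_one hn
  -- If `m` took both signs, a suitable positive multiple of `y` would be opposite to `x`, against
  -- strong convexity.
  have key : ∀ m : K.fn (K.carrier ρ), ∀ x ∈ K.carrier ρ, ∀ y ∈ K.carrier ρ, 0 < m.1 x →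
      0 ≤ m.1 y := by
    intro m x hx y hy hpos
    by_contra hneg
    obtain ⟨z, hz, hzm⟩ := hc.exists_smul hy (a := m.1 x / -m.1 y)
      (div_nonneg hpos.le (by linarith))
    have hy0 : m₀.1 y ≠ 0 := fun h => by rw [hm₀', h, mul_zero] at hneg; exact hneg le_rfl
    have hnm : (n m : ℝ) ≠ 0 := fun h => by rw [hm₀', h, zero_mul] at hneg; exact hneg le_rfl
    have := hc.salient x hx z hz (fun m' hm' => by
      have h1 : ∀ z, m' z = n ⟨m', hm'⟩ * m₀.1 z := hm₀' ⟨m', hm'⟩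
      rw [hzm m' hm', h1 x, h1 y, hm₀' m x, hm₀' m y]
      field_simp
      ring) m.1 m.2
    linarith
  obtain ⟨x, hx, hmx⟩ := exists_ne_zero hc m₀.2 hne
  obtain ⟨m, hm, hpos, hmx, hgen⟩ : ∃ m ∈ K.fn (K.carrier ρ), (∀ y ∈ K.carrier ρ, 0 ≤ m y) ∧
      0 < m x ∧ ∀ m' ∈ K.fn (K.carrier ρ), ∃ n : ℤ, ∀ y, m' y = n * m y := by
    rcases lt_or_gt_of_ne hmx with h | h
    · have h' : 0 < (-m₀).1 x := by
        change 0 < -(m₀.1 x)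
        linarith
      refine ⟨(-m₀).1, (-m₀).2, fun y hy => key (-m₀) x hx y hy h', h', fun m' hm' =>
        ⟨-n ⟨m', hm'⟩, fun y => ?_⟩⟩
      refine (hm₀' ⟨m', hm'⟩ y).trans ?_
      change _ = _ * -(m₀.1 y)
      push_cast
      ring
    · exact ⟨m₀.1, m₀.2, fun y hy => key m₀ x hx y hy h, h, fun m' hm' =>
        ⟨n ⟨m', hm'⟩, hm₀' ⟨m', hm'⟩⟩⟩
  obtain ⟨t, ht, hti⟩ := hc.exists_inner
  have hmt : 0 < m t := (hpos t ht.1).lt_of_ne' fun h0 => hmx.ne' (ht.2 m hm hpos h0 x hx)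
  obtain ⟨u, hu, hum⟩ := hc.exists_smul ht.1 (a := (m t)⁻¹) (inv_nonneg.2 hmt.le)
  have hmu : m u = 1 := by rw [hum m hm, inv_mul_cancel₀ hmt.ne']
  refine ⟨u, hu, fun m' hm' => ?_, m, by rwa [← fn_carrier], hmu⟩
  rw [← fn_carrier] at hm'
  obtain ⟨l, hl⟩ := hgen m' hm'
  exact ⟨l, by rw [hl, hmu, mul_one]⟩

/-- The points of a ray are the multiples of the primitive generator. -/
theorem IsPrimitiveGenerator.exists_mul (hd : K.dim (K.carrier ρ) = 1)
    (hu : K.IsPrimitiveGenerator ρ u) {x : X} (hx : x ∈ K.carrier ρ) :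
    ∃ a : ℝ, 0 ≤ a ∧ ∀ m ∈ K.M ρ, m x = a * m u := by
  have hS := isSubcone_carrier (K := K) ρ
  have := finite_fn hS
  have := free_fn hS
  obtain ⟨m₀, -, n, hn, hm₀⟩ := exists_coordinate (0 : K.fn (K.carrier ρ) →+ PUnit.{1})
    (fun _ => ⟨0, rfl⟩) (by rw [Module.finrank_zero_of_subsingleton]; exact hd.symm)
  have hm₀' : ∀ m ∈ K.M ρ, ∃ n : ℤ, ∀ x, m x = n * m₀.1 x := fun m hm =>
    ⟨n ⟨m, by rwa [fn_carrier]⟩, fun x =>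
    (congrFun (congrArg Subtype.val (hm₀ ⟨m, by rwa [fn_carrier]⟩ rfl)) x).trans (zsmul_eq_mul _ _)⟩
  obtain ⟨hu, -, m, hm, hmu⟩ := hu
  have h0 : m₀.1 u ≠ 0 := by
    obtain ⟨l, hl⟩ := hm₀' m hm
    intro h
    rw [hl, h, mul_zero] at hmu
    exact zero_ne_one hmu
  have e : ∀ m ∈ K.M ρ, m x = m₀.1 x / m₀.1 u * m u := fun m hm => by
    obtain ⟨l, hl⟩ := hm₀' m hm
    rw [hl, hl]
    field_simp
  refine ⟨_, ?_, e⟩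
  by_contra hneg
  obtain ⟨z, hz, hzm⟩ := (K.isCone ρ).exists_smul hu (a := -(m₀.1 x / m₀.1 u))
    (by linarith)
  have := (K.isCone ρ).salient x hx z hz (fun m hm => by
    rw [hzm m hm, e m hm]
    ring) m hm
  rw [e m hm, hmu, mul_one] at this
  exact hneg this.ge

theorem IsPrimitiveGenerator.isInner (hd : K.dim (K.carrier ρ) = 1)
    (hu : K.IsPrimitiveGenerator ρ u) : IsInner (K.carrier ρ) (K.M ρ) u :=
  ⟨hu.1, fun m hm _ h0 x hx => by
    obtain ⟨a, -, ha⟩ := hu.exists_mul hd hx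
    rw [ha m hm, h0, mul_zero]⟩

variable (K) in
/-- The primitive generator of a ray. -/
def primGen (ρ : K.ConesOfDim 1) : X := (exists_isPrimitiveGenerator ρ.2).choose

theorem isPrimitiveGenerator_primGen (ρ : K.ConesOfDim 1) :
    K.IsPrimitiveGenerator ρ.1 (K.primGen ρ) := (exists_isPrimitiveGenerator ρ.2).choose_spec

/-- A divisor has an integral value at the primitive generator, so the floor in the definition of
the slope loses nothing. -/
theorem raySlope_eq {ψ : X → ℝ} (hψ : K.IsDivisor ψ) (ρ : K.ConesOfDim 1) :
    (K.raySlope ψ ρ.1 : ℝ) = ψ (K.primGen ρ) := by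
  have hu := isPrimitiveGenerator_primGen ρ
  obtain ⟨n, hn⟩ := hu.2.1 _ (hψ ρ.1)
  rw [restr_of_mem hu.1] at hn
  rw [raySlope, dif_pos (exists_isPrimitiveGenerator ρ.2)]
  change ((⌊ψ (K.primGen ρ)⌋ : ℤ) : ℝ) = _
  rw [hn, Int.floor_intCast]

theorem isIntegralPt_of_subset {S : Set X} (hS : K.IsSubcone S) {i : K.Idx}
    (h : K.carrier i ⊆ S) {x : X} (hx : x ∈ K.carrier i) (hi : IsIntegralPt (K.M i) x) :
    IsIntegralPt (K.fn S) x := fun m hm => by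
  have h1 := (isSubcone_carrier i).restr_mem hS h hm
  rw [fn_carrier] at h1
  obtain ⟨n, hn⟩ := hi _ h1
  exact ⟨n, by rw [← hn, restr_of_mem hx]⟩

end Rays

end ConeComplex

namespace ConeComplex

variable {X : Type u} {Y : Type u'} {K : ConeComplex X} {L : ConeComplex Y}

/-- If a map is injective on the span of a cone, it is so on the span of every subcone: up to
multiples, functions on the subcone extend to the cone and descend from there to the image. -/
theorem IsLinOn.dim_eq {π : X → Y} {S S' : Set X} {T T' : Set Y} (h : IsLinOn K L π S T)
    (hd : L.dim T = K.dim S) (h' : IsLinOn K L π S' T') (hs : S' ⊆ S) : L.dim T' = K.dim S' := by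
  have := finite_fn h'.isSubcone
  have := finite_fn h'.isSubcone_image
  have hT : T' ⊆ T := by rw [← h'.image_eq, ← h.image_eq]; exact Set.image_mono hs
  refine finrank_eq_of_exists_smul h'.hom h'.hom_injective fun m => ?_
  obtain ⟨m', hm', hr⟩ := h'.isSubcone.exists_restr h.isSubcone hs m.2
  obtain ⟨n, hn, a, ha, hv⟩ := h.exists_smul' hd hm'
  refine ⟨n, hn.ne', ⟨_, h'.isSubcone_image.restr_mem h.isSubcone_image hT ha⟩,
    Subtype.ext (funext fun x => ?_)⟩
  by_cases hx : x ∈ S'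
  · refine (h'.hom_apply _ hx).trans ?_
    refine (restr_of_mem (h'.mapsTo hx) _).trans ?_
    rw [hv x (hs hx), ← restr_of_mem hx m', hr]
    exact (zsmul_eq_mul _ _).symm
  · rw [h'.isSubcone.isCone.supp _ (h'.hom _).2 x hx, h'.isSubcone.isCone.supp _ (n • m).2 x hx]

theorem isLinOn_refine {K' : ConeComplex X} (h : K.IsProperSubdivision K') (i : K'.Idx) :
    IsLinOn K' K id (K'.carrier i) (K'.carrier i) :=
  h.mor.isLinOn (isSubcone_carrier i) (Set.image_id _)

theorem isLinOn_refine_bijective {K' : ConeComplex X} (h : K.IsProperSubdivision K') (i : K'.Idx) :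
    Function.Bijective (isLinOn_refine h i).hom := by
  refine ⟨(isLinOn_refine h i).hom_injective, fun m => ⟨⟨m.1, ?_⟩, Subtype.ext (funext fun x => ?_)⟩⟩
  · rw [h.fn_carrier, ← ConeComplex.fn_carrier]
    exact m.2
  · by_cases hx : x ∈ K'.carrier i
    · exact IsLinOn.hom_apply _ _ hx
    · exact (restr_of_notMem hx _).trans ((isSubcone_carrier i).isCone.supp _ m.2 x hx).symm

/-! ### Projection of a cone to a star -/

section Projection

variable {t j : K.Idx} (h : K.carrier t ⊆ K.carrier j)

/-- A point of the cone `j` need not lie in the open star of `t`. Adding an inner point of `t` moves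
it there and does not affect functions vanishing on `t`. -/
theorem exists_proj (h : K.carrier t ⊆ K.carrier j) {y : X} (hy : y ∈ K.carrier j) : ∃ p ∈ K.starCarrier t j,
    ∀ m ∈ K.M j, (∀ z ∈ K.carrier t, m z = 0) → ∀ g : K.StarPt t → ℝ,
      (∀ x, g (K.starMk t x) = m x.1) → g p = m y := by
  obtain ⟨s, hs, -, hsh⟩ := exists_shift h
  obtain ⟨x, hx, hxm⟩ := hsh y hy
  exact ⟨_, mem_starCarrier.2 hx, fun m hm h0 g hg => by rw [hg, hxm m hm, h0 s hs, add_zero]⟩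

open Classical in
/-- The projection of the cone `j` to the cone `j / t` of the star. -/
def proj (y : X) : K.StarPt t :=
  if hy : y ∈ K.carrier j then (exists_proj h hy).choose
  else K.starMk t ⟨_, (exists_generic (i := t)).choose_spec.2⟩

theorem proj_mem {y : X} (hy : y ∈ K.carrier j) : proj h y ∈ K.starCarrier t j := by
  rw [proj, dif_pos hy]
  exact (exists_proj h hy).choose_spec.1

theorem apply_proj {y : X} (hy : y ∈ K.carrier j) {m : X → ℝ} (hm : m ∈ K.M j)
    (h0 : ∀ z ∈ K.carrier t, m z = 0) {g : K.StarPt t → ℝ} (hg : ∀ x, g (K.starMk t x) = m x.1) :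
    g (proj h y) = m y := by
  rw [proj, dif_pos hy]
  exact (exists_proj h hy).choose_spec.2 m hm h0 g hg

theorem proj_eq {y : X} (hy : y ∈ K.carrier j) {p : K.StarPt t} (hp : p ∈ K.starCarrier t j)
    (h' : ∀ m ∈ K.M j, (∀ z ∈ K.carrier t, m z = 0) → ∀ g : K.StarPt t → ℝ,
      (∀ x, g (K.starMk t x) = m x.1) → m y = g p) : proj h y = p := by
  refine (star_isCone h).separates _ (proj_mem h hy) _ hp ?_
  rintro g ⟨m, hm, h0, hg⟩
  rw [apply_proj h hy hm h0 hg, h' m hm h0 g hg]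

theorem proj_eq_starMk (x : K.openStar t) (hx : x.1 ∈ K.carrier j) : proj h x.1 = K.starMk t x :=
  proj_eq h hx (mem_starCarrier.2 hx) fun _ _ _ _ hg => (hg x).symm

theorem proj_congr {y y' : X} (hy : y ∈ K.carrier j) (hy' : y' ∈ K.carrier j)
    (h' : ∀ m ∈ K.M j, (∀ z ∈ K.carrier t, m z = 0) → m y = m y') : proj h y = proj h y' :=
  proj_eq h hy (proj_mem h hy') fun m hm h0 _ hg => by
    rw [apply_proj h hy' hm h0 hg, h' m hm h0]

theorem isLinOn_proj {S : Set X} (hS : K.IsSubcone S) (hSj : S ⊆ K.carrier j) :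
    IsLinOn K (K.star t) (proj h) S (proj h '' S) := by
  have hmaps : Set.MapsTo (proj h) S (K.starCarrier t j) := fun y hy => proj_mem h (hSj hy)
  have hpull : ∀ g ∈ K.starM t j, restr S (g ∘ proj h) ∈ K.fn S := by
    rintro g ⟨m, hm, h0, hg⟩
    rw [hS.fn_eq hSj]
    refine ⟨m, hm, funext fun y => ?_⟩
    by_cases hy : y ∈ S
    · rw [restr_of_mem hy, restr_of_mem hy]
      exact (apply_proj h (hSj hy) hm h0 hg).symm
    · rw [restr_of_notMem hy, restr_of_notMem hy]
  have hT : (K.star t).IsSubcone (proj h '' S) :=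
    ⟨⟨j, h⟩, hmaps.image_subset, hS.isCone.image (star_isCone h) hmaps hpull⟩
  refine ⟨hS, hT, rfl, fun m hm => ?_⟩
  rw [hT.fn_eq (i := ⟨j, h⟩) hmaps.image_subset] at hm
  obtain ⟨g, hg, rfl⟩ := hm
  rw [restr_comp (Set.mapsTo_image _ _)]
  exact hpull g hg

/-- Functions pulled back from the star vanish at the points of `t`. -/
theorem isLinOn_proj_apply_eq_zero {S : Set X} (hS : K.IsSubcone S) (hSj : S ⊆ K.carrier j)
    (g : (K.star t).fn (proj h '' S)) {y : X} (hy : y ∈ S) (hyt : y ∈ K.carrier t) :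
    ((isLinOn_proj h hS hSj).hom g).1 y = 0 := by
  have hmaps : Set.MapsTo (proj h) S (K.starCarrier t j) := fun y hy => proj_mem h (hSj hy)
  have hl := isLinOn_proj h hS hSj
  rw [hl.hom_apply g hy]
  obtain ⟨g, hg⟩ := g
  rw [hl.isSubcone_image.fn_eq (i := ⟨j, h⟩) hmaps.image_subset] at hg
  obtain ⟨g, ⟨m, hm, h0, hgm⟩, rfl⟩ := hg
  exact (restr_of_mem (Set.mem_image_of_mem _ hy) _).trans
    ((apply_proj h (hSj hy) hm h0 hgm).trans (h0 y hyt))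

theorem proj_image_carrier : proj h '' K.carrier j = K.starCarrier t j := by
  refine Set.Subset.antisymm ?_ ?_
  · rintro _ ⟨y, hy, rfl⟩
    exact proj_mem h hy
  · rintro _ ⟨x, hx, rfl⟩
    exact ⟨x.1, hx, proj_eq_starMk h x hx⟩

theorem isLinOn_proj_carrier : IsLinOn K (K.star t) (proj h) (K.carrier j) (K.starCarrier t j) := by
  have := isLinOn_proj h (isSubcone_carrier j) subset_rfl
  rwa [proj_image_carrier] at this

theorem exists_proj_carrier_hom {m : K.fn (K.carrier j)} (h0 : ∀ z ∈ K.carrier t, m.1 z = 0) :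
    ∃ g, (isLinOn_proj_carrier h).hom g = m := by
  have hm : m.1 ∈ K.M j := (fn_carrier j).le m.2
  obtain ⟨g, hg, hgm⟩ := exists_star_fn hm h0
  have hg' : g ∈ (K.star t).fn (K.starCarrier t j) := by
    have := fn_carrier (K := K.star t) ⟨j, h⟩
    exact this.symm ▸ hg
  refine ⟨⟨g, hg'⟩, Subtype.ext (funext fun y => ?_)⟩
  by_cases hy : y ∈ K.carrier j
  · exact (IsLinOn.hom_apply _ _ hy).trans (apply_proj h hy hm h0 hgm)
  · exact (restr_of_notMem hy _).trans ((isSubcone_carrier j).isCone.supp _ m.2 y hy).symm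

theorem proj_carrier_hom_eq_zero (g : (K.star t).fn (K.starCarrier t j)) {z : X}
    (hz : z ∈ K.carrier t) : ((isLinOn_proj_carrier h).hom g).1 z = 0 := by
  obtain ⟨g, hg⟩ := g
  have hg' : g ∈ K.starM t j := (fn_carrier (K := K.star t) ⟨j, h⟩).le hg
  obtain ⟨m, hm, h0, hg''⟩ := hg'
  exact (IsLinOn.hom_apply _ _ (h hz)).trans ((apply_proj h (h hz) hm h0 hg'').trans (h0 z hz))

/-- Functions on `j / t` are those on `j` with zero restriction to `t`, and the lattice of functions
on `t` is free. Dually, the lattice of `j` maps onto that of `j / t`. -/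
theorem proj_carrier_dual_surjective : Function.Surjective
    (AddMonoidHom.compHom' (isLinOn_proj_carrier h).hom :
      (K.fn (K.carrier j) →+ ℤ) →+ ((K.star t).fn (K.starCarrier t j) →+ ℤ)) := by
  have := free_fn (isSubcone_carrier (K := K) t)
  refine dual_surjective (isLinOn_proj_carrier h).hom_injective
    (resHom_surjective (isSubcone_carrier t) (isSubcone_carrier j) h) (fun g => ?_) fun m hm => ?_
  · exact resHom_eq_zero.2 fun x hx => proj_carrier_hom_eq_zero h g hx
  · exact exists_proj_carrier_hom h (resHom_eq_zero.1 hm)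

/-- Rank and nullity of the restriction from `j` to `t`, whose kernel consists of the functions on
`j / t`. -/
theorem dim_starCarrier (h : K.carrier t ⊆ K.carrier j) :
    (K.star t).dim (K.starCarrier t j) + K.dim (K.carrier t) = K.dim (K.carrier j) := by
  have ht := isSubcone_carrier (K := K) t
  have hj := isSubcone_carrier (K := K) j
  let r := (resHom ht hj h).toIntLinearMap
  have := finite_fn hj
  have h1 := Submodule.finrank_quotient_add_finrank (LinearMap.ker r)
  rw [LinearEquiv.finrank_eq (r.quotKerEquivOfSurjective (resHom_surjective ht hj h))] at h1
  let e := (isLinOn_proj_carrier h).hom.toIntLinearMap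
  have h2 : LinearMap.range e = LinearMap.ker r := by
    ext m
    constructor
    · rintro ⟨g, rfl⟩
      exact (resHom_eq_zero (hκ := ht) (hS := hj) (h := h)).2
        fun x hx => proj_carrier_hom_eq_zero h g hx
    · exact fun hm => exists_proj_carrier_hom h ((resHom_eq_zero (hκ := ht) (hS := hj) (h := h)).1 hm)
  rw [← h2, LinearMap.finrank_range_of_inj (isLinOn_proj_carrier h).hom_injective, add_comm] at h1
  exact h1

end Projection

/-! ### Induced maps of stars in terms of projections -/

section StarMap

variable {f : Mor K L} {ρ σ : K.Idx} {j : L.Idx}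

/-- Functions vanishing on the target of `ρ` pull back to functions vanishing on `ρ`. They take the
same values at the two points, and they separate the points of the star. -/
theorem Mor.starFun_proj (hρ : K.carrier ρ ⊆ K.carrier σ)
    (hj : Set.MapsTo f.toFun (K.carrier σ) (L.carrier j))
    (ht : L.carrier (f.target ρ) ⊆ L.carrier j) {x : X} (hx : x ∈ K.carrier σ) :
    f.starFun ρ (proj hρ x) = proj ht (f.toFun x) := by
  obtain ⟨x', hx', he⟩ := proj_mem hρ hx
  rw [← he]
  have h1 : f.starFun ρ (K.starMk ρ x') = L.starMk (f.target ρ) ⟨f.toFun x'.1, fun j hj => by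
    obtain ⟨k, -, hik, hkj⟩ := f.mapsTo_of_mem x' hj
    exact f.target_subset (hkj.mono_left hik)⟩ := rfl
  rw [h1, ← proj_eq_starMk ht _ (hj hx')]
  refine proj_congr ht (hj hx') (hj hx) fun m hm h0 => ?_
  have h2 := f.restr_comp_mem hj hm
  have h3 : ∀ z ∈ K.carrier ρ, restr (K.carrier σ) (m ∘ f.toFun) z = 0 := fun z hz => by
    rw [restr_of_mem (hρ hz)]; exact h0 _ (f.mapsTo_target ρ hz)
  obtain ⟨g, -, hg⟩ := exists_star_fn h2 h3
  have h4 := apply_proj hρ hx h2 h3 hg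
  rw [← he, hg, restr_of_mem hx', restr_of_mem hx] at h4
  exact h4

theorem Mor.starFun_image (hρ : K.carrier ρ ⊆ K.carrier σ)
    (hj : Set.MapsTo f.toFun (K.carrier σ) (L.carrier j))
    (ht : L.carrier (f.target ρ) ⊆ L.carrier j) :
    f.starFun ρ '' K.starCarrier ρ σ = proj ht '' (f.toFun '' K.carrier σ) := by
  rw [← proj_image_carrier hρ, Set.image_image, Set.image_image]
  exact Set.image_congr fun x hx => f.starFun_proj hρ hj ht hx

/-- The lattice of `σ` maps onto that of `σ / ρ`. Hence the image of the lattice of `σ / ρ` can be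
computed from `σ`, by first applying `f` and then projecting. -/
theorem Mor.starMap_latIndex {S : Set Y} (hρ : K.carrier ρ ⊆ K.carrier σ)
    (hS : IsLinOn K L f.toFun (K.carrier σ) S) (hj : S ⊆ L.carrier j)
    (ht : L.carrier (f.target ρ) ⊆ L.carrier j) (hσ : (K.star ρ).IsSubcone (K.starCarrier ρ σ)) :
    (f.starMap ρ).latIndex hσ =
      dualIndex (hS.hom.comp (isLinOn_proj ht hS.isSubcone_image hj).hom) := by
  obtain rfl := hS.image_eq
  have hj' := Set.mapsTo_iff_image_subset.2 hj
  have hA : IsLinOn (K.star ρ) (L.star (f.target ρ)) (f.starMap ρ).toFun (K.starCarrier ρ σ)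
      (proj ht '' (f.toFun '' K.carrier σ)) :=
    (f.starMap ρ).isLinOn hσ (f.starFun_image hρ hj' ht)
  have hB := isLinOn_proj_carrier hρ
  have hC := (isLinOn_proj ht hS.isSubcone_image hj).comp hS
  have e : (hA.comp hB).hom = hC.hom :=
    (hA.comp hB).hom_congr hC fun x hx => f.starFun_proj hρ hj' ht hx
  rw [hA.hom_comp hB, (isLinOn_proj ht hS.isSubcone_image hj).hom_comp hS] at e
  rw [(f.starMap ρ).latIndex_eq_dualIndex hσ hA, ← e]
  exact (dualIndex_comp_of_surjective _ (proj_carrier_dual_surjective hρ)).symm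

open Classical in
theorem Mor.extPush_of_cls {S : Set Y} {k : ℕ} (hρd : K.dim (K.carrier ρ) = 1)
    (hσ : K.dim (K.carrier σ) = k + 1) (hρ : K.carrier ρ ⊆ K.carrier σ)
    (hS : IsLinOn K L f.toFun (K.carrier σ) S) (hj : S ⊆ L.carrier j)
    (ht : L.carrier (f.target ρ) ⊆ L.carrier j) :
    f.extPush k (DirectSum.of (fun i => (K.star i).Weight k) ρ
      ((K.star ρ).cls k (K.starCarrier ρ σ))) =
    DirectSum.of (fun i => (L.star i).Weight k) (f.target ρ)
      ((dualIndex (hS.hom.comp (isLinOn_proj ht hS.isSubcone_image hj).hom) : ℤ) •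
        (L.star (f.target ρ)).cls k (proj ht '' S)) := by
  have hσ' : (K.star ρ).IsSubcone (K.starCarrier ρ σ) := isSubcone_carrier (K := K.star ρ) ⟨σ, hρ⟩
  have hd := dim_starCarrier hρ
  rw [Mor.extPush, DirectSum.toAddMonoid_of, AddMonoidHom.comp_apply,
    (f.starMap ρ).push_cls hσ' (by omega), f.starMap_latIndex hρ hS hj ht]
  obtain rfl := hS.image_eq
  congr 3
  exact f.starFun_image hρ (Set.mapsTo_iff_image_subset.2 hj) ht

end StarMap

end ConeComplex

namespace ConeComplex

variable {X : Type u} {Y : Type u'} {K : ConeComplex X} {L : ConeComplex Y}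

/-- The evaluation of functions at an integral point. -/
def intEval {M : AddSubgroup (X → ℝ)} {x : X} (h : IsIntegralPt M x) : M →+ ℤ :=
  AddMonoidHom.mk' (fun m => (h m.1 m.2).choose) fun m m' => by
    have h1 := (h m.1 m.2).choose_spec
    have h2 := (h m'.1 m'.2).choose_spec
    have h3 := (h (m + m').1 (m + m').2).choose_spec
    have h4 : (m + m').1 x = m.1 x + m'.1 x := rfl
    rw [h1, h2, h3] at h4
    exact_mod_cast h4

theorem intEval_eq {M : AddSubgroup (X → ℝ)} {x : X} (h : IsIntegralPt M x) (m : M) :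
    (intEval h m : ℝ) = m.1 x := (h m.1 m.2).choose_spec.symm

theorem intEval_eq_zero {M : AddSubgroup (X → ℝ)} {x : X} {h : IsIntegralPt M x} {m : M} :
    intEval h m = 0 ↔ m.1 x = 0 := by
  rw [← intEval_eq h, Int.cast_eq_zero]

theorem dim_eq_one {S : Set X} (hS : K.IsSubcone S) {x : X} (hx : IsIntegralPt (K.fn S) x)
    (h : ∀ m ∈ K.fn S, m x = 0 → m = 0) (hne : ∃ m ∈ K.fn S, m x ≠ 0) : K.dim S = 1 := by
  have := finite_fn hS
  have := free_fn hS
  have hi : Function.Injective (intEval hx).toIntLinearMap := by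
    refine (injective_iff_map_eq_zero (intEval hx)).2 fun m hm => Subtype.ext ?_
    exact h m.1 m.2 (intEval_eq_zero.1 hm)
  have h1 := LinearMap.finrank_le_finrank_of_injective hi
  rw [Module.finrank_self] at h1
  refine le_antisymm h1 (Nat.one_le_iff_ne_zero.2 fun h0 => ?_)
  obtain ⟨m, hm, hmx⟩ := hne
  have h2 : Subsingleton (K.fn S) := (Module.finrank_eq_zero_iff_of_free ℤ _).1 h0
  have h3 : (⟨m, hm⟩ : K.fn S) = 0 := Subsingleton.elim _ _
  exact hmx (congrFun (congrArg Subtype.val h3) x)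

/-! ### Passage to full-dimensional parts -/

section Restriction

variable {π : X → Y} {S S' : Set X} {T T' : Set Y}

theorem resHom_image_injective (h : IsLinOn K L π S T) (h' : IsLinOn K L π S' T') (hs : S' ⊆ S)
    (ht : T' ⊆ T) (hd : K.dim S' = K.dim S) :
    Function.Injective (resHom h'.isSubcone_image h.isSubcone_image ht) := by
  refine resHom_injective _ _ _ fun m hm h0 => ?_
  have : (h.hom ⟨m, hm⟩).1 = 0 := eq_zero_of_restr h'.isSubcone h.isSubcone hs hd
    (h.hom ⟨m, hm⟩).2 fun x hx => (h.hom_apply ⟨m, hm⟩ (hs hx)).trans (h0 _ (h'.mapsTo hx))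
  exact congrArg Subtype.val (h.hom_injective (a₁ := ⟨m, hm⟩) (a₂ := 0)
    (by rw [map_zero]; exact Subtype.ext this))

theorem IsLinOn.image_subset (h : IsLinOn K L π S T) (h' : IsLinOn K L π S' T') (hs : S' ⊆ S) :
    T' ⊆ T := by
  rw [← h'.image_eq, ← h.image_eq]; exact Set.image_mono hs

theorem IsLinOn.dim_image_eq (h : IsLinOn K L π S T) (h' : IsLinOn K L π S' T') (hs : S' ⊆ S)
    (hd : K.dim S' = K.dim S) : L.dim T' = L.dim T :=
  (LinearEquiv.finrank_eq (LinearEquiv.ofBijective (resHom h'.isSubcone_image h.isSubcone_image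
    (h.image_subset h' hs)).toIntLinearMap ⟨resHom_image_injective h h' hs (h.image_subset h' hs) hd,
      resHom_surjective h'.isSubcone_image h.isSubcone_image (h.image_subset h' hs)⟩)).symm

/-- Restriction to a full-dimensional part is an isomorphism of the lattices of functions, both for
the source and for the image. -/
theorem IsLinOn.dualIndex_eq (h : IsLinOn K L π S T) (h' : IsLinOn K L π S' T') (hs : S' ⊆ S)
    (hd : K.dim S' = K.dim S) : dualIndex h'.hom = dualIndex h.hom := by
  have ht := h.image_subset h' hs
  let r := resHom h'.isSubcone h.isSubcone hs
  let r' := resHom h'.isSubcone_image h.isSubcone_image ht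
  have hr : Function.Bijective r := ⟨resHom_injective _ _ _ fun m hm h0 =>
    eq_zero_of_restr h'.isSubcone h.isSubcone hs hd hm h0, resHom_surjective _ _ _⟩
  have hr' : Function.Bijective r' :=
    ⟨resHom_image_injective h h' hs ht hd, resHom_surjective _ _ _⟩
  have e : r.comp h.hom = h'.hom.comp r' := by
    refine AddMonoidHom.ext fun m => Subtype.ext (funext fun x => ?_)
    by_cases hx : x ∈ S'
    · exact (restr_of_mem hx _).trans ((h.hom_apply m (hs hx)).trans
        ((h'.hom_apply (r' m) hx).trans (restr_of_mem (h'.mapsTo hx) _)).symm)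
    · exact (restr_of_notMem hx _).trans (restr_of_notMem hx _).symm
  have e1 := dualIndex_comp_of_surjective h.hom (bijective_dual r hr.1 hr.2).2
  rw [e, dualIndex_comp _ _ fun b => ⟨1, one_pos, by
    obtain ⟨a, ha⟩ := hr'.2 b
    exact ⟨a, by rw [ha, one_smul]⟩⟩, dualIndex_of_bijective hr', mul_one] at e1
  exact e1

end Restriction

/-! ### Projection of the parts of a cone along a ray -/

section ProjTerm

variable {j t : L.Idx} {S : Set Y}

/-- Functions on the projection pull back to functions vanishing at `y`. Since the projection loses
exactly one dimension, these have finite index among all functions vanishing at `y`. -/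
theorem exists_proj_hom (ht : L.carrier t ⊆ L.carrier j) (hS : L.IsSubcone S)
    (hSj : S ⊆ L.carrier j) {y : Y} (hy : y ∈ S) (hyt : y ∈ L.carrier t)
    (hyi : IsIntegralPt (L.fn S) y) (hne : ∃ m ∈ L.fn S, m y ≠ 0)
    (hd : (L.star t).dim (proj ht '' S) + 1 = L.dim S) (m : L.fn S) (hm : m.1 y = 0) :
    ∃ n : ℤ, 0 < n ∧ ∃ g, (isLinOn_proj ht hS hSj).hom g = n • m := by
  have hl := isLinOn_proj ht hS hSj
  have := finite_fn hS
  have := free_fn hS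
  have := finite_fn hl.isSubcone_image
  have := free_fn hl.isSubcone_image
  refine exists_smul_of_eval_eq_zero (e := intEval hyi) (fun h => ?_) hl.hom_injective
    (fun g => intEval_eq_zero.2 (isLinOn_proj_apply_eq_zero ht hS hSj g hy hyt)) hd
    (intEval_eq_zero.2 hm)
  obtain ⟨m, hm, hmy⟩ := hne
  exact hmy ((intEval_eq_zero (m := ⟨m, hm⟩)).1 (DFunLike.congr_fun h _))

/-- If the projection along `y` lowers the dimension by one, then `y` spans a ray of `S`. -/
theorem exists_ray_fn (ht : L.carrier t ⊆ L.carrier j) (hS : L.IsSubcone S)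
    (hSj : S ⊆ L.carrier j) {y : Y} (hy : y ∈ S) (hyt : y ∈ L.carrier t)
    (hyi : IsIntegralPt (L.fn S) y) (hne : ∃ m ∈ L.fn S, m y ≠ 0)
    (hd : (L.star t).dim (proj ht '' S) + 1 = L.dim S) :
    ∃ m ∈ L.fn S, (∀ x ∈ S, 0 ≤ m x) ∧ m y = 0 ∧
      ∀ m' ∈ L.fn S, m' y = 0 → ∀ x ∈ S, m x = 0 → m' x = 0 := by
  have hl := isLinOn_proj ht hS hSj
  have hc := hl.isSubcone_image.isCone
  obtain ⟨B, hB, hB'⟩ := hc.exists_ineq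
  have hv : ∀ x ∈ S, (hl.hom (∑ b ∈ B, b)).1 x = ∑ b ∈ B, b.1 (proj ht x) := fun x hx => by
    rw [hl.hom_apply _ hx, AddSubgroup.val_finsetSum, Finset.sum_apply]
  -- Where the sum of all inequalities of the projected cone vanishes, each of them vanishes. The
  -- projected cone then contains the negative of the projected point, so by strong convexity all
  -- functions on it vanish there.
  refine ⟨(hl.hom (∑ b ∈ B, b)).1, (hl.hom (∑ b ∈ B, b)).2, fun x hx => ?_,
    isLinOn_proj_apply_eq_zero ht hS hSj _ hy hyt, fun m' hm' h0 x hx hmx => ?_⟩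
  · rw [hv x hx]
    exact Finset.sum_nonneg fun b hb => hB b hb _ (hl.mapsTo hx)
  · rw [hv x hx, Finset.sum_eq_zero_iff_of_nonneg fun b hb => hB b hb _ (hl.mapsTo hx)] at hmx
    obtain ⟨z, hz, hzm⟩ := hB' (-evalAt _ (proj ht x)) fun b hb => by
      rw [AddMonoidHom.neg_apply, evalAt_apply, hmx b hb, neg_zero]
    obtain ⟨n, hn, g, hg⟩ := exists_proj_hom ht hS hSj hy hyt hyi hne hd ⟨m', hm'⟩ h0
    have h1 := hc.salient _ (hl.mapsTo hx) z hz (fun m hm => by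
      refine (congrArg (m (proj ht x) + ·) (hzm ⟨m, hm⟩)).trans ?_
      exact add_neg_cancel (m (proj ht x))) g.1 g.2
    rw [← hl.hom_apply g hx, hg] at h1
    have h2 : (n : ℝ) * m' x = 0 := (zsmul_eq_mul _ _).symm.trans h1
    exact (mul_eq_zero.1 h2).resolve_left (by exact_mod_cast hn.ne')

open Classical in
/-- The class of the projection of `S` to the star at `t`, with the index of the projection as its
multiplicity. -/
def projTerm (hS : L.IsSubcone S) (hSj : S ⊆ L.carrier j) (k : ℕ) (t : L.Idx)
    (ht : L.carrier t ⊆ L.carrier j) : L.ExtWeight k :=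
  DirectSum.of (fun i => (L.star i).Weight k) t
    ((dualIndex (isLinOn_proj ht hS hSj).hom : ℤ) • (L.star t).cls k (proj ht '' S))

theorem projTerm_congr (hS : L.IsSubcone S) (hSj : S ⊆ L.carrier j) (k : ℕ) {t t' : L.Idx}
    (h : t = t') (ht : L.carrier t ⊆ L.carrier j) :
    projTerm hS hSj k t ht = projTerm hS hSj k t' (h ▸ ht) := by
  subst h; rfl

theorem Mor.target_eq_minCone (f : Mor K L) {i : K.Idx} {x : X}
    (hx : IsInner (K.carrier i) (K.M i) x) : f.target i = L.minCone (f.toFun x) := by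
  refine L.carrier_injective (Set.Subset.antisymm (f.target_subset ?_)
    (minCone_subset (f.mapsTo_target i hx.1)))
  exact f.mapsTo_of_minimal hx.1 (fun j hj => subset_of_isInner hx hj) (L.mem_minCone _)

variable {L' : ConeComplex Y} (h' : L.IsProperSubdivision L')

theorem IsProperSubdivision.target_mor (i : L'.Idx) :
    L'.carrier i ⊆ L.carrier (h'.mor.target i) := fun _ hx => h'.mor.mapsTo_target i hx

/-- Primitive generators of rays are primitive in all larger cones. -/
theorem IsPrimitiveGenerator.of_subset (hS : L.IsSubcone S) {ρ : L'.Idx}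
    (hρ : L'.carrier ρ ⊆ S) {y : Y} (h' : L.IsProperSubdivision L')
    (hy : L'.IsPrimitiveGenerator ρ y) :
    IsIntegralPt (L.fn S) y ∧ ∃ m ∈ L.fn S, m y = 1 := by
  refine ⟨fun m hm => ?_, ?_⟩
  · obtain ⟨n, hn⟩ := hy.2.1 _ (h'.fn_carrier ρ ▸ (h'.isSubcone ρ).restr_mem hS hρ hm)
    exact ⟨n, by rw [← hn, restr_of_mem hy.1]⟩
  · obtain ⟨m, hm, hmy⟩ := hy.2.2
    obtain ⟨m', hm', hr⟩ := (h'.isSubcone ρ).exists_restr hS hρ (h'.fn_carrier ρ ▸ hm)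
    exact ⟨m', hm', by rw [← hmy, ← hr, restr_of_mem hy.1]⟩

open Classical in
/-- The classes of the projections of the parts of a subdivision around a ray. -/
theorem sum_projTerm {k : ℕ} (hS : L.IsSubcone S) (hSj : S ⊆ L.carrier j) (hU : L'.IsUnion S)
    (hd : L.dim S = k + 1) (ρ : L'.ConesOfDim 1) (hρ : L'.carrier ρ.1 ⊆ S)
    (hρt : L'.carrier ρ.1 ⊆ L.carrier t) (ht : L.carrier t ⊆ L.carrier j) :
    ∑ i : {i : L'.ConesOfDim (k + 1) // L'.carrier i.1 ⊆ S} with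
      L'.carrier ρ.1 ⊆ L'.carrier i.1.1,
      projTerm (h'.isSubcone i.1.1) (i.2.trans hSj) k t ht = projTerm hS hSj k t ht := by
  have hl := isLinOn_proj ht hS hSj
  have hli : ∀ i : {i : L'.ConesOfDim (k + 1) // L'.carrier i.1 ⊆ S}, IsLinOn L (L.star t)
    (proj ht) (L'.carrier i.1.1) (proj ht '' L'.carrier i.1.1) := fun i =>
    isLinOn_proj ht (h'.isSubcone i.1.1) (i.2.trans hSj)
  have hdi : ∀ i : {i : L'.ConesOfDim (k + 1) // L'.carrier i.1 ⊆ S},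
    L.dim (L'.carrier i.1.1) = L.dim S := fun i => by rw [← h'.dim_eq, hd]; exact i.1.2
  simp only [projTerm]
  rw [← map_sum]
  congr 1
  rw [Finset.sum_congr rfl fun i _ => by rw [hl.dualIndex_eq (hli i) i.2 (hdi i)],
    ← Finset.smul_sum]
  congr 1
  have hdT := fun i => hl.dim_image_eq (hli i) i.2 (hdi i)
  by_cases hk : (L.star t).dim (proj ht '' S) = k
  swap
  · rw [cls_of_dim_ne hk, Finset.sum_eq_zero]
    exact fun i _ => cls_of_dim_ne ((hdT i).trans_ne hk)
  have hu := isPrimitiveGenerator_primGen ρ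
  have hin := hu.isInner ρ.2
  set u := L'.primGen ρ
  obtain ⟨hui, m₁, hm₁, hmu⟩ := hu.of_subset hS hρ h'
  refine (cls_eq_sum_of_separated _ (fun i : {i : L'.ConesOfDim (k + 1) // L'.carrier i.1 ⊆ S} =>
    proj ht '' L'.carrier i.1.1) hl.isSubcone_image hk (fun i _ => (hli i).isSubcone_image)
    (fun i _ => (hdT i).trans hk) ?_ fun i hi i' hi' hne => ?_).symm
  -- The projections of the parts around `ρ` cover that of `S`: from the generator `u` of `ρ`, a
  -- step `δ y` leads into a part around `ρ`. Rescaling by `δ⁻¹` gives a point with the same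
  -- projection as `y`, because `u` lies in `t`.
  · refine Set.Subset.antisymm ?_ (Set.iUnion₂_subset fun i _ => Set.image_mono i.2)
    rintro _ ⟨y, hy, rfl⟩
    obtain ⟨i, hρi, hi, ha⟩ := exists_over h' hS hU hρ hin hy
    obtain ⟨δ, hδ, x, hx, hxm⟩ := ha.exists
    obtain ⟨i', hii', hi', hdi'⟩ := exists_full h' hS hU hi
    obtain ⟨z, hz, hzm⟩ := (L'.isCone i').exists_smul (hii' hx) (inv_nonneg.2 hδ.le)
    refine Set.mem_iUnion₂.2 ⟨⟨⟨i', hdi'.trans hd⟩, hi'⟩,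
      Finset.mem_filter.2 ⟨Finset.mem_univ _, hρi.trans hii'⟩, z, hz, ?_⟩
    refine proj_congr ht (hSj (hi' hz)) (hSj hy) fun m hm h0 => ?_
    have h1 : restr S m ∈ L.fn S := by
      rw [hS.fn_eq hSj]; exact AddSubgroup.mem_map_of_mem _ hm
    have h2 := hzm _ (h'.fn_carrier i' ▸ (h'.isSubcone i').restr_mem hS hi' h1)
    have h3 := hxm _ h1
    rw [restr_of_mem (hi (hx)), restr_of_mem hy, restr_of_mem (hρ hu.1), h0 _ (hρt hu.1),
      zero_add] at h3
    rw [restr_of_mem hz, restr_of_mem (hii' hx), restr_of_mem (hi' hz),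
      restr_of_mem (hi' (hii' hx)), h3, inv_mul_cancel_left₀ hδ.ne'] at h2
    exact h2
  -- A function separating two parts around `ρ` vanishes at `u`, so a multiple of it comes from the
  -- projection and separates the projected parts.
  · obtain ⟨m, hm, hm0, h1, h2⟩ := exists_separation h' hS (i := i.1.1) (j := i'.1.1)
      (fun he => hne (Subtype.ext (Subtype.ext he))) i.2 i'.2
    have hmu0 : m u = 0 := le_antisymm (h2 _ ((Finset.mem_filter.1 hi').2 hu.1))
      (h1 _ ((Finset.mem_filter.1 hi).2 hu.1))
    obtain ⟨n, hn, g, hg⟩ := exists_proj_hom ht hS hSj (hρ hu.1) (hρt hu.1) hui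
      ⟨m₁, hm₁, by rw [hmu]; exact one_ne_zero⟩ (by rw [hk, hd]) ⟨m, hm⟩ hmu0
    have hn' : (0 : ℝ) < n := by exact_mod_cast hn
    have hgv : ∀ x ∈ S, g.1 (proj ht x) = n * m x := fun x hx => by
      rw [← hl.hom_apply g hx, hg]
      exact zsmul_eq_mul _ _
    refine ⟨g.1, g.2, fun h0 => ?_, ?_, ?_⟩
    · obtain ⟨x, hx, hmx⟩ := exists_ne_zero hS.isCone hm hm0
      have := hgv x hx
      rw [h0] at this
      exact mul_ne_zero hn'.ne' hmx this.symm
    · rintro _ ⟨x, hx, rfl⟩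
      rw [hgv x (i.2 hx)]
      exact mul_nonneg hn'.le (h1 x hx)
    · rintro _ ⟨x, hx, rfl⟩
      rw [hgv x (i'.2 hx)]
      exact mul_nonpos_of_nonneg_of_nonpos hn'.le (h2 x hx)

end ProjTerm

end ConeComplex

namespace ConeComplex

variable {X : Type u} {Y : Type u'} {K : ConeComplex X} {L : ConeComplex Y}

theorem IsDivisor.restr_mem {ψ : X → ℝ} (hψ : K.IsDivisor ψ) {S : Set X} (hS : K.IsSubcone S) :
    restr S ψ ∈ K.fn S := by
  obtain ⟨j, hj, -⟩ := id hS
  rw [hS.fn_eq hj, ← restr_restr hj]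
  exact AddSubgroup.mem_map_of_mem _ (hψ j)

theorem IsDivisor.comp {ψ : Y → ℝ} (hψ : L.IsDivisor ψ) (f : Mor K L) :
    K.IsDivisor (ψ ∘ f.toFun) := fun i => by
  have h := f.isLinOn (isSubcone_carrier i) rfl
  have h1 := h.restr_comp_mem _ (hψ.restr_mem h.isSubcone_image)
  rwa [restr_comp h.mapsTo, fn_carrier] at h1

/-! ### Rays of a subcone and the behaviour of indices -/

section Rays

variable {L' : ConeComplex Y} (h' : L.IsProperSubdivision L') {S : Set Y} {j t : L.Idx}

theorem mem_of_smul (h' : L.IsProperSubdivision L') (hS : L.IsSubcone S) {i : L'.Idx}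
    (hi : L'.carrier i ⊆ S) {x y : Y} (hx : x ∈ L'.carrier i) (hy : y ∈ S) {a : ℝ} (ha : 0 ≤ a)
    (h : ∀ m ∈ L.fn S, m y = a * m x) : y ∈ L'.carrier i := by
  obtain ⟨z, hz, hzm⟩ := (L'.isCone i).exists_smul hx ha
  rwa [hS.isCone.separates y hy z (hi hz) fun m hm => by
    have := hzm _ (h'.fn_carrier i ▸ (h'.isSubcone i).restr_mem hS hi hm)
    rw [restr_of_mem hz, restr_of_mem hx] at this
    rw [h m hm, this]]

theorem minCone_subset_of_isUnion (hU : L'.IsUnion S) {y : Y} (hy : y ∈ S) :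
    L'.carrier (L'.minCone y) ⊆ S := by
  obtain ⟨i, hi, hi'⟩ := hU y hy
  exact (minCone_subset hi).trans hi'

theorem minCone_eq_of_smul (h' : L.IsProperSubdivision L') (hS : L.IsSubcone S)
    (hU : L'.IsUnion S) {x y : Y} (hx : x ∈ S) (hy : y ∈ S) {a : ℝ} (ha : 0 < a)
    (h : ∀ m ∈ L.fn S, m y = a * m x) : L'.minCone y = L'.minCone x := by
  refine L'.carrier_injective (Set.Subset.antisymm (minCone_subset ?_) (minCone_subset ?_))
  · exact mem_of_smul h' hS (minCone_subset_of_isUnion hU hx) (L'.mem_minCone x) hy ha.le h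
  · refine mem_of_smul h' hS (minCone_subset_of_isUnion hU hy) (L'.mem_minCone y) hx
      (inv_nonneg.2 ha.le) fun m hm => ?_
    rw [h m hm, inv_mul_cancel_left₀ ha.ne']

/-- The point `y` lies in the zero set of the function of `exists_ray_fn`, which contains its
minimal cone in `L'`. On that zero set a function is determined by its value at `y`. -/
theorem dim_minCone_eq_one (h' : L.IsProperSubdivision L') (ht : L.carrier t ⊆ L.carrier j)
    (hS : L.IsSubcone S) (hSj : S ⊆ L.carrier j) (hU : L'.IsUnion S) {y : Y} (hy : y ∈ S)
    (hyt : y ∈ L.carrier t) (hyi : IsIntegralPt (L.fn S) y) (hne : ∃ m ∈ L.fn S, m y ≠ 0)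
    (hd : (L.star t).dim (proj ht '' S) + 1 = L.dim S) :
    L'.dim (L'.carrier (L'.minCone y)) = 1 := by
  obtain ⟨m, hm, hpos, hmy, hray⟩ := exists_ray_fn ht hS hSj hy hyt hyi hne hd
  have hκ := minCone_subset_of_isUnion hU hy
  have hsub := h'.isSubcone (L'.minCone y)
  have hyκ := L'.mem_minCone y
  have hmκ : ∀ x ∈ L'.carrier (L'.minCone y), m x = 0 := fun x hx => by
    have := (isInner_minCone y).2 _ (h'.fn_carrier _ ▸ hsub.restr_mem hS hκ hm)
      (fun z hz => by rw [restr_of_mem hz]; exact hpos z (hκ hz))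
      (by rw [restr_of_mem hyκ, hmy]) x hx
    rwa [restr_of_mem hx] at this
  rw [h'.dim_eq]
  refine dim_eq_one hsub (x := y) (fun a ha => ?_) (fun a ha h0 => ?_) ?_
  · obtain ⟨a', ha', rfl⟩ := hsub.exists_restr hS hκ ha
    rw [restr_of_mem hyκ]
    exact hyi a' ha'
  · obtain ⟨a', ha', rfl⟩ := hsub.exists_restr hS hκ ha
    rw [restr_of_mem hyκ] at h0
    funext x
    by_cases hx : x ∈ L'.carrier (L'.minCone y)
    · rw [restr_of_mem hx]
      exact hray a' ha' h0 x (hκ hx) (hmκ x hx)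
    · exact restr_of_notMem hx _
  · obtain ⟨a, ha, hay⟩ := hne
    exact ⟨_, hsub.restr_mem hS hκ ha, by rwa [restr_of_mem hyκ]⟩

variable {f : Mor K L} {σ : K.Idx}

/-- The compatibility of the index of a map on a cone with that on the quotient by a ray. -/
theorem dualIndex_mul_dualIndex_proj (hS : IsLinOn K L f.toFun (K.carrier σ) S)
    (hSj : S ⊆ L.carrier j) (ht : L.carrier t ⊆ L.carrier j)
    (hd : L.dim S = K.dim (K.carrier σ)) (hdT : (L.star t).dim (proj ht '' S) + 1 = L.dim S)
    {x : X} (hx : x ∈ K.carrier σ) (hxi : IsIntegralPt (K.fn (K.carrier σ)) x)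
    (hx1 : ∃ m ∈ K.fn (K.carrier σ), m x = 1) {y : Y} (hy : y ∈ S) (hyt : y ∈ L.carrier t)
    (hyi : IsIntegralPt (L.fn S) y) (hy1 : ∃ m ∈ L.fn S, m y = 1) {b : ℕ} (hb : b ≠ 0)
    (hxy : ∀ m ∈ L.fn S, m (f.toFun x) = b * m y) :
    dualIndex hS.hom * dualIndex (isLinOn_proj ht hS.isSubcone_image hSj).hom =
      dualIndex (hS.hom.comp (isLinOn_proj ht hS.isSubcone_image hSj).hom) * b := by
  obtain ⟨a₁, ha₁, ha⟩ := hy1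
  obtain ⟨b₁, hb₁, hb'⟩ := hx1
  refine dualIndex_mul_dualIndex (e := intEval hyi) (e' := intEval hxi) (b := (b : ℤ))
    (by exact_mod_cast hb) (hS.exists_smul hd) (fun a => ?_)
    (fun g => intEval_eq_zero.2 (isLinOn_proj_apply_eq_zero ht hS.isSubcone_image hSj g hy hyt))
    (fun a h0 => exists_proj_hom ht hS.isSubcone_image hSj hy hyt hyi
      ⟨a₁, ha₁, by rw [ha]; exact one_ne_zero⟩ hdT a (intEval_eq_zero.1 h0))
    (a₁ := ⟨a₁, ha₁⟩) ?_ (b₁ := ⟨b₁, hb₁⟩) ?_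
  · have : ((intEval hxi (hS.hom a) : ℤ) : ℝ) = ((b * intEval hyi a : ℤ) : ℝ) := by
      push_cast
      rw [intEval_eq, intEval_eq, hS.hom_apply _ hx, hxy _ a.2]
    exact_mod_cast this
  · have : ((intEval hyi ⟨a₁, ha₁⟩ : ℤ) : ℝ) = 1 :=
      (intEval_eq hyi ⟨a₁, ha₁⟩).trans ha
    exact_mod_cast this
  · have : ((intEval hxi ⟨b₁, hb₁⟩ : ℤ) : ℝ) = 1 :=
      (intEval_eq hxi ⟨b₁, hb₁⟩).trans hb'
    exact_mod_cast this

/-- If the projection loses no dimension, every function on `S` has a multiple that comes from the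
projection, and such functions vanish on `t`. -/
theorem apply_eq_zero_of_dim (ht : L.carrier t ⊆ L.carrier j) (hS : L.IsSubcone S)
    (hSj : S ⊆ L.carrier j) (hd : (L.star t).dim (proj ht '' S) = L.dim S) {y : Y} (hy : y ∈ S)
    (hyt : y ∈ L.carrier t) {m : Y → ℝ} (hm : m ∈ L.fn S) : m y = 0 := by
  have hl := isLinOn_proj ht hS hSj
  obtain ⟨n, hn, a, ha⟩ := hl.exists_smul hd ⟨m, hm⟩
  have h1 := isLinOn_proj_apply_eq_zero ht hS hSj a hy hyt
  rw [ha] at h1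
  have h2 : (n : ℝ) * m y = 0 := (zsmul_eq_mul _ _).symm.trans h1
  exact (mul_eq_zero.1 h2).resolve_left (by exact_mod_cast hn.ne')

open Classical in
/-- The contribution of the cone `σ` and the ray `t` to the push-forward of a product with a
divisor. -/
def pullTerm (hS : IsLinOn K L f.toFun (K.carrier σ) S) (hSj : S ⊆ L.carrier j) (k : ℕ) (t : L.Idx)
    (ht : L.carrier t ⊆ L.carrier j) : L.ExtWeight k :=
  DirectSum.of (fun i => (L.star i).Weight k) t
    ((dualIndex (hS.hom.comp (isLinOn_proj ht hS.isSubcone_image hSj).hom) : ℤ) •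
      (L.star t).cls k (proj ht '' S))

theorem pullTerm_eq_zero (hS : IsLinOn K L f.toFun (K.carrier σ) S) (hSj : S ⊆ L.carrier j) {k : ℕ}
    (ht : L.carrier t ⊆ L.carrier j) (hk : (L.star t).dim (proj ht '' S) ≠ k) :
    pullTerm hS hSj k t ht = 0 := by
  rw [pullTerm, cls_of_dim_ne hk, smul_zero, map_zero]

theorem projTerm_eq_zero (hS : L.IsSubcone S) (hSj : S ⊆ L.carrier j) {k : ℕ}
    (ht : L.carrier t ⊆ L.carrier j) (hk : (L.star t).dim (proj ht '' S) ≠ k) :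
    projTerm hS hSj k t ht = 0 := by
  rw [projTerm, cls_of_dim_ne hk, smul_zero, map_zero]

end Rays

end ConeComplex

namespace ConeComplex

variable {X : Type u} {Y : Type u'} {K : ConeComplex X} {L : ConeComplex Y}

/-! ### Comparison of rays in the source and in the target -/

section Rays

variable {L' : ConeComplex Y} (h' : L.IsProperSubdivision L') {S : Set Y} {j : L.Idx} {k : ℕ}
  {f : Mor K L} {σ : K.Idx}

/-- Some function has the value `1` at the primitive generator, so its value at the integral point
`y` is the multiplicity. -/
theorem exists_mul_primGen (h' : L.IsProperSubdivision L') (hS : L.IsSubcone S)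
    (ρ : L'.ConesOfDim 1) (hρ : L'.carrier ρ.1 ⊆ S) {y : Y} (hy : y ∈ L'.carrier ρ.1)
    (hyi : IsIntegralPt (L.fn S) y) (hne : ∃ m ∈ L.fn S, m y ≠ 0) :
    ∃ b : ℕ, b ≠ 0 ∧ ∀ m ∈ L.fn S, m y = b * m (L'.primGen ρ) := by
  have hu := isPrimitiveGenerator_primGen ρ
  obtain ⟨hui, m₁, hm₁, hmu⟩ := hu.of_subset hS hρ h'
  obtain ⟨a, ha, hay⟩ := hu.exists_mul ρ.2 hy
  have hay' : ∀ m ∈ L.fn S, m y = a * m (L'.primGen ρ) := fun m hm => by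
    have := hay _ (h'.fn_carrier ρ.1 ▸ (h'.isSubcone ρ.1).restr_mem hS hρ hm)
    rwa [restr_of_mem hy, restr_of_mem hu.1] at this
  obtain ⟨n, hn⟩ := hyi m₁ hm₁
  rw [hay' m₁ hm₁, hmu, mul_one] at hn
  subst hn
  lift n to ℕ using (by exact_mod_cast ha)
  refine ⟨n, fun h0 => ?_, fun m hm => by rw [hay' m hm]; norm_cast⟩
  obtain ⟨m, hm, hmy⟩ := hne
  rw [hay' m hm, h0] at hmy
  simp at hmy

theorem IsProperSubdivision.target_mor_eq (h' : L.IsProperSubdivision L') {i : L'.Idx} {y : Y}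
    (hy : L'.minCone y = i) : h'.mor.target i = L.minCone y := by
  subst hy
  exact h'.mor.target_eq_minCone (isInner_minCone y)

theorem image_integral (hS : IsLinOn K L f.toFun (K.carrier σ) S) {x : X} (hx : x ∈ K.carrier σ)
    (hxi : IsIntegralPt (K.fn (K.carrier σ)) x) : IsIntegralPt (L.fn S) (f.toFun x) :=
  fun m hm => by
    obtain ⟨n, hn⟩ := hxi _ (hS.hom ⟨m, hm⟩).2
    exact ⟨n, by rw [← hn, hS.hom_apply _ hx]⟩

/-- A multiple of the function cutting out `ρ₁` in `σ` comes from the image. It vanishes at the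
image of the generator of `ρ₁`, hence on the ray `ρ`, hence at the generator of `ρ₂`. -/
theorem eq_of_minCone_image_eq (h' : L.IsProperSubdivision L')
    (hS : IsLinOn K L f.toFun (K.carrier σ) S) (hd : L.dim S = K.dim (K.carrier σ))
    {ρ : L'.ConesOfDim 1} (hρ : L'.carrier ρ.1 ⊆ S) {ρ₁ ρ₂ : K.ConesOfDim 1}
    (h₁ : K.carrier ρ₁.1 ⊆ K.carrier σ) (h₂ : K.carrier ρ₂.1 ⊆ K.carrier σ)
    (hy₁ : f.toFun (K.primGen ρ₁) ∈ L'.carrier ρ.1) (hy₂ : f.toFun (K.primGen ρ₂) ∈ L'.carrier ρ.1)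
    (hne : ∃ m ∈ L.fn S, m (f.toFun (K.primGen ρ₁)) ≠ 0) :
    K.carrier ρ₂.1 ⊆ K.carrier ρ₁.1 := by
  have hu₁ := isPrimitiveGenerator_primGen ρ₁
  have hu₂ := isPrimitiveGenerator_primGen ρ₂
  have hi₁ := image_integral hS (h₁ hu₁.1) (isIntegralPt_of_subset (isSubcone_carrier σ) h₁ hu₁.1 hu₁.2.1)
  obtain ⟨b, hb, hby⟩ := exists_mul_primGen h' hS.isSubcone_image ρ hρ hy₁ hi₁ hne
  obtain ⟨a, ha, hay⟩ := (isPrimitiveGenerator_primGen ρ).exists_mul ρ.2 hy₂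
  have hb' : (b : ℝ) ≠ 0 := by exact_mod_cast hb
  obtain ⟨hf, m₀, hm₀, hpos, he⟩ := isFaceOf_of_subset h₁
  refine subset_of_isInner (hu₂.isInner ρ₂.2) ?_
  rw [he]
  refine ⟨h₂ hu₂.1, ?_⟩
  have hu₁' := hu₁.1
  rw [he] at hu₁'
  obtain ⟨n, hn, c, hc, hcm⟩ := hS.exists_smul' hd (m := m₀) (by rwa [fn_carrier])
  have e₁ := hby c hc
  have e₂ := hay _ (h'.fn_carrier ρ.1 ▸ (h'.isSubcone ρ.1).restr_mem hS.isSubcone_image hρ hc)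
  rw [restr_of_mem hy₂, restr_of_mem (isPrimitiveGenerator_primGen ρ).1] at e₂
  rw [hcm _ (h₁ hu₁.1), hu₁'.2, mul_zero, eq_comm, mul_eq_zero] at e₁
  rw [hcm _ (h₂ hu₂.1), e₁.resolve_left hb', mul_zero, mul_eq_zero] at e₂
  exact e₂.resolve_left (by exact_mod_cast hn.ne')

/-- A ray of the image is the image of a ray. -/
theorem exists_ray_of_image (hS : IsLinOn K L f.toFun (K.carrier σ) S) (hSj : S ⊆ L.carrier j)
    (hd : L.dim S = K.dim (K.carrier σ)) {t : L.Idx} (ht : L.carrier t ⊆ L.carrier j) {y : Y}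
    (hy : y ∈ S) (hyt : y ∈ L.carrier t) (hyi : IsIntegralPt (L.fn S) y)
    (hne : ∃ m ∈ L.fn S, m y ≠ 0) (hdT : (L.star t).dim (proj ht '' S) + 1 = L.dim S) :
    ∃ ρ : K.ConesOfDim 1, K.carrier ρ.1 ⊆ K.carrier σ ∧
      ∃ a : ℝ, 0 < a ∧ ∀ m ∈ L.fn S, m y = a * m (f.toFun (K.primGen ρ)) := by
  obtain ⟨m, hm, hpos, hmy, hray⟩ := exists_ray_fn ht hS.isSubcone_image hSj hy hyt hyi hne hdT
  have hpm : (hS.hom ⟨m, hm⟩).1 ∈ K.M σ := (fn_carrier σ).le (hS.hom ⟨m, hm⟩).2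
  -- The ray of `σ` is the zero set of the pull-back of the function that cuts out the ray of the
  -- image through `y`.
  obtain ⟨ρ, hρ, -⟩ := K.exists_face σ _ _ ⟨rfl, _, hpm, fun x hx => by
    rw [hS.hom_apply _ hx]; exact hpos _ (hS.mapsTo hx), rfl⟩
  have hρσ : K.carrier ρ ⊆ K.carrier σ := fun x hx => by rw [hρ] at hx; exact hx.1
  have hρ0 : ∀ x ∈ K.carrier ρ, m (f.toFun x) = 0 := fun x hx =>
    (hS.hom_apply ⟨m, hm⟩ (hρσ hx)).symm.trans (by rw [hρ] at hx; exact hx.2)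
  have hl := f.isLinOn (isSubcone_carrier ρ) rfl
  have hTS : f.toFun '' K.carrier ρ ⊆ S := hS.image_subset hl hρσ
  obtain ⟨x₀, hx₀, rfl⟩ : ∃ x ∈ K.carrier σ, f.toFun x = y := by
    rw [← hS.image_eq] at hy
    exact hy
  have hx₀ρ : x₀ ∈ K.carrier ρ := by
    rw [hρ]
    exact ⟨hx₀, (hS.hom_apply _ hx₀).trans hmy⟩
  have hyT := Set.mem_image_of_mem f.toFun hx₀ρ
  -- As `f` preserves the dimension of `σ`, it also preserves that of the face. On the image of the
  -- face, evaluation at `y` is injective.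
  have hdim : K.dim (K.carrier ρ) = 1 := by
    rw [← hS.dim_eq hd hl hρσ]
    refine dim_eq_one hl.isSubcone_image (x := f.toFun x₀) (fun a ha => ?_) (fun a ha h0 => ?_) ?_
    · obtain ⟨a', ha', rfl⟩ := hl.isSubcone_image.exists_restr hS.isSubcone_image hTS ha
      rw [restr_of_mem hyT]
      exact hyi a' ha'
    · obtain ⟨a', ha', rfl⟩ := hl.isSubcone_image.exists_restr hS.isSubcone_image hTS ha
      rw [restr_of_mem hyT] at h0
      funext z
      by_cases hz : z ∈ f.toFun '' K.carrier ρ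
      · rw [restr_of_mem hz]
        obtain ⟨x, hx, rfl⟩ := hz
        exact hray a' ha' h0 _ (hTS ⟨x, hx, rfl⟩) (hρ0 x hx)
      · exact restr_of_notMem hz _
    · obtain ⟨a, ha, hay⟩ := hne
      exact ⟨_, hl.isSubcone_image.restr_mem hS.isSubcone_image hTS ha, by rwa [restr_of_mem hyT]⟩
  have hu := isPrimitiveGenerator_primGen (⟨ρ, hdim⟩ : K.ConesOfDim 1)
  obtain ⟨a, ha, hax⟩ := hu.exists_mul hdim hx₀ρ
  have e : ∀ c ∈ L.fn S, c (f.toFun x₀) = a * c (f.toFun (K.primGen ⟨ρ, hdim⟩)) := fun c hc => by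
    have h1 := (isSubcone_carrier ρ).restr_mem hS.isSubcone hρσ (hS.hom ⟨c, hc⟩).2
    rw [fn_carrier] at h1
    have h2 := hax _ h1
    rw [restr_of_mem hx₀ρ, restr_of_mem hu.1, hS.hom_apply _ hx₀,
      hS.hom_apply _ (hρσ hu.1)] at h2
    exact h2
  refine ⟨⟨ρ, hdim⟩, hρσ, a, ha.lt_of_ne' ?_, e⟩
  rintro rfl
  obtain ⟨c, hc, hcy⟩ := hne
  exact hcy (by rw [e c hc, zero_mul])

open Classical in
/-- The contributions of a cone `σ` and of the parts of its image to the push-forward of the product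
with a divisor agree. -/
theorem sum_pullTerm (h' : L.IsProperSubdivision L') (hσ : K.dim (K.carrier σ) = k + 1)
    (hS : IsLinOn K L f.toFun (K.carrier σ) S) (hSj : S ⊆ L.carrier j) (hU : L'.IsUnion S)
    {ψ : Y → ℝ} (hψ : L.IsDivisor ψ) :
    ∑ ρ : {ρ : K.ConesOfDim 1 // K.carrier ρ.1 ⊆ K.carrier σ},
      K.raySlope (ψ ∘ f.toFun) ρ.1.1 • pullTerm hS hSj k (f.target ρ.1.1)
        (f.target_subset fun _ hx => hSj (hS.mapsTo (ρ.2 hx))) =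
    if L.dim S = k + 1 then (dualIndex hS.hom : ℤ) •
      ∑ ρ : {ρ : L'.ConesOfDim 1 // L'.carrier ρ.1 ⊆ S},
        L'.raySlope ψ ρ.1.1 • projTerm hS.isSubcone_image hSj k (h'.mor.target ρ.1.1)
          (h'.mor.target_subset fun _ hx => hSj (ρ.2 hx)) else 0 := by
  have hψK : K.IsDivisor (ψ ∘ f.toFun) := hψ.comp f
  have hψL' : L'.IsDivisor ψ := hψ.comp h'.mor
  have hψS := hψ.restr_mem hS.isSubcone_image
  have hu : ∀ ρ : {ρ : K.ConesOfDim 1 // K.carrier ρ.1 ⊆ K.carrier σ},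
      K.primGen ρ.1 ∈ K.carrier ρ.1.1 := fun ρ => (isPrimitiveGenerator_primGen ρ.1).1
  have hy : ∀ ρ : {ρ : K.ConesOfDim 1 // K.carrier ρ.1 ⊆ K.carrier σ},
      f.toFun (K.primGen ρ.1) ∈ S := fun ρ => hS.mapsTo (ρ.2 (hu ρ))
  have hyt : ∀ ρ : {ρ : K.ConesOfDim 1 // K.carrier ρ.1 ⊆ K.carrier σ},
      f.toFun (K.primGen ρ.1) ∈ L.carrier (f.target ρ.1.1) := fun ρ => f.mapsTo_target _ (hu ρ)
  have hte : ∀ ρ : {ρ : K.ConesOfDim 1 // K.carrier ρ.1 ⊆ K.carrier σ},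
      f.target ρ.1.1 = L.minCone (f.toFun (K.primGen ρ.1)) := fun ρ =>
    f.target_eq_minCone ((isPrimitiveGenerator_primGen ρ.1).isInner ρ.1.2)
  have hslope : ∀ ρ : {ρ : K.ConesOfDim 1 // K.carrier ρ.1 ⊆ K.carrier σ},
      (K.raySlope (ψ ∘ f.toFun) ρ.1.1 : ℝ) = ψ (f.toFun (K.primGen ρ.1)) := fun ρ =>
    raySlope_eq hψK ρ.1
  have hne : ∀ ρ : {ρ : K.ConesOfDim 1 // K.carrier ρ.1 ⊆ K.carrier σ},
      K.raySlope (ψ ∘ f.toFun) ρ.1.1 ≠ 0 → ∃ m ∈ L.fn S, m (f.toFun (K.primGen ρ.1)) ≠ 0 := by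
    intro ρ h0
    refine ⟨_, hψS, ?_⟩
    rw [restr_of_mem (hy ρ), ← hslope]
    exact_mod_cast h0
  split_ifs with hd
  swap
  -- The image has dimension at most `k`. Either its projection has another dimension than `k` and
  -- the class is zero, or the projection loses no dimension; then the image of the generator is
  -- zero in `S` and the slope vanishes.
  · refine Finset.sum_eq_zero fun ρ _ => ?_
    by_cases hk : (L.star (f.target ρ.1.1)).dim
        (proj (f.target_subset fun _ hx => hSj (hS.mapsTo (ρ.2 hx))) '' S) = k
    · have h1 := (isLinOn_proj (f.target_subset fun _ hx => hSj (hS.mapsTo (ρ.2 hx)))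
        hS.isSubcone_image hSj).dim_le
      have h2 := hS.dim_le
      have h3 := apply_eq_zero_of_dim _ hS.isSubcone_image hSj (hk.trans (by omega)) (hy ρ) (hyt ρ)
        hψS
      rw [restr_of_mem (hy ρ), ← hslope, Int.cast_eq_zero] at h3
      rw [h3, zero_smul]
    · rw [pullTerm_eq_zero hS hSj _ hk, smul_zero]
  have hdσ : L.dim S = K.dim (K.carrier σ) := hd.trans hσ.symm
  rw [Finset.smul_sum]
  -- Only rays with nonzero slope and with a projection of dimension `k` contribute. For these, the
  -- image of the generator spans a ray of `S`, and sending a ray of `σ` to the cone of `L'` around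
  -- this image is a bijection onto the contributing rays of `L'` in `S`.
  let good : {ρ : K.ConesOfDim 1 // K.carrier ρ.1 ⊆ K.carrier σ} → Prop := fun ρ =>
    K.raySlope (ψ ∘ f.toFun) ρ.1.1 ≠ 0 ∧ (L.star (f.target ρ.1.1)).dim
        (proj (f.target_subset fun _ hx => hSj (hS.mapsTo (ρ.2 hx))) '' S) = k
  let good' : {ρ : L'.ConesOfDim 1 // L'.carrier ρ.1 ⊆ S} → Prop := fun ρ =>
    L'.raySlope ψ ρ.1.1 ≠ 0 ∧ (L.star (h'.mor.target ρ.1.1)).dim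
        (proj (h'.mor.target_subset fun _ hx => hSj (ρ.2 hx)) '' S) = k
  rw [← Finset.sum_filter_of_ne (p := good), ← Finset.sum_filter_of_ne (p := good')]
  rotate_left
  · intro ρ _ h0
    refine ⟨fun h => h0 (by rw [h, zero_smul, smul_zero]), ?_⟩
    by_contra hk
    exact h0 (by rw [projTerm_eq_zero _ _ _ hk, smul_zero, smul_zero])
  · intro ρ _ h0
    refine ⟨fun h => h0 (by rw [h, zero_smul]), ?_⟩
    by_contra hk
    exact h0 (by rw [pullTerm_eq_zero _ _ _ hk, smul_zero])
  have hint : ∀ ρ : {ρ : K.ConesOfDim 1 // K.carrier ρ.1 ⊆ K.carrier σ},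
      IsIntegralPt (L.fn S) (f.toFun (K.primGen ρ.1)) := fun ρ =>
    image_integral hS (ρ.2 (hu ρ)) (isIntegralPt_of_subset (isSubcone_carrier σ) ρ.2 (hu ρ)
      (isPrimitiveGenerator_primGen ρ.1).2.1)
  have hdim : ∀ ρ, good ρ → L'.dim (L'.carrier (L'.minCone (f.toFun (K.primGen ρ.1)))) = 1 :=
    fun ρ hρ => dim_minCone_eq_one h' _ hS.isSubcone_image hSj hU (hy ρ) (hyt ρ) (hint ρ)
      (hne ρ hρ.1) (by rw [hρ.2, hd])
  have htt : ∀ (ρ : {ρ : K.ConesOfDim 1 // K.carrier ρ.1 ⊆ K.carrier σ})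
      (ρ' : {ρ : L'.ConesOfDim 1 // L'.carrier ρ.1 ⊆ S}),
      L'.minCone (f.toFun (K.primGen ρ.1)) = ρ'.1.1 → h'.mor.target ρ'.1.1 = f.target ρ.1.1 :=
    fun ρ ρ' h => (h'.target_mor_eq h).trans (hte ρ).symm
  have hdt : ∀ {t t' : L.Idx} (_ : t = t') (ht : L.carrier t ⊆ L.carrier j)
      (ht' : L.carrier t' ⊆ L.carrier j),
      (L.star t).dim (proj ht '' S) = (L.star t').dim (proj ht' '' S) := by
    rintro t _ rfl _ _
    rfl
  -- The generator of `ρ` is sent to `b` times the generator of `ρ'`, so the slopes of the divisor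
  -- differ by the factor `b`.
  have hdata : ∀ (ρ : {ρ : K.ConesOfDim 1 // K.carrier ρ.1 ⊆ K.carrier σ})
      (ρ' : {ρ : L'.ConesOfDim 1 // L'.carrier ρ.1 ⊆ S}), good ρ →
      L'.minCone (f.toFun (K.primGen ρ.1)) = ρ'.1.1 → ∃ b : ℕ, b ≠ 0 ∧
        (∀ m ∈ L.fn S, m (f.toFun (K.primGen ρ.1)) = b * m (L'.primGen ρ'.1)) ∧
        K.raySlope (ψ ∘ f.toFun) ρ.1.1 = b * L'.raySlope ψ ρ'.1.1 := by
    intro ρ ρ' hρ h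
    obtain ⟨b, hb, hbm⟩ := exists_mul_primGen h' hS.isSubcone_image ρ'.1 ρ'.2
      (h ▸ L'.mem_minCone _) (hint ρ) (hne ρ hρ.1)
    refine ⟨b, hb, hbm, ?_⟩
    have h1 := hbm _ hψS
    rw [restr_of_mem (hy ρ), restr_of_mem (ρ'.2 (isPrimitiveGenerator_primGen ρ'.1).1), ← hslope,
      ← raySlope_eq hψL'] at h1
    exact_mod_cast h1
  refine Finset.sum_bij (fun ρ hρ => ⟨⟨L'.minCone (f.toFun (K.primGen ρ.1)),
    hdim ρ (Finset.mem_filter.1 hρ).2⟩, minCone_subset_of_isUnion hU (hy ρ)⟩) ?_ ?_ ?_ ?_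
  · intro ρ hρ
    have hρ := (Finset.mem_filter.1 hρ).2
    refine Finset.mem_filter.2 ⟨Finset.mem_univ _, fun h0 => ?_, ?_⟩
    · obtain ⟨b, -, -, hb⟩ := hdata ρ ⟨⟨_, hdim ρ hρ⟩, minCone_subset_of_isUnion hU (hy ρ)⟩ hρ rfl
      exact hρ.1 (hb.trans (by rw [h0, mul_zero]))
    · exact (hdt (htt ρ ⟨⟨_, hdim ρ hρ⟩, minCone_subset_of_isUnion hU (hy ρ)⟩ rfl) _ _).trans hρ.2
  · intro ρ₁ h₁ ρ₂ h₂ he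
    have h₁ := (Finset.mem_filter.1 h₁).2
    have h₂ := (Finset.mem_filter.1 h₂).2
    have he : L'.minCone (f.toFun (K.primGen ρ₁.1)) = L'.minCone (f.toFun (K.primGen ρ₂.1)) :=
      congrArg (fun ρ : {ρ : L'.ConesOfDim 1 // L'.carrier ρ.1 ⊆ S} => ρ.1.1) he
    have hm₁ := L'.mem_minCone (f.toFun (K.primGen ρ₁.1))
    have hm₂ := L'.mem_minCone (f.toFun (K.primGen ρ₂.1))
    rw [← he] at hm₂
    refine Subtype.ext (Subtype.ext (K.carrier_injective (Set.Subset.antisymm ?_ ?_)))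
    · exact eq_of_minCone_image_eq h' hS hdσ (ρ := ⟨_, hdim ρ₁ h₁⟩)
        (minCone_subset_of_isUnion hU (hy ρ₁)) ρ₂.2 ρ₁.2 hm₂ hm₁ (hne ρ₂ h₂.1)
    · exact eq_of_minCone_image_eq h' hS hdσ (ρ := ⟨_, hdim ρ₁ h₁⟩)
        (minCone_subset_of_isUnion hU (hy ρ₁)) ρ₁.2 ρ₂.2 hm₁ hm₂ (hne ρ₁ h₁.1)
  · intro ρ' hρ'
    have hρ' := (Finset.mem_filter.1 hρ').2
    have hu' := isPrimitiveGenerator_primGen ρ'.1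
    obtain ⟨hi', m₁, hm₁, hmu⟩ := hu'.of_subset hS.isSubcone_image ρ'.2 h'
    obtain ⟨ρ, hρσ, a, ha, ham⟩ := exists_ray_of_image hS hSj hdσ
      (h'.mor.target_subset fun _ hx => hSj (ρ'.2 hx)) (ρ'.2 hu'.1) (h'.target_mor _ hu'.1) hi'
      ⟨m₁, hm₁, by rw [hmu]; exact one_ne_zero⟩ (by rw [hρ'.2, hd])
    have hmin : L'.minCone (f.toFun (K.primGen ρ)) = ρ'.1.1 := by
      rw [← minCone_eq_of_smul h' hS.isSubcone_image hU (hy ⟨ρ, hρσ⟩) (ρ'.2 hu'.1) ha ham]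
      exact minCone_eq_of_isInner (hu'.isInner ρ'.1.2)
    have hgood : good ⟨ρ, hρσ⟩ := by
      refine ⟨fun h0 => hρ'.1 ?_, (hdt (htt ⟨ρ, hρσ⟩ ρ' hmin) _ _).symm.trans hρ'.2⟩
      have h1 := ham _ hψS
      have h2 := hslope ⟨ρ, hρσ⟩
      rw [h0, Int.cast_zero] at h2
      rw [restr_of_mem (hy ⟨ρ, hρσ⟩), restr_of_mem (ρ'.2 hu'.1), ← raySlope_eq hψL', ← h2,
        mul_zero] at h1
      exact_mod_cast h1
    exact ⟨⟨ρ, hρσ⟩, Finset.mem_filter.2 ⟨Finset.mem_univ _, hgood⟩,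
      Subtype.ext (Subtype.ext hmin)⟩
  · intro ρ hρ
    have hρ := (Finset.mem_filter.1 hρ).2
    generalize hρ' : (⟨⟨L'.minCone (f.toFun (K.primGen ρ.1)), hdim ρ hρ⟩,
      minCone_subset_of_isUnion hU (hy ρ)⟩ : {ρ : L'.ConesOfDim 1 // L'.carrier ρ.1 ⊆ S}) = ρ'
    have hmin : L'.minCone (f.toFun (K.primGen ρ.1)) = ρ'.1.1 := by rw [← hρ']
    obtain ⟨b, hb, hbm, hbs⟩ := hdata ρ ρ' hρ hmin
    have hu' := isPrimitiveGenerator_primGen ρ'.1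
    obtain ⟨hi', h1'⟩ := hu'.of_subset hS.isSubcone_image ρ'.2 h'
    obtain ⟨m₁, hm₁, hmu⟩ := (isPrimitiveGenerator_primGen ρ.1).2.2
    obtain ⟨m₂, hm₂, hr⟩ := (isSubcone_carrier ρ.1.1).exists_restr (isSubcone_carrier σ) ρ.2
      (m := m₁) (by rwa [fn_carrier])
    rw [← hr, restr_of_mem (hu ρ)] at hmu
    -- The same factor `b` relates the product of the index on `σ` and that of the projection to the
    -- index of the composite, so the two contributions agree.
    have key := dualIndex_mul_dualIndex_proj hS hSj
      (f.target_subset fun _ hx => hSj (hS.mapsTo (ρ.2 hx))) hdσ (by rw [hρ.2, hd]) (ρ.2 (hu ρ))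
      (isIntegralPt_of_subset (isSubcone_carrier σ) ρ.2 (hu ρ)
        (isPrimitiveGenerator_primGen ρ.1).2.1) ⟨m₂, hm₂, hmu⟩ (ρ'.2 hu'.1)
      (htt ρ ρ' hmin ▸ h'.target_mor _ hu'.1) hi' h1' hb hbm
    rw [projTerm_congr _ _ _ (htt ρ ρ' hmin), pullTerm, projTerm, ← map_zsmul, ← map_zsmul,
      ← map_zsmul, smul_smul, smul_smul, smul_smul, hbs]
    have key' : (dualIndex hS.hom * dualIndex (isLinOn_proj
      (f.target_subset fun _ hx => hSj (hS.mapsTo (ρ.2 hx))) hS.isSubcone_image hSj).hom : ℤ) =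
      dualIndex (hS.hom.comp (isLinOn_proj
      (f.target_subset fun _ hx => hSj (hS.mapsTo (ρ.2 hx))) hS.isSubcone_image hSj).hom) * b := by
      exact_mod_cast key
    congr 2
    linear_combination (-L'.raySlope ψ ρ'.1.1) * key'

end Rays

end ConeComplex

namespace ConeComplex

variable {X : Type u} {Y : Type u'} {K : ConeComplex X} {L : ConeComplex Y}

/-! ### The projection formula -/

section ProjectionFormula

variable {L' : ConeComplex Y} (h' : L.IsProperSubdivision L') {f : Mor K L} {k : ℕ}

variable (K) in
open Classical in
/-- The product of a Cartier divisor and a weight, on the extended cone complex. -/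
def rayProduct (ψ : X → ℝ) (c : K.ConesOfDim (k + 1) → ℤ) : K.ExtWeight k :=
  ∑ᶠ ρ : K.ConesOfDim 1, K.raySlope ψ ρ.1 •
    DirectSum.of (fun i => (K.star i).Weight k) ρ.1 (K.pullbackWeight c ρ.1)

open Classical in
-- Sorting the product by the cones of the weight instead of by the rays makes it possible to treat
-- one cone at a time.
theorem rayProduct_eq (ψ : X → ℝ) (c : K.ConesOfDim (k + 1) → ℤ) :
    K.rayProduct ψ c = ∑ σ : K.ConesOfDim (k + 1), c σ •
      ∑ ρ : K.ConesOfDim 1 with K.carrier ρ.1 ⊆ K.carrier σ.1, K.raySlope ψ ρ.1 •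
        DirectSum.of (fun i => (K.star i).Weight k) ρ.1
          ((K.star ρ.1).cls k (K.starCarrier ρ.1 σ.1)) := by
  rw [rayProduct, finsum_eq_sum_of_fintype]
  simp only [Finset.sum_filter, Finset.smul_sum]
  rw [Finset.sum_comm]
  refine Finset.sum_congr rfl fun ρ _ => ?_
  rw [pullbackWeight, finsum_eq_sum_of_fintype, sum_conesOver ρ.1 fun σ : K.ConesOfDim (k + 1) =>
    c σ • (K.star ρ.1).cls k (K.starCarrier ρ.1 σ.1), map_sum, Finset.smul_sum, Finset.sum_filter]
  refine Finset.sum_congr rfl fun σ _ => ?_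
  split_ifs
  · rw [map_zsmul, smul_comm]
  · rw [smul_zero]

open Classical in
-- This is the projection formula for a single cone. On the left are the projections of the whole
-- image along rays, by `sum_pullTerm`; on the right the image is cut into parts, and the parts
-- around each ray reassemble by `sum_projTerm`.
theorem extPush_cone (h' : L.IsProperSubdivision L') {σ : K.Idx}
    (hU : L'.IsUnion (f.toFun '' K.carrier σ)) (hσ : K.dim (K.carrier σ) = k + 1) {ψ : Y → ℝ}
    (hψ : L.IsDivisor ψ) :
    f.extPush k (∑ ρ : K.ConesOfDim 1 with K.carrier ρ.1 ⊆ K.carrier σ,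
      K.raySlope (ψ ∘ f.toFun) ρ.1 • DirectSum.of (fun i => (K.star i).Weight k) ρ.1
        ((K.star ρ.1).cls k (K.starCarrier ρ.1 σ))) =
    if L.dim (f.toFun '' K.carrier σ) = k + 1 then
      (f.latIndex (isSubcone_carrier σ) : ℤ) • ∑ i : L'.ConesOfDim (k + 1) with
        L'.carrier i.1 ⊆ f.toFun '' K.carrier σ, h'.mor.extPush k
          (∑ ρ : L'.ConesOfDim 1 with L'.carrier ρ.1 ⊆ L'.carrier i.1,
            L'.raySlope ψ ρ.1 • DirectSum.of (fun i => (L'.star i).Weight k) ρ.1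
              ((L'.star ρ.1).cls k (L'.starCarrier ρ.1 i.1))) else 0 := by
  have hS := f.isLinOn (isSubcone_carrier σ) rfl
  set S := f.toFun '' K.carrier σ
  obtain ⟨j, hSj, -⟩ := id hS.isSubcone_image
  rw [map_sum, Finset.sum_subtype (p := fun ρ : K.ConesOfDim 1 => K.carrier ρ.1 ⊆ K.carrier σ) _
    (fun ρ => by simp), Finset.sum_congr rfl fun ρ _ => by
      rw [map_zsmul, f.extPush_of_cls ρ.1.2 hσ ρ.2 hS hSj
        (f.target_subset fun _ hx => hSj (hS.mapsTo (ρ.2 hx)))]]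
  refine (sum_pullTerm h' hσ hS hSj hU hψ).trans ?_
  split_ifs with hd
  swap
  · rfl
  rw [f.latIndex_eq_dualIndex _ hS]
  congr 1
  -- The morphism from `L'` to `L` is an isomorphism of lattices on each cone, so only the index of
  -- the projection remains.
  have e : ∀ (i : L'.ConesOfDim (k + 1)) (hi : L'.carrier i.1 ⊆ S) (ρ : L'.ConesOfDim 1)
      (hρ : L'.carrier ρ.1 ⊆ L'.carrier i.1),
      h'.mor.extPush k (DirectSum.of (fun i => (L'.star i).Weight k) ρ.1
        ((L'.star ρ.1).cls k (L'.starCarrier ρ.1 i.1))) =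
      projTerm (h'.isSubcone i.1) (hi.trans hSj) k (h'.mor.target ρ.1)
        (h'.mor.target_subset fun _ hx => hSj (hi (hρ hx))) := by
    intro i hi ρ hρ
    have ht : L.carrier (h'.mor.target ρ.1) ⊆ L.carrier j :=
      h'.mor.target_subset fun _ hx => hSj (hi (hρ hx))
    have hb := isLinOn_refine_bijective h' i.1
    have e1 := dualIndex_comp_of_surjective (isLinOn_proj ht (h'.isSubcone i.1) (hi.trans hSj)).hom
      (bijective_dual _ hb.1 hb.2).2
    refine (h'.mor.extPush_of_cls ρ.2 i.2 hρ (isLinOn_refine h' i.1) (hi.trans hSj) ht).trans ?_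
    exact congrArg (fun d : ℕ => DirectSum.of (fun i => (L.star i).Weight k) (h'.mor.target ρ.1)
      ((d : ℤ) • (L.star (h'.mor.target ρ.1)).cls k (proj ht '' L'.carrier i.1))) e1
  simp only [map_sum, map_zsmul]
  -- The double sum is reordered so that the rays come first: for each ray in `S`, the inner sum
  -- runs over the parts containing it.
  rw [Finset.sum_comm' (t' := Finset.univ.filter fun ρ : L'.ConesOfDim 1 => L'.carrier ρ.1 ⊆ S)
    (s' := fun ρ => (Finset.univ.filter fun i : L'.ConesOfDim (k + 1) => L'.carrier i.1 ⊆ S).filter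
      fun i => L'.carrier ρ.1 ⊆ L'.carrier i.1)
    (fun i ρ => by
      simp only [Finset.mem_filter, Finset.mem_univ, true_and]
      exact ⟨fun h => ⟨h, h.2.trans h.1⟩, fun h => h.1⟩),
    Finset.sum_subtype (p := fun ρ : L'.ConesOfDim 1 => L'.carrier ρ.1 ⊆ S)
      (Finset.univ.filter fun ρ : L'.ConesOfDim 1 => L'.carrier ρ.1 ⊆ S) (fun ρ => by simp)]
  refine Finset.sum_congr rfl fun ρ _ => ?_
  rw [← Finset.smul_sum, ← sum_projTerm h' hS.isSubcone_image hSj hU hd ρ.1 ρ.2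
    (h'.target_mor ρ.1.1), Finset.sum_filter, Finset.sum_filter,
    Finset.sum_subtype (p := fun i : L'.ConesOfDim (k + 1) => L'.carrier i.1 ⊆ S)
      (Finset.univ.filter fun i : L'.ConesOfDim (k + 1) => L'.carrier i.1 ⊆ S) (fun ρ => by simp)]
  congr 1
  refine Finset.sum_congr rfl fun i _ => ?_
  split_ifs with hρ
  · rw [e i.1 i.2 ρ.1 hρ]
  · rfl

/-- The projection formula for the push-forward of the product with a Cartier divisor. -/
theorem extPush_rayProduct (h' : L.IsProperSubdivision L')
    (hU : ∀ σ, L'.IsUnion (f.toFun '' K.carrier σ)) {ψ : Y → ℝ} (hψ : L.IsDivisor ψ)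
    (c : K.ConesOfDim (k + 1) → ℤ) : f.extPush k (K.rayProduct (ψ ∘ f.toFun) c) =
      divisorProduct h' ψ (pushWeight L' f c) := by
  classical
  have e : divisorProduct h' ψ (pushWeight L' f c) =
    h'.mor.extPush k (L'.rayProduct ψ (pushWeight L' f c)) := rfl
  rw [e, rayProduct_eq, rayProduct_eq, map_sum, map_sum]
  simp only [pushWeight, Finset.sum_smul, map_sum]
  rw [Finset.sum_comm]
  refine Finset.sum_congr rfl fun σ _ => ?_
  rw [map_zsmul, extPush_cone h' (hU σ.1) σ.2 hψ]
  by_cases hd : L.dim (f.toFun '' K.carrier σ.1) = k + 1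
  · rw [if_pos hd, Finset.sum_filter, Finset.smul_sum, Finset.smul_sum]
    refine Finset.sum_congr rfl fun i _ => ?_
    by_cases hi : L'.carrier i.1 ⊆ f.toFun '' K.carrier σ.1
    · rw [if_pos hi, if_pos ⟨hd, hi⟩, smul_smul, mul_comm, map_zsmul]
    · rw [if_neg hi, if_neg fun h => hi h.2, zero_smul, map_zero, smul_zero, smul_zero]
  · rw [if_neg hd, smul_zero]
    refine (Finset.sum_eq_zero fun i _ => ?_).symm
    rw [if_neg fun h => hd h.1, zero_smul, map_zero]

end ProjectionFormula

end ConeComplex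

/-! ### Functoriality on extended complexes -/

namespace ConeComplex

variable {X : Type u} {Y : Type u'} {Z : Type u''} {K : ConeComplex X} {L : ConeComplex Y}
  {Q : ConeComplex Z} {k : ℕ}

theorem minCone_starMk {i : K.Idx} (x : K.openStar i) :
    ((K.star i).minCone (K.starMk i x)).1 = K.minCone x.1 := by
  refine K.carrier_injective (Set.Subset.antisymm ?_ (minCone_subset
    (mem_starCarrier.1 ((K.star i).mem_minCone (K.starMk i x)))))
  refine subset_of_starCarrier_subset ((K.star i).minCone (K.starMk i x)).2 (minCone_subset (K := K.star i)
    (j := ⟨K.minCone x.1, x.2 _ (K.mem_minCone _)⟩) (mem_starCarrier.2 (K.mem_minCone _)))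

theorem Mor.target_minCone (f : Mor K L) (x : X) :
    f.target (K.minCone x) = L.minCone (f.toFun x) :=
  f.target_eq_minCone (isInner_minCone x)

open Classical in
-- Two routes to the same stratum have target stars indexed by cones that are equal only after an
-- argument. The maps into them are compared through common representatives in the open stars.
theorem of_push_congr {s s' : L.Idx} (hs : s = s') {a : Mor K (L.star s)} {b : Mor K (L.star s')}
    (h : ∀ p, ∃ x hx hx', a.toFun p = L.starMk s ⟨x, hx⟩ ∧ b.toFun p = L.starMk s' ⟨x, hx'⟩)
    (A : K.Weight k) : DirectSum.of (fun j => (L.star j).Weight k) s (a.push k A) =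
      DirectSum.of (fun j => (L.star j).Weight k) s' (b.push k A) := by
  subst hs
  have e : a = b := Mor.ext (funext fun p => by
    obtain ⟨x, hx, hx', h1, h2⟩ := h p
    exact h1.trans h2.symm)
  rw [e]

theorem Mor.push_push (g : Mor L Q) (f : Mor K L) (A : K.Weight k) :
    g.push k (f.push k A) = (g.comp f).push k A := by
  rw [push_comp, AddMonoidHom.comp_apply]

open Classical in
theorem Mor.extPush_of (f : Mor K L) (i : K.Idx) (A : (K.star i).Weight k) :
    f.extPush k (DirectSum.of (fun i => (K.star i).Weight k) i A) =
      DirectSum.of (fun j => (L.star j).Weight k) (f.target i) ((f.starMap i).push k A) :=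
  DirectSum.toAddMonoid_of _ _ _

open Classical in
theorem inclPush_of (i : K.Idx) (j : (K.star i).Idx) (A : ((K.star i).star j).Weight k) :
    K.inclPush i k (DirectSum.of (fun j => ((K.star i).star j).Weight k) j A) =
      DirectSum.of (fun j => (K.star j).Weight k) j.1 ((K.starIncl i j).push k A) :=
  DirectSum.toAddMonoid_of _ _ _

/-- The inclusion is defined by choosing a representative of a point of the iterated star; any
representative gives the same result. -/
theorem starIncl_starMk {i : K.Idx} {j : (K.star i).Idx} (q : (K.star i).openStar j)
    (x : K.openStar i) (hq : K.starMk i x = q.1) : ∃ h,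
    (K.starIncl i j).toFun ((K.star i).starMk j q) = K.starMk j.1 ⟨x.1, h⟩ := by
  have hx : x.1 ∈ K.openStar j.1 := fun l hl => subset_of_starCarrier_subset j.2
    (q.2 ⟨l, x.2 l hl⟩ (hq ▸ mem_starCarrier.2 hl))
  refine ⟨hx, ?_⟩
  obtain ⟨h, he⟩ := (K.exists_starStar i j ((K.star i).starMk j q)).choose_spec
  change K.starMk j.1 (K.exists_starStar i j ((K.star i).starMk j q)).choose = _
  set y := (K.exists_starStar i j ((K.star i).starMk j q)).choose
  obtain ⟨q, hq'⟩ := q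
  subst hq
  obtain ⟨h1, h2⟩ := starMk_eq.1 he
  refine starMk_eq.2 ⟨fun l => ⟨fun hl => ?_, fun hl => ?_⟩, fun l hl m hm h0 => ?_⟩
  · have hl' : y.1 ∈ K.carrier l := hl
    exact (mem_starCarrier (i := i) (x := x)).1 ((h1 ⟨l, j.2.trans (y.2 l hl)⟩).1
      ((mem_starCarrier (i := i) (x := ⟨y.1, fun l hl => j.2.trans (y.2 l hl)⟩)).2 hl'))
  · have hl' : x.1 ∈ K.carrier l := hl
    exact (mem_starCarrier (i := i) (x := ⟨y.1, fun l hl => j.2.trans (y.2 l hl)⟩)).1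
      ((h1 ⟨l, x.2 l hl⟩).2 ((mem_starCarrier (i := i) (x := x)).2 hl'))
  · obtain ⟨g, hg, hgm⟩ := exists_star_fn (i := i) hm fun z hz => h0 z (j.2 hz)
    have := h2 ⟨l, j.2.trans (y.2 l hl)⟩ (mem_starCarrier.2 hl) g hg (by
      rintro _ ⟨x, hx, rfl⟩
      rw [hgm, h0 _ hx])
    rwa [hgm, hgm] at this

/-- On each stratum this is functoriality of the push-forward of weights. The target strata agree
because both are the minimal cone of the image of an inner point. -/
theorem Mor.extPush_comp (g : Mor L Q) (f : Mor K L) :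
    (g.comp f).extPush k = (g.extPush k).comp (f.extPush k) := by
  classical
  refine DirectSum.addHom_ext fun i A => ?_
  rw [AddMonoidHom.comp_apply, extPush_of, extPush_of, extPush_of]
  refine Eq.trans ?_ (congrArg _ (push_push _ _ A).symm)
  obtain ⟨x, hx, rfl⟩ := K.exists_inner i
  refine of_push_congr ?_ (fun p => ?_) A
  · rw [target_minCone, target_minCone, target_minCone]
    rfl
  · obtain ⟨y, rfl⟩ := starMk_surjective _ p
    exact ⟨_, _, _, rfl, rfl⟩

/-- A stratum of the star at `i` is a stratum of `K`, and on representatives in `K` both composites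
are given by `f` itself. -/
theorem Mor.extPush_inclPush (f : Mor K L) (i : K.Idx) :
    (f.extPush k).comp (K.inclPush i k) =
      (L.inclPush (f.target i) k).comp ((f.starMap i).extPush k) := by
  classical
  refine DirectSum.addHom_ext fun j A => ?_
  refine ((congrArg (f.extPush k) (inclPush_of i j A)).trans ((extPush_of f j.1 _).trans
    (congrArg _ (push_push _ _ A)))).trans (Eq.trans ?_ ((congrArg (L.inclPush (f.target i) k)
    (extPush_of (f.starMap i) j A)).trans ((inclPush_of _ _ _).trans
    (congrArg _ (push_push _ _ A)))).symm)
  refine of_push_congr ?_ (fun p => ?_) A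
  · obtain ⟨p, hp, rfl⟩ := (K.star i).exists_inner j
    obtain ⟨x, rfl⟩ := starMk_surjective _ p
    rw [minCone_starMk, target_minCone, target_minCone]
    exact (minCone_starMk (K := L) (i := f.target i) ⟨f.toFun x.1, fun j hj => by
      obtain ⟨_, -, hik, hkj⟩ := f.mapsTo_of_mem x hj
      exact f.target_subset (hkj.mono_left hik)⟩).symm
  · obtain ⟨q, rfl⟩ := starMk_surjective _ p
    obtain ⟨x, hx⟩ := starMk_surjective i q.1
    obtain ⟨h, he⟩ := starIncl_starMk q x hx
    refine ⟨f.toFun x.1, _, ?_, congrArg (f.starFun j.1) he, ?_⟩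
    rotate_left
    · refine (starIncl_starMk (K := L) _ ⟨f.toFun x.1, ?_⟩ ?_).choose_spec
      · intro j hj
        obtain ⟨k, -, hik, hkj⟩ := f.mapsTo_of_mem x hj
        exact f.target_subset (hkj.mono_left hik)
      · change _ = f.starFun i q.1
        rw [← hx]
        rfl

/-- A triply iterated star is identified with a star of `K` in two ways, which agree because both
keep representatives. -/
theorem inclPush_inclPush (i : K.Idx) (j : (K.star i).Idx) :
    (K.inclPush i k).comp ((K.star i).inclPush j k) =
      (K.inclPush j.1 k).comp ((K.starIncl i j).extPush k) := by
  classical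
  refine DirectSum.addHom_ext fun l A => ?_
  refine ((congrArg (K.inclPush i k) (inclPush_of j l A)).trans ((inclPush_of i l.1 _).trans
    (congrArg _ (Mor.push_push _ _ A)))).trans (Eq.trans ?_ ((congrArg (K.inclPush j.1 k)
    (Mor.extPush_of (K.starIncl i j) l A)).trans ((inclPush_of _ _ _).trans
    (congrArg _ (Mor.push_push _ _ A)))).symm)
  refine of_push_congr ?_ (fun p => ?_) A
  · obtain ⟨r, hr, rfl⟩ := ((K.star i).star j).exists_inner l
    obtain ⟨q, rfl⟩ := starMk_surjective _ r
    obtain ⟨x, hx⟩ := starMk_surjective i q.1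
    obtain ⟨h, he⟩ := starIncl_starMk q x hx
    rw [minCone_starMk, Mor.target_minCone, he, minCone_starMk, ← hx, minCone_starMk]
  · obtain ⟨⟨r, hr⟩, rfl⟩ := starMk_surjective _ p
    obtain ⟨q, rfl⟩ := starMk_surjective _ r
    obtain ⟨x, hx⟩ := starMk_surjective i q.1
    obtain ⟨h, he⟩ := starIncl_starMk q x hx
    obtain ⟨h₁, he₁⟩ := starIncl_starMk (K := K.star i) ⟨(K.star i).starMk j q, hr⟩ q rfl
    obtain ⟨h₂, he₂⟩ := starIncl_starMk (K := K) (⟨q.1, h₁⟩ : (K.star i).openStar l.1) x hx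
    refine ⟨x.1, h₂, ?_, (congrArg (K.starIncl i l.1).toFun he₁).trans he₂, ?_⟩
    rotate_left
    · exact (starIncl_starMk (K := K) _ ⟨x.1, h⟩ he.symm).choose_spec

end ConeComplex

namespace ConeComplex

variable {X : Type u} {Y : Type u'} {K K' : ConeComplex X} {L L' : ConeComplex Y} {k : ℕ}

/-- The lattice of a cone of `K'` is the same whether computed in `K'` or in `K`, so the morphism of
the subdivision has index one on every cone. -/
theorem weightClass_eq_push (h : K.IsProperSubdivision K') (c : K'.ConesOfDim k → ℤ) :
    weightClass h c = h.mor.push k (∑ σ, c σ • K'.cls k (K'.carrier σ.1)) := by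
  rw [weightClass_eq_sum, map_sum]
  refine Finset.sum_congr rfl fun σ _ => ?_
  have e : h.mor.latIndex (isSubcone_carrier σ.1) = 1 :=
    (h.mor.latIndex_eq_dualIndex (isSubcone_carrier σ.1) (isLinOn_refine h σ.1)).trans
      (dualIndex_of_bijective (isLinOn_refine_bijective h σ.1))
  rw [map_zsmul, h.mor.push_cls (isSubcone_carrier σ.1) σ.2, e, Nat.cast_one, one_smul]
  exact congrArg (fun S => c σ • K.cls k S) (Set.image_id _).symm

theorem exists_isUnion_image (F : Mor K' L) : ∃ L', L.IsProperSubdivision L' ∧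
    ∀ σ, L'.IsUnion (F.toFun '' K'.carrier σ) := by
  obtain ⟨L', h', hL'⟩ := L.exists_adapted (𝒮 := Set.range fun σ => F.toFun '' K'.carrier σ)
    (Set.finite_range _) (by
      rintro _ ⟨σ, rfl⟩
      exact F.isSubcone_image (isSubcone_carrier σ))
  exact ⟨L', h', fun σ => hL' _ ⟨σ, rfl⟩⟩

end ConeComplex

theorem map_mem_of_directSum {ι : Type*} [DecidableEq ι] {β : ι → Type*}
    [∀ i, AddCommGroup (β i)] {B : Type*} [AddCommGroup B] (F : (⨁ i, β i) →+ B)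
    (H : AddSubgroup B) {A : ⨁ i, β i} (h : ∀ i, F (DirectSum.of β i (A i)) ∈ H) : F A ∈ H := by
  classical
  rw [← DirectSum.sum_support_of A, map_sum]
  exact sum_mem fun i _ => h i

/-! ### Balancing tested by functionals; push-forward of cycles -/

namespace WECC

open ConeComplex

variable {X : Type u} {Y : Type u'} {Z : Type u''} (W : WECC.{u, v} X) (V : WECC.{u', v'} Y)
  (U : WECC.{u'', v''} Z)

variable {W} in
-- The span of a cone is a rational subspace, so integral functionals that vanish on the cone
-- suffice to cut it out.
theorem mem_linSpan_iff {i : W.Idx} {z : ℝ ⊗[ℤ] W.N} : z ∈ W.linSpan (W.carrier i) ↔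
    ∀ m : W.N →ₗ[ℤ] ℤ, (∀ x ∈ W.carrier i, evalR m (W.φ x) = 0) → evalR m z = 0 := by
  constructor
  · intro hz m hm
    refine Submodule.span_induction (p := fun z _ => evalR m z = 0) ?_ (map_zero _)
      (fun x y _ _ hx hy => by rw [map_add, hx, hy, add_zero])
      (fun a x _ hx => by rw [map_smul, hx, smul_zero]) hz
    rintro _ ⟨x, hx, rfl⟩
    exact hm x hx
  · intro h
    set Λ := W.subLattice (W.carrier i)
    -- The quotient of the lattice by `Λ` is free, so its functionals separate the points of its
    -- real extension. Pulled back to the lattice, they vanish on the cone.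
    have h0 : Λ.mkQ.lTensor ℝ z = 0 := eq_of_evalR fun m => by
      rw [map_zero]
      refine (evalR_baseChange m Λ.mkQ z).trans (h _ fun x hx => W.evalR_mkQ_φ_eq_zero m hx)
    -- By exactness of the tensor product, `z` comes from `ℝ ⊗ Λ`, and every element of `Λ` lies in
    -- the span by definition.
    obtain ⟨w, rfl⟩ := (lTensor_exact ℝ (LinearMap.exact_subtype_mkQ Λ)
      (Submodule.mkQ_surjective Λ) z).1 h0
    have hw : ∀ w : ℝ ⊗[ℤ] Λ, Λ.subtype.lTensor ℝ w ∈ W.linSpan (W.carrier i) := by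
      intro w
      induction w with
      | zero => rw [map_zero]; exact zero_mem _
      | add a b ha hb => rw [map_add]; exact add_mem ha hb
      | tmul r n =>
        have : (r ⊗ₜ[ℤ] n.1 : ℝ ⊗[ℤ] W.N) = r • ((1 : ℝ) ⊗ₜ[ℤ] n.1) := by
          rw [TensorProduct.smul_tmul', smul_eq_mul, mul_one]
        rw [LinearMap.lTensor_tmul]
        change (r ⊗ₜ[ℤ] n.1 : ℝ ⊗[ℤ] W.N) ∈ _
        rw [this]
        exact Submodule.smul_mem _ _ n.2
    exact hw w

variable {W} in
-- This turns the vector equation modulo a subspace into scalar equations, to which the computations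
-- with integral linear functions apply.
theorem isMinkowskiWeight_iff {l : ℕ} {c : W.ConesOfDim (l + 1) → ℤ} :
    W.IsMinkowskiWeight c ↔ ∀ τ : W.ConesOfDim l, ∀ v : W.ConesOver (l + 1) τ.1 → X,
      (∀ σ, W.IsLatticeNormal σ.1.1 τ.1 (v σ)) → ∀ m : W.N →ₗ[ℤ] ℤ,
      (∀ x ∈ W.carrier τ.1, evalR m (W.φ x) = 0) →
      ∑ σ, (c σ.1 : ℝ) * evalR m (W.φ (v σ)) = 0 := by
  have key : ∀ (τ : W.ConesOfDim l) (v : W.ConesOver (l + 1) τ.1 → X) (m : W.N →ₗ[ℤ] ℤ),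
      evalR m (∑ᶠ σ : W.ConesOver (l + 1) τ.1, c σ.1 • W.φ (v σ)) =
        ∑ σ, (c σ.1 : ℝ) * evalR m (W.φ (v σ)) := by
    intro τ v m
    rw [finsum_eq_sum_of_fintype, map_sum]
    exact Finset.sum_congr rfl fun σ _ => by rw [map_zsmul, zsmul_eq_mul]
  constructor
  · intro h τ v hv m hm
    rw [← key]
    exact mem_linSpan_iff.1 (h τ.1 (by rw [τ.2]) v hv) m hm
  · intro h τ hτ v hv
    refine mem_linSpan_iff.2 fun m hm => ?_
    exact (key ⟨τ, Nat.succ_injective hτ⟩ v m).trans (h ⟨τ, Nat.succ_injective hτ⟩ v hv m hm)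

/-- A map is compatible with the weak embeddings if it pulls back integral linear functions on the
target lattice to integral linear functions on the source lattice. -/
def Compatible (f : X → Y) : Prop := ∀ m : V.N →ₗ[ℤ] ℤ, ∃ m' : W.N →ₗ[ℤ] ℤ, ∀ x,
  evalR m (V.φ (f x)) = evalR m' (W.φ x)

variable {W V U}

theorem Mor.compatible (f : Mor W V) : W.Compatible V f.toFun := fun m =>
  ⟨m ∘ₗ f.latHom, fun x => by rw [f.comm, evalR_baseChange]⟩

theorem Compatible.comp {g : Y → Z} {f : X → Y} (hg : V.Compatible U g) (hf : W.Compatible V f) :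
    W.Compatible U (g ∘ f) := fun m => by
  obtain ⟨m', hm'⟩ := hg m
  obtain ⟨m'', hm''⟩ := hf m'
  exact ⟨m'', fun x => (hm' _).trans (hm'' x)⟩

theorem evalR_star_φ {i : W.Idx} (m : (W.star i).N →ₗ[ℤ] ℤ) (x : W.openStar i) :
    evalR m ((W.star i).φ (W.starMk i x)) =
      evalR (m ∘ₗ (W.subLattice (W.carrier i)).mkQ) (W.φ x.1) :=
  evalR_baseChange _ _ _

/-- A functional vanishing on the image of the cone vanishes on its span, hence on the sublattice by
which the lattice of the star is a quotient. -/
theorem exists_star_functional {i : W.Idx} {m : W.N →ₗ[ℤ] ℤ}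
    (hm : ∀ x ∈ W.carrier i, evalR m (W.φ x) = 0) : ∃ m' : (W.star i).N →ₗ[ℤ] ℤ,
    ∀ x : W.openStar i, evalR m (W.φ x.1) = evalR m' ((W.star i).φ (W.starMk i x)) := by
  refine ⟨(W.subLattice (W.carrier i)).liftQ m fun n hn => ?_, fun x => ?_⟩
  · have := mem_linSpan_iff.1 (W.mem_subLattice.1 hn) m hm
    rw [evalR_tmul, mul_one] at this
    exact_mod_cast this
  · refine Eq.trans ?_ (evalR_star_φ _ x).symm
    exact congrArg (fun m => evalR m (W.φ x.1)) (Submodule.liftQ_mkQ _ _ _).symm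

theorem Compatible.starMap {f : ConeComplex.Mor W.toConeComplex V.toConeComplex}
    (hf : W.Compatible V f.toFun) (i : W.Idx) :
    (W.star i).Compatible (V.star (f.target i)) (f.starMap i).toFun := fun m => by
  obtain ⟨m', hm'⟩ := hf (m ∘ₗ (V.subLattice (V.carrier (f.target i))).mkQ)
  obtain ⟨m'', hm''⟩ := exists_star_functional (i := i) (m := m') fun x hx =>
    (hm' x).symm.trans (evalR_mkQ_φ_eq_zero _ _ (f.mapsTo_target i hx))
  refine ⟨m'', fun p => ?_⟩
  obtain ⟨x, rfl⟩ := starMk_surjective i p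
  exact (evalR_star_φ m _).trans ((hm' x.1).trans (hm'' x))

/-- A functional on the lattice of the star at `j` is pulled back to `N` and then descends through
the two successive quotients. No isomorphism between the iterated quotient and the quotient is
needed. -/
theorem compatible_starIncl (i : W.Idx) (j : (W.star i).Idx) :
    ((W.star i).star j).Compatible (W.star j.1) (W.starIncl i j).toFun := fun m => by
  have h0 : ∀ x ∈ W.carrier j.1, evalR (m ∘ₗ (W.subLattice (W.carrier j.1)).mkQ) (W.φ x) = 0 :=
    fun x hx => evalR_mkQ_φ_eq_zero _ _ hx
  obtain ⟨m', hm'⟩ := exists_star_functional (i := i) fun x hx => h0 x (j.2 hx)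
  obtain ⟨m'', hm''⟩ := exists_star_functional (W := W.star i) (i := j) (m := m') (by
    rintro _ ⟨x, hx, rfl⟩
    exact (hm' x).symm.trans (h0 _ hx))
  refine ⟨m'', fun p => ?_⟩
  obtain ⟨q, rfl⟩ := starMk_surjective (K := W.toConeComplex.star i) j p
  obtain ⟨x, hx⟩ := starMk_surjective i q.1
  obtain ⟨h, he⟩ := starIncl_starMk q x hx
  refine (congrArg (fun z => evalR m ((W.star j.1).φ z)) he).trans ((evalR_star_φ m _).trans
    ((hm' x).trans (Eq.trans ?_ (hm'' q))))
  exact congrArg (fun z => evalR m' ((W.star i).φ z)) hx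

theorem IsMinkowskiWeight.push {f : ConeComplex.Mor W.toConeComplex V.toConeComplex}
    (hf : W.Compatible V f.toFun) {K' : ConeComplex X} {h : W.IsProperSubdivision K'} {k : ℕ}
    {c : K'.ConesOfDim k → ℤ} (hc : (W.refine K' h).IsMinkowskiWeight c) {L' : ConeComplex Y}
    (h' : V.IsProperSubdivision L')
    (hU : ∀ σ, L'.IsUnion ((f.comp h.mor).toFun '' K'.carrier σ)) :
    (V.refine L' h').IsMinkowskiWeight (pushWeight L' (f.comp h.mor) c) := by
  cases k with
  -- There are no cones of dimension `-1`, so balancing is vacuous for `k = 0`.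
  | zero => exact fun τ hτ => absurd hτ (Nat.succ_ne_zero _)
  | succ l =>
    refine isMinkowskiWeight_iff.2 fun κ v hv m hm => ?_
    obtain ⟨m', hm'⟩ := hf m
    refine pushWeight_balanced h' (f.comp h.mor) hU κ.2 (μ := fun y => evalR m (V.φ y))
      (fun i => V.integral i m) hm (fun τ hτ w hw => ?_) hv
    have := isMinkowskiWeight_iff.1 hc τ w hw m' fun x hx => (hm' x).symm.trans (hτ x hx)
    rw [← this]
    exact Finset.sum_congr rfl fun σ _ => congrArg _ (hm' _)

/-- It is enough to treat the class of one balanced weight on a subdivision. Its push-forward is the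
class of `pushWeight` on an adapted subdivision of the target. -/
theorem push_mem_cycles {f : ConeComplex.Mor W.toConeComplex V.toConeComplex}
    (hf : W.Compatible V f.toFun) {k : ℕ} {A : W.Weight k} (hA : A ∈ W.cycles k) :
    f.push k A ∈ V.cycles k := by
  refine (AddSubgroup.closure_le ((V.cycles k).comap (f.push k))).2 ?_ hA
  rintro _ ⟨K', h, c, hc, rfl⟩
  obtain ⟨L', h', hU⟩ := exists_isUnion_image (f.comp h.mor)
  refine AddSubgroup.subset_closure ⟨L', h', pushWeight L' (f.comp h.mor) c, hc.push hf h' hU, ?_⟩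
  rw [weightClass_eq_push, ConeComplex.Mor.push_push, push_weight h' _ hU]

theorem of_mem_extCycles [DecidableEq W.Idx] {k : ℕ} {i : W.Idx} {A : (W.star i).Weight k}
    (hA : A ∈ (W.star i).cycles k) :
    DirectSum.of (fun i => (W.toConeComplex.star i).Weight k) i A ∈ W.extCycles k := fun j => by
  by_cases h : i = j
  · subst h
    have e := DirectSum.of_eq_same (β := fun i => (W.toConeComplex.star i).Weight k) i A
    exact e.symm ▸ hA
  · have e := DirectSum.of_eq_of_ne (β := fun i => (W.toConeComplex.star i).Weight k) i j A
      (Ne.symm h)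
    exact e.symm ▸ zero_mem ((W.star j).cycles k)

theorem extPush_mem_extCycles {f : ConeComplex.Mor W.toConeComplex V.toConeComplex}
    (hf : W.Compatible V f.toFun) {k : ℕ} {A : W.ExtWeight k} (hA : A ∈ W.extCycles k) :
    f.extPush k A ∈ V.extCycles k := by
  classical
  refine map_mem_of_directSum (β := fun i => (W.toConeComplex.star i).Weight k) _ _ fun i => ?_
  rw [ConeComplex.Mor.extPush_of]
  exact of_mem_extCycles (push_mem_cycles (hf.starMap i) (hA i))

theorem inclPush_mem_extCycles {i : W.Idx} {k : ℕ} {A : (W.star i).ExtWeight k}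
    (hA : A ∈ (W.star i).extCycles k) : W.inclPush i k A ∈ W.extCycles k := by
  classical
  refine map_mem_of_directSum (β := fun j => ((W.toConeComplex.star i).star j).Weight k) _ _
    fun j => ?_
  refine (inclPush_of i j (A j)).symm ▸ of_mem_extCycles (push_mem_cycles (compatible_starIncl i j) (hA j))

theorem ExtMor.push_mem_extCycles (f : ExtMor W V) {k : ℕ} {A : W.ExtWeight k}
    (hA : A ∈ W.extCycles k) : f.push k A ∈ V.extCycles k := by
  cases f with
  | dominant f => exact extPush_mem_extCycles f.compatible hA
  | boundary δ f => exact inclPush_mem_extCycles (extPush_mem_extCycles f.compatible hA)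

end WECC

/-! ### Products with the line -/

namespace ConeComplex

variable {X : Type u} {Y : Type u'} {Z : Type u''} {K K' : ConeComplex X} {L L' : ConeComplex Y}
  {Q : ConeComplex Z} {k : ℕ}

theorem isDivisor_starDivisor {ψ : X → ℝ} (hψ : K.IsDivisor ψ) (i : K.Idx)
    (h0 : ∀ x ∈ K.carrier i, ψ x = 0) : (K.star i).IsDivisor (starDivisor hψ i h0) := by
  rintro ⟨j, hj⟩
  refine ⟨_, hψ j, fun z hz => by rw [restr_of_mem (hj hz), h0 z hz], fun x => ?_⟩
  change restr (K.starCarrier i j) _ _ = _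
  by_cases hx : x.1 ∈ K.carrier j
  · rw [restr_of_mem (mem_starCarrier.2 hx), restr_of_mem hx]
    rfl
  · rw [restr_of_notMem (fun h => hx (mem_starCarrier.1 h)), restr_of_notMem hx]

variable (Q) in
/-- The product of a morphism with the identity of `Q`. -/
def Mor.prodMap (f : Mor K L) : Mor (K.prod Q) (L.prod Q) where
  toFun p := (f.toFun p.1, p.2)
  map_cone := by
    rintro ⟨i, s⟩
    obtain ⟨j, hj, hm⟩ := f.map_cone i
    refine ⟨(j, s), fun p hp => ⟨hj hp.1, hp.2⟩, ?_⟩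
    rintro _ ⟨⟨m, m'⟩, ⟨h1, h2⟩, rfl⟩
    refine ⟨(_, m'), ⟨hm m h1, h2⟩, ?_⟩
    funext p
    change _ = restr (K.carrier i ×ˢ Q.carrier s) _ p
    by_cases hp : p ∈ K.carrier i ×ˢ Q.carrier s
    · rw [restr_of_mem hp, sumFn_apply hp]
      refine Eq.trans ?_ (sumFn_apply (S := L.carrier j) (S' := Q.carrier s)
        (p := (f.toFun p.1, p.2)) ⟨hj hp.1, hp.2⟩ (m, m')).symm
      exact congrArg (· + m' p.2) (restr_of_mem hp.1 _)
    · exact (restr_of_notMem hp _).trans (restr_of_notMem hp _).symm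

theorem minCone_prod_zero (x : X) :
    (K.prod line).minCone (x, 0) = (K.minCone x, (0 : SignType)) := by
  refine (K.prod line).carrier_injective (Set.Subset.antisymm (minCone_subset
    ⟨K.mem_minCone x, zero_mem_lineRay 0⟩) ?_)
  have h := (K.prod line).mem_minCone (x, 0)
  rintro ⟨y, t⟩ ⟨hy, ht⟩
  change t ∈ lineRay 0 at ht
  rw [lineRay_zero] at ht
  obtain rfl : t = 0 := ht
  exact ⟨minCone_subset h.1 hy, h.2⟩

theorem mem_openStar_prod {i : K.Idx} (x : K.openStar i) (t : ℝ) :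
    (x.1, t) ∈ (K.prod line).openStar (i, (0 : SignType)) := by
  rintro ⟨j, s⟩ hj
  refine Set.prod_mono (x.2 j hj.1) ?_
  change lineRay 0 ⊆ lineRay s
  rw [lineRay_zero]
  rintro _ rfl
  exact zero_mem_lineRay s

/-- The linear function on the line vanishes at `0`, so vanishing on `i × 0` is a condition on the
first summand only. -/
theorem prod_line_fn_vanish {i j : K.Idx} {s : SignType} (h : K.carrier i ⊆ K.carrier j)
    {m : X → ℝ} {m' : ℝ → ℝ} (hm' : m' ∈ line.M s)
    (h0 : ∀ z ∈ (K.prod line).carrier (i, (0 : SignType)),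
      sumFn (K.carrier j) (line.carrier s) (m, m') z = 0) : ∀ z ∈ K.carrier i, m z = 0 := by
  intro z hz
  have h1 := h0 (z, 0) ⟨hz, zero_mem_lineRay 0⟩
  rw [sumFn_apply ⟨h hz, zero_mem_lineRay s⟩] at h1
  obtain ⟨_, ⟨n, rfl⟩, rfl⟩ := hm'
  have h2 : restr (lineRay s) (n • id) (0 : ℝ) = 0 := by
    rw [restr_of_mem (zero_mem_lineRay s)]
    simp
  change m z + restr (lineRay s) (n • id) (0 : ℝ) = 0 at h1
  rwa [h2, add_zero] at h1

variable (K) in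
/-- The canonical morphism from the product of a star with `Π¹` to a star of the product. -/
def starProd (i : K.Idx) : Mor ((K.star i).prod line) ((K.prod line).star (i, (0 : SignType))) where
  toFun p := Quotient.lift (fun x : K.openStar i =>
    (K.prod line).starMk (i, (0 : SignType)) ⟨(x.1, p.2), mem_openStar_prod x p.2⟩) (by
      intro x y h
      refine starMk_eq.2 ⟨fun j => and_congr_left fun _ => h.1 j.1, ?_⟩
      rintro ⟨j, s⟩ hj _ ⟨⟨m, m'⟩, ⟨hm, hm'⟩, rfl⟩ h0
      have h1 := h.2 j hj.1 m hm (prod_line_fn_vanish (x.2 j hj.1) hm' h0)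
      refine (sumFn_apply hj _).trans (Eq.trans ?_
        (sumFn_apply (p := (y.1, p.2)) ⟨(h.1 j).1 hj.1, hj.2⟩ _).symm)
      exact congrArg (· + m' p.2) h1) p.1
  map_cone := by
    rintro ⟨⟨j, hj⟩, s⟩
    have hjs : (K.prod line).carrier (i, (0 : SignType)) ⊆ (K.prod line).carrier (j, s) := by
      rintro ⟨y, t⟩ ⟨hy, ht⟩
      change t ∈ lineRay 0 at ht
      rw [lineRay_zero] at ht
      obtain rfl : t = 0 := ht
      exact ⟨hj hy, zero_mem_lineRay s⟩
    refine ⟨⟨(j, s), hjs⟩, ?_, ?_⟩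
    · rintro ⟨_, t⟩ ⟨⟨x, hx, rfl⟩, ht⟩
      exact ⟨⟨(x.1, t), mem_openStar_prod x t⟩, ⟨hx, ht⟩, rfl⟩
    · rintro g ⟨_, ⟨⟨m, m'⟩, ⟨hm, hm'⟩, rfl⟩, h0, hg⟩
      obtain ⟨g', hg', hgm⟩ := exists_star_fn (i := i) hm (prod_line_fn_vanish hj hm' h0)
      refine ⟨(g', m'), ⟨hg', hm'⟩, ?_⟩
      funext ⟨p, t⟩
      obtain ⟨x, rfl⟩ := starMk_surjective i p
      change _ = restr (K.starCarrier i j ×ˢ lineRay s) _ _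
      by_cases hp : (K.starMk i x, t) ∈ K.starCarrier i j ×ˢ lineRay s
      · rw [restr_of_mem hp]
        refine (sumFn_apply hp _).trans (Eq.trans ?_ (hg ⟨(x.1, t), mem_openStar_prod x t⟩).symm)
        refine Eq.trans ?_ (sumFn_apply (p := (x.1, t)) ⟨mem_starCarrier.1 hp.1, hp.2⟩ _).symm
        exact congrArg (· + m' t) (hgm x)
      · exact (restr_of_notMem hp _).trans (restr_of_notMem hp _).symm

open Classical in
theorem inclPush_congr {s s' : L.Idx} (hs : s = s') {a : Mor K (L.star s)}
    {b : Mor K (L.star s')}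
    (h : ∀ p, ∃ x hx hx', a.toFun p = L.starMk s ⟨x, hx⟩ ∧ b.toFun p = L.starMk s' ⟨x, hx'⟩)
    (A : K.ExtWeight k) : L.inclPush s k (a.extPush k A) = L.inclPush s' k (b.extPush k A) := by
  subst hs
  have e : a = b := Mor.ext (funext fun p => by
    obtain ⟨x, hx, hx', h1, h2⟩ := h p
    exact h1.trans h2.symm)
  rw [e]

/-- This transports the construction of rational equivalences from the star at `δ` to the whole
complex: the projection to the star factors through the star of the product at `δ × 0`. -/
theorem fst_inclPush_inclPush (δ : K.Idx) (B : ((K.star δ).prod line).ExtWeight k) :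
    K.inclPush δ k ((fstMor (K.star δ) line).extPush k B) =
      (fstMor K line).extPush k ((K.prod line).inclPush (δ, (0 : SignType)) k
        ((K.starProd δ).extPush k B)) := by
  have e := DFunLike.congr_fun ((fstMor K line).extPush_inclPush (k := k) (δ, (0 : SignType)))
    ((K.starProd δ).extPush k B)
  refine Eq.trans ?_ e.symm
  have e' := DFunLike.congr_fun (Mor.extPush_comp (k := k)
    ((fstMor K line).starMap (δ, (0 : SignType))) (K.starProd δ)) B
  refine Eq.trans ?_ (congrArg (K.inclPush ((fstMor K line).target (δ, (0 : SignType))) k) e')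
  refine inclPush_congr ?_ (fun p => ?_) B
  · obtain ⟨x, hx, rfl⟩ := K.exists_inner δ
    exact ((congrArg (fstMor K line).target (minCone_prod_zero x).symm).trans
      (Mor.target_minCone _ _)).symm
  · obtain ⟨p, t⟩ := p
    obtain ⟨x, rfl⟩ := starMk_surjective δ p
    exact ⟨x.1, _, _, rfl, rfl⟩

theorem fst_prodMap (f : Mor K L) (B : (K.prod line).ExtWeight k) :
    f.extPush k ((fstMor K line).extPush k B) =
      (fstMor L line).extPush k ((f.prodMap line).extPush k B) := by
  have e1 := DFunLike.congr_fun (Mor.extPush_comp (k := k) f (fstMor K line)) B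
  have e2 := DFunLike.congr_fun (Mor.extPush_comp (k := k) (fstMor L line) (f.prodMap line)) B
  exact e1.symm.trans e2

theorem Mor.target_prodMap (f : Mor K L) (σ : K.Idx) :
    (f.prodMap line).target (σ, (0 : SignType)) = (f.target σ, (0 : SignType)) := by
  obtain ⟨x, hx, rfl⟩ := K.exists_inner σ
  refine (congrArg (f.prodMap line).target (minCone_prod_zero x).symm).trans
    ((Mor.target_minCone _ _).trans ((minCone_prod_zero (f.toFun x)).trans ?_))
  exact congrArg (fun j => (j, (0 : SignType))) (f.target_minCone x).symm

/-- The zero section is preserved, so `σ × 0` over the star corresponds to a cone of the form `σ ×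
0` of the product. Hence generators of the relations have the right shape after transport. -/
theorem exists_target_starProd (δ : K.Idx) (σ : (K.star δ).Idx) :
    ((K.starProd δ).target (σ, (0 : SignType))).1 = (σ.1, (0 : SignType)) := by
  obtain ⟨p, hp, rfl⟩ := (K.star δ).exists_inner σ
  obtain ⟨x, rfl⟩ := starMk_surjective δ p
  have e := (congrArg (K.starProd δ).target
    (minCone_prod_zero (K := K.star δ) (K.starMk δ x)).symm).trans (Mor.target_minCone _ _)
  refine (congrArg Subtype.val e).trans ((minCone_starMk (K := K.prod line)
    (i := (δ, (0 : SignType))) ⟨(x.1, 0), mem_openStar_prod x 0⟩).trans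
    ((minCone_prod_zero x.1).trans ?_))
  exact congrArg (fun j => (j, (0 : SignType))) (minCone_starMk x).symm

end ConeComplex

/-! ### Push-forward of rational equivalence -/

namespace WECC

open ConeComplex

variable {X : Type u} {Y : Type u'} {Z : Type u''} {W : WECC.{u, v} X} {V : WECC.{u', v'} Y}
  {U : WECC.{u'', v''} Z}

theorem evalR_prod_φ (m : (W.prod V).N →ₗ[ℤ] ℤ) (p : X × Y) : evalR m ((W.prod V).φ p) =
    evalR (m ∘ₗ LinearMap.inl ℤ W.N V.N) (W.φ p.1) +
      evalR (m ∘ₗ LinearMap.inr ℤ W.N V.N) (V.φ p.2) :=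
  (map_add (evalR m) _ _).trans
    (congrArg₂ (· + ·) (evalR_baseChange _ _ _) (evalR_baseChange _ _ _))

theorem exists_prod_functional (a : W.N →ₗ[ℤ] ℤ) (b : V.N →ₗ[ℤ] ℤ) :
    ∃ m : (W.prod V).N →ₗ[ℤ] ℤ, ∀ p, evalR m ((W.prod V).φ p) =
      evalR a (W.φ p.1) + evalR b (V.φ p.2) :=
  ⟨a.coprod b, fun p => (evalR_prod_φ _ p).trans (congrArg₂ (· + ·)
    (congrArg (fun m => evalR m (W.φ p.1)) (LinearMap.coprod_inl a b))
    (congrArg (fun m => evalR m (V.φ p.2)) (LinearMap.coprod_inr a b)))⟩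

theorem Compatible.prodMap {f : ConeComplex.Mor W.toConeComplex V.toConeComplex}
    (hf : W.Compatible V f.toFun) :
    (W.prod U).Compatible (V.prod U) (f.prodMap U.toConeComplex).toFun := fun m => by
  obtain ⟨a, ha⟩ := hf (m ∘ₗ LinearMap.inl ℤ V.N U.N)
  obtain ⟨m', hm'⟩ := exists_prod_functional a (m ∘ₗ LinearMap.inr ℤ V.N U.N)
  refine ⟨m', fun p => ?_⟩
  exact (evalR_prod_φ m _).trans (Eq.trans (congrArg (· + _) (ha p.1)) (hm' p).symm)

theorem compatible_starProd (i : W.Idx) : ((W.star i).prod line).Compatible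
    ((W.prod line).star (i, (0 : SignType))) (W.starProd i).toFun := fun m => by
  set m₁ : (W.prod line).N →ₗ[ℤ] ℤ :=
    m ∘ₗ ((W.prod line).subLattice ((W.prod line).carrier (i, (0 : SignType)))).mkQ with hm₁
  obtain ⟨a, ha⟩ := exists_star_functional (i := i) (m := m₁ ∘ₗ LinearMap.inl ℤ W.N line.N)
    fun x hx => by
      have h1 := (evalR_prod_φ m₁ (x, 0)).symm.trans
        (evalR_mkQ_φ_eq_zero (W.prod line) m (i := (i, (0 : SignType)))
          (z := (x, 0)) ⟨hx, zero_mem_lineRay 0⟩)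
      have h2 : line.φ 0 = 0 := TensorProduct.zero_tmul _ _
      rwa [h2, map_zero, add_zero] at h1
  obtain ⟨m', hm'⟩ := exists_prod_functional a (m₁ ∘ₗ LinearMap.inr ℤ W.N line.N)
  refine ⟨m', ?_⟩
  rintro ⟨p, t⟩
  obtain ⟨x, rfl⟩ := starMk_surjective i p
  refine (evalR_star_φ m ⟨(x.1, t), mem_openStar_prod x t⟩).trans ((evalR_prod_φ m₁ (x.1, t)).trans
    (Eq.trans ?_ (hm' _).symm))
  exact congrArg (· + _) (ha x)

/-- The projection formula for a map `G` into a star of the product: if the second coordinate pulls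
back to `ψ`, the push-forward of `ψ · [c]` is the product of the divisor of the second coordinate
with a push-forward of `c`, which is balanced. This is a defining generator of the relations. -/
theorem mem_ratEquiv {τ : (V.prod line).Idx} {δ : V.Idx} (hτ : τ = (δ, (0 : SignType)))
    {G : ConeComplex.Mor W.toConeComplex ((V.prod line).toConeComplex.star τ)}
    (hG : W.Compatible ((V.prod line).star τ) G.toFun) {ψ : X → ℝ}
    (hψ : ∀ p, ∃ x, G.toFun p = starMk τ x ∧ x.1.2 = ψ p) {k : ℕ} {K' : ConeComplex X}
    {h : W.IsProperSubdivision K'} {c : K'.ConesOfDim (k + 1) → ℤ}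
    (hc : (W.refine K' h).IsMinkowskiWeight c) :
    (fstMor V.toConeComplex ConeComplex.line).extPush k
      ((V.prod line).inclPush τ k (G.extPush k (divisorProduct h ψ c))) ∈ V.ratEquiv k := by
  subst hτ
  obtain ⟨L', h', hU⟩ := exists_isUnion_image (G.comp h.mor)
  refine AddSubgroup.subset_closure ⟨δ, L', h', pushWeight L' (G.comp h.mor) c,
    hc.push hG h' hU, ?_⟩
  have hD := isDivisor_starDivisor V.isDivisor_snd (δ, (0 : SignType)) (V.snd_eq_zero δ)
  -- The hypothesis on representatives says that `ψ` is the pull-back of the divisor given by the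
  -- second coordinate.
  have e : ψ = starDivisor V.isDivisor_snd (δ, (0 : SignType)) (V.snd_eq_zero δ) ∘
      (G.comp h.mor).toFun := funext fun p => by
    obtain ⟨x, hx, hxp⟩ := hψ p
    refine hxp.symm.trans ?_
    exact (congrArg (starDivisor V.isDivisor_snd (δ, (0 : SignType)) (V.snd_eq_zero δ)) hx).symm
  have e1 := DFunLike.congr_fun (ConeComplex.Mor.extPush_comp (k := k) G h.mor) (K'.rayProduct ψ c)
  have e2 := (congrArg (fun ψ => (G.comp h.mor).extPush k (K'.rayProduct ψ c)) e).trans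
    (extPush_rayProduct h' hU hD c)
  exact congrArg _ (congrArg ((V.prod line).inclPush (δ, (0 : SignType)) k) (e1.symm.trans e2))

/-- The map on the star at `σ × 0` induced by `f × id` preserves the second coordinate, and `f`
after the first projection equals the first projection after `f × id`. -/
theorem extPush_mem_ratEquiv {f : ConeComplex.Mor W.toConeComplex V.toConeComplex}
    (hf : W.Compatible V f.toFun) {k : ℕ} {A : W.ExtWeight k} (hA : A ∈ W.ratEquiv k) :
    f.extPush k A ∈ V.ratEquiv k := by
  refine (AddSubgroup.closure_le ((V.ratEquiv k).comap (f.extPush k))).2 ?_ hA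
  rintro _ ⟨σ, K', h, c, hc, rfl⟩
  have e := DFunLike.congr_fun ((f.prodMap ConeComplex.line).extPush_inclPush (k := k)
    (σ, (0 : SignType))) (divisorProduct h (starDivisor W.isDivisor_snd (σ, (0 : SignType))
      (W.snd_eq_zero σ)) c)
  have := mem_ratEquiv (f.target_prodMap σ) ((hf.prodMap (U := line)).starMap (σ, (0 : SignType)))
    (ψ := starDivisor W.isDivisor_snd (σ, (0 : SignType)) (W.snd_eq_zero σ)) (fun p => by
      obtain ⟨x, rfl⟩ := starMk_surjective _ p
      exact ⟨_, rfl, rfl⟩) hc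
  exact (congrArg (· ∈ V.ratEquiv k) ((fst_prodMap f _).trans (congrArg _ e))).mpr this

/-- Here `G` is the star map of the canonical morphism to the star of the product at `δ × 0`,
followed by the identification of an iterated star with a star of the product. Both preserve the
second coordinate. -/
theorem inclPush_mem_ratEquiv {δ : W.Idx} {k : ℕ} {A : (W.star δ).ExtWeight k}
    (hA : A ∈ (W.star δ).ratEquiv k) : W.inclPush δ k A ∈ W.ratEquiv k := by
  refine (AddSubgroup.closure_le ((W.ratEquiv k).comap (W.inclPush δ k))).2 ?_ hA
  rintro _ ⟨σ, K', h, c, hc, rfl⟩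
  set D := divisorProduct h (starDivisor (W.star δ).isDivisor_snd (σ, (0 : SignType))
      ((W.star δ).snd_eq_zero σ)) c
  have e1 := DFunLike.congr_fun ((W.starProd δ).extPush_inclPush (k := k) (σ, (0 : SignType))) D
  have e2 := DFunLike.congr_fun (inclPush_inclPush (K := W.toConeComplex.prod ConeComplex.line)
    (k := k) (δ, (0 : SignType)) ((W.starProd δ).target (σ, (0 : SignType))))
    (((W.starProd δ).starMap (σ, (0 : SignType))).extPush k D)
  have e3 := DFunLike.congr_fun (ConeComplex.Mor.extPush_comp (k := k)
    ((W.toConeComplex.prod ConeComplex.line).starIncl (δ, (0 : SignType))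
      ((W.starProd δ).target (σ, (0 : SignType)))) ((W.starProd δ).starMap (σ, (0 : SignType)))) D
  have := mem_ratEquiv (V := W) (exists_target_starProd δ σ)
    ((compatible_starIncl (W := W.prod line) (δ, (0 : SignType))
      ((W.starProd δ).target (σ, (0 : SignType)))).comp
      ((compatible_starProd δ).starMap (σ, (0 : SignType))))
    (G := ((W.toConeComplex.prod ConeComplex.line).starIncl (δ, (0 : SignType))
      ((W.starProd δ).target (σ, (0 : SignType)))).comp
      ((W.starProd δ).starMap (σ, (0 : SignType))))
    (ψ := starDivisor (W.star δ).isDivisor_snd (σ, (0 : SignType)) ((W.star δ).snd_eq_zero σ))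
    (fun p => by
      obtain ⟨⟨⟨q, t⟩, hq⟩, rfl⟩ := starMk_surjective _ p
      obtain ⟨x, rfl⟩ := starMk_surjective δ q
      obtain ⟨h, he⟩ := starIncl_starMk (K := W.toConeComplex.prod ConeComplex.line)
        (i := (δ, (0 : SignType))) (j := (W.starProd δ).target (σ, (0 : SignType)))
        ⟨(W.starProd δ).toFun (W.starMk δ x, t), fun j hj => by
          obtain ⟨_, -, hik, hkj⟩ := (W.starProd δ).mapsTo_of_mem ⟨_, hq⟩ hj
          exact (W.starProd δ).target_subset (hkj.mono_left hik)⟩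
        ⟨(x.1, t), mem_openStar_prod x t⟩ rfl
      exact ⟨⟨(x.1, t), h⟩, he, rfl⟩) hc
  refine (congrArg (· ∈ W.ratEquiv k) ?_).mpr this
  refine (fst_inclPush_inclPush δ _).trans (congrArg _ ?_)
  exact (congrArg _ e1).trans (e2.trans (congrArg
    ((W.toConeComplex.prod ConeComplex.line).inclPush
      ((W.starProd δ).target (σ, (0 : SignType))).1 k) e3.symm))

theorem ExtMor.push_mem_ratEquiv (f : ExtMor W V) {k : ℕ} {A : W.ExtWeight k}
    (hA : A ∈ W.ratEquiv k) : f.push k A ∈ V.ratEquiv k := by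
  cases f with
  | dominant f => exact extPush_mem_ratEquiv f.compatible hA
  | boundary δ f => exact inclPush_mem_ratEquiv (extPush_mem_ratEquiv f.compatible hA)

end WECC

/-! ### Degrees of zero-dimensional weights -/

namespace ConeComplex

variable {X : Type u} {Y : Type u'} {K K' : ConeComplex X} {L : ConeComplex Y} {k : ℕ}

theorem eq_zero_of_dim_eq_zero {S : Set X} (hS : K.IsSubcone S) (hd : K.dim S = 0) {m : X → ℝ}
    (hm : m ∈ K.fn S) : m = 0 := by
  have := finite_fn hS
  obtain ⟨n, hn, h⟩ := Module.finrank_eq_zero_iff.1 hd ⟨m, hm⟩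
  exact (smul_eq_zero.1 (congrArg Subtype.val h)).resolve_left hn

theorem eq_of_dim_eq {i j : K.Idx} (h : K.carrier i ⊆ K.carrier j)
    (hd : K.dim (K.carrier i) = K.dim (K.carrier j)) : i = j := by
  obtain ⟨-, m, hm, -, he⟩ := isFaceOf_of_subset h
  have h0 := eq_zero_of_restr (isSubcone_carrier i) (isSubcone_carrier j) h hd
    ((fn_carrier j).ge hm) fun x hx => (he.le hx).2
  refine K.carrier_injective (h.antisymm fun x hx => ?_)
  rw [he, h0]
  exact ⟨hx, rfl⟩

variable (K) in
/-- The degree of a zero-dimensional weight. -/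
def weightDeg : K.Weight 0 →+ ℤ :=
  QuotientAddGroup.lift _ (FreeAbelianGroup.lift fun _ => 1) ((AddSubgroup.closure_le _).2 (by
    rintro _ ⟨σ, T, ⟨hT, hsep⟩, rfl⟩
    obtain ⟨z, hz, -⟩ := σ.isSubcone.isCone.exists_zero
    rw [hT] at hz
    obtain ⟨τ, hτ, -⟩ := Set.mem_iUnion₂.1 hz
    -- A zero-dimensional subcone carries no nonzero functions, so two distinct parts could not be
    -- separated.
    have h : T = {τ} := by
      refine Finset.eq_singleton_iff_unique_mem.2 ⟨hτ, fun τ' hτ' => ?_⟩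
      by_contra hne
      obtain ⟨m, hm, hm0, -⟩ := hsep τ' hτ' τ hτ hne
      exact hm0 (eq_zero_of_dim_eq_zero σ.isSubcone σ.dim_eq hm)
    subst h
    change FreeAbelianGroup.lift (fun _ => (1 : ℤ)) _ = 0
    rw [Finset.sum_singleton, map_sub, FreeAbelianGroup.lift_apply_of,
      FreeAbelianGroup.lift_apply_of, sub_self]))

theorem weightDeg_cls {S : Set X} (hS : K.IsSubcone S) (hd : K.dim S = 0) :
    K.weightDeg (K.cls 0 S) = 1 := by
  rw [cls_of_dim hS hd]
  exact FreeAbelianGroup.lift_apply_of _ _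

/-- The image of a zero-dimensional subcone is zero-dimensional and the index of the map between the
zero lattices is one. -/
theorem Mor.weightDeg_push (f : Mor K L) : L.weightDeg.comp (f.push 0) = K.weightDeg := by
  refine weight_hom_ext fun S hS hd => ?_
  have hl := f.isLinOn hS rfl
  have hd' : L.dim (f.toFun '' S) = 0 := Nat.le_zero.1 (hd ▸ hl.dim_le)
  have e : f.latIndex hS = 1 := by
    refine (f.latIndex_eq_dualIndex hS hl).trans (dualIndex_of_bijective ⟨hl.hom_injective, ?_⟩)
    exact fun m => ⟨0, Subtype.ext (((congrArg Subtype.val (map_zero _))).trans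
      (eq_zero_of_dim_eq_zero hS hd m.2).symm)⟩
  rw [AddMonoidHom.comp_apply, f.push_cls hS hd, e, Nat.cast_one, one_smul, weightDeg_cls hS hd,
    weightDeg_cls (f.isSubcone_image hS) hd']

open Classical in
variable (K) in
/-- The degree of a zero-dimensional weight on the extended cone complex. -/
def extDeg : K.ExtWeight 0 →+ ℤ := DirectSum.toAddMonoid fun i => (K.star i).weightDeg

theorem extDeg_of [inst : DecidableEq K.Idx] (i : K.Idx) (A : (K.star i).Weight 0) :
    K.extDeg (DirectSum.of (fun i => (K.star i).Weight 0) i A) = (K.star i).weightDeg A := by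
  obtain rfl : inst = fun _ _ => Classical.propDecidable _ := Subsingleton.elim _ _
  classical exact DirectSum.toAddMonoid_of _ _ _

theorem Mor.extDeg_extPush (f : Mor K L) : L.extDeg.comp (f.extPush 0) = K.extDeg := by
  classical
  refine DirectSum.addHom_ext fun i A => ?_
  refine (congrArg L.extDeg (f.extPush_of i A)).trans ((extDeg_of _ _).trans
    (Eq.trans ?_ (extDeg_of i A).symm))
  exact DFunLike.congr_fun (f.starMap i).weightDeg_push A

theorem extDeg_inclPush (i : K.Idx) : K.extDeg.comp (K.inclPush i 0) = (K.star i).extDeg := by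
  classical
  refine DirectSum.addHom_ext fun j A => ?_
  refine (congrArg K.extDeg (inclPush_of i j A)).trans ((extDeg_of _ _).trans
    (Eq.trans ?_ (extDeg_of j A).symm))
  exact DFunLike.congr_fun (K.starIncl i j).weightDeg_push A

/-- The only ray contained in a one-dimensional cone is the cone itself, and its quotient by itself
is a point of degree one. -/
theorem extDeg_rayProduct (ψ : X → ℝ) (c : K.ConesOfDim 1 → ℤ) :
    K.extDeg (K.rayProduct ψ c) = ∑ ρ, c ρ * K.raySlope ψ ρ.1 := by
  classical
  rw [rayProduct_eq, map_sum]
  refine Finset.sum_congr rfl fun σ _ => ?_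
  have e : (Finset.univ.filter fun ρ : K.ConesOfDim 1 => K.carrier ρ.1 ⊆ K.carrier σ.1) = {σ} := by
    ext ρ
    simp only [Finset.mem_filter, Finset.mem_univ, true_and, Finset.mem_singleton]
    refine ⟨fun h => Subtype.ext (eq_of_dim_eq h (ρ.2.trans σ.2.symm)), ?_⟩
    rintro rfl
    exact subset_rfl
  have hd := dim_starCarrier (K := K) (t := σ.1) (j := σ.1) subset_rfl
  have h1 : (K.star σ.1).weightDeg ((K.star σ.1).cls 0 (K.starCarrier σ.1 σ.1)) = 1 :=
    weightDeg_cls (isSubcone_carrier (K := K.star σ.1) ⟨σ.1, subset_rfl⟩) (Nat.add_eq_right.1 hd)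
  rw [e, Finset.sum_singleton, map_zsmul, map_zsmul, extDeg_of, h1, smul_eq_mul, smul_eq_mul,
    mul_one]

theorem exists_zero_cone (ρ : K.ConesOfDim 1) :
    ∃ o : K.ConesOfDim 0, K.carrier o.1 ⊆ K.carrier ρ.1 := by
  have hu := isPrimitiveGenerator_primGen ρ
  obtain ⟨m, hm, hm1⟩ := hu.2.2
  obtain ⟨o, ho, -⟩ := K.exists_face ρ.1 _ _ ⟨rfl, m, hm, fun x hx => by
    obtain ⟨a, ha, h⟩ := hu.exists_mul ρ.2 hx
    rw [h m hm, hm1, mul_one]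
    exact ha, rfl⟩
  have hsub : K.carrier o ⊆ K.carrier ρ.1 := ho.le.trans fun x hx => hx.1
  have h := dim_lt_of_vanishing (isSubcone_carrier o) (isSubcone_carrier ρ.1) hsub
    ((fn_carrier ρ.1).ge hm) (fun h0 => by simp [h0] at hm1) fun x hx => (ho.le hx).2
  have h' : K.dim (K.carrier ρ.1) = 1 := ρ.2
  exact ⟨⟨o, by omega⟩, hsub⟩

section Subsingleton

variable [Subsingleton X]

theorem dim_of_subsingleton {S : Set X} (hS : K.IsSubcone S) : K.dim S = 0 := by
  have : Subsingleton (K.fn S) := ⟨fun a b => by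
    obtain ⟨z, -, hz⟩ := hS.isCone.exists_zero
    refine Subtype.ext (funext fun x => ?_)
    rw [Subsingleton.elim x z, hz _ a.2, hz _ b.2]⟩
  exact Module.finrank_zero_of_subsingleton

theorem weight_hom_eq_zero_of_subsingleton {A : Type*} [AddCommGroup A] (hk : k ≠ 0)
    (F : K.Weight k →+ A) : F = 0 :=
  weight_hom_ext fun _ hS hd => absurd (hd.symm.trans (dim_of_subsingleton hS)) hk

theorem eq_deg_smul_of_subsingleton (A : K.Weight 0) :
    A = K.weightDeg A • K.cls 0 Set.univ := by
  have e : AddMonoidHom.id (K.Weight 0) =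
      (zmultiplesHom (K.Weight 0) (K.cls 0 Set.univ)).comp K.weightDeg := by
    refine weight_hom_ext fun S hS hd => ?_
    obtain ⟨z, hz, -⟩ := hS.isCone.exists_zero
    have hS' : S = Set.univ := Set.eq_univ_of_forall fun x => Subsingleton.elim z x ▸ hz
    rw [AddMonoidHom.comp_apply, weightDeg_cls hS hd, hS', zmultiplesHom_apply, one_smul]
    rfl
  exact DFunLike.congr_fun e A

end Subsingleton

end ConeComplex

/-! ### Degree zero of rationally trivial cycles on the point -/

namespace WECC

open ConeComplex

variable {X : Type u} {Y : Type u'} {W : WECC.{u, v} X} {V : WECC.{u', v'} Y}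

/-- The degree is the sum of the weights times the slopes of `ψ`. As `ψ` comes from a functional on
the lattice, this sum is the balancing condition at the vertex, where the primitive generators serve
as lattice normal vectors. -/
theorem IsMinkowskiWeight.extDeg_eq_zero {K' : ConeComplex X} {h : W.IsProperSubdivision K'}
    {c : K'.ConesOfDim 1 → ℤ} (hc : (W.refine K' h).IsMinkowskiWeight c) {m : W.N →ₗ[ℤ] ℤ}
    {ψ : X → ℝ} (hψ : ∀ x, evalR m (W.φ x) = ψ x) (hinj : Function.Injective ψ) :
    W.extDeg (divisorProduct h ψ c) = 0 := by
  have hD : K'.IsDivisor ψ := fun i => by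
    have e : (fun x => evalR m (W.φ x)) = ψ := funext hψ
    exact e ▸ (W.refine K' h).integral i m
  have e : W.extDeg (divisorProduct h ψ c) = K'.extDeg (K'.rayProduct ψ c) :=
    DFunLike.congr_fun h.mor.extDeg_extPush _
  rw [e, extDeg_rayProduct]
  rcases isEmpty_or_nonempty (K'.ConesOfDim 1) with hE | ⟨⟨ρ₀⟩⟩
  · exact Finset.sum_of_isEmpty _
  obtain ⟨o, ho⟩ := exists_zero_cone ρ₀
  have hz : ∀ f ∈ K'.M o.1, f = 0 := fun f hf =>
    eq_zero_of_dim_eq_zero (isSubcone_carrier o.1) o.2 ((fn_carrier o.1).ge hf)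
  have hψo : ∀ x ∈ K'.carrier o.1, ψ x = 0 := fun x hx => by
    rw [← restr_of_mem hx ψ, hz _ (hD o.1)]
    rfl
  -- `ψ` vanishes at the zero of every ray and at the vertex `o`; by injectivity these points
  -- coincide, so balancing at `o` involves all rays.
  have hall : ∀ ρ : K'.ConesOfDim 1, K'.carrier o.1 ⊆ K'.carrier ρ.1 := fun ρ x hx => by
    obtain ⟨y, hy, hy0⟩ := (K'.isCone ρ.1).exists_zero
    have : ψ y = 0 := by rw [← restr_of_mem hy ψ, hy0 _ (hD ρ.1)]
    rwa [hinj ((hψo x hx).trans this.symm)]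
  have key := isMinkowskiWeight_iff.1 hc o (fun σ => K'.primGen σ.1) (fun σ => by
    have hu := isPrimitiveGenerator_primGen σ.1
    obtain ⟨f, hf, hf1⟩ := hu.2.2
    refine ⟨hu.1, hu.2.1, f, hf, fun x hx => ?_, hf1⟩
    exact (restr_of_mem hx f).symm.trans
      (congrFun (hz _ (restr_mem (K := K') (hall σ.1) hf)) x)) m fun x hx => (hψ x).trans (hψo x hx)
  have hs : ∑ σ : K'.ConesOver 1 o.1, (c σ.1 : ℝ) * evalR m (W.φ (K'.primGen σ.1)) =
      ∑ ρ, (c ρ : ℝ) * K'.raySlope ψ ρ.1 :=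
    Fintype.sum_bijective (fun σ : K'.ConesOver 1 o.1 => σ.1)
      ⟨Subtype.val_injective, fun ρ => ⟨⟨ρ, hall ρ⟩, rfl⟩⟩ _ _ fun σ => by
        rw [hψ, ← raySlope_eq hD]
  have : (∑ ρ, (c ρ : ℝ) * K'.raySlope ψ ρ.1) = 0 := hs.symm.trans key
  exact_mod_cast this

/-- The second coordinate is the functional given by the projection of `N × ℤ` to `ℤ`. It vanishes
on `σ × 0` and so descends to the lattice of the star. -/
theorem exists_starDivisor_functional (σ : W.Idx) :
    ∃ m : ((W.prod line).star (σ, (0 : SignType))).N →ₗ[ℤ] ℤ, ∀ p,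
      evalR m (((W.prod line).star (σ, (0 : SignType))).φ p) =
        starDivisor W.isDivisor_snd (σ, (0 : SignType)) (W.snd_eq_zero σ) p := by
  obtain ⟨m, hm⟩ := exists_prod_functional (W := W) (V := line) 0 (LinearMap.id : ℤ →ₗ[ℤ] ℤ)
  have hm' : ∀ p : X × ℝ, evalR m ((W.prod line).φ p) = p.2 := fun p => by
    refine (hm p).trans ?_
    have e : evalR (LinearMap.id : ℤ →ₗ[ℤ] ℤ) (line.φ p.2) = p.2 :=
      (evalR_tmul _ _ _).trans (by simp)
    have e' : evalR (0 : W.N →ₗ[ℤ] ℤ) (W.φ p.1) = 0 := by simp [evalR]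
    rw [e', zero_add]
    exact e
  obtain ⟨m', h⟩ := exists_star_functional (W := W.prod line) (i := (σ, (0 : SignType))) (m := m)
    fun x hx => (hm' x).trans (W.snd_eq_zero σ x hx)
  refine ⟨m', fun p => ?_⟩
  obtain ⟨x, rfl⟩ := starMk_surjective _ p
  exact (h x).symm.trans (hm' x.1)

/-- Push-forwards preserve the degree, so it can be computed on the star of `Π⁰ × Π¹`, which is a
line. There the second coordinate is injective and the balancing condition applies. -/
theorem extDeg_of_mem_ratEquiv_point {A : point.ExtWeight 0} (hA : A ∈ point.ratEquiv 0) :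
    point.extDeg A = 0 := by
  refine (AddSubgroup.closure_le point.extDeg.ker).2 ?_ hA
  rintro _ ⟨σ, K', h, c, hc, rfl⟩
  obtain ⟨m, hm⟩ := exists_starDivisor_functional (W := point) σ
  refine (DFunLike.congr_fun (ConeComplex.Mor.extDeg_extPush
    (fstMor point.toConeComplex ConeComplex.line)) _).trans
    ((DFunLike.congr_fun (extDeg_inclPush (K := point.toConeComplex.prod ConeComplex.line)
      (σ, (0 : SignType))) _).trans (hc.extDeg_eq_zero hm ?_))
  intro p q hpq
  obtain ⟨⟨⟨⟨⟩, s⟩, hs⟩, rfl⟩ := starMk_surjective _ p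
  obtain ⟨⟨⟨⟨⟩, t⟩, ht⟩, rfl⟩ := starMk_surjective _ q
  have e : s = t := hpq
  subst e
  rfl

instance : DecidableEq point.Idx := inferInstanceAs (DecidableEq Unit)

instance (i : point.Idx) : Subsingleton (point.toConeComplex.StarPt i) :=
  (starMk_surjective i).subsingleton

theorem isSubcone_univ_point_star : (point.toConeComplex.star ()).IsSubcone Set.univ ∧
    (point.toConeComplex.star ()).dim Set.univ = 0 := by
  have : Subsingleton (point.toConeComplex.StarPt ()) := (starMk_surjective _).subsingleton
  have hS : (point.toConeComplex.star ()).IsSubcone Set.univ := by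
    have := isSubcone_carrier (K := point.toConeComplex.star ()) ⟨(), subset_rfl⟩
    obtain ⟨z, hz, -⟩ := this.isCone.exists_zero
    exact Set.eq_univ_of_forall (fun x => Subsingleton.elim z x ▸ hz) ▸ this
  exact ⟨hS, dim_of_subsingleton hS⟩

/-- The degree of an element of the graded group of weights on `Π⁰`. -/
def pointDeg : (⨁ k, point.ExtWeight k) →+ ℤ := DirectSum.toAddMonoid fun k =>
  match k with
  | 0 => point.extDeg
  | _ + 1 => 0

theorem pointDeg_pointCycle : pointDeg pointCycle = 1 := by
  obtain ⟨hS, hd⟩ := isSubcone_univ_point_star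
  exact (DirectSum.toAddMonoid_of _ _ _).trans ((extDeg_of _ _).trans (weightDeg_cls hS hd))

/-- On a complex with one point all subcones have dimension zero, so weights of positive dimension
vanish and the others are multiples of the class of the point. -/
theorem eq_pointDeg_smul (A : ⨁ k, point.ExtWeight k) : A = pointDeg A • pointCycle := by
  have e : AddMonoidHom.id (⨁ k, point.ExtWeight k) =
      (zmultiplesHom _ pointCycle).comp pointDeg := by
    refine DirectSum.addHom_ext' fun k => DirectSum.addHom_ext' fun i => ?_
    cases k with
    | zero =>
      refine AddMonoidHom.ext fun A => ?_
      have h := eq_deg_smul_of_subsingleton (K := point.toConeComplex.star i) A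
      have e : pointDeg (DirectSum.of (fun k => point.ExtWeight k) 0
          (DirectSum.of (fun i => (point.toConeComplex.star i).Weight 0) i A)) =
          (point.toConeComplex.star i).weightDeg A :=
        (DirectSum.toAddMonoid_of _ _ _).trans (extDeg_of _ _)
      refine (congrArg (fun A => DirectSum.of (fun k => point.ExtWeight k) 0
        (DirectSum.of (fun i => (point.toConeComplex.star i).Weight 0) i A)) h).trans
        (Eq.trans ?_ (congrArg (· • pointCycle) e.symm))
      exact (congrArg _ (map_zsmul _ _ _)).trans (map_zsmul _ _ _)
    | succ k =>
      exact (weight_hom_eq_zero_of_subsingleton k.succ_ne_zero _).trans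
        (weight_hom_eq_zero_of_subsingleton k.succ_ne_zero _).symm
  exact DFunLike.congr_fun e A

theorem pointDeg_of_mem_ratEquiv {k : ℕ} {A : point.ExtWeight k} (hA : A ∈ point.ratEquiv k) :
    pointDeg (DirectSum.of (fun k => point.ExtWeight k) k A) = 0 := by
  refine (DirectSum.toAddMonoid_of _ _ _).trans ?_
  cases k with
  | zero => exact extDeg_of_mem_ratEquiv_point hA
  | succ k => rfl

variable (W) in
theorem chow_hom_ext {A : Type*} [AddCommGroup A] {F G : (⨁ k, W.Chow k) →+ A}
    (h : ∀ k (B : W.extCycles k), F (DirectSum.of W.Chow k (W.chowClass B)) =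
      G (DirectSum.of W.Chow k (W.chowClass B))) : F = G := by
  refine DirectSum.addHom_ext fun k B => ?_
  obtain ⟨B, rfl⟩ := QuotientAddGroup.mk_surjective B
  exact h k B

variable (W) in
/-- A family of homomorphisms on cycles that vanish on cycles rationally equivalent to zero induces
a homomorphism on the Chow group. -/
theorem exists_chow_hom {A : Type*} [AddCommGroup A] (F : ∀ k, W.extCycles k →+ A)
    (hF : ∀ k (B : W.extCycles k), B.1 ∈ W.ratEquiv k → F k B = 0) :
    ∃ G : (⨁ k, W.Chow k) →+ A, ∀ k (B : W.extCycles k),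
      G (DirectSum.of W.Chow k (W.chowClass B)) = F k B :=
  ⟨DirectSum.toAddMonoid fun k => QuotientAddGroup.lift _ (F k) fun B hB => hF k B hB,
    fun _ _ => DirectSum.toAddMonoid_of _ _ _⟩

end WECC

end TropicalCycles

end

theorem mainTheorem11 {X : Type u} {Y : Type u'} (W : TropicalCycles.WECC.{u, v} X)
    (V : TropicalCycles.WECC.{u', v'} Y) (f : TropicalCycles.WECC.ExtMor W V) :
    (∀ k, ∀ A ∈ W.extCycles k, f.push k A ∈ V.extCycles k) ∧
    (∀ k, ∀ A ∈ W.ratEquiv k, f.push k A ∈ V.ratEquiv k) ∧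
    (∃! F : (⨁ k, W.Chow k) →+ ⨁ k, V.Chow k, ∀ (k : ℕ) (A : W.extCycles k) (B : V.extCycles k),
      f.push k A = B →
        F (DirectSum.of W.Chow k (W.chowClass A)) = DirectSum.of V.Chow k (V.chowClass B)) ∧
    (∃! deg : (⨁ k, W.Chow k) →+ ℤ, ∀ (k : ℕ) (A : W.extCycles k),
      DirectSum.of (fun k => TropicalCycles.WECC.point.ExtWeight k) k
          ((TropicalCycles.WECC.ExtMor.dominant W.toPoint).push k A) =
        deg (DirectSum.of W.Chow k (W.chowClass A)) • TropicalCycles.WECC.pointCycle) := by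
  refine ⟨fun k A hA => f.push_mem_extCycles hA, fun k A hA => f.push_mem_ratEquiv hA, ?_, ?_⟩
  · obtain ⟨F, hF⟩ := W.exists_chow_hom (fun k => (DirectSum.of V.Chow k).comp
      ((QuotientAddGroup.mk' _).comp (((f.push k).comp (W.extCycles k).subtype).codRestrict
        (V.extCycles k) fun A => f.push_mem_extCycles A.2))) fun k B hB => by
      refine (congrArg (DirectSum.of V.Chow k) ((QuotientAddGroup.eq_zero_iff _).2 ?_)).trans
        (map_zero _)
      exact f.push_mem_ratEquiv hB
    refine ⟨F, fun k A B h => (hF k A).trans ?_, fun G hG => W.chow_hom_ext fun k A => ?_⟩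
    · exact congrArg (fun B => DirectSum.of V.Chow k (V.chowClass B)) (Subtype.ext h)
    · exact (hG k A ⟨_, f.push_mem_extCycles A.2⟩ rfl).trans (hF k A).symm
  · obtain ⟨F, hF⟩ := W.exists_chow_hom (fun k => (TropicalCycles.WECC.pointDeg.comp
      (DirectSum.of (fun k => TropicalCycles.WECC.point.ExtWeight k) k)).comp
      (((TropicalCycles.WECC.ExtMor.dominant W.toPoint).push k).comp (W.extCycles k).subtype))
      fun k B hB => TropicalCycles.WECC.pointDeg_of_mem_ratEquiv
        ((TropicalCycles.WECC.ExtMor.dominant W.toPoint).push_mem_ratEquiv hB)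
    refine ⟨F, fun k A => ?_, fun G hG => W.chow_hom_ext fun k A => ?_⟩
    · exact (TropicalCycles.WECC.eq_pointDeg_smul _).trans
        (congrArg (· • TropicalCycles.WECC.pointCycle) (hF k A).symm)
    -- The point has degree one, so applying the degree to the defining equation determines `G` on
    -- the classes of homogeneous cycles.
    · have h := congrArg TropicalCycles.WECC.pointDeg (hG k A)
      rw [map_zsmul, TropicalCycles.WECC.pointDeg_pointCycle, smul_eq_mul, mul_one] at h
      exact h.symm.trans (hF k A).symm
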